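/- Fix $0<\beta<1$ and a sequence of times $T=T(N)\in\mathbb Z_{\ge 0}$ with $T(N)\to\infty$ and $T(N)/N\to0$ as $N\to\infty$. **Kernels.** For integers $a_1<\dots<a_N$, $\vec a=(a_1,\dots,a_N)$, $x_1,x_2\in\mathbb Z$ and $t_1,t_2\in\mathbb Z_{\ge1}$, let (with $(z)_k=z(z+1)\cdots(z+k-1)$) $$ K^{\mathrm{Bernoulli}}_{\vec a;\beta}(t_1,x_1;t_2,x_2)=\mathbf 1_{x_1\ge x_2}\mathbf 1_{t_1>t_2}(-1)^{x_1-x_2+1}\binom{t_1-t_2}{x_1-x_2} +\frac{t_1!}{(t_2-1)!}\frac1{(2\pi i)^2}\int_{x_2-t_2+\frac12-i\infty}^{x_2-t_2+\frac12+i\infty}dz\oint dw\,\frac{(z-x_2+1)_{t_2-1}}{(w-x_1)_{t_1+1}}\frac1{w-z}\frac{\sin\pi w}{\sin\pi z}\Big(\frac{1-\beta}{\beta}\Big)^{w-z}\prod_{r=1}^N\frac{z-a_r}{w-a_r}, $$ where $z$ runs upwards over the vertical line and the $w$ contour is a positively oriented circle, or a union of two such circles, encircling all the $w$ poles of the integrand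 (they lie in $\{x_1-t_1,\dots,x_1\}$) except $w=z$, and not meeting the $z$ line. This is the correlation kernel of the noncolliding Bernoulli random walk with parameter $\beta$ started from $\vec a$. For $u\in\mathbb C$ with $\operatorname{Im}u>0$ and $t,x,s,y\in\mathbb Z$, let the extended discrete sine kernel be $$K_u(t,x;s,y)=-\frac1{2\pi i}\int_{\bar u}^u(1-z)^{t-s}z^{-(x-y)-1}\,dz,$$ where the path crosses the real line in $(0,1)$ if $t>s$ and in $(-\infty,0)$ if $t\le s$. **Assumptions.** Let $\mathsf D(N),\mathsf Q(N)>0$ satisfy $\mathsf D(N)/T(N)\to0$, $T(N)/\mathsf Q(N)\to0$, $\mathsf Q(N)/N\to0$, let $0<\rho_\bullet\le\rho^\bullet<1$, and for $\mathsf R,\delta>0$ let constants $\mathsf A_{\mathsf R,\delta}$ and $N_1(\mathsf R,\delta)\in\mathbb Z_{\ge0}$ be given. Consider initial configurations $\mathfrak A(N)=(a_1<\dots<a_N)\subset\mathbb Z$ such that 1. (local density) every segment of length $\mathsf D(N)$ inside $[-\mathsf Q(N),\mathsf Q(N)]$ contains at least $\rho_\bullet\mathsf D(N)$ and at most $\rho^\bullet\mathsf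 D(N)$ points of $\mathfrak A(N)$; 2. (intermediate scales) for all $\mathsf R,\delta>0$ with $N\ge N_1(\mathsf R,\delta)$, $\ \Big|\sum_{i:\ \mathsf RT(N)\le|a_i|\le\delta N}\frac1{a_i}\Big|\le\mathsf A_{\mathsf R,\delta}$. **Critical point.** Put $$\mathsf S'(\mathsf z)=\sum_{r=1}^N\frac1{T\mathsf z-a_r}-\lim_{M\to\infty}\sum_{\substack{|j|<M\\ j\le -T\text{ or }j\ge0}}\frac1{T\mathsf z-j}-\log(\beta^{-1}-1).$$ **Theorem.** For all fixed $t_1,x_1,t_2,x_2\in\mathbb Z$ there are $N_0$ and a sequence $\varepsilon_N\to0$, depending only on these four numbers, on $\beta$, and on the data $T,\mathsf D,\mathsf Q,\rho_\bullet,\rho^\bullet,\mathsf A,N_1$ of the assumptions, but not on the configurations, such that for every $N\ge N_0$ and every $\mathfrak A(N)$ satisfying 1 and 2 one has $t_1+T(N),\,t_2+T(N)\ge1$, the equation $\mathsf S'(\mathsf z)=0$ has a unique root $\mathsf z_c=\mathsf z_c(N)$ in the upper half plane $\operatorname{Im}\mathsf z>0$, and $$\Big|K^{\mathrm{Bernoulli}}_{\mathfrak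 A(N);\beta}\big(t_1+T(N),x_1;t_2+T(N),x_2\big)-K_{\mathsf z_c/(\mathsf z_c+1)}(t_1,x_1;t_2,x_2)\Big|\le\varepsilon_N.$$ -/

import Mathlib

open Complex Filter Topology

noncomputable section

/-- Rising factorial `(z)_k = z (z + 1) ⋯ (z + k - 1)`. -/
def poch (z : ℂ) (k : ℕ) : ℂ := (ascPochhammer ℂ k).eval z

/-- The integrand of the double contour integral in the Bernoulli kernel. -/
def bernoulliIntegrand {N : ℕ} (a : Fin N → ℤ) (β : ℝ) (t₁ : ℕ) (x₁ : ℤ) (t₂ : ℕ) (x₂ : ℤ)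
    (z w : ℂ) : ℂ :=
  poch (z - x₂ + 1) (t₂ - 1) / poch (w - x₁) (t₁ + 1)
    * (1 / (w - z))
    * (Complex.sin (Real.pi * w) / Complex.sin (Real.pi * z))
    * (((1 - β) / β : ℝ) : ℂ) ^ (w - z)
    * ∏ r : Fin N, (z - a r) / (w - a r)

/-- The integral over the counter-clockwise circle with diameter `[m - 1/4, M + 1/4]`, which
encircles exactly the integers `m, m + 1, …, M`; it is `0` if there are no such integers. -/
def blockCircleIntegral (f : ℂ → ℂ) (m M : ℤ) : ℂ :=
  if m ≤ M then ∮ w in C((((m + M : ℝ) / 2 : ℝ) : ℂ), ((M - m : ℝ) / 2 + 1 / 4)), f w else 0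

/-- The `w` integral. All `w` poles other than `w = z` lie in `{x₁ - t₁, …, x₁}`; the contour
consists of one circle around the points of this set to the left of the line
`Re z = x₂ - t₂ + 1/2` and one circle around those to its right (only one of the two circles if all
the points are on the same side). Neither circle meets or encircles any point of the line. -/
def wContourIntegral (f : ℂ → ℂ) (t₁ : ℕ) (x₁ : ℤ) (t₂ : ℕ) (x₂ : ℤ) : ℂ :=
  blockCircleIntegral f (x₁ - t₁) (min x₁ (x₂ - t₂))
    + blockCircleIntegral f (max (x₁ - t₁) (x₂ - t₂ + 1)) x₁

/-- The correlation kernel of the noncolliding Bernoulli random walk with parameter `β` started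
from `a`, for times `t₁, t₂ ≥ 1`. The `z` contour is the upward vertical line
`z = x₂ - t₂ + 1/2 + i y`. -/
def bernoulliKernel {N : ℕ} (a : Fin N → ℤ) (β : ℝ) (t₁ : ℕ) (x₁ : ℤ) (t₂ : ℕ) (x₂ : ℤ) : ℂ :=
  (if x₂ ≤ x₁ ∧ t₂ < t₁ then
      (-1 : ℂ) ^ (x₁ - x₂ + 1) * ((t₁ - t₂).choose (x₁ - x₂).toNat : ℂ)
    else 0)
  + ((t₁.factorial : ℂ) / ((t₂ - 1).factorial : ℂ)) * (1 / (2 * Real.pi * I) ^ 2)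
    * ∫ y : ℝ, I * wContourIntegral
        (bernoulliIntegrand a β t₁ x₁ t₂ x₂ ((x₂ : ℂ) - t₂ + 1 / 2 + y * I)) t₁ x₁ t₂ x₂

/-- The integral of `f` along the straight segment from `p` to `q`. -/
def segmentIntegral (f : ℂ → ℂ) (p q : ℂ) : ℂ :=
  ∫ s in (0 : ℝ)..1, (q - p) * f (p + s * (q - p))

/-- The integrand `(1 - z)^(t - s) z^(-(x - y) - 1)` of the extended discrete sine kernel. -/
def extendedSineIntegrand (t x s y : ℤ) (z : ℂ) : ℂ :=
  (1 - z) ^ (t - s) * z ^ (-(x - y) - 1)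

/-- The point where the integration path of the extended sine kernel crosses the real line. -/
def crossingPoint (t s : ℤ) : ℂ := if s < t then 1 / 2 else -1

/-- The extended discrete sine kernel of slope `u` with `Im u > 0`. The path from `conj u` to `u`
is the broken line through `1/2` if `t > s` (it crosses the real line in `(0, 1)`), and through `-1`
if `t ≤ s` (it crosses the real line in `(-∞, 0)`). -/
def extendedSineKernel (u : ℂ) (t x s y : ℤ) : ℂ :=
  -(1 / (2 * Real.pi * I)) *
    (segmentIntegral (extendedSineIntegrand t x s y) ((starRingEnd ℂ) u) (crossingPoint t s)
      + segmentIntegral (extendedSineIntegrand t x s y) (crossingPoint t s) u)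

/-- `p.v. ∑ 1 / (v - j)` over `j ∈ {…, -T - 1, -T} ∪ {0, 1, …}`, the limit of the sums over
`|j| < M`. -/
def pvSum (T : ℕ) (v : ℂ) : ℂ :=
  limUnder atTop fun M : ℕ =>
    ∑ j ∈ (Finset.Ioo (-(M : ℤ)) (M : ℤ)).filter (fun j : ℤ => j ≤ -(T : ℤ) ∨ 0 ≤ j),
      1 / (v - (j : ℂ))

/-- The function `S'(z)`. -/
def SPrime {N : ℕ} (a : Fin N → ℤ) (β : ℝ) (T : ℕ) (z : ℂ) : ℂ :=
  (∑ r : Fin N, 1 / ((T : ℂ) * z - a r)) - pvSum T ((T : ℂ) * z) - (Real.log (β⁻¹ - 1) : ℂ)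

/-- Every closed segment of length `D` inside `[-Q, Q]` contains at least `ρ₁ D` and at most
`ρ₂ D` points of the configuration. -/
def LocalDensity {N : ℕ} (a : Fin N → ℤ) (D Q ρ₁ ρ₂ : ℝ) : Prop :=
  ∀ y : ℝ, -Q ≤ y → y + D ≤ Q →
    ρ₁ * D ≤ ((Finset.univ.filter fun i => y ≤ (a i : ℝ) ∧ (a i : ℝ) ≤ y + D).card : ℝ) ∧
    ((Finset.univ.filter fun i => y ≤ (a i : ℝ) ∧ (a i : ℝ) ≤ y + D).card : ℝ) ≤ ρ₂ * D

/-- For all `R, δ > 0` for which `N` is large enough (namely `N ≥ N₁ R δ`), the sum of `1 / a i`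
over `R T ≤ |a i| ≤ δ N` is at most `A R δ` in absolute value. -/
def IntermediateScales {N : ℕ} (a : Fin N → ℤ) (T : ℕ) (A : ℝ → ℝ → ℝ) (N₁ : ℝ → ℝ → ℕ) : Prop :=
  ∀ R δ : ℝ, 0 < R → 0 < δ → N₁ R δ ≤ N →
    |∑ i ∈ Finset.univ.filter (fun i => R * T ≤ |(a i : ℝ)| ∧ |(a i : ℝ)| ≤ δ * N),
      1 / (a i : ℝ)| ≤ A R δ

end

/-! Off the real axis, `SPrime` at `v = T z` is, up to the constant `log (β⁻¹ - 1)`, the Cauchy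
transform of the integer weights `wt`: the indicator of the particles minus the indicator of the
complement of `(-T, 0)`. The weights are nonnegative on `(-T, 0)` and nonpositive elsewhere, and
nearly everything rests on this sign pattern. If the transform `S` takes a real value `c` at `vc`,
then `energy`, the sum of `m j / |vc - j|²`, vanishes. Consequently (`IsCauchyTransform.factor`) `S
v - c` equals `(v - vc) (v - conj vc) / (v (v + T))` times a function `nevan` that maps the upper
half plane to itself, because each term of its imaginary part has the sign of `-m j * j * (j + T)`
(`nevan_im`, `nevan_im_ge`). Uniqueness of the root follows at once (`eq_of_real`).

Existence is a connectedness argument in `c` (`exists_critical`). The real values attained form an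
open set by the open mapping theorem, and a relatively closed one on bounded intervals because the
points where they are attained are confined to a compact region at scale `T` (`exists_apriori`).
Confinement holds because the energy is negative far away and has a strict sign close to the real
axis away from `0` and `-T`, while near these two points a logarithmically growing dyadic sum
(`dyadic_sum_ge`) contradicts the boundedness of `c`. The density assumption provides the windows
used here, and the intermediate scale assumption bounds the far field (`regularWeights_wt`).

The factorization also dictates the contours. Curves of steepest descent would depend on the
configuration. Instead one takes the level curves through `zc` of the real part of `z + |zc|² log z
- |zc + 1|² log (z + 1)`, a primitive of the rational factor in the scaled variable. On them the
rational factor times `dz` is imaginary, so `log ‖action‖` has as derivative a real factor of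
constant sign times the imaginary part of `nevan`, and it is monotone for every admissible
configuration (`Arm.log_norm_action`). In terms of the distances `|z|` and `|z + 1|` the level
equation separates: each distance is an explicit function `rad` of a common parameter (`exists_arm`,
`exists_contours`).

The `w` integral of the kernel is a sum of residues at particles, hence a Lagrange interpolant in
`z` (`wContourIntegral_bernoulli`). The integral over any loop around the relevant particles
produces the same interpolant, plus the residue at `w = z` when `z` is inside
(`Loop.residueSum_eq`). With `z` on the two arms where the action decreases and `w` on the loop of
the two arms where it increases, the double integral is `O(T ^ (-1/4))`, and only the integral of
the residue over the arm inside the loop survives (`norm_bernoulliKernel_sub_le`,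
`exists_norm_bernoulliKernel_sub_le`).

In that integral all Gamma functions combine into ratios tending to `1` and powers of `ζ` and `ζ +
1` (`mainTerm_eq`). The substitution `u = ζ / (ζ + 1)` turns it into the extended sine kernel; the
binomial term accounts for crossing the real line in `(-∞, 0)` instead of `(0, 1)` when `t₁ > t₂`
(`binomial_add_integral_eq_extendedSineKernel`). All constants depend only on the compact region
containing `zc`, which makes the limit uniform. -/

noncomputable section

/-! ### The function `ell` -/

/-- The signed square root of `exp (2 y) - 1 - 2 y`. -/
def signedRoot (y : ℝ) : ℝ :=
  if 0 ≤ y then √(Real.exp (2 * y) - 1 - 2 * y) else -√(Real.exp (2 * y) - 1 - 2 * y)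

lemma exp_sub_nonneg (y : ℝ) : 0 ≤ Real.exp (2 * y) - 1 - 2 * y := by
  linarith [Real.add_one_le_exp (2 * y)]

lemma exp_sub_strictMonoOn : StrictMonoOn (fun y : ℝ => Real.exp (2 * y) - 1 - 2 * y) (Set.Ici 0) := by
  apply strictMonoOn_of_deriv_pos (convex_Ici 0) (by fun_prop)
  intro x hx
  simp only [interior_Ici, Set.mem_Ioi] at hx
  have : HasDerivAt (fun y : ℝ => Real.exp (2 * y) - 1 - 2 * y) (Real.exp (2 * x) * (2 * 1) - 2 * 1) x :=
    ((((hasDerivAt_id x).const_mul 2).exp).sub_const 1).sub ((hasDerivAt_id x).const_mul 2)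
  rw [this.deriv]
  have := Real.add_one_lt_exp (x := 2 * x) (by linarith)
  linarith

lemma exp_sub_strictAntiOn : StrictAntiOn (fun y : ℝ => Real.exp (2 * y) - 1 - 2 * y) (Set.Iic 0) := by
  apply strictAntiOn_of_deriv_neg (convex_Iic 0) (by fun_prop)
  intro x hx
  simp only [interior_Iic, Set.mem_Iio] at hx
  have : HasDerivAt (fun y : ℝ => Real.exp (2 * y) - 1 - 2 * y) (Real.exp (2 * x) * (2 * 1) - 2 * 1) x :=
    ((((hasDerivAt_id x).const_mul 2).exp).sub_const 1).sub ((hasDerivAt_id x).const_mul 2)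
  rw [this.deriv]
  have : Real.exp (2 * x) < 1 := by rw [Real.exp_lt_one_iff]; linarith
  linarith

lemma signedRoot_zero : signedRoot 0 = 0 := by simp [signedRoot]

lemma signedRoot_pos {y : ℝ} (hy : 0 < y) : 0 < signedRoot y := by
  have := exp_sub_strictMonoOn (a := 0) (b := y) (by simp) (by simpa using hy.le) hy
  rw [signedRoot, if_pos hy.le]
  apply Real.sqrt_pos.2
  simpa using this

lemma signedRoot_neg {y : ℝ} (hy : y < 0) : signedRoot y < 0 := by
  have := exp_sub_strictAntiOn (a := y) (b := 0) (by simpa using hy.le) (by simp) hy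
  rw [signedRoot, if_neg (by linarith), neg_lt_zero]
  apply Real.sqrt_pos.2
  simpa using this

lemma signedRoot_sq (y : ℝ) : signedRoot y ^ 2 = Real.exp (2 * y) - 1 - 2 * y := by
  unfold signedRoot
  split_ifs <;> simp [Real.sq_sqrt (exp_sub_nonneg y)]

lemma signedRoot_strictMono : StrictMono signedRoot := by
  intro x y hxy
  rcases lt_or_ge x 0 with hx | hx
  · rcases le_or_gt 0 y with hy | hy
    · rcases hy.eq_or_lt with rfl | hy
      · rw [signedRoot_zero]; exact signedRoot_neg hx
      · exact (signedRoot_neg hx).trans (signedRoot_pos hy)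
    · rw [signedRoot, signedRoot, if_neg (by linarith), if_neg (by linarith), neg_lt_neg_iff]
      exact Real.sqrt_lt_sqrt (exp_sub_nonneg y)
        (exp_sub_strictAntiOn (by simpa using hx.le) (by simpa using hy.le) hxy)
  · rw [signedRoot, signedRoot, if_pos hx, if_pos (by linarith)]
    exact Real.sqrt_lt_sqrt (exp_sub_nonneg x)
        (exp_sub_strictMonoOn (by simpa using hx) (by simp; linarith) hxy)

lemma continuous_signedRoot : Continuous signedRoot := by
  unfold signedRoot
  apply Continuous.if_le (by fun_prop) (by fun_prop) (by fun_prop) (by fun_prop)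
  intro x hx
  simp [← hx]

lemma signedRoot_surjective : Function.Surjective signedRoot := by
  apply continuous_signedRoot.surjective
  · rw [tendsto_atTop]
    intro b
    filter_upwards [eventually_ge_atTop (max 0 b)] with y hy
    have h0 : 0 ≤ y := (le_max_left _ _).trans hy
    refine ((le_max_right _ _).trans hy).trans ?_
    rw [signedRoot, if_pos h0]
    apply Real.le_sqrt_of_sq_le
    have := Real.quadratic_le_exp_of_nonneg (x := 2 * y) (by linarith)
    nlinarith
  · rw [tendsto_atBot]
    intro b
    filter_upwards [eventually_le_atBot (-(1 + b ^ 2))] with y hy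
    have h0 : y < 0 := by nlinarith [sq_nonneg b]
    rw [signedRoot, if_neg (by linarith)]
    rw [neg_le]
    apply Real.le_sqrt_of_sq_le
    have := Real.exp_pos (2 * y)
    nlinarith

/-- The homeomorphism of `ℝ` given by `signedRoot`. -/
def signedRootIso : ℝ ≃o ℝ := signedRoot_strictMono.orderIsoOfSurjective _ signedRoot_surjective

/-- The increasing function `ell` with `ell x ^ 2 - 1 - 2 log (ell x) = x ^ 2`. -/
def ell (x : ℝ) : ℝ := Real.exp (signedRootIso.symm x)

lemma signedRoot_symm (x : ℝ) : signedRoot (signedRootIso.symm x) = x :=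
  signedRootIso.apply_symm_apply x

lemma ell_pos (x : ℝ) : 0 < ell x := Real.exp_pos _

lemma continuous_ell : Continuous ell :=
  Real.continuous_exp.comp signedRootIso.symm.toHomeomorph.continuous

lemma ell_strictMono : StrictMono ell :=
  Real.exp_strictMono.comp signedRootIso.symm.strictMono

lemma ell_zero : ell 0 = 1 := by
  have : signedRootIso.symm 0 = 0 := by
    rw [OrderIso.symm_apply_eq]
    exact signedRoot_zero.symm
  rw [ell, this, Real.exp_zero]

lemma ell_eq (x : ℝ) : ell x ^ 2 - 1 - 2 * Real.log (ell x) = x ^ 2 := by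
  have := signedRoot_sq (signedRootIso.symm x)
  rw [signedRoot_symm] at this
  rw [this, ell, Real.log_exp, ← Real.exp_nat_mul]
  norm_num

lemma one_lt_ell {x : ℝ} (hx : 0 < x) : 1 < ell x := ell_zero ▸ ell_strictMono hx

lemma ell_lt_one {x : ℝ} (hx : x < 0) : ell x < 1 := ell_zero ▸ ell_strictMono hx

lemma ell_sq_ne_one {x : ℝ} (hx : x ≠ 0) : ell x ^ 2 - 1 ≠ 0 := by
  rcases hx.lt_or_gt with h | h
  · have := ell_lt_one h
    have := ell_pos x
    nlinarith
  · have := one_lt_ell h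
    nlinarith

/-- Inverse function theorem for `signedRoot`. The origin is left out because the square root is not
differentiated at a zero of its argument; the arms need only positive parameters. -/
lemma hasDerivAt_ell {x : ℝ} (hx : x ≠ 0) :
    HasDerivAt ell (x * ell x / (ell x ^ 2 - 1)) x := by
  set y := signedRootIso.symm x with hy
  have hyx : signedRoot y = x := signedRoot_symm x
  have hex : Real.exp (2 * y) = ell x ^ 2 := by
    rw [ell, ← hy, ← Real.exp_nat_mul]; norm_num
  have hd : HasDerivAt signedRoot ((ell x ^ 2 - 1) / x) y := by
    have h1 : HasDerivAt (fun y : ℝ => Real.exp (2 * y) - 1 - 2 * y)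
        (Real.exp (2 * y) * (2 * 1) - 2 * 1) y :=
      ((((hasDerivAt_id y).const_mul 2).exp).sub_const 1).sub ((hasDerivAt_id y).const_mul 2)
    have hpos : Real.exp (2 * y) - 1 - 2 * y ≠ 0 := by
      rw [← signedRoot_sq, hyx]; positivity
    have h2 := h1.sqrt hpos
    rcases lt_trichotomy y 0 with h | h | h
    · have hs : √(Real.exp (2 * y) - 1 - 2 * y) = -x := by
        rw [← hyx, signedRoot, if_neg (by linarith), neg_neg]
      refine (h2.neg.congr_of_eventuallyEq ?_).congr_deriv ?_
      · filter_upwards [Iio_mem_nhds h] with z hz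
        rw [signedRoot, if_neg (by simpa using hz)]
        rfl
      · rw [hs, hex]; field_simp
    · rw [h, signedRoot_zero] at hyx
      exact absurd hyx.symm hx
    · have hs : √(Real.exp (2 * y) - 1 - 2 * y) = x := by
        rw [← hyx, signedRoot, if_pos h.le]
      refine (h2.congr_of_eventuallyEq ?_).congr_deriv ?_
      · filter_upwards [Ioi_mem_nhds h] with z hz
        rw [signedRoot, if_pos (by simp at hz; exact hz.le)]
      · rw [hs, hex]; field_simp
  have hinv : HasDerivAt signedRootIso.symm ((ell x ^ 2 - 1) / x)⁻¹ x := by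
    apply HasDerivAt.of_local_left_inverse (f := signedRoot)
      signedRootIso.symm.toHomeomorph.continuous.continuousAt
    · exact hd
    · exact div_ne_zero (ell_sq_ne_one hx) hx
    · exact Eventually.of_forall fun z => signedRoot_symm z
  refine hinv.exp.congr_deriv ?_
  change ell x * _ = _
  rw [inv_div]; ring

/-- The bound `log y ≤ y - 1` in `ell_eq`. Together with `sq_mul_ell_le` it controls `x / (ell x -
1)` from both sides, and hence the derivative of `ell`. -/
lemma abs_ell_sub_one_le (x : ℝ) : (ell x - 1) ^ 2 ≤ x ^ 2 := by
  have := ell_eq x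
  have := Real.log_le_sub_one_of_pos (ell_pos x)
  nlinarith

/-- The opposite bound `1 - 1 / y ≤ log y` in `ell_eq`, with `y³ - 3 y + 2 = (y - 1)² (y + 2)`. -/
lemma sq_mul_ell_le (x : ℝ) : x ^ 2 * ell x ≤ (ell x - 1) ^ 2 * (ell x + 2) := by
  have h0 := ell_pos x
  have h1 := ell_eq x
  have h2 := Real.one_sub_inv_le_log_of_pos h0
  have h3 : ell x - 1 ≤ Real.log (ell x) * ell x := by
    have := mul_le_mul_of_nonneg_right h2 h0.le
    rwa [sub_mul, inv_mul_cancel₀ h0.ne', one_mul] at this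
  rw [← h1]
  nlinarith

lemma ell_div_pos {x : ℝ} (hx : x ≠ 0) : 0 < x / (ell x - 1) := by
  rcases hx.lt_or_gt with h | h
  · exact div_pos_of_neg_of_neg h (by linarith [ell_lt_one h])
  · exact div_pos h (by linarith [one_lt_ell h])

/-- The derivative is `x / (ell x - 1)`, which is at least `1`, times `ell x / (ell x + 1)`. A lower
bound on a radius thus gives a lower bound on its speed. -/
lemma le_ell_deriv {x : ℝ} (hx : x ≠ 0) :
    ell x / (ell x + 1) ≤ x * ell x / (ell x ^ 2 - 1) := by
  have h0 := ell_pos x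
  have h1 := ell_div_pos hx
  have h2 : 1 ≤ x / (ell x - 1) := by
    have hne : ell x - 1 ≠ 0 := by rintro h; rw [h] at h1; simp at h1
    have h3 : 1 ≤ (x / (ell x - 1)) ^ 2 := by
      rw [div_pow, one_le_div (by positivity)]
      exact abs_ell_sub_one_le x
    nlinarith
  have : x * ell x / (ell x ^ 2 - 1) = (x / (ell x - 1)) * (ell x / (ell x + 1)) := by
    rw [div_mul_div_comm]; ring_nf
  rw [this]
  exact le_mul_of_one_le_left (by positivity) h2

/-- After squaring, `sq_mul_ell_le` reduces the claim to `y (y + 2) ≤ (y + 1)²`. -/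
lemma ell_deriv_le {x : ℝ} (hx : x ≠ 0) : x * ell x / (ell x ^ 2 - 1) ≤ 1 := by
  have h0 := ell_pos x
  have h1 := ell_div_pos hx
  have hne : ell x - 1 ≠ 0 := by rintro h; rw [h] at h1; simp at h1
  have : x * ell x / (ell x ^ 2 - 1) = (x / (ell x - 1)) * (ell x / (ell x + 1)) := by
    rw [div_mul_div_comm]; ring_nf
  rw [this]
  have h4 : ((x / (ell x - 1)) * (ell x / (ell x + 1))) ^ 2 ≤ 1 := by
    rw [mul_pow, div_pow, div_pow, div_mul_div_comm, div_le_one (by positivity)]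
    have := mul_le_mul_of_nonneg_right (sq_mul_ell_le x) h0.le
    nlinarith [sq_nonneg (ell x - 1)]
  have h5 : 0 < (x / (ell x - 1)) * (ell x / (ell x + 1)) := by positivity
  nlinarith

/-- For nonpositive `x` the term `ell x ^ 2 - 1` in `ell_eq` can be dropped. This decay brings a
shrinking radius below `1 / 2` at a bounded parameter. -/
lemma ell_le_exp {x : ℝ} (hx : x ≤ 0) : ell x ≤ Real.exp (-x ^ 2 / 2) := by
  have h0 := ell_pos x
  rw [← Real.log_le_iff_le_exp h0]
  have := ell_eq x
  have h1 : ell x ≤ 1 := by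
    rcases hx.eq_or_lt with rfl | h
    · rw [ell_zero]
    · exact (ell_lt_one h).le
  nlinarith

lemma one_add_half_le_ell {x : ℝ} (hx : 0 ≤ x) : 1 + x / 2 ≤ ell x := by
  have h0 := ell_pos x
  have h1 := sq_mul_ell_le x
  have h2 : 1 ≤ ell x := by
    rcases hx.eq_or_lt with rfl | h
    · rw [ell_zero]
    · exact (one_lt_ell h).le
  have h3 : x ^ 2 ≤ 3 * (ell x - 1) ^ 2 := by
    have : x ^ 2 * ell x ≤ (3 * (ell x - 1) ^ 2) * ell x := by
      nlinarith [sq_nonneg (ell x - 1)]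
    exact le_of_mul_le_mul_right this h0
  nlinarith

end

noncomputable section

/-! ### Radii along the arms -/

/-- `rad α e s` is the radius with level `s ^ 2`, larger than `α` for `e = 1` and smaller for
`e = -1` (when `s > 0`). -/
def rad (α e s : ℝ) : ℝ := α * ell (e * s / α)

/-- The level function, minimal at `P = α`. -/
def level (α P : ℝ) : ℝ := P ^ 2 - α ^ 2 - 2 * α ^ 2 * Real.log (P / α)

/-- A number is a sign. -/
def IsSign (e : ℝ) : Prop := e = 1 ∨ e = -1

lemma IsSign.mul_self {e : ℝ} (h : IsSign e) : e * e = 1 := by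
  rcases h with rfl | rfl <;> norm_num

lemma IsSign.ne_zero {e : ℝ} (h : IsSign e) : e ≠ 0 := by
  rcases h with rfl | rfl <;> norm_num

lemma isSign_one : IsSign 1 := Or.inl rfl

lemma isSign_neg_one : IsSign (-1) := Or.inr rfl

section rad

variable {α e : ℝ}

lemma rad_pos (hα : 0 < α) (s : ℝ) : 0 < rad α e s := mul_pos hα (ell_pos _)

lemma rad_zero : rad α e 0 = α := by simp [rad, ell_zero]

lemma level_rad (hα : 0 < α) (he : IsSign e) (s : ℝ) : level α (rad α e s) = s ^ 2 := by
  have h := ell_eq (e * s / α)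
  have h2 : rad α e s / α = ell (e * s / α) := by rw [rad]; field_simp
  rw [level, h2, rad]
  have h3 : (e * s / α) ^ 2 * α ^ 2 = s ^ 2 := by
    rw [div_pow, mul_pow, pow_two e, he.mul_self]; field_simp
  rw [← h3, ← h]; ring

lemma sign_mul_rad_sub_pos (hα : 0 < α) (he : IsSign e) {s : ℝ} (hs : 0 < s) :
    0 < e * (rad α e s - α) := by
  rcases he with rfl | rfl
  · have := one_lt_ell (x := 1 * s / α) (by positivity)
    rw [rad]; nlinarith
  · have := ell_lt_one (x := -1 * s / α) (by rw [neg_one_mul, neg_div, neg_lt_zero]; positivity)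
    rw [rad]; nlinarith

lemma rad_sq_sub_ne (hα : 0 < α) (he : IsSign e) {s : ℝ} (hs : 0 < s) :
    rad α e s ^ 2 - α ^ 2 ≠ 0 := by
  have h1 := sign_mul_rad_sub_pos hα he hs
  have h2 := rad_pos (e := e) hα s
  have h3 : rad α e s - α ≠ 0 := by rintro h; simp [h] at h1
  rw [sq_sub_sq]
  exact mul_ne_zero (by positivity) h3

lemma hasDerivAt_rad (hα : 0 < α) (he : IsSign e) {s : ℝ} (hs : 0 < s) :
    HasDerivAt (rad α e) (s * rad α e s / (rad α e s ^ 2 - α ^ 2)) s := by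
  have hx : e * s / α ≠ 0 := div_ne_zero (mul_ne_zero he.ne_zero hs.ne') hα.ne'
  have h1 : HasDerivAt (fun s : ℝ => e * s / α) (e * 1 / α) s :=
    ((hasDerivAt_id s).const_mul e).div_const α
  have h2 := ((hasDerivAt_ell hx).comp s h1).const_mul α
  refine h2.congr_deriv ?_
  have h3 := ell_sq_ne_one hx
  have h4 : rad α e s ^ 2 - α ^ 2 = α ^ 2 * (ell (e * s / α) ^ 2 - 1) := by rw [rad]; ring
  rw [h4, rad]
  have := he.mul_self
  field_simp
  rw [pow_two, this]; ring

/-- Rescaled form of `le_ell_deriv` and `ell_deriv_le`. The bounds stay uniform as `s → 0`, where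
both numerator and denominator of the derivative vanish. -/
lemma sign_mul_rad_deriv (hα : 0 < α) (he : IsSign e) {s : ℝ} (hs : 0 < s) :
    rad α e s / (rad α e s + α) ≤ e * (s * rad α e s / (rad α e s ^ 2 - α ^ 2)) ∧
      e * (s * rad α e s / (rad α e s ^ 2 - α ^ 2)) ≤ 1 := by
  have hx : e * s / α ≠ 0 := div_ne_zero (mul_ne_zero he.ne_zero hs.ne') hα.ne'
  have h3 := ell_sq_ne_one hx
  have h4 : rad α e s ^ 2 - α ^ 2 = α ^ 2 * (ell (e * s / α) ^ 2 - 1) := by rw [rad]; ring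
  have h5 : e * (s * rad α e s / (rad α e s ^ 2 - α ^ 2)) =
      (e * s / α) * ell (e * s / α) / (ell (e * s / α) ^ 2 - 1) := by
    rw [h4, rad]; field_simp
  have h6 : rad α e s / (rad α e s + α) = ell (e * s / α) / (ell (e * s / α) + 1) := by
    have := ell_pos (e * s / α)
    rw [rad]; field_simp
  rw [h5, h6]
  exact ⟨le_ell_deriv hx, ell_deriv_le hx⟩

lemma continuous_rad : Continuous (rad α e) := by
  unfold rad
  exact continuous_const.mul (continuous_ell.comp (by fun_prop))

lemma abs_rad_deriv_le (hα : 0 < α) (he : IsSign e) {s : ℝ} (hs : 0 < s) :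
    |s * rad α e s / (rad α e s ^ 2 - α ^ 2)| ≤ 1 := by
  have h := sign_mul_rad_deriv hα he hs
  have h2 : 0 < rad α e s / (rad α e s + α) := by
    have := rad_pos (e := e) hα s
    positivity
  rcases he with rfl | rfl <;> rw [abs_le] <;> constructor <;> linarith

end rad

/-! ### Real points of a given level -/

lemma level_self {α : ℝ} (hα : 0 < α) : level α α = 0 := by simp [level, hα.ne']

lemma level_pos {α P : ℝ} (hα : 0 < α) (hP : 0 < P) (h : P ≠ α) : 0 < level α P := by
  have h1 : Real.log (P / α) ≤ P / α - 1 := Real.log_le_sub_one_of_pos (by positivity)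
  have h2 : 2 * α ^ 2 * Real.log (P / α) ≤ 2 * α ^ 2 * (P / α - 1) := by gcongr
  have h3 : 2 * α ^ 2 * (P / α - 1) = 2 * α * P - 2 * α ^ 2 := by field_simp
  have h4 : 0 < (P - α) ^ 2 := by have := sub_ne_zero.2 h; positivity
  rw [level]; nlinarith

/-- The difference of the two levels along the real axis. -/
def levelDiff (α β ξ : ℝ) : ℝ := level β (ξ + 1) - level α ξ

/-- For `α = |zc|` and `β = |zc + 1|` one has `β² - α² - 1 = 2 Re zc`, so the quadratic in the
numerator is `|ξ - zc|²`. Hence `levelDiff` is strictly monotone on each interval cut out by `-1`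
and `0`. -/
lemma hasDerivAt_levelDiff {α β ξ : ℝ} (hα : 0 < α) (hβ : 0 < β) (h0 : ξ ≠ 0) (h1 : ξ + 1 ≠ 0) :
    HasDerivAt (levelDiff α β)
      (2 * (ξ ^ 2 - (β ^ 2 - α ^ 2 - 1) * ξ + α ^ 2) / (ξ * (ξ + 1))) ξ := by
  have aux : ∀ (α P : ℝ), 0 < α → P ≠ 0 → HasDerivAt (level α) (2 * P - 2 * α ^ 2 / P) P := by
    intro α P hα hP
    have e1 : HasDerivAt (fun P : ℝ => Real.log (P / α)) (1 / α / (P / α)) P :=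
      ((hasDerivAt_id P).div_const α).log (div_ne_zero hP hα.ne')
    have e2 := (((hasDerivAt_pow 2 P).sub_const (α ^ 2)).sub (e1.const_mul (2 * α ^ 2)))
    refine e2.congr_deriv ?_
    field_simp
    push_cast
    ring
  have h2 := ((aux β (ξ + 1) hβ h1).comp ξ ((hasDerivAt_id ξ).add_const 1)).sub (aux α ξ hα h0)
  refine h2.congr_deriv ?_
  field_simp
  ring

section levelpoints

variable {α β : ℝ} (hα : 0 < α) (hβ : 0 < β) (h : (β ^ 2 - α ^ 2 - 1) ^ 2 < 4 * α ^ 2)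
include hα hβ h

omit hα hβ in
lemma quad_pos (ξ : ℝ) : 0 < ξ ^ 2 - (β ^ 2 - α ^ 2 - 1) * ξ + α ^ 2 := by
  nlinarith [sq_nonneg (2 * ξ - (β ^ 2 - α ^ 2 - 1))]

/-- The discriminant condition says that there is a nondegenerate triangle with vertices `0`, `-1`
and a point at distances `α`, `β` from them. -/
lemma triangle_lt : α < 1 + β ∧ β < 1 + α ∧ 1 < α + β := by
  have h3 : (4 : ℝ) * α ^ 2 = (2 * α) ^ 2 := by ring
  rw [h3] at h
  have h4 := abs_lt.1 (abs_lt_of_sq_lt_sq h (by positivity))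
  refine ⟨?_, ?_, ?_⟩ <;> nlinarith

/-- `levelDiff` increases on the positive axis, is positive at `α` and, when `β > 1`, negative at `β
- 1`, so a zero lies strictly between. This locates the points of the positive axis on the level
curves. -/
lemma lt_of_level_pos_axis {P : ℝ} (hP : 0 < P) (hl : level β (1 + P) = level α P) :
    P < α ∧ β < 1 + P := by
  obtain ⟨t1, t2, t3⟩ := triangle_lt hα hβ h
  have hmono : StrictMonoOn (levelDiff α β) (Set.Ioi 0) := by
    apply strictMonoOn_of_deriv_pos (convex_Ioi 0)
    · intro x hx
      simp only [Set.mem_Ioi] at hx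
      exact (hasDerivAt_levelDiff hα hβ hx.ne' (by positivity)).continuousAt.continuousWithinAt
    · intro x hx
      simp only [interior_Ioi, Set.mem_Ioi] at hx
      rw [(hasDerivAt_levelDiff hα hβ hx.ne' (by positivity)).deriv]
      have := quad_pos h x
      positivity
  have hD : levelDiff α β P = 0 := by rw [levelDiff, add_comm, hl, sub_self]
  constructor
  · by_contra hc
    have h1 := hmono.monotoneOn (a := α) (b := P) hα hP (not_lt.1 hc)
    rw [hD, levelDiff, level_self hα] at h1
    have := level_pos (P := α + 1) hβ (by positivity) (by linarith)
    linarith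
  · by_contra hc
    have hβ1 : 0 < β - 1 := by linarith
    have h1 := hmono.monotoneOn (a := P) (b := β - 1) hP hβ1 (by linarith)
    rw [hD, levelDiff, sub_add_cancel, level_self hβ] at h1
    have := level_pos (P := β - 1) hα (by positivity) (by linarith)
    linarith

/-- Same argument between `-1` and `0`, where `levelDiff` decreases. -/
lemma lt_of_level_mid {P Q : ℝ} (hP : 0 < P) (hQ : 0 < Q) (hPQ : P + Q = 1)
    (hl : level β Q = level α P) : P < α ∧ Q < β := by
  obtain ⟨t1, t2, t3⟩ := triangle_lt hα hβ h
  have hanti : StrictAntiOn (levelDiff α β) (Set.Ioo (-1) 0) := by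
    apply strictAntiOn_of_deriv_neg (convex_Ioo _ _)
    · intro x hx
      simp only [Set.mem_Ioo] at hx
      exact (hasDerivAt_levelDiff hα hβ hx.2.ne (by linarith)).continuousAt.continuousWithinAt
    · intro x hx
      simp only [interior_Ioo, Set.mem_Ioo] at hx
      rw [(hasDerivAt_levelDiff hα hβ hx.2.ne (by linarith)).deriv]
      have := quad_pos h x
      exact div_neg_of_pos_of_neg (by linarith) (mul_neg_of_neg_of_pos hx.2 (by linarith))
  have hneg : ∀ (α P : ℝ), level α (-P) = level α P := by
    intro α P
    simp [level, neg_div]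
  have hD : levelDiff α β (-P) = 0 := by
    rw [levelDiff, hneg, ← hl, show -P + 1 = Q by linarith, sub_self]
  constructor
  · by_contra hc
    have h1 := hanti.antitoneOn (a := -P) (b := -α) ⟨by linarith, by linarith⟩
      ⟨by linarith, by linarith⟩ (by linarith)
    rw [hD, levelDiff, hneg, level_self hα] at h1
    have := level_pos (P := -α + 1) hβ (by linarith) (by linarith)
    linarith
  · by_contra hc
    have h1 := hanti.antitoneOn (a := β - 1) (b := -P) ⟨by linarith, by linarith⟩
      ⟨by linarith, by linarith⟩ (by linarith)
    rw [hD, levelDiff, sub_add_cancel, level_self hβ] at h1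
    have := level_pos (P := 1 - β) hα (by linarith) (by linarith)
    rw [show β - 1 = -(1 - β) by ring, hneg] at h1
    linarith

omit hα hβ in
lemma quad_symm : (α ^ 2 - β ^ 2 - 1) ^ 2 < 4 * β ^ 2 := by nlinarith

/-- If this failed, continuity would produce a parameter whose radii belong to a point of the
positive axis with equal levels. By `lt_of_level_pos_axis` they would then lie on opposite sides of
`α` and `β`, whereas both move in the same direction `e`. -/
lemma one_add_rad_sub_pos {e : ℝ} (he : IsSign e) {s : ℝ} (hs : 0 ≤ s) :
    0 < 1 + rad α e s - rad β e s := by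
  have h0 : 0 < 1 + rad α e 0 - rad β e 0 := by
    rw [rad_zero, rad_zero]
    linarith [(triangle_lt hα hβ h).2.1]
  by_contra hc
  obtain ⟨r, hr, hr0⟩ := intermediate_value_Icc' (f := fun s => 1 + rad α e s - rad β e s) hs
    ((continuous_const.add continuous_rad).sub continuous_rad).continuousOn
    (Set.mem_Icc.2 ⟨not_lt.1 hc, h0.le⟩)
  have hrad : rad β e r = 1 + rad α e r := by simp only at hr0; linarith
  have hl : level β (1 + rad α e r) = level α (rad α e r) := by
    rw [← hrad, level_rad hα he, level_rad hβ he]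
  have h2 := lt_of_level_pos_axis hα hβ h (rad_pos hα r) hl
  rw [← hrad] at h2
  rcases hr.1.eq_or_lt with h3 | h3
  · rw [← h3, rad_zero] at h2; exact lt_irrefl _ h2.1
  · have h4 := sign_mul_rad_sub_pos hα he h3
    have h5 := sign_mul_rad_sub_pos hβ he h3
    rcases he with rfl | rfl <;> linarith

/-- Equality would give a point of the segment from `-1` to `0`, where `lt_of_level_mid` puts both
radii below their initial values; here they move in opposite directions. -/
lemma rad_add_rad_sub_one_pos {e : ℝ} (he : IsSign e) {s : ℝ} (hs : 0 ≤ s) :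
    0 < rad α e s + rad β (-e) s - 1 := by
  have hne : IsSign (-e) := by rcases he with rfl | rfl <;> simp [IsSign]
  have h0 : 0 < rad α e 0 + rad β (-e) 0 - 1 := by
    rw [rad_zero, rad_zero]
    linarith [(triangle_lt hα hβ h).2.2]
  by_contra hc
  obtain ⟨r, hr, hr0⟩ := intermediate_value_Icc' (f := fun s => rad α e s + rad β (-e) s - 1) hs
    ((continuous_rad.add continuous_rad).sub continuous_const).continuousOn
    (Set.mem_Icc.2 ⟨not_lt.1 hc, h0.le⟩)
  have hrad : rad α e r + rad β (-e) r = 1 := by simp only at hr0; linarith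
  have hl : level β (rad β (-e) r) = level α (rad α e r) := by
    rw [level_rad hα he, level_rad hβ hne]
  have h2 := lt_of_level_mid hα hβ h (rad_pos hα r) (rad_pos hβ r) hrad hl
  rcases hr.1.eq_or_lt with h3 | h3
  · rw [← h3, rad_zero] at h2; exact lt_irrefl _ h2.1
  · have h4 := sign_mul_rad_sub_pos hα he h3
    have h5 := sign_mul_rad_sub_pos hβ hne h3
    rcases he with rfl | rfl <;> linarith

end levelpoints

end

noncomputable section

/-! ### Points with given distances to `0` and `-1` -/

/-- The abscissa of a point at distance `P` from `0` and `Q` from `-1`. -/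
def bipRe (P Q : ℝ) : ℝ := (Q ^ 2 - P ^ 2 - 1) / 2

/-- The squared ordinate of a point at distance `P` from `0` and `Q` from `-1`. -/
def bipSq (P Q : ℝ) : ℝ := P ^ 2 - bipRe P Q ^ 2

/-- The point of the closed upper half plane at distance `P` from `0` and `Q` from `-1`. -/
def bip (P Q : ℝ) : ℂ := ⟨bipRe P Q, √(bipSq P Q)⟩

/-- Heron's formula for the triangle with sides `1`, `P`, `Q`. The factor that vanishes tells which
of the three real intervals is reached. -/
lemma four_mul_bipSq (P Q : ℝ) :
    4 * bipSq P Q = (P + Q + 1) * (P + Q - 1) * (1 + P - Q) * (1 + Q - P) := by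
  rw [bipSq, bipRe]; ring

lemma norm_bip {P Q : ℝ} (hP : 0 ≤ P) (h : 0 ≤ bipSq P Q) : ‖bip P Q‖ = P := by
  rw [← sq_eq_sq₀ (norm_nonneg _) hP, ← normSq_eq_norm_sq, normSq_apply, bip]
  simp only
  rw [Real.mul_self_sqrt h, bipSq]; ring

lemma norm_bip_add_one {P Q : ℝ} (hQ : 0 ≤ Q) (h : 0 ≤ bipSq P Q) : ‖bip P Q + 1‖ = Q := by
  rw [← sq_eq_sq₀ (norm_nonneg _) hQ, ← normSq_eq_norm_sq, normSq_apply, bip]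
  simp only [add_re, add_im, one_re, one_im, add_zero]
  rw [Real.mul_self_sqrt h, bipSq, bipRe]; ring

lemma bipRe_norm (z : ℂ) : bipRe ‖z‖ ‖z + 1‖ = z.re := by
  rw [bipRe, ← normSq_eq_norm_sq, ← normSq_eq_norm_sq, normSq_apply, normSq_apply]
  simp only [add_re, add_im, one_re, one_im, add_zero]; ring

lemma bipSq_norm (z : ℂ) : bipSq ‖z‖ ‖z + 1‖ = z.im ^ 2 := by
  rw [bipSq, bipRe_norm, ← normSq_eq_norm_sq, normSq_apply]; ring

lemma bip_norm {z : ℂ} (hz : 0 ≤ z.im) : bip ‖z‖ ‖z + 1‖ = z := by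
  apply Complex.ext
  · exact bipRe_norm z
  · rw [bip]
    simp only
    rw [bipSq_norm, Real.sqrt_sq hz]

/-- The derivative of `bip` along a curve. -/
lemma hasDerivAt_bip {P Q : ℝ → ℝ} {P' Q' s : ℝ} (hP : HasDerivAt P P' s) (hQ : HasDerivAt Q Q' s)
    (h : 0 < bipSq (P s) (Q s)) :
    HasDerivAt (fun s => bip (P s) (Q s))
      (I * ((bip (P s) (Q s) + 1) * (2 * P s * P' : ℝ) - bip (P s) (Q s) * (2 * Q s * Q' : ℝ))
        / (2 * √(bipSq (P s) (Q s)) : ℝ)) s := by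
  have hx : HasDerivAt (fun s => bipRe (P s) (Q s)) (Q s * Q' - P s * P') s := by
    have := (((hQ.pow 2).sub (hP.pow 2)).sub_const 1).div_const 2
    refine this.congr_deriv ?_
    push_cast; ring
  have hV : HasDerivAt (fun s => bipSq (P s) (Q s))
      (2 * P s * P' - 2 * bipRe (P s) (Q s) * (Q s * Q' - P s * P')) s := by
    refine ((hP.pow 2).sub (hx.pow 2)).congr_deriv ?_
    push_cast; ring
  have hy := hV.sqrt h.ne'
  have hc := hx.ofReal_comp.add (hy.ofReal_comp.mul_const I)
  have hfun : (fun s => bip (P s) (Q s)) = (fun y => ((bipRe (P y) (Q y) : ℝ) : ℂ)) +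
      fun y => ((√(bipSq (P y) (Q y)) : ℝ) : ℂ) * I := by
    ext y
    apply Complex.ext <;> simp [bip]
  rw [hfun]
  refine hc.congr_deriv ?_
  have hpos : 0 < √(bipSq (P s) (Q s)) := Real.sqrt_pos.2 h
  have hyC : ((√(bipSq (P s) (Q s)) : ℝ) : ℂ) ≠ 0 := ofReal_ne_zero.2 hpos.ne'
  have hb : bip (P s) (Q s) = (bipRe (P s) (Q s) : ℝ) + (√(bipSq (P s) (Q s)) : ℝ) * I := by
    apply Complex.ext <;> simp [bip]
  rw [hb]
  push_cast
  field_simp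
  linear_combination (-(√(bipSq (P s) (Q s)) * (P s * P' - Q s * Q')) : ℂ) * I_sq

/-! ### Arms -/

/-- An arm of the steepest descent contours at `zc`: along it the function
`(z - zc) (z - conj zc) / (z (z + 1))`, multiplied by the velocity, is purely imaginary. -/
structure Arm (zc : ℂ) (e f c₀ C : ℝ) where
  path : ℝ → ℂ
  vel : ℝ → ℂ
  start : path 0 = zc
  cont : ContinuousOn path (Set.Icc 0 1)
  hasDerivAt : ∀ τ ∈ Set.Ioo (0 : ℝ) 1, HasDerivAt path (vel τ) τ
  vel_cont : ContinuousOn vel (Set.Ioo 0 1)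
  vel_bound : ∀ τ ∈ Set.Ioo (0 : ℝ) 1, ‖vel τ‖ ≤ C
  im_pos : ∀ τ ∈ Set.Ico (0 : ℝ) 1, 0 < (path τ).im
  le_norm : ∀ τ ∈ Set.Icc (0 : ℝ) 1, c₀ ≤ ‖path τ‖
  le_norm_add_one : ∀ τ ∈ Set.Icc (0 : ℝ) 1, c₀ ≤ ‖path τ + 1‖
  norm_le : ∀ τ ∈ Set.Icc (0 : ℝ) 1, ‖path τ‖ ≤ C
  grow : ∀ τ ∈ Set.Icc (0 : ℝ) 1, c₀ * τ ≤ e * (‖path τ‖ - ‖zc‖)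
  grow_add_one : ∀ τ ∈ Set.Icc (0 : ℝ) 1, c₀ * τ ≤ f * (‖path τ + 1‖ - ‖zc + 1‖)
  im_ge : ∀ τ ∈ Set.Icc (0 : ℝ) (1 / 2), c₀ ≤ (path τ).im
  descent : ∀ τ ∈ Set.Ioo (0 : ℝ) 1, ∃ κ : ℝ,
    (path τ - zc) * (path τ - (starRingEnd ℂ) zc) / (path τ * (path τ + 1)) * vel τ = I * κ ∧
      0 ≤ e * f * κ ∧ (τ ≤ 1 / 2 → c₀ * τ ≤ e * f * κ)

/-- The algebraic identity behind the descent property. -/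
lemma descent_identity {z zc : ℂ} {s : ℝ} (hz : z ≠ 0) (hz1 : z + 1 ≠ 0)
    (hA : ‖z‖ ^ 2 - ‖zc‖ ^ 2 ≠ 0) (hB : ‖z + 1‖ ^ 2 - ‖zc + 1‖ ^ 2 ≠ 0) (hy : z.im ≠ 0) :
    (z - zc) * (z - (starRingEnd ℂ) zc) / (z * (z + 1)) *
      (I * ((z + 1) * (2 * ‖z‖ * (s * ‖z‖ / (‖z‖ ^ 2 - ‖zc‖ ^ 2)) : ℝ)
        - z * (2 * ‖z + 1‖ * (s * ‖z + 1‖ / (‖z + 1‖ ^ 2 - ‖zc + 1‖ ^ 2)) : ℝ)) / (2 * z.im : ℝ)) =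
    I * ((s * (‖z - zc‖ ^ 2 * ‖z - (starRingEnd ℂ) zc‖ ^ 2) /
      (z.im * ((‖z‖ ^ 2 - ‖zc‖ ^ 2) * (‖z + 1‖ ^ 2 - ‖zc + 1‖ ^ 2))) : ℝ) : ℂ) := by
  set p := ‖z‖ ^ 2 with hp
  set q := ‖z + 1‖ ^ 2 with hq
  set A := ‖zc‖ ^ 2 with hA'
  set B := ‖zc + 1‖ ^ 2 with hB'
  -- Both sides are `z² - 2 z Re zc + |zc|²`; this writes the rational function through the
  -- increments of the two squared distances.
  have hP : (z - zc) * (z - (starRingEnd ℂ) zc) = (q - B : ℝ) * z - (p - A : ℝ) * (z + 1) := by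
    rw [hp, hq, hA', hB']
    simp only [← normSq_eq_norm_sq, normSq_apply]
    apply Complex.ext <;> simp <;> ring
  have hconj : (p * q : ℝ) * (starRingEnd ℂ) ((z - zc) * (z - (starRingEnd ℂ) zc)) =
      ((p * (q - B) : ℝ) * (z + 1) - (q * (p - A) : ℝ) * z) * (starRingEnd ℂ) (z * (z + 1)) := by
    have e1 : (p : ℂ) = z * (starRingEnd ℂ) z := by rw [mul_conj, hp, normSq_eq_norm_sq]
    have e2 : (q : ℂ) = (z + 1) * (starRingEnd ℂ) (z + 1) := by rw [mul_conj, hq, normSq_eq_norm_sq]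
    rw [hP]
    push_cast
    rw [e1, e2]
    simp only [map_sub, map_mul, map_add, map_one, conj_ofReal, conj_conj]
    ring
  have hn : ((‖z - zc‖ ^ 2 * ‖z - (starRingEnd ℂ) zc‖ ^ 2 : ℝ) : ℂ) =
      (z - zc) * (z - (starRingEnd ℂ) zc) *
        (starRingEnd ℂ) ((z - zc) * (z - (starRingEnd ℂ) zc)) := by
    rw [mul_conj, normSq_eq_norm_sq, norm_mul]; push_cast; ring
  have hpq : ((p * q : ℝ) : ℂ) = z * (z + 1) * (starRingEnd ℂ) (z * (z + 1)) := by
    rw [mul_conj, normSq_eq_norm_sq, norm_mul, hp, hq]; push_cast; ring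
  have hyC : (z.im : ℂ) ≠ 0 := ofReal_ne_zero.2 hy
  have hAC : (p : ℂ) - A ≠ 0 := by exact_mod_cast hA
  have hBC : (q : ℂ) - B ≠ 0 := by exact_mod_cast hB
  have hzz : (starRingEnd ℂ) (z * (z + 1)) ≠ 0 := by
    rw [Ne, map_eq_zero]; exact mul_ne_zero hz hz1
  -- The velocity is therefore a real multiple of `i` times the conjugate of the rational function,
  -- and the product of the two is imaginary.
  have key : (z * (z + 1)) * (starRingEnd ℂ) ((z - zc) * (z - (starRingEnd ℂ) zc)) =
      ((p * (q - B) : ℝ) * (z + 1) - (q * (p - A) : ℝ) * z) := by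
    apply mul_right_cancel₀ hzz
    rw [← hconj, hpq]; ring
  have e3 : ‖z‖ * ‖z‖ = p := by rw [hp]; ring
  have e4 : ‖z + 1‖ * ‖z + 1‖ = q := by rw [hq]; ring
  have e5 : 2 * ‖z‖ * (s * ‖z‖ / (p - A)) = 2 * s * p / (p - A) := by rw [← e3]; ring
  have e6 : 2 * ‖z + 1‖ * (s * ‖z + 1‖ / (q - B)) = 2 * s * q / (q - B) := by rw [← e4]; ring
  have e7 : ((s * (‖z - zc‖ ^ 2 * ‖z - (starRingEnd ℂ) zc‖ ^ 2) / (z.im * ((p - A) * (q - B))) : ℝ) : ℂ)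
      = s * ((z - zc) * (z - (starRingEnd ℂ) zc) *
        (starRingEnd ℂ) ((z - zc) * (z - (starRingEnd ℂ) zc))) / (z.im * ((p - A) * (q - B))) := by
    rw [← hn]; push_cast; ring
  rw [e5, e6, e7]
  push_cast at key ⊢
  generalize (starRingEnd ℂ) ((z - zc) * (z - (starRingEnd ℂ) zc)) = X at key ⊢
  generalize (z - zc) * (z - (starRingEnd ℂ) zc) = Y
  have : X = (p * (q - B) * (z + 1) - q * (p - A) * z) / (z * (z + 1)) := by
    rw [← key]; field_simp
  rw [this]
  field_simp

end

/-! ### Construction of a single arm -/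

noncomputable section

/-- Mean value inequality: the speed is at least `rad / (rad + α)`, hence at least `δ / (2 M)`,
while the radius stays in `[δ, M]`. -/
lemma rad_grow {α e δ M S : ℝ} (hα : 0 < α) (he : IsSign e) (hδ : 0 < δ) (hM : 0 < M)
    (h : ∀ s ∈ Set.Icc 0 S, δ ≤ rad α e s ∧ rad α e s ≤ M) {s : ℝ} (hs : s ∈ Set.Icc 0 S) :
    δ / (2 * M) * s ≤ e * (rad α e s - α) := by
  have hαM : α ≤ M := by
    have := (h 0 ⟨le_rfl, hs.1.trans hs.2⟩).2
    rwa [rad_zero] at this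
  have hmvt := (convex_Icc (0 : ℝ) s).mul_sub_le_image_sub_of_le_deriv
    (f := fun s => e * rad α e s) (C := δ / (2 * M))
    (continuous_const.mul continuous_rad).continuousOn
    (by
      intro x hx
      rw [interior_Icc] at hx
      exact ((hasDerivAt_rad hα he hx.1).const_mul e).differentiableAt.differentiableWithinAt)
    (by
      intro x hx
      rw [interior_Icc] at hx
      rw [((hasDerivAt_rad hα he hx.1).const_mul e).deriv]
      refine le_trans ?_ (sign_mul_rad_deriv hα he hx.1).1
      have hx2 := h x ⟨hx.1.le, hx.2.le.trans hs.2⟩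
      have := rad_pos (e := e) hα x
      rw [div_le_div_iff₀ (by positivity) (by positivity)]
      nlinarith)
    0 (Set.left_mem_Icc.2 hs.1) s (Set.right_mem_Icc.2 hs.1) hs.1
  simp only [rad_zero, sub_zero] at hmvt
  linarith

/-- Arms exist, with constants depending only on bounds for the radii. -/
lemma exists_arm {δ M : ℝ} (hδ : 0 < δ) (hM : 0 < M) :
    ∃ c₀ > 0, ∃ C > 0, ∀ zc : ℂ, δ ≤ zc.im → ∀ e f : ℝ, IsSign e → IsSign f →
      ∀ S : ℝ, δ ≤ S → S ≤ M →
      (∀ s ∈ Set.Icc 0 S, δ ≤ rad ‖zc‖ e s ∧ rad ‖zc‖ e s ≤ M) →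
      (∀ s ∈ Set.Icc 0 S, δ ≤ rad ‖zc + 1‖ f s ∧ rad ‖zc + 1‖ f s ≤ M) →
      (∀ s ∈ Set.Icc 0 S, δ * (S - s) ≤ bipSq (rad ‖zc‖ e s) (rad ‖zc + 1‖ f s)) →
      ∃ arm : Arm zc e f c₀ C, arm.path 1 = bip (rad ‖zc‖ e S) (rad ‖zc + 1‖ f S) := by
  -- `δ / 2` serves the ordinate for `τ ≤ 1 / 2`, `δ² / (2 M)` the growth of the radii, `δ⁴ / (4
  -- M³)` the descent; `4 M³ / δ` bounds the velocity.
  refine ⟨min (δ / 2) (min (δ ^ 2 / (2 * M)) (δ ^ 4 / (4 * M ^ 3))), by positivity,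
    max M (4 * M ^ 3 / δ), by positivity, ?_⟩
  set c₀ := min (δ / 2) (min (δ ^ 2 / (2 * M)) (δ ^ 4 / (4 * M ^ 3))) with hc₀
  have hc1 : c₀ ≤ δ / 2 := min_le_left _ _
  have hc2 : c₀ ≤ δ ^ 2 / (2 * M) := (min_le_right _ _).trans (min_le_left _ _)
  have hc3 : c₀ ≤ δ ^ 4 / (4 * M ^ 3) := (min_le_right _ _).trans (min_le_right _ _)
  intro zc hzc e f he hf S hS hSM hP hQ hV
  have hzim : 0 < zc.im := hδ.trans_le hzc
  set α := ‖zc‖ with hαdef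
  set β := ‖zc + 1‖ with hβdef
  have hα : 0 < α := norm_pos_iff.2 (by rintro h; simp [h] at hzim)
  have hβ : 0 < β := norm_pos_iff.2 (by
    rintro h
    have : (zc + 1).im = 0 := by rw [h]; rfl
    simp at this
    linarith)
  have hS0 : 0 < S := hδ.trans_le hS
  -- the parameter
  set σ : ℝ → ℝ := fun τ => S * (τ * (2 - τ)) with hσ
  have hσmem : ∀ τ ∈ Set.Icc (0 : ℝ) 1, σ τ ∈ Set.Icc 0 S := by
    intro τ hτ
    have h1 : 0 ≤ τ * (2 - τ) := mul_nonneg hτ.1 (by linarith [hτ.2])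
    have h2 : τ * (2 - τ) ≤ 1 := by nlinarith [sq_nonneg (1 - τ)]
    exact ⟨mul_nonneg hS0.le h1, by simp only [hσ]; nlinarith⟩
  have hσpos : ∀ τ ∈ Set.Ioo (0 : ℝ) 1, 0 < σ τ := by
    intro τ hτ
    exact mul_pos hS0 (mul_pos hτ.1 (by linarith [hτ.2]))
  have hσge : ∀ τ ∈ Set.Icc (0 : ℝ) 1, S * τ ≤ σ τ := by
    intro τ hτ
    simp only [hσ]
    have : τ ≤ τ * (2 - τ) := by nlinarith [hτ.1, hτ.2]
    gcongr
  -- An arm may end on the real axis, where the squared ordinate can vanish linearly in `s` and the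
  -- velocity in `s` blows up. The double zero at `τ = 1` keeps the ordinate bounded below by a
  -- multiple of `1 - τ`, and the factor `1 - τ` from the chain rule then bounds the velocity.
  have hσsub : ∀ τ, S - σ τ = S * (1 - τ) ^ 2 := by intro τ; simp only [hσ]; ring
  have hσd : ∀ τ, HasDerivAt σ (S * (2 * (1 - τ))) τ := by
    intro τ
    have := ((hasDerivAt_id τ).mul ((hasDerivAt_id τ).const_sub 2)).const_mul S
    refine this.congr_deriv ?_
    simp only [id]
    ring
  set P : ℝ → ℝ := fun s => rad α e s with hPdef
  set Q : ℝ → ℝ := fun s => rad β f s with hQdef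
  have hσc : Continuous σ := by simp only [hσ]; fun_prop
  have hPc : Continuous P := continuous_rad
  have hQc : Continuous Q := continuous_rad
  have hV0 : ∀ τ ∈ Set.Icc (0 : ℝ) 1, 0 ≤ bipSq (P (σ τ)) (Q (σ τ)) := by
    intro τ hτ
    refine le_trans ?_ (hV _ (hσmem τ hτ))
    exact mul_nonneg hδ.le (by linarith [(hσmem τ hτ).2])
  have hy : ∀ τ ∈ Set.Icc (0 : ℝ) 1, δ * (1 - τ) ≤ √(bipSq (P (σ τ)) (Q (σ τ))) := by
    intro τ hτ
    apply Real.le_sqrt_of_sq_le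
    refine le_trans ?_ (hV _ (hσmem τ hτ))
    rw [hσsub]
    nlinarith [sq_nonneg (1 - τ), mul_nonneg (mul_nonneg hδ.le (sub_nonneg.2 hS)) (sq_nonneg (1 - τ))]
  have hypos : ∀ τ ∈ Set.Ico (0 : ℝ) 1, 0 < √(bipSq (P (σ τ)) (Q (σ τ))) := by
    intro τ hτ
    exact lt_of_lt_of_le (mul_pos hδ (by linarith [hτ.2])) (hy τ ⟨hτ.1, hτ.2.le⟩)
  set path : ℝ → ℂ := fun τ => bip (P (σ τ)) (Q (σ τ)) with hpath
  have hn : ∀ τ ∈ Set.Icc (0 : ℝ) 1, ‖path τ‖ = P (σ τ) := fun τ hτ =>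
    norm_bip (rad_pos hα _).le (hV0 τ hτ)
  have hn1 : ∀ τ ∈ Set.Icc (0 : ℝ) 1, ‖path τ + 1‖ = Q (σ τ) := fun τ hτ =>
    norm_bip_add_one (rad_pos hβ _).le (hV0 τ hτ)
  have him : ∀ τ, (path τ).im = √(bipSq (P (σ τ)) (Q (σ τ))) := fun τ => rfl
  set vs : ℝ → ℂ := fun s => I * ((bip (P s) (Q s) + 1) *
      (2 * P s * (s * P s / (P s ^ 2 - α ^ 2)) : ℝ)
      - bip (P s) (Q s) * (2 * Q s * (s * Q s / (Q s ^ 2 - β ^ 2)) : ℝ))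
      / (2 * √(bipSq (P s) (Q s)) : ℝ) with hvs
  set vel : ℝ → ℂ := fun τ => (S * (2 * (1 - τ)) : ℝ) * vs (σ τ) with hvel
  have hder : ∀ τ ∈ Set.Ioo (0 : ℝ) 1, HasDerivAt path (vel τ) τ := by
    intro τ hτ
    have hb := hasDerivAt_bip (hasDerivAt_rad hα he (hσpos τ hτ)) (hasDerivAt_rad hβ hf (hσpos τ hτ))
      (Real.sqrt_pos.1 (hypos τ ⟨hτ.1.le, hτ.2⟩))
    have := hb.scomp τ (hσd τ)
    simp only [real_smul] at this
    exact this
  have hbipc : Continuous fun s => bip (P s) (Q s) := by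
    have : (fun s => bip (P s) (Q s)) = fun s => ((bipRe (P s) (Q s) : ℝ) : ℂ) +
        ((√(bipSq (P s) (Q s)) : ℝ) : ℂ) * I := by
      ext s; apply Complex.ext <;> simp [bip]
    rw [this]
    unfold bipSq bipRe
    fun_prop
  have hdP : ∀ τ ∈ Set.Ioo (0 : ℝ) 1, P (σ τ) ^ 2 - α ^ 2 ≠ 0 := fun τ hτ =>
    rad_sq_sub_ne hα he (hσpos τ hτ)
  have hdQ : ∀ τ ∈ Set.Ioo (0 : ℝ) 1, Q (σ τ) ^ 2 - β ^ 2 ≠ 0 := fun τ hτ =>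
    rad_sq_sub_ne hβ hf (hσpos τ hτ)
  have hPσ : Continuous fun τ => P (σ τ) := hPc.comp hσc
  have hQσ : Continuous fun τ => Q (σ τ) := hQc.comp hσc
  have hVσ : Continuous fun τ => √(bipSq (P (σ τ)) (Q (σ τ))) := by
    unfold bipSq bipRe; fun_prop
  have hbσ : Continuous fun τ => bip (P (σ τ)) (Q (σ τ)) := hbipc.comp hσc
  refine ⟨{ path := path, vel := vel, start := ?_, cont := ?_, hasDerivAt := hder, vel_cont := ?_,
            vel_bound := ?_, im_pos := ?_, le_norm := ?_, le_norm_add_one := ?_, norm_le := ?_,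
            grow := ?_, grow_add_one := ?_, im_ge := ?_, descent := ?_ }, ?_⟩
  · simp only [hpath, hσ, hPdef, hQdef]
    simp only [zero_mul, mul_zero, rad_zero]
    exact bip_norm hzim.le
  · exact (hbipc.comp hσc).continuousOn
  · simp only [hvel, hvs]
    have c1 : ContinuousOn (fun τ => (2 * P (σ τ) * (σ τ * P (σ τ) / (P (σ τ) ^ 2 - α ^ 2)) : ℝ))
        (Set.Ioo 0 1) :=
      ContinuousOn.mul (by fun_prop) (ContinuousOn.div (by fun_prop) (by fun_prop) hdP)
    have c2 : ContinuousOn (fun τ => (2 * Q (σ τ) * (σ τ * Q (σ τ) / (Q (σ τ) ^ 2 - β ^ 2)) : ℝ))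
        (Set.Ioo 0 1) :=
      ContinuousOn.mul (by fun_prop) (ContinuousOn.div (by fun_prop) (by fun_prop) hdQ)
    have c1' := continuous_ofReal.comp_continuousOn c1
    have c2' := continuous_ofReal.comp_continuousOn c2
    have c3 : Continuous fun τ => ((2 * √(bipSq (P (σ τ)) (Q (σ τ))) : ℝ) : ℂ) := by fun_prop
    refine ContinuousOn.mul (by fun_prop) (ContinuousOn.div ?_ c3.continuousOn ?_)
    · exact continuousOn_const.mul (((hbσ.add continuous_const).continuousOn.mul c1').sub
        (hbσ.continuousOn.mul c2'))
    · intro τ hτ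
      exact ofReal_ne_zero.2 (by linarith [hypos τ ⟨hτ.1.le, hτ.2⟩])
  · intro τ hτ
    have hτ' : τ ∈ Set.Icc (0 : ℝ) 1 := ⟨hτ.1.le, hτ.2.le⟩
    have hm := hσmem τ hτ'
    have hp0 := rad_pos (e := e) hα (σ τ)
    have hq0 := rad_pos (e := f) hβ (σ τ)
    have hyp := hypos τ ⟨hτ.1.le, hτ.2⟩
    have b1 : ‖vs (σ τ)‖ ≤ 2 * M ^ 2 / √(bipSq (P (σ τ)) (Q (σ τ))) := by
      have e1 : ‖vs (σ τ)‖ = ‖(bip (P (σ τ)) (Q (σ τ)) + 1) *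
          (2 * P (σ τ) * (σ τ * P (σ τ) / (P (σ τ) ^ 2 - α ^ 2)) : ℝ)
          - bip (P (σ τ)) (Q (σ τ)) * (2 * Q (σ τ) * (σ τ * Q (σ τ) / (Q (σ τ) ^ 2 - β ^ 2)) : ℝ)‖ /
          (2 * √(bipSq (P (σ τ)) (Q (σ τ)))) := by
        simp only [hvs]
        rw [norm_div, norm_mul, norm_I, one_mul, norm_real, Real.norm_of_nonneg (by positivity)]
      rw [e1, div_le_div_iff₀ (by positivity) hyp]
      have t1 := abs_rad_deriv_le hα he (hσpos τ hτ)
      have t2 := abs_rad_deriv_le hβ hf (hσpos τ hτ)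
      have e2 : ‖(bip (P (σ τ)) (Q (σ τ)) + 1) *
          (2 * P (σ τ) * (σ τ * P (σ τ) / (P (σ τ) ^ 2 - α ^ 2)) : ℝ)
          - bip (P (σ τ)) (Q (σ τ)) * (2 * Q (σ τ) * (σ τ * Q (σ τ) / (Q (σ τ) ^ 2 - β ^ 2)) : ℝ)‖
          ≤ Q (σ τ) * (2 * P (σ τ) * 1) + P (σ τ) * (2 * Q (σ τ) * 1) := by
        refine (norm_sub_le _ _).trans ?_
        rw [norm_mul, norm_mul, norm_real, norm_real, norm_mul, norm_mul (2 * Q (σ τ)),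
          Real.norm_of_nonneg (show 0 ≤ 2 * P (σ τ) by positivity),
          Real.norm_of_nonneg (show 0 ≤ 2 * Q (σ τ) by positivity)]
        have := hn τ hτ'
        have := hn1 τ hτ'
        simp only [hpath] at *
        rw [hn τ hτ', hn1 τ hτ']
        gcongr
        · exact t1
        · exact t2
      have e3 : Q (σ τ) * (2 * P (σ τ) * 1) + P (σ τ) * (2 * Q (σ τ) * 1) ≤ 4 * M ^ 2 := by
        have := (hP _ hm).2
        have := (hQ _ hm).2
        have : P (σ τ) * Q (σ τ) ≤ M * M := by gcongr
        nlinarith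
      have := mul_le_mul_of_nonneg_right (e2.trans e3) hyp.le
      linarith
    have b2 : ‖vel τ‖ = S * (2 * (1 - τ)) * ‖vs (σ τ)‖ := by
      simp only [hvel]
      rw [norm_mul, norm_real, Real.norm_of_nonneg]
      exact mul_nonneg hS0.le (by linarith [hτ.2])
    have h1τ : 0 < 1 - τ := by linarith [hτ.2]
    rw [b2]
    refine le_trans ?_ (le_max_right _ _)
    have b3 : ‖vs (σ τ)‖ ≤ 2 * M ^ 2 / (δ * (1 - τ)) := by
      refine b1.trans ?_
      gcongr
      exact hy τ hτ'
    calc S * (2 * (1 - τ)) * ‖vs (σ τ)‖ ≤ M * (2 * (1 - τ)) * (2 * M ^ 2 / (δ * (1 - τ))) := by gcongr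
      _ = 4 * M ^ 3 / δ := by field_simp; ring
  · exact fun τ hτ => hypos τ hτ
  · intro τ hτ
    rw [hn τ hτ]
    linarith [(hP _ (hσmem τ hτ)).1]
  · intro τ hτ
    rw [hn1 τ hτ]
    linarith [(hQ _ (hσmem τ hτ)).1]
  · intro τ hτ
    rw [hn τ hτ]
    exact (hP _ (hσmem τ hτ)).2.trans (le_max_left _ _)
  · intro τ hτ
    rw [hn τ hτ]
    refine le_trans ?_ (rad_grow hα he hδ hM hP (hσmem τ hτ))
    have := hσge τ hτ
    calc c₀ * τ ≤ δ ^ 2 / (2 * M) * τ := by gcongr; exact hτ.1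
      _ = δ / (2 * M) * (δ * τ) := by ring
      _ ≤ δ / (2 * M) * σ τ := by
        gcongr
        exact le_trans (mul_le_mul_of_nonneg_right hS hτ.1) this
  · intro τ hτ
    rw [hn1 τ hτ]
    refine le_trans ?_ (rad_grow hβ hf hδ hM hQ (hσmem τ hτ))
    have := hσge τ hτ
    calc c₀ * τ ≤ δ ^ 2 / (2 * M) * τ := by gcongr; exact hτ.1
      _ = δ / (2 * M) * (δ * τ) := by ring
      _ ≤ δ / (2 * M) * σ τ := by
        gcongr
        exact le_trans (mul_le_mul_of_nonneg_right hS hτ.1) this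
  · intro τ hτ
    rw [him]
    refine le_trans ?_ (hy τ ⟨hτ.1, by linarith [hτ.2]⟩)
    nlinarith [hτ.2]
  · intro τ hτ
    have hτ' : τ ∈ Set.Icc (0 : ℝ) 1 := ⟨hτ.1.le, hτ.2.le⟩
    have hm := hσmem τ hτ'
    have hs := hσpos τ hτ
    have hp0 : 0 < P (σ τ) := rad_pos (e := e) hα (σ τ)
    have hq0 : 0 < Q (σ τ) := rad_pos (e := f) hβ (σ τ)
    have hyp := hypos τ ⟨hτ.1.le, hτ.2⟩
    have hz0 : path τ ≠ 0 := by rw [← norm_pos_iff, hn τ hτ']; exact hp0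
    have hz1 : path τ + 1 ≠ 0 := by rw [← norm_pos_iff, hn1 τ hτ']; exact hq0
    have hid := descent_identity (z := path τ) (zc := zc) (s := σ τ) hz0 hz1
      (by rw [hn τ hτ']; exact hdP τ hτ) (by rw [hn1 τ hτ']; exact hdQ τ hτ)
      (by rw [him]; exact hyp.ne')
    rw [hn τ hτ', hn1 τ hτ', him] at hid
    have h1τ : 0 < 1 - τ := by linarith [hτ.2]
    set κs := σ τ * (‖path τ - zc‖ ^ 2 * ‖path τ - (starRingEnd ℂ) zc‖ ^ 2) /
      (√(bipSq (P (σ τ)) (Q (σ τ))) * ((P (σ τ) ^ 2 - α ^ 2) * (Q (σ τ) ^ 2 - β ^ 2))) with hκs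
    -- Each increment of a distance is at most `‖path τ - zc‖`, so the square of this norm absorbs
    -- the two increments in the denominator and only the factor `σ τ` is small near `zc`.
    have hlow : σ τ * δ ^ 2 / (4 * M ^ 3) ≤ e * f * κs := by
      have g1 := sign_mul_rad_sub_pos hα he hs
      have g2 := sign_mul_rad_sub_pos hβ hf hs
      have n1 : |P (σ τ) - α| ≤ ‖path τ - zc‖ := by
        rw [← hn τ hτ']; exact abs_norm_sub_norm_le _ _
      have n2 : |Q (σ τ) - β| ≤ ‖path τ - zc‖ := by
        rw [← hn1 τ hτ']
        have := abs_norm_sub_norm_le (path τ + 1) (zc + 1)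
        rwa [add_sub_add_right_eq_sub] at this
      have n3 : δ ≤ ‖path τ - (starRingEnd ℂ) zc‖ := by
        refine le_trans ?_ ((le_abs_self _).trans (abs_im_le_norm _))
        simp only [sub_im, conj_im, him]
        linarith
      have a1 : |P (σ τ) - α| = e * (P (σ τ) - α) := by
        rcases he with rfl | rfl
        · rw [abs_of_pos (by simpa using g1), one_mul]
        · rw [abs_of_neg (by simpa using g1), neg_one_mul]
      have a2 : |Q (σ τ) - β| = f * (Q (σ τ) - β) := by
        rcases hf with rfl | rfl
        · rw [abs_of_pos (by simpa using g2), one_mul]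
        · rw [abs_of_neg (by simpa using g2), neg_one_mul]
      rw [a1] at n1
      rw [a2] at n2
      set X := e * (P (σ τ) - α) with hX
      set Y := f * (Q (σ τ) - β) with hY
      have hXpos : 0 < X := g1
      have hYpos : 0 < Y := g2
      have hprod : e * f * κs = σ τ * (‖path τ - zc‖ ^ 2 * ‖path τ - (starRingEnd ℂ) zc‖ ^ 2) /
          (√(bipSq (P (σ τ)) (Q (σ τ))) * ((X * (P (σ τ) + α)) * (Y * (Q (σ τ) + β)))) := by
        have i1 : (X * (P (σ τ) + α)) * (Y * (Q (σ τ) + β)) =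
            e * f * ((P (σ τ) ^ 2 - α ^ 2) * (Q (σ τ) ^ 2 - β ^ 2)) := by rw [hX, hY]; ring
        rw [i1, hκs]
        have i2 : e * f = 1 ∨ e * f = -1 := by
          rcases he with rfl | rfl <;> rcases hf with rfl | rfl <;> norm_num
        rcases i2 with i2 | i2
        · rw [i2, one_mul, one_mul]
        · rw [i2, neg_one_mul, neg_one_mul, mul_neg, div_neg]
      have hPM : P (σ τ) ≤ M := (hP _ hm).2
      have hQM : Q (σ τ) ≤ M := (hQ _ hm).2
      have hαM : α ≤ M := by
        have := (hP 0 ⟨le_rfl, hS0.le⟩).2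
        rwa [rad_zero] at this
      have hβM : β ≤ M := by
        have := (hQ 0 ⟨le_rfl, hS0.le⟩).2
        rwa [rad_zero] at this
      have hyM : √(bipSq (P (σ τ)) (Q (σ τ))) ≤ M := by
        refine le_trans ?_ hPM
        rw [← him, ← hn τ hτ']
        exact (le_abs_self _).trans (abs_im_le_norm _)
      rw [hprod]
      calc σ τ * δ ^ 2 / (4 * M ^ 3) = σ τ * ((X * Y) * δ ^ 2) /
            (M * ((X * (M + M)) * (Y * (M + M)))) := by field_simp; ring
        _ ≤ _ := by
          gcongr
          · rw [pow_two]
            exact mul_le_mul n1 n2 hYpos.le (norm_nonneg _)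
    refine ⟨S * (2 * (1 - τ)) * κs, ?_, ?_, ?_⟩
    · push_cast
      simp only [hvel]
      have : path τ = bip (P (σ τ)) (Q (σ τ)) := rfl
      have hvs' : vs (σ τ) = I * ((path τ + 1) *
          (2 * P (σ τ) * (σ τ * P (σ τ) / (P (σ τ) ^ 2 - α ^ 2)) : ℝ)
          - path τ * (2 * Q (σ τ) * (σ τ * Q (σ τ) / (Q (σ τ) ^ 2 - β ^ 2)) : ℝ))
          / (2 * √(bipSq (P (σ τ)) (Q (σ τ))) : ℝ) := rfl
      rw [hvs', mul_left_comm, hid]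
      push_cast
      ring
    · have : 0 ≤ e * f * κs := le_trans (by positivity) hlow
      calc (0 : ℝ) ≤ (S * (2 * (1 - τ))) * (e * f * κs) := by positivity
        _ = _ := by ring
    · intro hτh
      have hge := hσge τ hτ'
      calc c₀ * τ ≤ δ ^ 4 / (4 * M ^ 3) * τ := by gcongr; exact hτ.1.le
        _ = δ * ((δ * τ) * δ ^ 2 / (4 * M ^ 3)) := by ring
        _ ≤ (S * (2 * (1 - τ))) * (σ τ * δ ^ 2 / (4 * M ^ 3)) := by
          have r1 : δ ≤ S * (2 * (1 - τ)) := by nlinarith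
          have r2 : δ * τ ≤ σ τ := le_trans (mul_le_mul_of_nonneg_right hS hτ.1.le) hge
          have : 0 < τ := hτ.1
          gcongr
        _ ≤ (S * (2 * (1 - τ))) * (e * f * κs) := by gcongr
        _ = _ := by ring
  · change bip (P (σ 1)) (Q (σ 1)) = _
    have : σ 1 = S := by simp only [hσ]; norm_num
    rw [this]

end

/-! ### The four arms, uniformly over compact sets of critical points -/

noncomputable section

/-- Weakening the constants of an arm. -/
def Arm.weaken {zc : ℂ} {e f c C c₁ C₁ : ℝ} (a : Arm zc e f c C) (hc : c₁ ≤ c) (hC : C ≤ C₁) :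
    Arm zc e f c₁ C₁ where
  path := a.path
  vel := a.vel
  start := a.start
  cont := a.cont
  hasDerivAt := a.hasDerivAt
  vel_cont := a.vel_cont
  vel_bound τ hτ := (a.vel_bound τ hτ).trans hC
  im_pos := a.im_pos
  le_norm τ hτ := hc.trans (a.le_norm τ hτ)
  le_norm_add_one τ hτ := hc.trans (a.le_norm_add_one τ hτ)
  norm_le τ hτ := (a.norm_le τ hτ).trans hC
  grow τ hτ := (mul_le_mul_of_nonneg_right hc hτ.1).trans (a.grow τ hτ)
  grow_add_one τ hτ := (mul_le_mul_of_nonneg_right hc hτ.1).trans (a.grow_add_one τ hτ)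
  im_ge τ hτ := hc.trans (a.im_ge τ hτ)
  descent τ hτ := by
    obtain ⟨κ, h1, h2, h3⟩ := a.descent τ hτ
    exact ⟨κ, h1, h2, fun h => (mul_le_mul_of_nonneg_right hc hτ.1.le).trans (h3 h)⟩

lemma rad_increment {α e δ M S : ℝ} (hα : 0 < α) (he : IsSign e) (hδ : 0 < δ) (hM : 0 < M)
    (h : ∀ s ∈ Set.Icc 0 S, δ ≤ rad α e s ∧ rad α e s ≤ M) {s t : ℝ} (hs : 0 ≤ s) (hst : s ≤ t)
    (ht : t ≤ S) :
    δ / (2 * M) * (t - s) ≤ e * (rad α e t - rad α e s) ∧ e * (rad α e t - rad α e s) ≤ t - s := by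
  have hαM : α ≤ M := by
    have := (h 0 ⟨le_rfl, hs.trans (hst.trans ht)⟩).2
    rwa [rad_zero] at this
  have hdiff : DifferentiableOn ℝ (fun s => e * rad α e s) (interior (Set.Icc s t)) := by
    intro x hx
    rw [interior_Icc] at hx
    exact ((hasDerivAt_rad hα he (hs.trans_lt hx.1)).const_mul
      e).differentiableAt.differentiableWithinAt
  have h1 := (convex_Icc s t).mul_sub_le_image_sub_of_le_deriv
    (f := fun s => e * rad α e s) (C := δ / (2 * M))
    (continuous_const.mul continuous_rad).continuousOn hdiff
    (by
      intro x hx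
      rw [interior_Icc] at hx
      have hx0 := hs.trans_lt hx.1
      rw [((hasDerivAt_rad hα he hx0).const_mul e).deriv]
      refine le_trans ?_ (sign_mul_rad_deriv hα he hx0).1
      have hx2 := h x ⟨hx0.le, hx.2.le.trans ht⟩
      have := rad_pos (e := e) hα x
      rw [div_le_div_iff₀ (by positivity) (by positivity)]
      nlinarith)
    s (Set.left_mem_Icc.2 hst) t (Set.right_mem_Icc.2 hst) hst
  have h2 := (convex_Icc s t).image_sub_le_mul_sub_of_deriv_le
    (f := fun s => e * rad α e s) (C := 1)
    (continuous_const.mul continuous_rad).continuousOn hdiff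
    (by
      intro x hx
      rw [interior_Icc] at hx
      have hx0 := hs.trans_lt hx.1
      rw [((hasDerivAt_rad hα he hx0).const_mul e).deriv]
      exact (sign_mul_rad_deriv hα he hx0).2)
    s (Set.left_mem_Icc.2 hst) t (Set.right_mem_Icc.2 hst) hst
  constructor <;> linarith

lemma quad_lt_of_im_pos {z : ℂ} (hz : 0 < z.im) :
    (‖z + 1‖ ^ 2 - ‖z‖ ^ 2 - 1) ^ 2 < 4 * ‖z‖ ^ 2 := by
  have h := bipSq_norm z
  rw [bipSq, bipRe] at h
  have : 0 < z.im ^ 2 := by positivity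
  linarith

lemma norm_pos_of_im_pos {z : ℂ} (hz : 0 < z.im) : 0 < ‖z‖ := by
  rw [norm_pos_iff]; rintro rfl; simp at hz

lemma norm_add_one_pos_of_im_pos {z : ℂ} (hz : 0 < z.im) : 0 < ‖z + 1‖ :=
  norm_pos_of_im_pos (by simpa using hz)

lemma continuousOn_rad_norm (e : ℝ) (c : ℂ) :
    ContinuousOn (fun x : ℂ × ℝ => rad ‖x.1 + c‖ e x.2) {x | x.1 + c ≠ 0} := by
  unfold rad
  refine ContinuousOn.mul (by fun_prop) (continuous_ell.comp_continuousOn ?_)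
  refine ContinuousOn.div (by fun_prop) (by fun_prop) ?_
  intro x hx
  exact norm_ne_zero_iff.2 hx

/-- Compactness of `K × [0, M₀]`, applied to the pointwise strict inequalities `rad_pos`,
`one_add_rad_sub_pos` and `rad_add_rad_sub_one_pos`. -/
lemma rad_uniform_bounds {K : Set ℂ} (hK : IsCompact K) (hKim : ∀ z ∈ K, 0 < z.im) (M₀ : ℝ) :
    ∃ δ > 0, ∃ M > 0, ∀ z ∈ K, ∀ s ∈ Set.Icc 0 M₀, ∀ e, IsSign e →
      (δ ≤ rad ‖z‖ e s ∧ rad ‖z‖ e s ≤ M) ∧ (δ ≤ rad ‖z + 1‖ e s ∧ rad ‖z + 1‖ e s ≤ M) ∧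
      δ ≤ 1 + rad ‖z‖ e s - rad ‖z + 1‖ e s ∧ δ ≤ 1 + rad ‖z + 1‖ e s - rad ‖z‖ e s ∧
      δ ≤ rad ‖z‖ e s + rad ‖z + 1‖ (-e) s - 1 := by
  have aux : ∀ e, IsSign e → ∃ δ > 0, ∃ M > 0, ∀ z ∈ K, ∀ s ∈ Set.Icc 0 M₀,
      (δ ≤ rad ‖z‖ e s ∧ rad ‖z‖ e s ≤ M) ∧ (δ ≤ rad ‖z + 1‖ e s ∧ rad ‖z + 1‖ e s ≤ M) ∧
      δ ≤ 1 + rad ‖z‖ e s - rad ‖z + 1‖ e s ∧ δ ≤ 1 + rad ‖z + 1‖ e s - rad ‖z‖ e s ∧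
      δ ≤ rad ‖z‖ e s + rad ‖z + 1‖ (-e) s - 1 := by
    intro e he
    have hcomp : IsCompact (K ×ˢ Set.Icc 0 M₀) := hK.prod isCompact_Icc
    have cP : ContinuousOn (fun x : ℂ × ℝ => rad ‖x.1‖ e x.2) (K ×ˢ Set.Icc 0 M₀) := by
      have := continuousOn_rad_norm e 0
      simp only [add_zero] at this
      refine this.mono fun x hx => ?_
      exact norm_pos_iff.1 (norm_pos_of_im_pos (hKim _ hx.1))
    have cQ : ∀ e, ContinuousOn (fun x : ℂ × ℝ => rad ‖x.1 + 1‖ e x.2) (K ×ˢ Set.Icc 0 M₀) := by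
      intro e
      refine (continuousOn_rad_norm e 1).mono fun x hx => ?_
      exact norm_pos_iff.1 (norm_add_one_pos_of_im_pos (hKim _ hx.1))
    have cG := cP.inf ((cQ e).inf (((continuousOn_const (c := (1 : ℝ))).add cP |>.sub (cQ e)).inf
      (((continuousOn_const (c := (1 : ℝ))).add (cQ e) |>.sub cP).inf
        ((cP.add (cQ (-e))).sub (continuousOn_const (c := (1 : ℝ)))))))
    obtain ⟨δ, hδ, hδ'⟩ := hcomp.exists_forall_le' cG (a := 0) (by
      intro x hx
      have hz := hKim _ hx.1
      have hα := norm_pos_of_im_pos hz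
      have hβ := norm_add_one_pos_of_im_pos hz
      have hq := quad_lt_of_im_pos hz
      simp only [lt_min_iff]
      exact ⟨rad_pos hα _, rad_pos hβ _, one_add_rad_sub_pos hα hβ hq he hx.2.1,
        one_add_rad_sub_pos hβ hα (quad_symm hq) he hx.2.1,
        rad_add_rad_sub_one_pos hα hβ hq he hx.2.1⟩)
    obtain ⟨M1, hM1⟩ := hcomp.exists_bound_of_continuousOn cP
    obtain ⟨M2, hM2⟩ := hcomp.exists_bound_of_continuousOn (cQ e)
    refine ⟨δ, hδ, max 1 (max M1 M2), by positivity, fun z hz s hs => ?_⟩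
    have h1 := hδ' (z, s) ⟨hz, hs⟩
    simp only [le_min_iff] at h1
    have h2 := (le_abs_self _).trans (hM1 (z, s) ⟨hz, hs⟩)
    have h3 := (le_abs_self _).trans (hM2 (z, s) ⟨hz, hs⟩)
    exact ⟨⟨h1.1, h2.trans ((le_max_left _ _).trans (le_max_right _ _))⟩,
      ⟨h1.2.1, h3.trans ((le_max_right _ _).trans (le_max_right _ _))⟩, h1.2.2⟩
  obtain ⟨δ1, hδ1, M1, hM1, H1⟩ := aux 1 isSign_one
  obtain ⟨δ2, hδ2, M2, hM2, H2⟩ := aux (-1) isSign_neg_one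
  refine ⟨min δ1 δ2, by positivity, max M1 M2, by positivity, fun z hz s hs e he => ?_⟩
  have l1 := min_le_left δ1 δ2
  have l2 := min_le_right δ1 δ2
  have r1 := le_max_left M1 M2
  have r2 := le_max_right M1 M2
  rcases he with rfl | rfl
  · obtain ⟨⟨a1, a2⟩, ⟨a3, a4⟩, a5, a6, a7⟩ := H1 z hz s hs
    exact ⟨⟨l1.trans a1, a2.trans r1⟩, ⟨l1.trans a3, a4.trans r1⟩, l1.trans a5, l1.trans a6,
      l1.trans a7⟩
  · obtain ⟨⟨a1, a2⟩, ⟨a3, a4⟩, a5, a6, a7⟩ := H2 z hz s hs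
    exact ⟨⟨l2.trans a1, a2.trans r2⟩, ⟨l2.trans a3, a4.trans r2⟩, l2.trans a5, l2.trans a6,
      l2.trans a7⟩

lemma bipSq_lower {P Q a b c d : ℝ} (h0 : 1 ≤ P + Q + 1) (h1 : a ≤ P + Q - 1) (h2 : b ≤ 1 + P - Q)
    (h3 : c ≤ 1 + Q - P) (ha : 0 ≤ a) (hb : 0 ≤ b) (hc : 0 ≤ c) (hd : d ≤ a * b * c / 4) :
    d ≤ bipSq P Q := by
  have h := four_mul_bipSq P Q
  have h4 : 1 * a * b * c ≤ (P + Q + 1) * (P + Q - 1) * (1 + P - Q) * (1 + Q - P) := by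
    have k1 : 0 ≤ P + Q - 1 := ha.trans h1
    have k2 : 0 ≤ 1 + P - Q := hb.trans h2
    have k3 : 0 ≤ P + Q + 1 := by linarith
    gcongr
  linarith

/-- Existence of the four arms, uniformly for `zc` in a compact subset of the upper half plane. -/
theorem exists_contours {K : Set ℂ} (hK : IsCompact K) (hKim : ∀ z ∈ K, 0 < z.im) (R : ℝ) :
    ∃ c₀ > 0, ∃ C > 0, ∀ zc ∈ K, ∃ (zd : Arm zc (-1) (-1) c₀ C) (zu : Arm zc 1 1 c₀ C)
      (wr : Arm zc (-1) 1 c₀ C) (wl : Arm zc 1 (-1) c₀ C),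
      ((zd.path 1).im = 0 ∧ -1 < (zd.path 1).re ∧ (zd.path 1).re < 0) ∧
      ((wr.path 1).im = 0 ∧ 0 < (wr.path 1).re) ∧
      ((wl.path 1).im = 0 ∧ (wl.path 1).re < -1) ∧
      0 < (zu.path 1).im ∧ R ≤ ‖zu.path 1‖ ∧
      (∀ τ ∈ Set.Icc (0 : ℝ) 1, ‖wr.path τ‖ + 1 ≤ ‖zu.path 1‖) ∧
      (∀ τ ∈ Set.Icc (0 : ℝ) 1, ‖wl.path τ‖ + 1 ≤ ‖zu.path 1‖) := by
  obtain ⟨R0, hR0⟩ := hK.isBounded.exists_norm_le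
  set R1 := max 1 R0 + 1 with hR1
  have hR1' : 2 ≤ R1 := by have := le_max_left 1 R0; linarith
  have hnR : ∀ z ∈ K, ‖z‖ ≤ R1 := fun z hz =>
    (hR0 z hz).trans (by have := le_max_right 1 R0; linarith)
  have hnR1 : ∀ z ∈ K, ‖z + 1‖ ≤ R1 := fun z hz => by
    refine (norm_add_le _ _).trans ?_
    have := hR0 z hz
    have := le_max_right 1 R0
    simp only [norm_one]; linarith
  obtain ⟨b0, hb0, hb0'⟩ : ∃ b, 0 < b ∧ ∀ z ∈ K, b ≤ z.im :=
    hK.exists_forall_le' continuous_im.continuousOn hKim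
  -- Large enough that at parameter `M₀` every shrinking radius is below `1 / 2` and every growing
  -- one exceeds `3 / 2`, so each of the three arms below meets the real axis before `M₀`.
  set M₀ := 4 * R1 ^ 2 + 4 * R1 with hM₀
  have hM₀pos : 0 < M₀ := by positivity
  obtain ⟨δ, hδ, M, hM, H⟩ := rad_uniform_bounds hK hKim M₀
  have hnegbound : ∀ α, 0 < α → α ≤ R1 → rad α (-1) M₀ < 1 / 2 := by
    intro α hα hαR
    have h1 : ell (-1 * M₀ / α) ≤ Real.exp (-(-1 * M₀ / α) ^ 2 / 2) :=
      ell_le_exp (by rw [neg_one_mul, neg_div, neg_nonpos]; positivity)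
    have h2 : (4 * R1) ^ 2 ≤ (-1 * M₀ / α) ^ 2 := by
      have : 4 * R1 ≤ M₀ / α := by
        rw [le_div_iff₀ hα]; nlinarith
      rw [neg_one_mul, neg_div, neg_sq]
      gcongr
    have h3 : ell (-1 * M₀ / α) ≤ (1 + 8 * R1 ^ 2)⁻¹ := by
      refine h1.trans ?_
      rw [neg_div, Real.exp_neg]
      gcongr
      refine le_trans ?_ (Real.add_one_le_exp _)
      linarith
    rw [rad]
    calc α * ell (-1 * M₀ / α) ≤ R1 * (1 + 8 * R1 ^ 2)⁻¹ := by
          gcongr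
          exact (ell_pos _).le
      _ < 1 / 2 := by
        rw [← div_eq_mul_inv, div_lt_div_iff₀ (by positivity) (by norm_num)]
        nlinarith
  have hposbound : ∀ α, 0 < α → ∀ s, 0 ≤ s → α + s / 2 ≤ rad α 1 s := by
    intro α hα s hs
    have := one_add_half_le_ell (x := 1 * s / α) (by positivity)
    rw [rad]
    calc α + s / 2 = α * (1 + 1 * s / α / 2) := by field_simp
      _ ≤ _ := by gcongr
  have hM0 : ∀ z ∈ K, δ ≤ M := fun z hz =>
    ((H z hz 0 ⟨le_rfl, hM₀pos.le⟩ 1 isSign_one).1.1).trans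
      (H z hz 0 ⟨le_rfl, hM₀pos.le⟩ 1 isSign_one).1.2
  -- constants for the three arms ending on the real axis
  set δ' := min b0 (min (δ / 2) (δ ^ 3 / (4 * M))) with hδ'
  have hδ'pos : 0 < δ' := by positivity
  have hd1 : δ' ≤ b0 := min_le_left _ _
  have hd2 : δ' ≤ δ / 2 := (min_le_right _ _).trans (min_le_left _ _)
  have hd3 : δ' ≤ δ ^ 3 / (4 * M) := (min_le_right _ _).trans (min_le_right _ _)
  obtain ⟨c1, hc1, C1, hC1, A1⟩ := exists_arm hδ'pos (show 0 < max M M₀ by positivity)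
  -- constants for the arm going up
  set S₁ := 2 * (max R (C1 + 1)) + 2 with hS₁
  have hS₁pos : 0 < S₁ := by
    have := le_max_right R (C1 + 1)
    linarith
  obtain ⟨δ2, hδ2, M2, hM2, H2⟩ := rad_uniform_bounds hK hKim S₁
  set δ2' := min b0 (min δ2 (min S₁ (δ2 ^ 3 / (4 * S₁)))) with hδ2'
  have hδ2'pos : 0 < δ2' := by positivity
  have hd21 : δ2' ≤ b0 := min_le_left _ _
  have hd22 : δ2' ≤ δ2 := (min_le_right _ _).trans (min_le_left _ _)
  have hd24 : δ2' ≤ S₁ := (min_le_right _ _).trans ((min_le_right _ _).trans (min_le_left _ _))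
  have hd23 : δ2' ≤ δ2 ^ 3 / (4 * S₁) :=
    (min_le_right _ _).trans ((min_le_right _ _).trans (min_le_right _ _))
  obtain ⟨c2, hc2, C2, hC2, A2⟩ := exists_arm hδ2'pos (show 0 < max M2 S₁ by positivity)
  refine ⟨min c1 c2, by positivity, max C1 C2, by positivity, fun zc hzc => ?_⟩
  have hz := hKim _ hzc
  have hα := norm_pos_of_im_pos hz
  have hβ := norm_add_one_pos_of_im_pos hz
  have hδM := hM0 _ hzc
  have Hz := H zc hzc
  have hb : ∀ S ≤ M₀, ∀ e, IsSign e → ∀ s ∈ Set.Icc 0 S, δ ≤ rad ‖zc‖ e s ∧ rad ‖zc‖ e s ≤ M :=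
    fun S hS e he s hs => (Hz s ⟨hs.1, hs.2.trans hS⟩ e he).1
  have hb1 : ∀ S ≤ M₀, ∀ e, IsSign e → ∀ s ∈ Set.Icc 0 S,
      δ ≤ rad ‖zc + 1‖ e s ∧ rad ‖zc + 1‖ e s ≤ M :=
    fun S hS e he s hs => (Hz s ⟨hs.1, hs.2.trans hS⟩ e he).2.1
  have h0 := Hz 0 ⟨le_rfl, hM₀pos.le⟩ 1 isSign_one
  simp only [rad_zero] at h0
  obtain ⟨-, -, h01, h02, h03⟩ := h0
  have hcoef : ∀ x : ℝ, 0 ≤ x → δ' * x ≤ δ / (2 * M) * x * 2 * δ * δ / 4 ∧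
      δ' * x ≤ δ * (δ / (2 * M) * x * 2) * δ / 4 ∧ δ' * x ≤ δ * δ * (δ / (2 * M) * x * 2) / 4 := by
    intro x hx
    have e1 : δ ^ 3 / (4 * M) * x = δ / (2 * M) * x * 2 * δ * δ / 4 := by field_simp
    have e2 : δ ^ 3 / (4 * M) * x = δ * (δ / (2 * M) * x * 2) * δ / 4 := by field_simp
    have e3 : δ ^ 3 / (4 * M) * x = δ * δ * (δ / (2 * M) * x * 2) / 4 := by field_simp
    have := mul_le_mul_of_nonneg_right hd3 hx
    refine ⟨?_, ?_, ?_⟩ <;> linarith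
  have hwk : ∀ {e f : ℝ} {S : ℝ}, IsSign e → IsSign f → δ / 2 ≤ S → S ≤ M₀ →
      (∀ s ∈ Set.Icc 0 S, δ' * (S - s) ≤ bipSq (rad ‖zc‖ e s) (rad ‖zc + 1‖ f s)) →
      ∃ arm : Arm zc e f c1 C1, arm.path 1 = bip (rad ‖zc‖ e S) (rad ‖zc + 1‖ f S) := by
    intro e f S he hf hS1 hS2 hV
    refine A1 zc (hd1.trans (hb0' _ hzc)) e f he hf S (hd2.trans hS1)
      (hS2.trans (le_max_right _ _)) ?_ ?_ hV
    · intro s hs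
      have := hb S hS2 e he s hs
      exact ⟨by linarith, this.2.trans (le_max_left _ _)⟩
    · intro s hs
      have := hb1 S hS2 f hf s hs
      exact ⟨by linarith, this.2.trans (le_max_left _ _)⟩
  -- the arm down to (-1, 0)
  obtain ⟨zd, hzd1, hzd2⟩ : ∃ arm : Arm zc (-1) (-1) c1 C1, (arm.path 1).im = 0 ∧
      -1 < (arm.path 1).re ∧ (arm.path 1).re < 0 := by
    -- The arm ends when `P + Q = 1`, that is, on the segment between `-1` and `0`.
    obtain ⟨S, hS, hSeq⟩ := intermediate_value_Icc'
      (f := fun s => rad ‖zc‖ (-1) s + rad ‖zc + 1‖ (-1) s) hM₀pos.le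
      (continuous_rad.add continuous_rad).continuousOn (show (1 : ℝ) ∈ _ by
        constructor
        · have := hnegbound _ hα (hnR _ hzc)
          have := hnegbound _ hβ (hnR1 _ hzc)
          linarith
        · simp only [rad_zero]; linarith)
    simp only at hSeq
    have i1 := fun s (hs : s ∈ Set.Icc 0 S) => rad_increment hα isSign_neg_one hδ hM
      (hb S hS.2 _ isSign_neg_one) hs.1 hs.2 le_rfl
    have i2 := fun s (hs : s ∈ Set.Icc 0 S) => rad_increment hβ isSign_neg_one hδ hM
      (hb1 S hS.2 _ isSign_neg_one) hs.1 hs.2 le_rfl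
    have hSlow : δ / 2 ≤ S := by
      have a1 := (i1 0 ⟨le_rfl, hS.1⟩).2
      have a2 := (i2 0 ⟨le_rfl, hS.1⟩).2
      rw [rad_zero] at a1 a2
      linarith
    -- Of the factors in Heron's formula only `P + Q - 1` vanishes at the end, and it does so at a
    -- linear rate; this is the lower bound that `exists_arm` asks for.
    obtain ⟨arm, harm⟩ := hwk isSign_neg_one isSign_neg_one hSlow hS.2 (by
      intro s hs
      obtain ⟨⟨g1, -⟩, ⟨g2, -⟩, g3, g4, -⟩ := Hz s ⟨hs.1, hs.2.trans hS.2⟩ (-1) isSign_neg_one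
      have a1 := (i1 s hs).1
      have a2 := (i2 s hs).1
      have hx : 0 ≤ S - s := by linarith [hs.2]
      refine bipSq_lower (a := δ / (2 * M) * (S - s) * 2) (b := δ) (c := δ) (by linarith)
        (by linarith) g3 g4 (by positivity) hδ.le hδ.le (hcoef _ hx).1)
    have hp := rad_pos (e := -1) hα S
    have hq := rad_pos (e := -1) hβ S
    have hre : bipRe (rad ‖zc‖ (-1) S) (rad ‖zc + 1‖ (-1) S) = -rad ‖zc‖ (-1) S := by
      rw [bipRe, show rad ‖zc + 1‖ (-1) S = 1 - rad ‖zc‖ (-1) S by linarith]; ring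
    refine ⟨arm, ?_, ?_⟩
    · rw [harm, bip, bipSq, hre]; simp
    · rw [harm, bip, hre]
      constructor <;> simp only <;> linarith
  -- the arm to the positive axis
  obtain ⟨wr, hwr1, hwr2⟩ : ∃ arm : Arm zc (-1) 1 c1 C1, (arm.path 1).im = 0 ∧
      0 < (arm.path 1).re := by
    -- The arm ends when `Q = 1 + P`, that is, on the positive axis; now `1 + P - Q` is the
    -- vanishing factor.
    obtain ⟨S, hS, hSeq⟩ := intermediate_value_Icc
      (f := fun s => rad ‖zc + 1‖ 1 s - rad ‖zc‖ (-1) s) hM₀pos.le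
      (continuous_rad.sub continuous_rad).continuousOn (show (1 : ℝ) ∈ _ by
        constructor
        · simp only [rad_zero]; linarith
        · have := hnegbound _ hα (hnR _ hzc)
          have := hposbound _ hβ M₀ hM₀pos.le
          nlinarith)
    simp only at hSeq
    have i1 := fun s (hs : s ∈ Set.Icc 0 S) => rad_increment hα isSign_neg_one hδ hM
      (hb S hS.2 _ isSign_neg_one) hs.1 hs.2 le_rfl
    have i2 := fun s (hs : s ∈ Set.Icc 0 S) => rad_increment hβ isSign_one hδ hM
      (hb1 S hS.2 _ isSign_one) hs.1 hs.2 le_rfl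
    have hSlow : δ / 2 ≤ S := by
      have a1 := (i1 0 ⟨le_rfl, hS.1⟩).2
      have a2 := (i2 0 ⟨le_rfl, hS.1⟩).2
      rw [rad_zero] at a1 a2
      linarith
    obtain ⟨arm, harm⟩ := hwk isSign_neg_one isSign_one hSlow hS.2 (by
      intro s hs
      obtain ⟨⟨g1, -⟩, -, -, -, g5⟩ := Hz s ⟨hs.1, hs.2.trans hS.2⟩ (-1) isSign_neg_one
      have g2 := hb1 S hS.2 1 isSign_one s hs
      have a1 := (i1 s hs).1
      have a2 := (i2 s hs).1
      have hx : 0 ≤ S - s := by linarith [hs.2]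
      have b1 := (rad_increment hα isSign_neg_one hδ hM
        (hb S hS.2 _ isSign_neg_one) le_rfl hs.1 hs.2).1
      have b2 := (rad_increment hβ isSign_one hδ hM
        (hb1 S hS.2 _ isSign_one) le_rfl hs.1 hs.2).1
      have b3 : 0 ≤ δ / (2 * M) * (s - 0) := by have := hs.1; positivity
      rw [rad_zero] at b1 b2
      rw [neg_neg] at g5
      refine bipSq_lower (a := δ) (b := δ / (2 * M) * (S - s) * 2) (c := δ) (by linarith)
        g5 (by linarith) (by linarith) hδ.le (by positivity) hδ.le (hcoef _ hx).2.1)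
    have hp := rad_pos (e := -1) hα S
    have hre : bipRe (rad ‖zc‖ (-1) S) (rad ‖zc + 1‖ 1 S) = rad ‖zc‖ (-1) S := by
      rw [bipRe, show rad ‖zc + 1‖ 1 S = 1 + rad ‖zc‖ (-1) S by linarith]; ring
    refine ⟨arm, ?_, ?_⟩
    · rw [harm, bip, bipSq, hre]; simp
    · rw [harm, bip, hre]; exact hp
  -- the arm to the negative axis
  obtain ⟨wl, hwl1, hwl2⟩ : ∃ arm : Arm zc 1 (-1) c1 C1, (arm.path 1).im = 0 ∧
      (arm.path 1).re < -1 := by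
    -- The arm ends when `P = 1 + Q`, that is, to the left of `-1`; now `1 + Q - P` is the vanishing
    -- factor.
    obtain ⟨S, hS, hSeq⟩ := intermediate_value_Icc
      (f := fun s => rad ‖zc‖ 1 s - rad ‖zc + 1‖ (-1) s) hM₀pos.le
      (continuous_rad.sub continuous_rad).continuousOn (show (1 : ℝ) ∈ _ by
        constructor
        · simp only [rad_zero]; linarith
        · have := hnegbound _ hβ (hnR1 _ hzc)
          have := hposbound _ hα M₀ hM₀pos.le
          nlinarith)
    simp only at hSeq
    have i1 := fun s (hs : s ∈ Set.Icc 0 S) => rad_increment hα isSign_one hδ hM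
      (hb S hS.2 _ isSign_one) hs.1 hs.2 le_rfl
    have i2 := fun s (hs : s ∈ Set.Icc 0 S) => rad_increment hβ isSign_neg_one hδ hM
      (hb1 S hS.2 _ isSign_neg_one) hs.1 hs.2 le_rfl
    have hSlow : δ / 2 ≤ S := by
      have a1 := (i1 0 ⟨le_rfl, hS.1⟩).2
      have a2 := (i2 0 ⟨le_rfl, hS.1⟩).2
      rw [rad_zero] at a1 a2
      linarith
    obtain ⟨arm, harm⟩ := hwk isSign_one isSign_neg_one hSlow hS.2 (by
      intro s hs
      obtain ⟨⟨g1, -⟩, -, -, -, g5⟩ := Hz s ⟨hs.1, hs.2.trans hS.2⟩ 1 isSign_one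
      have g2 := hb1 S hS.2 (-1) isSign_neg_one s hs
      have a1 := (i1 s hs).1
      have a2 := (i2 s hs).1
      have hx : 0 ≤ S - s := by linarith [hs.2]
      have b1 := (rad_increment hα isSign_one hδ hM
        (hb S hS.2 _ isSign_one) le_rfl hs.1 hs.2).1
      have b2 := (rad_increment hβ isSign_neg_one hδ hM
        (hb1 S hS.2 _ isSign_neg_one) le_rfl hs.1 hs.2).1
      have b3 : 0 ≤ δ / (2 * M) * (s - 0) := by have := hs.1; positivity
      rw [rad_zero] at b1 b2
      refine bipSq_lower (a := δ) (b := δ) (c := δ / (2 * M) * (S - s) * 2) (by linarith)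
        g5 (by linarith) (by linarith) hδ.le hδ.le (by positivity) (hcoef _ hx).2.2)
    have hq := rad_pos (e := -1) hβ S
    have hre : bipRe (rad ‖zc‖ 1 S) (rad ‖zc + 1‖ (-1) S) = -rad ‖zc‖ 1 S := by
      rw [bipRe, show rad ‖zc‖ 1 S = 1 + rad ‖zc + 1‖ (-1) S by linarith]; ring
    refine ⟨arm, ?_, ?_⟩
    · rw [harm, bip, bipSq, hre]; simp
    · rw [harm, bip, hre]; simp only; linarith
  -- the arm going up
  have Hz2 := H2 zc hzc
  -- When both radii grow no factor of Heron's formula vanishes, so this arm stays off the axis and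
  -- can be followed as far out as desired.
  have hV2 : ∀ s ∈ Set.Icc 0 S₁, δ2 ^ 3 / 4 ≤ bipSq (rad ‖zc‖ 1 s) (rad ‖zc + 1‖ 1 s) := by
    intro s hs
    obtain ⟨⟨g1, -⟩, ⟨g2, -⟩, g3, g4, -⟩ := Hz2 s hs 1 isSign_one
    have h20 := (Hz2 0 ⟨le_rfl, hS₁pos.le⟩ 1 isSign_one).2.2.2.2
    simp only [rad_zero] at h20
    have p1 := hposbound _ hα s hs.1
    have p2 := hposbound _ hβ s hs.1
    have := hs.1
    exact bipSq_lower (a := δ2) (b := δ2) (c := δ2) (by linarith) (by linarith) g3 g4 hδ2.le hδ2.le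
      hδ2.le (by apply le_of_eq; ring)
  obtain ⟨zu, hzu⟩ := A2 zc (hd21.trans (hb0' _ hzc)) 1 1 isSign_one isSign_one S₁ hd24
    (le_max_right _ _)
    (fun s hs => ⟨hd22.trans (Hz2 s hs 1 isSign_one).1.1,
      (Hz2 s hs 1 isSign_one).1.2.trans (le_max_left _ _)⟩)
    (fun s hs => ⟨hd22.trans (Hz2 s hs 1 isSign_one).2.1.1,
      (Hz2 s hs 1 isSign_one).2.1.2.trans (le_max_left _ _)⟩)
    (by
      intro s hs
      refine le_trans ?_ (hV2 s hs)
      have hx : 0 ≤ S₁ - s := by linarith [hs.2]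
      calc δ2' * (S₁ - s) ≤ δ2 ^ 3 / (4 * S₁) * S₁ := by
            gcongr
            linarith [hs.1]
        _ = δ2 ^ 3 / 4 := by field_simp)
  have hVS : 0 < bipSq (rad ‖zc‖ 1 S₁) (rad ‖zc + 1‖ 1 S₁) :=
    lt_of_lt_of_le (by positivity) (hV2 S₁ ⟨hS₁pos.le, le_rfl⟩)
  have hnu : max R (C1 + 1) ≤ ‖zu.path 1‖ := by
    rw [hzu, norm_bip (rad_pos hα _).le hVS.le]
    refine le_trans ?_ (hposbound _ hα S₁ hS₁pos.le)
    rw [hS₁]; linarith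
  refine ⟨zd.weaken (min_le_left _ _) (le_max_left _ _), zu.weaken (min_le_right _ _) (le_max_right _ _),
    wr.weaken (min_le_left _ _) (le_max_left _ _), wl.weaken (min_le_left _ _) (le_max_left _ _),
    ⟨hzd1, hzd2⟩, ⟨hwr1, hwr2⟩, ⟨hwl1, hwl2⟩, ?_, (le_max_left _ _).trans hnu, ?_, ?_⟩
  · change 0 < (zu.path 1).im
    rw [hzu]
    exact Real.sqrt_pos.2 hVS
  · intro τ hτ
    have := wr.norm_le τ hτ
    change ‖wr.path τ‖ + 1 ≤ ‖zu.path 1‖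
    linarith [le_max_right R (C1 + 1)]
  · intro τ hτ
    have := wl.norm_le τ hτ
    change ‖wl.path τ‖ + 1 ≤ ‖zu.path 1‖
    linarith [le_max_right R (C1 + 1)]

end

noncomputable section

/-! ### Cauchy sums over the integers -/

/-- The symmetric partial sum `∑_{|j| < M} m j / (v - j)`. -/
def cauchySum (m : ℤ → ℝ) (M : ℕ) (v : ℂ) : ℂ :=
  ∑ j ∈ Finset.Ioo (-(M : ℤ)) (M : ℤ), (m j : ℂ) / (v - j)

/-- `S` is the principal value Cauchy transform of the bounded weights `m` off the real axis. -/
structure IsCauchyTransform (m : ℤ → ℝ) (S : ℂ → ℂ) : Prop where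
  abs_le : ∀ j, |m j| ≤ 1
  tendsto : ∀ v : ℂ, v.im ≠ 0 → Tendsto (fun M : ℕ => cauchySum m M v) atTop (𝓝 (S v))

lemma sub_int_ne_zero {v : ℂ} (hv : v.im ≠ 0) (j : ℤ) : v - j ≠ 0 := by
  intro h
  apply hv
  have := congrArg Complex.im h
  simpa using this

/-- Combines the bounds `|Im v|` and `|j| - ‖v‖` for the same distance. All absolute convergence
below comes from this linear growth. -/
lemma exists_le_norm_sub_int {v : ℂ} (hv : v.im ≠ 0) :
    ∃ c > 0, ∀ j : ℤ, c * (1 + |(j : ℝ)|) ≤ ‖v - j‖ := by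
  have hpos : 0 < |v.im| := abs_pos.2 hv
  refine ⟨|v.im| / (1 + ‖v‖ + |v.im|), by positivity, fun j => ?_⟩
  have h1 : |v.im| ≤ ‖v - j‖ := by simpa using abs_im_le_norm (v - j)
  have h2 : |(j : ℝ)| ≤ ‖v - j‖ + ‖v‖ := by
    have : (j : ℂ) = v - (v - j) := by ring
    have h3 : ‖(j : ℂ)‖ ≤ ‖v‖ + ‖v - j‖ := by
      rw [this]; exact (norm_sub_le _ _).trans (by simp)
    rw [norm_intCast] at h3
    linarith
  rw [div_mul_eq_mul_div, div_le_iff₀ (by positivity)]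
  nlinarith [norm_nonneg v]

lemma summable_inv_one_add_abs_sq : Summable fun j : ℤ => 1 / (1 + |(j : ℝ)|) ^ 2 := by
  have h1 : Summable fun j : ℤ => 1 / (j : ℝ) ^ 2 := Real.summable_one_div_int_pow.2 (by norm_num)
  have h2 : Summable fun j : ℤ => (if j = 0 then (1 : ℝ) else 0) :=
    summable_of_ne_finset_zero (s := {0}) (by intro b hb; simp at hb; simp [hb])
  refine Summable.of_nonneg_of_le (fun j => by positivity) (fun j => ?_) (h1.add h2)
  rcases eq_or_ne j 0 with rfl | hj
  · simp
  · have hj' : 0 < |(j : ℝ)| := abs_pos.2 (by exact_mod_cast hj)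
    simp only [hj, if_false, add_zero]
    rw [← sq_abs (j : ℝ)]
    gcongr
    linarith

lemma summable_of_quadratic_decay {f : ℤ → ℂ} {C : ℝ}
    (h : ∀ j, ‖f j‖ ≤ C * (1 / (1 + |(j : ℝ)|) ^ 2)) : Summable f :=
  Summable.of_norm_bounded (summable_inv_one_add_abs_sq.mul_left C) h

lemma summable_div_mul {m : ℤ → ℝ} (hm : ∀ j, |m j| ≤ 1) {v w : ℂ} (hv : v.im ≠ 0) (hw : w.im ≠ 0) :
    Summable fun j : ℤ => (m j : ℂ) / ((v - j) * (w - j)) := by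
  obtain ⟨c, hc, h1⟩ := exists_le_norm_sub_int hv
  obtain ⟨d, hd, h2⟩ := exists_le_norm_sub_int hw
  refine summable_of_quadratic_decay (C := 1 / (c * d)) fun j => ?_
  have := h1 j
  have := h2 j
  rw [norm_div, norm_mul, norm_real, Real.norm_eq_abs]
  calc |m j| / (‖v - j‖ * ‖w - j‖) ≤ 1 / ((c * (1 + |(j : ℝ)|)) * (d * (1 + |(j : ℝ)|))) := by
        gcongr
        exact hm j
    _ = _ := by field_simp

lemma summable_div_mul_norm {m : ℤ → ℝ} (hm : ∀ j, |m j| ≤ 1) {v w : ℂ} (hv : v.im ≠ 0)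
    (hw : w.im ≠ 0) : Summable fun j : ℤ => (m j * j : ℂ) / ((v - j) * (‖w - j‖ ^ 2 : ℝ)) := by
  obtain ⟨c, hc, h1⟩ := exists_le_norm_sub_int hv
  obtain ⟨d, hd, h2⟩ := exists_le_norm_sub_int hw
  refine summable_of_quadratic_decay (C := 1 / (c * d ^ 2)) fun j => ?_
  have := h1 j
  have := h2 j
  rw [norm_div, norm_mul, norm_mul, norm_real, norm_real, Real.norm_eq_abs, norm_intCast,
    Real.norm_of_nonneg (by positivity)]
  calc |m j| * |(j : ℝ)| / (‖v - j‖ * ‖w - j‖ ^ 2)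
      ≤ 1 * (1 + |(j : ℝ)|) / ((c * (1 + |(j : ℝ)|)) * (d * (1 + |(j : ℝ)|)) ^ 2) := by
        gcongr
        · exact hm j
        · linarith
    _ = _ := by field_simp

lemma summable_div_norm_mul {m : ℤ → ℝ} (hm : ∀ j, |m j| ≤ 1) {v w : ℂ} (hv : v.im ≠ 0)
    (hw : w.im ≠ 0) : Summable fun j : ℤ => (m j : ℂ) / ((v - j) * (‖w - j‖ ^ 2 : ℝ)) := by
  obtain ⟨c, hc, h1⟩ := exists_le_norm_sub_int hv
  obtain ⟨d, hd, h2⟩ := exists_le_norm_sub_int hw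
  refine summable_of_quadratic_decay (C := 1 / (c * d ^ 2)) fun j => ?_
  have := h1 j
  have := h2 j
  rw [norm_div, norm_mul, norm_real, norm_real, Real.norm_eq_abs,
    Real.norm_of_nonneg (by positivity)]
  calc |m j| / (‖v - j‖ * ‖w - j‖ ^ 2)
      ≤ 1 * (1 + |(j : ℝ)|) / ((c * (1 + |(j : ℝ)|)) * (d * (1 + |(j : ℝ)|)) ^ 2) := by
        gcongr
        · refine (hm j).trans ?_
          rw [one_mul]
          linarith [abs_nonneg (j : ℝ)]
    _ = _ := by field_simp

lemma tendsto_Ioo_neg_atTop :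
    Tendsto (fun M : ℕ => Finset.Ioo (-(M : ℤ)) (M : ℤ)) atTop atTop := by
  apply tendsto_atTop_finset_of_monotone
  · intro M M' h
    apply Finset.Ioo_subset_Ioo <;> simp [h]
  · intro x
    refine ⟨x.natAbs + 1, ?_⟩
    rw [Finset.mem_Ioo]
    omega

lemma HasSum.tendsto_Ioo {f : ℤ → ℂ} {s : ℂ} (h : HasSum f s) :
    Tendsto (fun M : ℕ => ∑ j ∈ Finset.Ioo (-(M : ℤ)) (M : ℤ), f j) atTop (𝓝 s) := by
  have h1 : Tendsto (fun s : Finset ℤ => ∑ b ∈ s, f b) atTop (𝓝 s) := by simpa [HasSum] using h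
  exact h1.comp tendsto_Ioo_neg_atTop

lemma conj_ne {v : ℂ} (hv : v.im ≠ 0) : ((starRingEnd ℂ) v).im ≠ 0 := by simpa using hv

lemma sub_mul_conj_sub_int (v : ℂ) (j : ℤ) :
    (v - j) * ((starRingEnd ℂ) v - j) = ((‖v - j‖ ^ 2 : ℝ) : ℂ) := by
  have h1 : (starRingEnd ℂ) v - j = (starRingEnd ℂ) (v - j) := by simp
  rw [h1, mul_conj, normSq_eq_norm_sq]

/-- The sum `∑ m j / |v - j| ^ 2`. -/
def energy (m : ℤ → ℝ) (v : ℂ) : ℝ := ∑' j : ℤ, m j / ‖v - j‖ ^ 2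

namespace IsCauchyTransform

variable {m : ℤ → ℝ} {S : ℂ → ℂ} (h : IsCauchyTransform m S)
include h

/-- Differences of Cauchy kernels decay quadratically, so the principal value becomes an absolutely
convergent sum. -/
lemma sub_eq {v w : ℂ} (hv : v.im ≠ 0) (hw : w.im ≠ 0) :
    S v - S w = (w - v) * ∑' j : ℤ, (m j : ℂ) / ((v - j) * (w - j)) := by
  have h1 := (h.tendsto v hv).sub (h.tendsto w hw)
  have h2 := ((summable_div_mul h.abs_le hv hw).hasSum.mul_left (w - v)).tendsto_Ioo
  refine tendsto_nhds_unique h1 (h2.congr fun M => ?_)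
  rw [cauchySum, cauchySum, ← Finset.sum_sub_distrib]
  refine Finset.sum_congr rfl fun j _ => ?_
  have := sub_int_ne_zero hv j
  have := sub_int_ne_zero hw j
  field_simp
  ring

lemma conj {v : ℂ} (hv : v.im ≠ 0) : S ((starRingEnd ℂ) v) = (starRingEnd ℂ) (S v) := by
  have h1 := h.tendsto _ (conj_ne hv)
  have h2 := (continuous_conj.tendsto _).comp (h.tendsto v hv)
  refine tendsto_nhds_unique h1 (h2.congr fun M => ?_)
  simp [cauchySum]

lemma summable_energy {v : ℂ} (hv : v.im ≠ 0) : Summable fun j : ℤ => m j / ‖v - j‖ ^ 2 := by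
  have h1 := summable_div_mul h.abs_le hv (conj_ne hv)
  simp_rw [sub_mul_conj_sub_int] at h1
  exact_mod_cast h1

/-- `sub_eq` at `v` and `conj v`. In particular the points with a real value of `S` are those of
zero energy. -/
lemma im_eq {v : ℂ} (hv : v.im ≠ 0) : (S v).im = -v.im * energy m v := by
  have h1 := h.sub_eq hv (conj_ne hv)
  rw [h.conj hv] at h1
  simp_rw [sub_mul_conj_sub_int] at h1
  have h2 : ∑' j : ℤ, (m j : ℂ) / ((‖v - j‖ ^ 2 : ℝ) : ℂ) = (energy m v : ℝ) := by
    rw [energy, ofReal_tsum]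
    push_cast
    rfl
  rw [h2] at h1
  have h3 := congrArg Complex.im h1
  simp at h3
  linarith

lemma energy_eq_zero {v : ℂ} {c : ℝ} (hv : v.im ≠ 0) (hc : S v = c) : energy m v = 0 := by
  have := h.im_eq hv
  rw [hc, ofReal_im] at this
  rcases mul_eq_zero.1 this.symm with h1 | h1
  · exact absurd (neg_eq_zero.1 h1) hv
  · exact h1

end IsCauchyTransform

/-- The Nevanlinna type function in the factorization of the Cauchy transform. -/
def nevan (m : ℤ → ℝ) (T : ℕ) (vc v : ℂ) : ℂ :=
  ∑' j : ℤ, (v + T) * ((m j * j : ℂ) / ((v - j) * (‖vc - j‖ ^ 2 : ℝ)))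

namespace IsCauchyTransform

variable {m : ℤ → ℝ} {S : ℂ → ℂ} (h : IsCauchyTransform m S)
include h

/-- Factorization of the Cauchy transform at a point `vc` where it takes a real value. -/
lemma factor {T : ℕ} {v vc : ℂ} {c : ℝ} (hv : v.im ≠ 0) (hvc : vc.im ≠ 0) (hc : S vc = c) :
    S v - c = (v - vc) * (v - (starRingEnd ℂ) vc) / (v * (v + T)) * nevan m T vc v := by
  have s1 := summable_div_norm_mul h.abs_le hv hvc
  have s2 := summable_div_mul_norm h.abs_le hv hvc
  have s0 : Summable fun j : ℤ => (m j : ℂ) / (‖vc - j‖ ^ 2 : ℝ) := by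
    have := h.summable_energy hvc
    exact_mod_cast this
  have e0 : ∑' j : ℤ, (m j : ℂ) / (‖vc - j‖ ^ 2 : ℝ) = 0 := by
    have := h.energy_eq_zero hvc hc
    rw [energy] at this
    have h2 := congrArg (fun x : ℝ => (x : ℂ)) this
    simp only [ofReal_tsum, ofReal_zero] at h2
    rw [← h2]
    push_cast
    rfl
  have hn : ∀ j : ℤ, ((‖vc - j‖ ^ 2 : ℝ) : ℂ) ≠ 0 := fun j => by
    rw [← sub_mul_conj_sub_int]
    exact mul_ne_zero (sub_int_ne_zero hvc j) (sub_int_ne_zero (conj_ne hvc) j)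
  -- The identity `(conj vc - v) + (v - j) = conj vc - j`; the extra term sums to the energy at
  -- `vc`, which is zero.
  have e1 : ∑' j : ℤ, (m j : ℂ) / ((v - j) * (vc - j)) =
      ((starRingEnd ℂ) vc - v) * ∑' j : ℤ, (m j : ℂ) / ((v - j) * (‖vc - j‖ ^ 2 : ℝ)) := by
    rw [← tsum_mul_left, ← add_zero (∑' j : ℤ, _ * _), ← e0, ← (s1.mul_left _).tsum_add s0]
    refine tsum_congr fun j => ?_
    have a1 := sub_int_ne_zero hv j
    have a2 := sub_int_ne_zero hvc j
    have a3 := sub_int_ne_zero (conj_ne hvc) j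
    rw [← sub_mul_conj_sub_int]
    field_simp
    ring
  -- Zero energy is used a second time, through `v = j + (v - j)`, to insert the factor `j` that
  -- carries the sign change of the weights at the origin.
  have e2 : v * ∑' j : ℤ, (m j : ℂ) / ((v - j) * (‖vc - j‖ ^ 2 : ℝ)) =
      ∑' j : ℤ, (m j * j : ℂ) / ((v - j) * (‖vc - j‖ ^ 2 : ℝ)) := by
    rw [← tsum_mul_left, ← add_zero (∑' j : ℤ, (m j * j : ℂ) / _), ← e0, ← s2.tsum_add s0]
    refine tsum_congr fun j => ?_
    have a1 := sub_int_ne_zero hv j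
    have a2 := hn j
    field_simp
    ring
  have hv0 : v ≠ 0 := by rintro rfl; simp at hv
  have hvT : v + T ≠ 0 := by
    have := sub_int_ne_zero hv (-(T : ℤ))
    simpa using this
  rw [← hc, h.sub_eq hv hvc, e1, nevan, tsum_mul_left, ← e2]
  field_simp
  ring

/-- The point of this formula is the factor `-(m j * j * (j + T))`: it is nonnegative for every `j`
when the weights change sign exactly at `-T` and `0`. -/
lemma nevan_im {T : ℕ} {v vc : ℂ} (hv : v.im ≠ 0) (hvc : vc.im ≠ 0) :
    HasSum (fun j : ℤ => -(m j * j * (j + T)) * v.im / (‖v - j‖ ^ 2 * ‖vc - j‖ ^ 2))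
      (nevan m T vc v).im := by
  have s2 := ((summable_div_mul_norm h.abs_le hv hvc).mul_left (v + T)).hasSum
  refine (hasSum_im s2).congr_fun fun j => ?_
  have a1 := sub_int_ne_zero hv j
  have hn : ‖v - j‖ ^ 2 ≠ 0 := by simpa using a1
  have hn' : ‖vc - j‖ ^ 2 ≠ 0 := by simpa using sub_int_ne_zero hvc j
  have e1 : (v + T) * ((m j * j : ℂ) / ((v - j) * (‖vc - j‖ ^ 2 : ℝ))) =
      (m j * j / ‖vc - j‖ ^ 2 : ℝ) * (1 + (((j + T) / ‖v - j‖ ^ 2 : ℝ) : ℂ) *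
        ((starRingEnd ℂ) v - j)) := by
    have e2 := sub_mul_conj_sub_int v j
    have e3 : (starRingEnd ℂ) v - j = ((‖v - j‖ ^ 2 : ℝ) : ℂ) / (v - j) := by
      rw [← e2]; field_simp
    rw [e3, ofReal_div, ofReal_div]
    have b1 : (‖v - j‖ : ℂ) ≠ 0 := by simpa using a1
    have b2 : (‖vc - j‖ : ℂ) ≠ 0 := by simpa using sub_int_ne_zero hvc j
    push_cast
    field_simp
    ring
  rw [e1, im_ofReal_mul, add_im, one_im, im_ofReal_mul]
  simp only [sub_im, conj_im, intCast_im, sub_zero]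
  field_simp
  ring

end IsCauchyTransform

end

noncomputable section

/-! ### The weights of a configuration -/

/-- `1` at the particles minus `1` at the points outside `(-T, 0)`. -/
def wt {N : ℕ} (a : Fin N → ℤ) (T : ℕ) (j : ℤ) : ℝ :=
  (if ∃ i, a i = j then 1 else 0) - (if j ≤ -(T : ℤ) ∨ 0 ≤ j then 1 else 0)

/-- The function `∑ 1 / (v - a r) - p.v. ∑ 1 / (v - j)`. -/
def pvField {N : ℕ} (a : Fin N → ℤ) (T : ℕ) (v : ℂ) : ℂ := (∑ r : Fin N, 1 / (v - a r)) - pvSum T v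

lemma SPrime_eq {N : ℕ} (a : Fin N → ℤ) (β : ℝ) (T : ℕ) (z : ℂ) :
    SPrime a β T z = pvField a T (T * z) - (Real.log (β⁻¹ - 1) : ℝ) := rfl

section wt

variable {N : ℕ} (a : Fin N → ℤ) (T : ℕ)

lemma abs_wt_le (j : ℤ) : |wt a T j| ≤ 1 := by
  unfold wt; split_ifs <;> simp

lemma wt_nonneg {j : ℤ} (h1 : -(T : ℤ) < j) (h2 : j < 0) : 0 ≤ wt a T j := by
  unfold wt
  rw [if_neg (show ¬(j ≤ -(T : ℤ) ∨ 0 ≤ j) by omega)]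
  split_ifs <;> simp

lemma wt_nonpos {j : ℤ} (h : j ≤ -(T : ℤ) ∨ 0 ≤ j) : wt a T j ≤ 0 := by
  unfold wt
  rw [if_pos h]
  split_ifs <;> simp

end wt

lemma sum_Ioo_neg_succ {f : ℤ → ℂ} (M : ℕ) :
    ∑ j ∈ Finset.Ioo (-((M + 1 : ℕ) : ℤ)) ((M + 1 : ℕ) : ℤ), f j =
      f 0 + ∑ k ∈ Finset.range M, (f (k + 1) + f (-(k + 1))) := by
  induction M with
  | zero =>
    have : Finset.Ioo (-((0 + 1 : ℕ) : ℤ)) ((0 + 1 : ℕ) : ℤ) = {0} := by decide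
    rw [this]; simp
  | succ M ih =>
    have h1 : Finset.Ioo (-((M + 1 + 1 : ℕ) : ℤ)) ((M + 1 + 1 : ℕ) : ℤ) =
        insert ((M : ℤ) + 1) (insert (-((M : ℤ) + 1))
          (Finset.Ioo (-((M + 1 : ℕ) : ℤ)) ((M + 1 : ℕ) : ℤ))) := by
      ext j; simp only [Finset.mem_insert, Finset.mem_Ioo]; omega
    rw [h1, Finset.sum_insert, Finset.sum_insert, ih, Finset.sum_range_succ]
    · ring
    · simp
    · simp only [Finset.mem_insert, Finset.mem_Ioo]; omega

lemma mem_integerComplement_of_im {v : ℂ} (hv : v.im ≠ 0) : v ∈ Complex.integerComplement := by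
  rintro ⟨n, hn⟩
  apply hv
  rw [← hn]; simp

/-- The symmetric partial sums of `1 / (v - j)` converge to `π cot (π v)`. -/
lemma tendsto_sum_inv_sub {v : ℂ} (hv : v.im ≠ 0) :
    Tendsto (fun M : ℕ => ∑ j ∈ Finset.Ioo (-(M : ℤ)) (M : ℤ), 1 / (v - j)) atTop
      (𝓝 (Real.pi * Complex.cot (Real.pi * v))) := by
  rw [← tendsto_add_atTop_iff_nat 1]
  have h := (tendsto_logDeriv_euler_cot_sub (mem_integerComplement_of_im hv)).const_add (1 / v)
  rw [add_sub_cancel] at h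
  refine h.congr fun M => ?_
  rw [sum_Ioo_neg_succ]
  simp only [cotTerm]
  push_cast
  simp [sub_eq_add_neg, add_comm]

lemma pvSum_tendsto (T : ℕ) {v : ℂ} (hv : v.im ≠ 0) :
    Tendsto (fun M : ℕ => ∑ j ∈ (Finset.Ioo (-(M : ℤ)) (M : ℤ)).filter
      (fun j : ℤ => j ≤ -(T : ℤ) ∨ 0 ≤ j), 1 / (v - (j : ℂ))) atTop
      (𝓝 (Real.pi * Complex.cot (Real.pi * v) -
        ∑ j ∈ Finset.Ioo (-(T : ℤ)) 0, 1 / (v - (j : ℂ)))) := by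
  have h := (tendsto_sum_inv_sub hv).sub_const (∑ j ∈ Finset.Ioo (-(T : ℤ)) 0, 1 / (v - (j : ℂ)))
  refine h.congr' ?_
  filter_upwards [eventually_ge_atTop (T + 1)] with M hM
  rw [sub_eq_iff_eq_add, ← Finset.sum_filter_add_sum_filter_not (Finset.Ioo (-(M : ℤ)) (M : ℤ))
    (fun j : ℤ => j ≤ -(T : ℤ) ∨ 0 ≤ j)]
  congr 1
  apply Finset.sum_congr _ fun _ _ => rfl
  ext j
  simp only [Finset.mem_filter, Finset.mem_Ioo]
  omega

lemma pvSum_eq (T : ℕ) {v : ℂ} (hv : v.im ≠ 0) :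
    pvSum T v = Real.pi * Complex.cot (Real.pi * v) -
      ∑ j ∈ Finset.Ioo (-(T : ℤ)) 0, 1 / (v - (j : ℂ)) :=
  (pvSum_tendsto T hv).limUnder_eq

lemma pvField_eq {N : ℕ} (a : Fin N → ℤ) (T : ℕ) {v : ℂ} (hv : v.im ≠ 0) :
    pvField a T v = (∑ r : Fin N, 1 / (v - a r)) + (∑ j ∈ Finset.Ioo (-(T : ℤ)) 0, 1 / (v - (j : ℂ)))
      - Real.pi * Complex.cot (Real.pi * v) := by
  rw [pvField, pvSum_eq T hv]; ring

lemma sum_particles {N : ℕ} {a : Fin N → ℤ} (ha : StrictMono a) {s : Finset ℤ}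
    (hs : ∀ i, a i ∈ s) (f : ℤ → ℂ) :
    ∑ j ∈ s, (if ∃ i, a i = j then f j else 0) = ∑ r, f (a r) := by
  classical
  rw [← Finset.sum_filter]
  have : s.filter (fun j => ∃ i, a i = j) = Finset.univ.image a := by
    ext j
    simp only [Finset.mem_filter, Finset.mem_image, Finset.mem_univ, true_and]
    exact ⟨fun h => h.2, fun h => ⟨by obtain ⟨i, rfl⟩ := h; exact hs i, h⟩⟩
  rw [this, Finset.sum_image (fun x _ y _ h => ha.injective h)]

lemma exists_bound_config {N : ℕ} (a : Fin N → ℤ) : ∃ M₀ : ℕ, ∀ i, |a i| < M₀ := by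
  refine ⟨∑ i, (a i).natAbs + 1, fun i => ?_⟩
  have h := Finset.single_le_sum (f := fun i => (a i).natAbs) (fun _ _ => Nat.zero_le _)
    (Finset.mem_univ i)
  rw [Int.abs_eq_natAbs]
  omega

lemma isCauchyTransform_pvField {N : ℕ} {a : Fin N → ℤ} (ha : StrictMono a) (T : ℕ) :
    IsCauchyTransform (wt a T) (pvField a T) where
  abs_le := abs_wt_le a T
  tendsto v hv := by
    have h1 := pvSum_tendsto T hv
    rw [← pvSum_eq T hv] at h1
    have h2 := h1.const_sub (∑ r : Fin N, 1 / (v - a r))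
    refine h2.congr' ?_
    obtain ⟨M₀, hM₀⟩ := exists_bound_config a
    filter_upwards [eventually_ge_atTop M₀] with M hM
    rw [cauchySum, ← sum_particles ha (s := Finset.Ioo (-(M : ℤ)) (M : ℤ))
      (fun i => by have := abs_lt.1 (hM₀ i); rw [Finset.mem_Ioo]; omega) (fun j => 1 / (v - (j : ℂ))),
      Finset.sum_filter, ← Finset.sum_sub_distrib]
    refine Finset.sum_congr rfl fun j _ => ?_
    simp only [wt]
    split_ifs <;> simp [neg_div]

/-- The closed form of `pvField` off the real axis. -/
def pvClosed {N : ℕ} (a : Fin N → ℤ) (T : ℕ) (v : ℂ) : ℂ :=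
  (∑ r : Fin N, 1 / (v - (a r : ℂ))) + (∑ j ∈ Finset.Ioo (-(T : ℤ)) 0, 1 / (v - (j : ℂ)))
    - Real.pi * (Complex.cos (Real.pi * v) / Complex.sin (Real.pi * v))

lemma differentiableAt_one_div_sub {v c : ℂ} (hc : v - c ≠ 0) :
    DifferentiableAt ℂ (fun v : ℂ => 1 / (v - c)) v :=
  (differentiableAt_const _).fun_div (differentiableAt_id.sub_const c) hc

lemma differentiableAt_pi_cot {v : ℂ} (hv : v.im ≠ 0) :
    DifferentiableAt ℂ (fun v : ℂ => (Real.pi : ℂ) *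
      (Complex.cos (Real.pi * v) / Complex.sin (Real.pi * v))) v := by
  have hs : Complex.sin (Real.pi * v) ≠ 0 := sin_pi_mul_ne_zero (mem_integerComplement_of_im hv)
  have h1 : DifferentiableAt ℂ (fun v : ℂ => (Real.pi : ℂ) * v) v := differentiableAt_id.const_mul _
  exact (h1.ccos.fun_div h1.csin hs).const_mul _

lemma differentiableAt_pvClosed {N : ℕ} (a : Fin N → ℤ) (T : ℕ) {v : ℂ} (hv : v.im ≠ 0) :
    DifferentiableAt ℂ (pvClosed a T) v := by
  have d2 : DifferentiableAt ℂ (fun v : ℂ => ∑ r : Fin N, 1 / (v - (a r : ℂ))) v :=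
    DifferentiableAt.fun_sum fun r _ => differentiableAt_one_div_sub (sub_int_ne_zero hv _)
  have d3 : DifferentiableAt ℂ (fun v : ℂ => ∑ j ∈ Finset.Ioo (-(T : ℤ)) 0, 1 / (v - (j : ℂ))) v :=
    DifferentiableAt.fun_sum fun r _ => differentiableAt_one_div_sub (sub_int_ne_zero hv _)
  exact (d2.fun_add d3).fun_sub (differentiableAt_pi_cot hv)

lemma pvField_eq_pvClosed {N : ℕ} (a : Fin N → ℤ) (T : ℕ) {v : ℂ} (hv : v.im ≠ 0) :
    pvField a T v = pvClosed a T v := by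
  rw [pvField_eq a T hv, Complex.cot_eq_cos_div_sin, pvClosed]

lemma differentiableAt_pvField {N : ℕ} (a : Fin N → ℤ) (T : ℕ) {v : ℂ} (hv : v.im ≠ 0) :
    DifferentiableAt ℂ (pvField a T) v := by
  refine (differentiableAt_pvClosed a T hv).congr_of_eventuallyEq ?_
  have hev : ∀ᶠ w : ℂ in 𝓝 v, w.im ≠ 0 :=
    (isOpen_compl_singleton.preimage continuous_im).mem_nhds hv
  exact hev.mono fun w hw => pvField_eq_pvClosed a T hw

end

noncomputable section

/-! ### Sums of inverse squares over integers -/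

/-- Telescoping of `1 / y² ≤ 1 / (y - 1/2) - 1 / (y + 1/2)`. -/
lemma sum_range_inv_sq_le {x : ℝ} (hx : 1 ≤ x) (n : ℕ) :
    ∑ k ∈ Finset.range n, 1 / (x + k) ^ 2 ≤ 1 / (x - 1 / 2) - 1 / (x + n - 1 / 2) := by
  induction n with
  | zero => simp
  | succ n ih =>
    rw [Finset.sum_range_succ]
    have h0 : (0 : ℝ) ≤ n := Nat.cast_nonneg n
    have h1 : 1 / (x + n) ^ 2 ≤ 1 / (x + n - 1 / 2) - 1 / (x + (n + 1 : ℕ) - 1 / 2) := by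
      have p1 : 0 < x + n - 1 / 2 := by linarith
      have p2 : 0 < x + (n + 1 : ℕ) - 1 / 2 := by push_cast; linarith
      rw [div_sub_div _ _ p1.ne' p2.ne', div_le_div_iff₀ (by positivity) (by positivity)]
      push_cast
      nlinarith
    linarith

lemma sum_inv_sq_le_of_le_sub {s : Finset ℤ} {ξ r : ℝ} (hr : 1 ≤ r)
    (h : ∀ j ∈ s, r ≤ (j : ℝ) - ξ) : ∑ j ∈ s, 1 / ((j : ℝ) - ξ) ^ 2 ≤ 2 / r := by
  set a : ℤ := ⌈ξ + r⌉
  have ha : r ≤ (a : ℝ) - ξ := by have := Int.le_ceil (ξ + r); linarith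
  have hs : ∀ j ∈ s, a ≤ j := fun j hj => Int.ceil_le.2 (by have := h j hj; linarith)
  obtain ⟨n, hn⟩ : ∃ n : ℕ, s ⊆ (Finset.range n).image (fun k : ℕ => a + (k : ℤ)) := by
    refine ⟨s.sup (fun j => (j - a).toNat) + 1, fun j hj => ?_⟩
    rw [Finset.mem_image]
    refine ⟨(j - a).toNat, ?_, ?_⟩
    · rw [Finset.mem_range]
      have := Finset.le_sup (f := fun j => (j - a).toNat) hj
      omega
    · have := hs j hj
      omega
  calc ∑ j ∈ s, 1 / ((j : ℝ) - ξ) ^ 2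
      ≤ ∑ j ∈ (Finset.range n).image (fun k : ℕ => a + (k : ℤ)), 1 / ((j : ℝ) - ξ) ^ 2 :=
        Finset.sum_le_sum_of_subset_of_nonneg hn fun _ _ _ => by positivity
    _ = ∑ k ∈ Finset.range n, 1 / (((a : ℝ) - ξ) + k) ^ 2 := by
        rw [Finset.sum_image (by intro x _ y _ h; simpa using h)]
        refine Finset.sum_congr rfl fun k _ => ?_
        push_cast
        ring
    _ ≤ 1 / ((a : ℝ) - ξ - 1 / 2) - 1 / ((a : ℝ) - ξ + n - 1 / 2) :=
        sum_range_inv_sq_le (hr.trans ha) n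
    _ ≤ 1 / ((a : ℝ) - ξ - 1 / 2) := by
        have : (0 : ℝ) ≤ n := Nat.cast_nonneg n
        have : 0 ≤ 1 / ((a : ℝ) - ξ + n - 1 / 2) := by
          apply div_nonneg zero_le_one
          linarith
        linarith
    _ ≤ 2 / r := by
        rw [div_le_div_iff₀ (by linarith) (by linarith)]
        linarith

lemma sum_inv_sq_le {s : Finset ℤ} {ξ r : ℝ} (hr : 1 ≤ r) (h : ∀ j ∈ s, r ≤ |ξ - j|) :
    ∑ j ∈ s, 1 / (ξ - j) ^ 2 ≤ 4 / r := by
  rw [← Finset.sum_filter_add_sum_filter_not s (fun j : ℤ => ξ ≤ j)]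
  have h1 : ∑ j ∈ s.filter (fun j : ℤ => ξ ≤ j), 1 / (ξ - j) ^ 2 ≤ 2 / r := by
    refine le_trans (le_of_eq ?_) (sum_inv_sq_le_of_le_sub (s := s.filter (fun j : ℤ => ξ ≤ j))
      (ξ := ξ) hr fun j hj => ?_)
    · exact Finset.sum_congr rfl fun j _ => by ring
    · rw [Finset.mem_filter] at hj
      have := h j hj.1
      rwa [abs_of_nonpos (by linarith), neg_sub] at this
  have h2 : ∑ j ∈ s.filter (fun j : ℤ => ¬ξ ≤ j), 1 / (ξ - j) ^ 2 ≤ 2 / r := by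
    refine le_trans (le_of_eq ?_) (sum_inv_sq_le_of_le_sub
      (s := (s.filter (fun j : ℤ => ¬ξ ≤ j)).image (fun j => -j)) (ξ := -ξ) hr fun j hj => ?_)
    · rw [Finset.sum_image (by intro x _ y _ h; simpa using h)]
      exact Finset.sum_congr rfl fun j _ => by push_cast; ring
    · rw [Finset.mem_image] at hj
      obtain ⟨k, hk, rfl⟩ := hj
      rw [Finset.mem_filter] at hk
      have := h k hk.1
      rw [abs_of_nonneg (by linarith)] at this
      push_cast
      linarith
  calc _ ≤ 2 / r + 2 / r := add_le_add h1 h2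
    _ = 4 / r := by ring

lemma sq_re_sub_le_norm_sq (v : ℂ) (j : ℤ) : (v.re - j) ^ 2 ≤ ‖v - j‖ ^ 2 := by
  have h1 : |v.re - j| ≤ ‖v - j‖ := by simpa using abs_re_le_norm (v - j)
  rw [← sq_abs (v.re - j)]
  gcongr

lemma sum_inv_norm_sq_le {s : Finset ℤ} {v : ℂ} {r : ℝ} (hr : 1 ≤ r)
    (h : ∀ j ∈ s, r ≤ |v.re - j|) : ∑ j ∈ s, 1 / ‖v - j‖ ^ 2 ≤ 4 / r := by
  refine le_trans (Finset.sum_le_sum fun j hj => ?_) (sum_inv_sq_le hr h)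
  have h1 : 0 < |v.re - j| := by have := h j hj; linarith
  have h2 := sq_re_sub_le_norm_sq v j
  have h3 : 0 < (v.re - j) ^ 2 := by rw [← sq_abs]; positivity
  gcongr

/-- Since the weights are bounded by `1`, the integers at horizontal distance at least `r`
contribute at most `4 / r` in total. -/
lemma IsCauchyTransform.abs_energy_sub_le {m : ℤ → ℝ} {S : ℂ → ℂ} (h : IsCauchyTransform m S)
    {v : ℂ} (hv : v.im ≠ 0) (s : Finset ℤ) {r : ℝ} (hr : 1 ≤ r)
    (hs : ∀ j : ℤ, j ∉ s → r ≤ |v.re - j|) :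
    |energy m v - ∑ j ∈ s, m j / ‖v - j‖ ^ 2| ≤ 4 / r := by
  classical
  have hsum := (h.summable_energy hv).hasSum
  have h1 : Tendsto (fun t : Finset ℤ => ∑ b ∈ t, m b / ‖v - b‖ ^ 2) atTop (𝓝 (energy m v)) := by
    simpa [HasSum, energy] using hsum
  have h2 := (h1.sub_const (∑ j ∈ s, m j / ‖v - j‖ ^ 2)).abs
  refine le_of_tendsto h2 ?_
  filter_upwards [eventually_ge_atTop s] with t ht
  rw [← Finset.sum_sdiff ht, add_sub_cancel_right]
  refine (Finset.abs_sum_le_sum_abs _ _).trans (le_trans (Finset.sum_le_sum fun j _ => ?_)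
    (sum_inv_norm_sq_le (s := t \ s) hr fun j hj => hs j (Finset.mem_sdiff.1 hj).2))
  rw [abs_div, abs_of_nonneg (by positivity : (0 : ℝ) ≤ ‖v - j‖ ^ 2)]
  gcongr
  exact h.abs_le j

/-! ### Regular weights -/

/-- Quantitative hypotheses on the weights: the signs of `wt`, a positive density `σ` of nonzero
weights in windows of length at least `D`, and a bound `B` on the far field. -/
structure RegularWeights (m : ℤ → ℝ) (S : ℂ → ℂ) (T : ℕ) (σ D B : ℝ) (K : ℕ) : Prop
    extends IsCauchyTransform m S where
  nonneg : ∀ j : ℤ, -(T : ℤ) < j → j < 0 → 0 ≤ m j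
  nonpos : ∀ j : ℤ, j ≤ -(T : ℤ) ∨ 0 ≤ j → m j ≤ 0
  window_mem : ∀ y ℓ : ℝ, D ≤ ℓ → -(T : ℝ) < y → y + ℓ < 0 →
    σ * ℓ ≤ ∑ j ∈ Finset.Icc ⌈y⌉ ⌊y + ℓ⌋, m j
  window_not_mem : ∀ y ℓ : ℝ, D ≤ ℓ →
    (0 ≤ y ∧ y + ℓ ≤ 2 * K * T ∨ -(2 * K * T : ℝ) ≤ y ∧ y + ℓ ≤ -T) →
    σ * ℓ ≤ ∑ j ∈ Finset.Icc ⌈y⌉ ⌊y + ℓ⌋, -m j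
  far : ∀ v : ℂ, v.im ≠ 0 → ‖v‖ ≤ K * T →
    ‖S v - ∑ j ∈ Finset.Ioo (-(2 * K * T : ℤ)) (2 * K * T), (m j : ℂ) / (v - j)‖ ≤ B

/-- Weights that are nonnegative near `x` and have positive density in a window at `x` have
positive energy close to `x`. -/
lemma IsCauchyTransform.energy_pos {m : ℤ → ℝ} {S : ℂ → ℂ} (hm : IsCauchyTransform m S)
    {v : ℂ} (hv : 0 < v.im) {r h σ : ℝ} (hr : 1 ≤ r) (hh : v.im ≤ h)
    (hhr : 8 * h < σ * r) (hpos : ∀ j : ℤ, |v.re - j| < r → 0 ≤ m j) {W : Finset ℤ}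
    (hW : ∀ j ∈ W, |v.re - j| ≤ h) (hWr : h < r) (hWσ : σ * h ≤ ∑ j ∈ W, m j) :
    0 < energy m v := by
  classical
  have hh0 : 0 < h := hv.trans_le hh
  set s : Finset ℤ := (Finset.Icc ⌈v.re - r⌉ ⌊v.re + r⌋).filter (fun j : ℤ => |v.re - j| < r) with hs
  have hmem : ∀ j : ℤ, |v.re - j| < r → j ∈ s := fun j hj => by
    rw [hs, Finset.mem_filter, Finset.mem_Icc, Int.ceil_le, Int.le_floor]
    have := abs_lt.1 hj
    exact ⟨⟨by linarith, by linarith⟩, hj⟩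
  have h1 := hm.abs_energy_sub_le hv.ne' s hr fun j hj => by
    by_contra hlt
    exact hj (hmem j (not_le.1 hlt))
  have h2 : ∑ j ∈ W, m j / ‖v - j‖ ^ 2 ≤ ∑ j ∈ s, m j / ‖v - j‖ ^ 2 := by
    refine Finset.sum_le_sum_of_subset_of_nonneg (fun j hj => hmem j ((hW j hj).trans_lt hWr))
      fun j hj _ => ?_
    rw [hs, Finset.mem_filter] at hj
    exact div_nonneg (hpos j hj.2) (by positivity)
  have h3 : (∑ j ∈ W, m j) / (2 * h ^ 2) ≤ ∑ j ∈ W, m j / ‖v - j‖ ^ 2 := by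
    rw [Finset.sum_div]
    refine Finset.sum_le_sum fun j hj => ?_
    have hj1 := hW j hj
    have e : ‖v - j‖ ^ 2 = (v.re - j) ^ 2 + v.im ^ 2 := by
      rw [← normSq_eq_norm_sq, normSq_apply]; simp; ring
    have : (v.re - j) ^ 2 ≤ h ^ 2 := by rw [← sq_abs (v.re - j)]; gcongr
    have : v.im ^ 2 ≤ h ^ 2 := by gcongr
    have : 0 < v.im ^ 2 := by positivity
    have := sq_nonneg (v.re - j)
    apply div_le_div_of_nonneg_left (hpos j (hj1.trans_lt hWr)) (by linarith) (by linarith)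
  have h4 : σ / (2 * h) ≤ (∑ j ∈ W, m j) / (2 * h ^ 2) := by
    rw [div_le_div_iff₀ (by positivity) (by positivity)]
    nlinarith
  -- The window of length `h` contributes at least `σ / (2 h)`, which under the assumption `8 h < σ
  -- r` beats the tail beyond distance `r`.
  have h5 : 4 / r < σ / (2 * h) := by
    rw [div_lt_div_iff₀ (by linarith) (by positivity)]
    linarith
  have := _root_.abs_le.1 h1
  linarith [this.1]

namespace IsCauchyTransform

lemma neg {m : ℤ → ℝ} {S : ℂ → ℂ} (h : IsCauchyTransform m S) :
    IsCauchyTransform (fun j => -m j) (fun v => -S v) where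
  abs_le j := by rw [abs_neg]; exact h.abs_le j
  tendsto v hv := by
    refine (h.tendsto v hv).neg.congr fun M => ?_
    simp [cauchySum, neg_div]

end IsCauchyTransform

lemma energy_neg (m : ℤ → ℝ) (v : ℂ) : energy (fun j => -m j) v = -energy m v := by
  simp [energy, neg_div, tsum_neg]

namespace RegularWeights

variable {m : ℤ → ℝ} {S : ℂ → ℂ} {T : ℕ} {σ D B : ℝ} {K : ℕ}

/-- The window next to `Re v` has length `max (Im v) D`: long enough for the density hypothesis, and
not shorter than the height of `v`. -/
lemma energy_pos_of_mem (h : RegularWeights m S T σ D B K) (hσ1 : σ ≤ 1) {v : ℂ}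
    (hv : 0 < v.im) {r : ℝ} (hr : 1 ≤ r) (hD : 8 * D < σ * r) (him : 8 * v.im < σ * r)
    (h1 : -(T : ℝ) + r ≤ v.re) (h2 : v.re ≤ -r) : 0 < energy m v := by
  have hm : 8 * max v.im D < σ * r := by
    rcases max_cases v.im D with h | h <;> rw [h.1] <;> assumption
  have hmr : max v.im D < r := by nlinarith
  refine h.toIsCauchyTransform.energy_pos hv hr (le_max_left _ D) hm (fun j hj => ?_)
    (W := Finset.Icc ⌈v.re⌉ ⌊v.re + max v.im D⌋) (fun j hj => ?_) hmr
    (h.window_mem _ _ (le_max_right _ _) (by linarith) (by linarith))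
  · have := abs_lt.1 hj
    have a1 : (-(T : ℤ) : ℝ) < j := by push_cast; linarith
    have a2 : (j : ℝ) < (0 : ℤ) := by push_cast; linarith
    exact h.nonneg j (by exact_mod_cast a1) (by exact_mod_cast a2)
  · rw [Finset.mem_Icc, Int.ceil_le, Int.le_floor] at hj
    rw [abs_le]
    constructor <;> linarith [le_max_left v.im D]

lemma energy_neg_of_not_mem (h : RegularWeights m S T σ D B K) (hσ1 : σ ≤ 1) {v : ℂ}
    (hv : 0 < v.im) {r : ℝ} (hr : 1 ≤ r) (hD : 8 * D < σ * r) (him : 8 * v.im < σ * r)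
    (h1 : r ≤ v.re ∧ v.re + r ≤ 2 * K * T ∨ v.re ≤ -(T : ℝ) - r ∧ -(2 * K * T : ℝ) ≤ v.re - r) :
    energy m v < 0 := by
  have hm : 8 * max v.im D < σ * r := by
    rcases max_cases v.im D with h | h <;> rw [h.1] <;> assumption
  have hmr : max v.im D < r := by nlinarith
  rw [← neg_pos, ← energy_neg]
  rcases h1 with ⟨h1, h2⟩ | ⟨h1, h2⟩
  · refine h.toIsCauchyTransform.neg.energy_pos hv hr (le_max_left _ D) hm (fun j hj => ?_)
      (W := Finset.Icc ⌈v.re⌉ ⌊v.re + max v.im D⌋) (fun j hj => ?_) hmr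
      (h.window_not_mem _ _ (le_max_right _ _) (Or.inl ⟨by linarith, by linarith⟩))
    · have := abs_lt.1 hj
      have a2 : ((0 : ℤ) : ℝ) < j := by push_cast; linarith
      have := h.nonpos j (Or.inr (by exact_mod_cast a2.le))
      linarith
    · rw [Finset.mem_Icc, Int.ceil_le, Int.le_floor] at hj
      rw [abs_le]
      constructor <;> linarith [le_max_left v.im D]
  · refine h.toIsCauchyTransform.neg.energy_pos hv hr (le_max_left _ D) hm (fun j hj => ?_)
      (W := Finset.Icc ⌈v.re - max v.im D⌉ ⌊v.re - max v.im D + max v.im D⌋) (fun j hj => ?_) hmr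
      (h.window_not_mem _ _ (le_max_right _ _) (Or.inr ⟨by linarith, by linarith⟩))
    · have := abs_lt.1 hj
      have a1 : (j : ℝ) < (-(T : ℤ) : ℝ) := by push_cast; linarith
      have := h.nonpos j (Or.inl (by exact_mod_cast a1.le))
      linarith
    · rw [Finset.mem_Icc, Int.ceil_le, Int.le_floor] at hj
      rw [abs_le]
      constructor <;> linarith [le_max_left v.im D]

/-- Far from the origin the energy is negative. -/
lemma energy_le (h : RegularWeights m S T σ D B K) (hK : 12 ≤ σ * K) (hσ1 : σ ≤ 1)
    (hD : D ≤ K * T) (hT : 0 < T) {v : ℂ} (hv : v.im ≠ 0) (hvK : K * T ≤ ‖v‖) :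
    energy m v ≤ -(T / ‖v‖ ^ 2) := by
  have hT' : (0 : ℝ) < T := by exact_mod_cast hT
  have hK12 : (12 : ℝ) ≤ K := by
    have : (0 : ℝ) ≤ K := Nat.cast_nonneg K
    nlinarith
  have hv12 : 12 * (T : ℝ) ≤ ‖v‖ := le_trans (by gcongr) hvK
  have hv0 : 0 < ‖v‖ := by linarith
  -- The points in `(-T, 0)` contribute at most `2 T / ‖v‖²`, while this window, of total weight at
  -- most `-12 T`, contributes at most `-3 T / ‖v‖²`; all other terms are nonpositive.
  set W : Finset ℤ := Finset.Icc ⌈(0 : ℝ)⌉ ⌊(0 : ℝ) + K * T⌋ with hW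
  have hWσ := h.window_not_mem 0 (K * T) hD (Or.inl ⟨le_rfl, by nlinarith⟩)
  rw [← hW] at hWσ
  have hWmem : ∀ j ∈ W, 0 ≤ j ∧ (j : ℝ) ≤ K * T := fun j hj => by
    rw [hW, Finset.mem_Icc, Int.le_floor, Int.ceil_zero] at hj
    exact ⟨hj.1, by linarith [hj.2]⟩
  have hdisj : Disjoint (Finset.Ioo (-(T : ℤ)) 0) W := by
    rw [Finset.disjoint_left]
    intro j hj hj'
    have := hWmem j hj'
    rw [Finset.mem_Ioo] at hj
    omega
  have h1 : energy m v ≤ ∑ j ∈ Finset.Ioo (-(T : ℤ)) 0 ∪ W, m j / ‖v - j‖ ^ 2 := by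
    have := (h.neg.summable_energy hv).sum_le_tsum (Finset.Ioo (-(T : ℤ)) 0 ∪ W) fun j hj => by
      apply div_nonneg _ (by positivity)
      rw [Finset.mem_union, Finset.mem_Ioo, not_or] at hj
      have := h.nonpos j (by omega)
      linarith
    have e := energy_neg m v
    rw [energy] at e
    rw [e] at this
    simp only [neg_div, Finset.sum_neg_distrib] at this
    linarith
  rw [Finset.sum_union hdisj] at h1
  have h2 : ∑ j ∈ Finset.Ioo (-(T : ℤ)) 0, m j / ‖v - j‖ ^ 2 ≤ 2 * T / ‖v‖ ^ 2 := by
    have : ∀ j ∈ Finset.Ioo (-(T : ℤ)) 0, m j / ‖v - j‖ ^ 2 ≤ 2 / ‖v‖ ^ 2 := fun j hj => by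
      rw [Finset.mem_Ioo] at hj
      have a1 : |(j : ℝ)| ≤ T := by
        rw [abs_le]
        constructor
        · exact_mod_cast hj.1.le
        · have : (j : ℝ) < 0 := by exact_mod_cast hj.2
          linarith
      have a2 : ‖v‖ - T ≤ ‖v - j‖ := by
        have := norm_sub_norm_le v (j : ℂ)
        rw [norm_intCast] at this
        linarith
      have a3 := (abs_le.1 (h.abs_le j)).2
      have a4 : 11 / 12 * ‖v‖ ≤ ‖v - j‖ := by linarith
      have a5 : (11 / 12 * ‖v‖) ^ 2 ≤ ‖v - j‖ ^ 2 := by gcongr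
      rw [div_le_div_iff₀ (by nlinarith) (by positivity)]
      nlinarith [sq_nonneg ‖v‖]
    refine (Finset.sum_le_card_nsmul _ _ _ this).trans ?_
    rw [Int.card_Ioo, nsmul_eq_mul, mul_div_assoc', mul_comm]
    have : (((0 - -(T : ℤ) - 1).toNat : ℕ) : ℝ) ≤ T := by
      exact_mod_cast (by omega : (0 - -(T : ℤ) - 1).toNat ≤ T)
    gcongr
  have h3 : ∑ j ∈ W, m j / ‖v - j‖ ^ 2 ≤ -(3 * T / ‖v‖ ^ 2) := by
    have : ∀ j ∈ W, m j / ‖v - j‖ ^ 2 ≤ m j / (4 * ‖v‖ ^ 2) := fun j hj => by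
      have a1 := hWmem j hj
      have a2 := h.nonpos j (Or.inr a1.1)
      have a3 : ‖v - j‖ ≤ 2 * ‖v‖ := by
        have := norm_sub_le v (j : ℂ)
        rw [norm_intCast, abs_of_nonneg (by exact_mod_cast a1.1)] at this
        linarith [a1.2]
      have a4 : 0 < ‖v - j‖ := norm_pos_iff.2 (sub_int_ne_zero hv j)
      rw [← neg_le_neg_iff, ← neg_div, ← neg_div]
      apply div_le_div_of_nonneg_left (by linarith) (by positivity)
      nlinarith
    refine (Finset.sum_le_sum this).trans ?_
    rw [← Finset.sum_div, ← neg_div, div_le_div_iff₀ (by positivity) (by positivity)]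
    rw [Finset.sum_neg_distrib] at hWσ
    have : 12 * (T : ℝ) ≤ σ * (K * T) := by nlinarith
    nlinarith [sq_nonneg ‖v‖]
  have e : -((T : ℝ) / ‖v‖ ^ 2) = 2 * T / ‖v‖ ^ 2 + -(3 * T / ‖v‖ ^ 2) := by ring
  rw [e]
  linarith

end RegularWeights

end

/-! ### Critical points keep away from `0` and `-T` -/

noncomputable section

lemma inv_four_pow_succ (k : ℕ) : ((1 : ℝ) / 4) ^ (k + 1) = (1 / 4) ^ k / 4 := by
  rw [pow_succ]; ring

/-- Near the origin the sum `∑ -m j * j / |v - j| ^ 2` is large. -/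
lemma dyadic_sum_ge {m : ℤ → ℝ} {T : ℕ} {σ D : ℝ} {K : ℕ} (hT : 0 < T)
    (habs : ∀ j, |m j| ≤ 1) (hpos : ∀ j : ℤ, -(T : ℤ) < j → j < 0 → 0 ≤ m j)
    (hneg : ∀ j : ℤ, j ≤ -(T : ℤ) ∨ 0 ≤ j → m j ≤ 0)
    (hwin : ∀ y ℓ : ℝ, D ≤ ℓ → -(T : ℝ) < y → y + ℓ < 0 →
      σ * ℓ ≤ ∑ j ∈ Finset.Icc ⌈y⌉ ⌊y + ℓ⌋, m j)
    {n : ℕ} (hn : 1 ≤ n) (hD : D ≤ (1 / 4) ^ n * T) {v : ℂ} (hv : v.im ≠ 0)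
    (hvn : ‖v‖ ≤ (1 / 4) ^ n * T)
    {s : Finset ℤ} (hs1 : Finset.Ioo (-(T : ℤ)) 0 ⊆ s)
    (hs2 : s ⊆ Finset.Icc (-(3 * K * T : ℤ)) (3 * K * T)) :
    n * (σ / 9) - 36 * K ^ 2 ≤ ∑ j ∈ s, -(m j * j) / ‖v - j‖ ^ 2 := by
  classical
  have hT' : (0 : ℝ) < T := by exact_mod_cast hT
  -- The windows `[-2 ℓ k, -ℓ k]` are disjoint, and each contributes at least `σ / 9`: there `|j| ≥
  -- ℓ k` and `‖v - j‖ ≤ 3 ℓ k`. This is the logarithmic divergence at the origin, one unit per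
  -- scale.
  set ℓ : ℕ → ℝ := fun k => (1 / 4) ^ k / 4 * T with hℓ
  have hℓpos : ∀ k, 0 < ℓ k := fun k => by simp only [hℓ]; positivity
  have hℓle : ∀ k, ℓ k ≤ T / 4 := fun k => by
    have : ((1 : ℝ) / 4) ^ k ≤ 1 := pow_le_one₀ (by norm_num) (by norm_num)
    simp only [hℓ]
    nlinarith
  have hℓanti : ∀ k k', k < k' → 4 * ℓ k' ≤ ℓ k := fun k k' h => by
    have : ((1 : ℝ) / 4) ^ k' ≤ (1 / 4) ^ (k + 1) :=
      pow_le_pow_of_le_one (by norm_num) (by norm_num) h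
    rw [inv_four_pow_succ] at this
    simp only [hℓ]
    nlinarith
  have hℓn : ∀ k, k < n → (1 / 4) ^ n * T ≤ ℓ k := fun k h => by
    have : ((1 : ℝ) / 4) ^ n ≤ (1 / 4) ^ (k + 1) :=
      pow_le_pow_of_le_one (by norm_num) (by norm_num) h
    rw [inv_four_pow_succ] at this
    simp only [hℓ]
    nlinarith
  set W : ℕ → Finset ℤ := fun k => Finset.Icc ⌈-(2 * ℓ k)⌉ ⌊-(2 * ℓ k) + ℓ k⌋ with hW
  have hWmem : ∀ k, ∀ j ∈ W k, -(2 * ℓ k) ≤ j ∧ (j : ℝ) ≤ -ℓ k := fun k j hj => by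
    simp only [hW, Finset.mem_Icc, Int.ceil_le, Int.le_floor] at hj
    exact ⟨hj.1, by linarith [hj.2]⟩
  have hWin : ∀ k, ∀ j ∈ W k, -(T : ℤ) < j ∧ j < 0 := fun k j hj => by
    have h1 := hWmem k j hj
    have h2 := hℓpos k
    have h3 := hℓle k
    have a1 : (-(T : ℤ) : ℝ) < j := by push_cast; linarith
    have a2 : (j : ℝ) < (0 : ℤ) := by push_cast; linarith
    exact ⟨by exact_mod_cast a1, by exact_mod_cast a2⟩
  have hnorm : ∀ j : ℤ, 0 < ‖v - j‖ := fun j => norm_pos_iff.2 (sub_int_ne_zero hv j)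
  have hWsum : ∀ k, k < n → σ / 9 ≤ ∑ j ∈ W k, -(m j * j) / ‖v - j‖ ^ 2 := fun k hk => by
    have hp := hℓpos k
    have h1 := hwin (-(2 * ℓ k)) (ℓ k) (hD.trans (hℓn k hk)) (by linarith [hℓle k]) (by linarith)
    calc σ / 9 = σ * ℓ k / (9 * ℓ k) := by field_simp
      _ ≤ (∑ j ∈ W k, m j) / (9 * ℓ k) := by gcongr
      _ = ∑ j ∈ W k, m j / (9 * ℓ k) := Finset.sum_div _ _ _
      _ ≤ _ := Finset.sum_le_sum fun j hj => by
        have h2 := hWmem k j hj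
        have h3 := hpos j (hWin k j hj).1 (hWin k j hj).2
        have h4 : ‖v - j‖ ≤ 3 * ℓ k := by
          have := norm_sub_le v (j : ℂ)
          rw [norm_intCast, abs_of_nonpos (by linarith)] at this
          linarith [hℓn k hk]
        have h5 := hnorm j
        rw [div_le_div_iff₀ (by positivity) (by positivity)]
        have h6 : ‖v - j‖ ^ 2 ≤ 9 * ℓ k ^ 2 := by nlinarith
        have h7 : m j * ‖v - j‖ ^ 2 ≤ m j * (9 * ℓ k ^ 2) := by gcongr
        nlinarith [mul_nonneg h3 hp.le]
  have hdisj : ((Finset.range n : Finset ℕ) : Set ℕ).PairwiseDisjoint W := by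
    have key : ∀ k k', k < k' → Disjoint (W k) (W k') := fun k k' hkk => by
      rw [Finset.disjoint_left]
      intro j h1 h2
      have h1 := hWmem k j h1
      have h2 := hWmem k' j h2
      linarith [hℓanti k k' hkk, hℓpos k', hℓpos k]
    intro k _ k' _ hkk
    rcases lt_or_gt_of_ne hkk with h | h
    · exact key k k' h
    · exact (key k' k h).symm
  set U := (Finset.range n).biUnion W with hU
  have hUsum : n * (σ / 9) ≤ ∑ j ∈ U, -(m j * j) / ‖v - j‖ ^ 2 := by
    rw [hU, Finset.sum_biUnion hdisj]
    have := Finset.card_nsmul_le_sum (Finset.range n) (fun k => ∑ j ∈ W k, -(m j * j) / ‖v - j‖ ^ 2)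
      (σ / 9) (fun k hk => hWsum k (Finset.mem_range.1 hk))
    rwa [Finset.card_range, nsmul_eq_mul] at this
  have hUs : U ⊆ s := by
    intro j hj
    rw [hU, Finset.mem_biUnion] at hj
    obtain ⟨k, _, hk⟩ := hj
    exact hs1 (Finset.mem_Ioo.2 (hWin k j hk))
  set s₁ := s.filter (fun j : ℤ => -(T : ℤ) < j)
  set s₂ := s.filter (fun j : ℤ => ¬-(T : ℤ) < j)
  have hsplit : ∑ j ∈ s, -(m j * j) / ‖v - j‖ ^ 2 = ∑ j ∈ s₁, -(m j * j) / ‖v - j‖ ^ 2 +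
      ∑ j ∈ s₂, -(m j * j) / ‖v - j‖ ^ 2 :=
    (Finset.sum_filter_add_sum_filter_not s _ _).symm
  have hs₁ : ∑ j ∈ U, -(m j * j) / ‖v - j‖ ^ 2 ≤ ∑ j ∈ s₁, -(m j * j) / ‖v - j‖ ^ 2 := by
    refine Finset.sum_le_sum_of_subset_of_nonneg (fun j hj => ?_) fun j hj _ => ?_
    · rw [Finset.mem_filter]
      refine ⟨hUs hj, ?_⟩
      rw [hU, Finset.mem_biUnion] at hj
      obtain ⟨k, _, hk⟩ := hj
      exact (hWin k j hk).1
    · rw [Finset.mem_filter] at hj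
      apply div_nonneg _ (by positivity)
      rcases lt_or_ge j 0 with h0 | h0
      · have a1 := hpos j hj.2 h0
        have a2 : (j : ℝ) < 0 := by exact_mod_cast h0
        nlinarith
      · have a1 := hneg j (Or.inr h0)
        have a2 : (0 : ℝ) ≤ j := by exact_mod_cast h0
        nlinarith
  -- Only the terms with `j ≤ -T` can be negative: at most `3 K T` of them, each at least `-12 K /
  -- T` because `v` stays within `T / 4` of the origin.
  have hs₂ : -(36 * (K : ℝ) ^ 2) ≤ ∑ j ∈ s₂, -(m j * j) / ‖v - j‖ ^ 2 := by
    have hterm : ∀ j ∈ s₂, -(12 * K / T : ℝ) ≤ -(m j * j) / ‖v - j‖ ^ 2 := fun j hj => by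
      rw [Finset.mem_filter, not_lt] at hj
      have b1 : (j : ℝ) ≤ -T := by exact_mod_cast hj.2
      have b2 : -(3 * K * T : ℝ) ≤ j := by exact_mod_cast (Finset.mem_Icc.1 (hs2 hj.1)).1
      have b3 : ‖v‖ ≤ T / 4 := by
        have := hvn
        have h4 : ((1 : ℝ) / 4) ^ n ≤ (1 / 4) ^ 1 :=
          pow_le_pow_of_le_one (by norm_num) (by norm_num) hn
        nlinarith
      have b4 : T / 2 ≤ ‖v - j‖ := by
        have := norm_sub_norm_le (j : ℂ) v
        rw [norm_intCast, abs_of_nonpos (by linarith), norm_sub_rev] at this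
        linarith
      have b5 : (T / 2 : ℝ) ^ 2 ≤ ‖v - j‖ ^ 2 := by gcongr
      have b6 : |m j * j| ≤ 3 * K * T := by
        rw [abs_mul, abs_of_nonpos (by linarith : (j : ℝ) ≤ 0)]
        have := habs j
        nlinarith [abs_nonneg (m j)]
      have b7 := (_root_.abs_le.1 b6).2
      rw [neg_div, neg_le_neg_iff, div_le_div_iff₀ (by nlinarith) hT']
      have hK0 : (0 : ℝ) ≤ K := Nat.cast_nonneg K
      nlinarith [mul_le_mul_of_nonneg_left b5 (by positivity : (0 : ℝ) ≤ 12 * K)]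
    have hcard : s₂.card ≤ 3 * K * T := by
      have hsub : s₂ ⊆ Finset.Ico (-(3 * K * T : ℤ)) 0 := fun j hj => by
        rw [Finset.mem_filter, not_lt] at hj
        rw [Finset.mem_Ico]
        exact ⟨(Finset.mem_Icc.1 (hs2 hj.1)).1, by omega⟩
      refine (Finset.card_le_card hsub).trans ?_
      rw [Int.card_Ico]
      have : (0 : ℤ) - -(3 * K * T : ℤ) = ((3 * K * T : ℕ) : ℤ) := by push_cast; ring
      rw [this, Int.toNat_natCast]
    have := Finset.card_nsmul_le_sum s₂ _ _ hterm
    rw [nsmul_eq_mul] at this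
    refine le_trans ?_ this
    have hcard' : (s₂.card : ℝ) ≤ 3 * K * T := by exact_mod_cast hcard
    have e : (36 * (K : ℝ) ^ 2) = 3 * K * T * (12 * K / T) := by field_simp; ring
    rw [mul_neg, neg_le_neg_iff, e]
    gcongr
  rw [hsplit]
  linarith

namespace RegularWeights

variable {m : ℤ → ℝ} {S : ℂ → ℂ} {T : ℕ} {σ D B : ℝ} {K : ℕ}

lemma re_div_sub_int {v : ℂ} (x : ℝ) (j : ℤ) :
    ((x : ℂ) / (v - j)).re = x * (v.re - j) / ‖v - j‖ ^ 2 := by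
  rw [div_re, normSq_eq_norm_sq]
  simp

/-- A bound for the sum in `dyadic_sum_ge` and its mirror image, at real values of `S`. -/
lemma abs_sum_le_of_real (h : RegularWeights m S T σ D B K) (hT : 0 < T) (hK : 2 ≤ K) {v : ℂ}
    {c C : ℝ} (hv : v.im ≠ 0) (hc : S v = c) (hC : |c| ≤ C) (p : ℝ) (hp : |p| ≤ T)
    (hvp : |v.re - p| ≤ T / 4) (hvn : ‖v‖ ≤ K * T) :
    |∑ j ∈ Finset.Ioo (-(2 * K * T : ℤ)) (2 * K * T), m j * (p - j) / ‖v - j‖ ^ 2| ≤ C + B + 2 := by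
  have hT' : (0 : ℝ) < T := by exact_mod_cast hT
  have hT1 : (1 : ℝ) ≤ T := by exact_mod_cast hT
  have hK' : (2 : ℝ) ≤ K := by exact_mod_cast hK
  set s := Finset.Ioo (-(2 * K * T : ℤ)) (2 * K * T)
  have h1 := (abs_re_le_norm _).trans (h.far v hv hvn)
  rw [hc, sub_re, ofReal_re, re_sum] at h1
  simp only [re_div_sub_int] at h1
  have h2 := h.abs_energy_sub_le hv s hT1 fun j hj => by
    have hj' : (2 * K * T : ℝ) ≤ |(j : ℝ)| := by
      have : (2 * K * T : ℤ) ≤ |j| := by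
        by_contra hlt
        exact hj (Finset.mem_Ioo.2 (_root_.abs_lt.1 (not_le.1 hlt)))
      exact_mod_cast this
    have a1 : |v.re| ≤ |v.re - p| + |p| := by
      have := abs_add_le (v.re - p) p
      rwa [sub_add_cancel] at this
    have a2 := abs_sub_abs_le_abs_sub (j : ℝ) v.re
    rw [abs_sub_comm] at a2
    have a3 : 4 * (T : ℝ) ≤ 2 * K * T := by nlinarith
    linarith
  rw [h.energy_eq_zero hv hc, zero_sub, abs_neg] at h2
  -- Since the full energy is zero, its truncation is `O(1 / T)`, and replacing `Re v` by the base
  -- point `p` costs at most `1`.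
  have h3 : ∑ j ∈ s, m j * (p - j) / ‖v - j‖ ^ 2 = ∑ j ∈ s, m j * (v.re - j) / ‖v - j‖ ^ 2 -
      (v.re - p) * ∑ j ∈ s, m j / ‖v - j‖ ^ 2 := by
    rw [Finset.mul_sum, ← Finset.sum_sub_distrib]
    exact Finset.sum_congr rfl fun j _ => by ring
  have h4 : |(v.re - p) * ∑ j ∈ s, m j / ‖v - j‖ ^ 2| ≤ 1 := by
    rw [abs_mul]
    calc _ ≤ T / 4 * (4 / (T : ℝ)) := by gcongr
      _ = 1 := by field_simp
  rw [h3, _root_.abs_le]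
  have := _root_.abs_le.1 h1
  have := _root_.abs_le.1 h4
  have := _root_.abs_le.1 hC
  constructor <;> linarith

/-- The lower bound of `dyadic_sum_ge` grows with the number of scales, while a bounded real value
of `S` caps the same sum. So such a point cannot be too close to the origin. -/
lemma le_of_norm_le (h : RegularWeights m S T σ D B K) (hT : 0 < T) (hK : 2 ≤ K) {v : ℂ}
    {c C : ℝ} (hv : v.im ≠ 0) (hc : S v = c) (hC : |c| ≤ C) {n : ℕ} (hn : 1 ≤ n)
    (hD : D ≤ (1 / 4) ^ n * T) (hvn : ‖v‖ ≤ (1 / 4) ^ n * T) :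
    n * (σ / 9) ≤ C + B + 2 + 36 * K ^ 2 := by
  have hT' : (0 : ℝ) < T := by exact_mod_cast hT
  have hK' : (2 : ℝ) ≤ K := by exact_mod_cast hK
  have b3 : ‖v‖ ≤ T / 4 := by
    have h4 : ((1 : ℝ) / 4) ^ n ≤ (1 / 4) ^ 1 := pow_le_pow_of_le_one (by norm_num) (by norm_num) hn
    nlinarith
  have h1 := h.abs_sum_le_of_real hT hK hv hc hC 0 (by simp) (by
    rw [sub_zero]; exact (abs_re_le_norm v).trans b3) (by nlinarith)
  have h2 := dyadic_sum_ge (K := K) hT h.abs_le h.nonneg h.nonpos h.window_mem hn hD hv hvn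
    (s := Finset.Ioo (-(2 * K * T : ℤ)) (2 * K * T)) ?_ ?_
  · have e : ∑ j ∈ Finset.Ioo (-(2 * K * T : ℤ)) (2 * K * T), m j * (0 - j) / ‖v - j‖ ^ 2 =
        ∑ j ∈ Finset.Ioo (-(2 * K * T : ℤ)) (2 * K * T), -(m j * j) / ‖v - j‖ ^ 2 :=
      Finset.sum_congr rfl fun j _ => by ring
    rw [e] at h1
    linarith [(_root_.abs_le.1 h1).2]
  · have : (T : ℤ) ≤ 2 * K * T := by nlinarith
    apply Finset.Ioo_subset_Ioo <;> nlinarith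
  · intro j hj
    rw [Finset.mem_Ioo] at hj
    rw [Finset.mem_Icc]
    constructor <;> nlinarith

/-- The reflection `j ↦ -T - j` exchanges `0` and `-T` and preserves the sign pattern. It shifts the
range of summation, which is why `dyadic_sum_ge` allows indices up to `3 K T`. -/
lemma le_of_norm_add_le (h : RegularWeights m S T σ D B K) (hT : 0 < T) (hK : 2 ≤ K) {v : ℂ}
    {c C : ℝ} (hv : v.im ≠ 0) (hc : S v = c) (hC : |c| ≤ C) {n : ℕ} (hn : 1 ≤ n)
    (hD : D ≤ (1 / 4) ^ n * T) (hvn : ‖v + T‖ ≤ (1 / 4) ^ n * T) :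
    n * (σ / 9) ≤ C + B + 2 + 36 * K ^ 2 := by
  have hT' : (0 : ℝ) < T := by exact_mod_cast hT
  have hK' : (2 : ℝ) ≤ K := by exact_mod_cast hK
  have b3 : ‖v + T‖ ≤ T / 4 := by
    have h4 : ((1 : ℝ) / 4) ^ n ≤ (1 / 4) ^ 1 := pow_le_pow_of_le_one (by norm_num) (by norm_num) hn
    nlinarith
  have b4 : ‖v‖ ≤ 2 * T := by
    have := norm_sub_le (v + T) (T : ℂ)
    rw [add_sub_cancel_right, norm_natCast] at this
    linarith
  have h1 := h.abs_sum_le_of_real hT hK hv hc hC (-(T : ℝ)) (by simp) (by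
    have := (abs_re_le_norm (v + T)).trans b3
    simpa using this) (by nlinarith)
  have h2 := dyadic_sum_ge (m := fun j => m (-T - j)) (K := K) (v := -T - v) (σ := σ) (D := D)
    (T := T) hT (fun j => h.abs_le _)
    (fun j h1 h2 => h.nonneg _ (by omega) (by omega)) (fun j hj => h.nonpos _ (by omega)) ?_ hn hD
    (by simpa using hv) ?_
    (s := (Finset.Ioo (-(2 * K * T : ℤ)) (2 * K * T)).image (fun j => -(T : ℤ) - j)) ?_ ?_
  · rw [Finset.sum_image (by intro x _ y _ h; simpa using h)] at h2
    have e : ∑ j ∈ Finset.Ioo (-(2 * K * T : ℤ)) (2 * K * T), m j * (-T - j) / ‖v - j‖ ^ 2 =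
        -∑ j ∈ Finset.Ioo (-(2 * K * T : ℤ)) (2 * K * T),
          -(m (-T - (-T - j)) * ((-T - j : ℤ) : ℝ)) / ‖-(T : ℂ) - v - ((-T - j : ℤ) : ℂ)‖ ^ 2 := by
      rw [← Finset.sum_neg_distrib]
      refine Finset.sum_congr rfl fun j _ => ?_
      rw [sub_sub_cancel]
      push_cast
      rw [sub_sub_sub_cancel_left, norm_sub_rev]
      ring
    rw [e, abs_neg] at h1
    linarith [(_root_.abs_le.1 h1).2]
  · intro y ℓ h1 h2 h3
    have h4 := h.window_mem (-T - y - ℓ) ℓ h1 (by linarith) (by linarith)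
    refine h4.trans (le_of_eq ?_)
    symm
    refine Finset.sum_nbij' (fun j => -(T : ℤ) - j) (fun j => -(T : ℤ) - j) ?_ ?_ ?_ ?_ ?_
    · intro j hj
      rw [Finset.mem_Icc, Int.ceil_le, Int.le_floor] at hj ⊢
      push_cast
      constructor <;> linarith [hj.1, hj.2]
    · intro j hj
      rw [Finset.mem_Icc, Int.ceil_le, Int.le_floor] at hj ⊢
      push_cast
      constructor <;> linarith [hj.1, hj.2]
    · intro j _; ring
    · intro j _; ring
    · intro j _; rfl
  · rw [← norm_neg, show -(-(T : ℂ) - v) = v + T by ring]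
    exact hvn
  · intro j hj
    rw [Finset.mem_Ioo] at hj
    rw [Finset.mem_image]
    refine ⟨-T - j, Finset.mem_Ioo.2 ⟨?_, ?_⟩, by ring⟩ <;> nlinarith
  · intro j hj
    rw [Finset.mem_image] at hj
    obtain ⟨k, hk, rfl⟩ := hj
    rw [Finset.mem_Ioo] at hk
    rw [Finset.mem_Icc]
    have : (2 * T : ℤ) ≤ K * T := by nlinarith
    constructor <;> nlinarith

end RegularWeights

end

/-! ### Existence, uniqueness and localization of the critical point -/

noncomputable section

namespace RegularWeights

variable {m : ℤ → ℝ} {S : ℂ → ℂ} {T : ℕ} {σ D B : ℝ} {K : ℕ}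

/-- Lower bound for the imaginary part of the Nevanlinna type function. -/
lemma nevan_im_ge (h : RegularWeights m S T σ D B K) (hT : 0 < T) (hD : D ≤ T / 2)
    {v vc : ℂ} (hv : 0 < v.im) (hvc : vc.im ≠ 0) {C : ℝ} (hvC : ‖v‖ ≤ C * T)
    (hvcC : ‖vc‖ ≤ C * T) :
    3 * σ / (32 * (C + 1) ^ 4) * (v.im / T) ≤ (nevan m T vc v).im := by
  have hT' : (0 : ℝ) < T := by exact_mod_cast hT
  have hC0 : 0 ≤ C := by
    have := (norm_nonneg v).trans hvC
    exact nonneg_of_mul_nonneg_left this hT'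
  have hs := h.nevan_im (T := T) hv.ne' hvc
  have hnn : ∀ j : ℤ, 0 ≤ -(m j * j * (j + T)) * v.im / (‖v - j‖ ^ 2 * ‖vc - j‖ ^ 2) := fun j => by
    apply div_nonneg (mul_nonneg _ hv.le) (by positivity)
    by_cases hj : -(T : ℤ) < j ∧ j < 0
    · have a1 := h.nonneg j hj.1 hj.2
      have a2 : (j : ℝ) < 0 := by exact_mod_cast hj.2
      have a3 : -(T : ℝ) < j := by exact_mod_cast hj.1
      have : 0 ≤ -(j : ℝ) * (j + T) := mul_nonneg (by linarith) (by linarith)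
      nlinarith [mul_nonneg a1 this]
    · have a1 := h.nonpos j (by omega)
      have : 0 ≤ (j : ℝ) * (j + T) := by
        rcases lt_or_ge j 0 with h0 | h0
        · have a2 : (j : ℝ) < 0 := by exact_mod_cast h0
          have a3 : (j : ℝ) ≤ -T := by exact_mod_cast (by omega : j ≤ -(T : ℤ))
          nlinarith
        · have a2 : (0 : ℝ) ≤ j := by exact_mod_cast h0
          positivity
      nlinarith [mul_nonneg (neg_nonneg.2 a1) this]
  -- All terms are nonnegative, so it is enough to keep the middle half of `(-T, 0)`, where `-j (j +
  -- T) ≥ 3 T² / 16`.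
  set W := Finset.Icc ⌈-(3 * T / 4 : ℝ)⌉ ⌊-(3 * T / 4 : ℝ) + T / 2⌋ with hW
  have hWσ := h.window_mem (-(3 * T / 4 : ℝ)) (T / 2) hD (by linarith) (by linarith)
  refine le_trans ?_ (sum_le_hasSum W (fun j _ => hnn j) hs)
  have hterm : ∀ j ∈ W, m j * (3 / 16 / (C + 1) ^ 4 * v.im / T ^ 2) ≤
      -(m j * j * (j + T)) * v.im / (‖v - j‖ ^ 2 * ‖vc - j‖ ^ 2) := fun j hj => by
    rw [hW, Finset.mem_Icc, Int.ceil_le, Int.le_floor] at hj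
    have a0 : 0 ≤ m j := by
      have b1 : (-(T : ℤ) : ℝ) < j := by push_cast; linarith [hj.1]
      have b2 : (j : ℝ) < (0 : ℤ) := by push_cast; linarith [hj.2]
      exact h.nonneg j (by exact_mod_cast b1) (by exact_mod_cast b2)
    have a1 : 3 / 16 * (T : ℝ) ^ 2 ≤ -(j * (j + T)) := by nlinarith [hj.1, hj.2]
    have key : ∀ u : ℂ, u.im ≠ 0 → ‖u‖ ≤ C * T → 0 < ‖u - j‖ ^ 2 ∧ ‖u - j‖ ^ 2 ≤ ((C + 1) * T) ^ 2 :=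
      fun u hu huC => by
        have b0 : 0 < ‖u - j‖ := norm_pos_iff.2 (sub_int_ne_zero hu j)
        have b1 : ‖u - j‖ ≤ (C + 1) * T := by
          have := norm_sub_le u (j : ℂ)
          rw [norm_intCast, abs_of_nonpos (by linarith [hj.2])] at this
          linarith [hj.1]
        exact ⟨by positivity, by gcongr⟩
    obtain ⟨k1, k2⟩ := key v hv.ne' hvC
    obtain ⟨k3, k4⟩ := key vc hvc hvcC
    have e : m j * (3 / 16 / (C + 1) ^ 4 * v.im / T ^ 2) =
        m j * (3 / 16 * T ^ 2) * v.im / (((C + 1) * T) ^ 2 * ((C + 1) * T) ^ 2) := by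
      field_simp
    rw [e]
    have e2 : -(m j * j * (j + T)) = m j * -(j * (j + T)) := by ring
    rw [e2]
    have : 0 ≤ m j * -(j * (j + T)) := mul_nonneg a0 (by nlinarith)
    gcongr
  refine le_trans ?_ (Finset.sum_le_sum hterm)
  rw [← Finset.sum_mul]
  calc 3 * σ / (32 * (C + 1) ^ 4) * (v.im / T)
      = σ * (T / 2) * (3 / 16 / (C + 1) ^ 4 * v.im / T ^ 2) := by field_simp; ring
    _ ≤ _ := by gcongr

/-- In the factorization at `vc` the function `nevan` has positive imaginary part and `v ≠ conj vc`,
so the only factor that can vanish is `v - vc`. -/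
lemma eq_of_real (h : RegularWeights m S T σ D B K) (hσ : 0 < σ) (hT : 0 < T) (hD : D ≤ T / 2)
    {v vc : ℂ} {c : ℝ} (hv : 0 < v.im) (hvc : 0 < vc.im) (h1 : S v = c) (h2 : S vc = c) :
    v = vc := by
  have hT' : (0 : ℝ) < T := by exact_mod_cast hT
  have hf := h.factor (T := T) hv.ne' hvc.ne' h2
  rw [h1, sub_self] at hf
  have hn := h.nevan_im_ge hT hD hv hvc.ne' (C := (‖v‖ + ‖vc‖) / T)
    (by rw [div_mul_cancel₀ _ hT'.ne']; linarith [norm_nonneg vc])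
    (by rw [div_mul_cancel₀ _ hT'.ne']; linarith [norm_nonneg v])
  have hpos : 0 < (nevan m T vc v).im := lt_of_lt_of_le (by positivity) hn
  have hne : nevan m T vc v ≠ 0 := fun h0 => by rw [h0] at hpos; simp at hpos
  have hv0 : v ≠ 0 := by rintro rfl; simp at hv
  have hvT : v + T ≠ 0 := by
    have := sub_int_ne_zero hv.ne' (-(T : ℤ))
    simpa using this
  have hcj : v - (starRingEnd ℂ) vc ≠ 0 := fun h0 => by
    have := congrArg Complex.im h0
    simp at this
    linarith
  have := hf.symm
  simp only [mul_eq_zero, div_eq_zero_iff, hne, hv0, hvT, hcj, or_false] at this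
  exact sub_eq_zero.1 this

end RegularWeights

/-- A priori localization of the points where the Cauchy transform takes a bounded real value. -/
lemma exists_apriori {σ : ℝ} (hσ : 0 < σ) (hσ1 : σ ≤ 1) (B C : ℝ) {K : ℕ} (hK : 12 ≤ σ * K) :
    ∃ κ > 0, ∃ ε > 0, ∃ T₀ : ℕ, 0 < T₀ ∧ ∀ (m : ℤ → ℝ) (S : ℂ → ℂ) (T : ℕ) (D : ℝ),
      RegularWeights m S T σ D B K → D ≤ ε * T → T₀ ≤ T → ∀ (v : ℂ) (c : ℝ), 0 < v.im → S v = c →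
      |c| ≤ C → κ * T ≤ v.im ∧ ‖v‖ ≤ K * T := by
  -- With `n₀ + 1` dyadic scales, `le_of_norm_le` and `le_of_norm_add_le` are contradicted, so the
  -- point is farther than `r₀ T` from `0` and from `-T`.
  obtain ⟨n₀, hn₀⟩ := exists_nat_gt ((C + B + 2 + 36 * K ^ 2) / (σ / 9))
  set n := n₀ + 1
  have hn : C + B + 2 + 36 * (K : ℝ) ^ 2 < n * (σ / 9) := by
    rw [div_lt_iff₀ (by positivity)] at hn₀
    have : ((n₀ + 1 : ℕ) : ℝ) * (σ / 9) = n₀ * (σ / 9) + σ / 9 := by push_cast; ring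
    rw [this]
    linarith [div_pos hσ (by norm_num : (0 : ℝ) < 9)]
  set r₀ : ℝ := (1 / 4) ^ n with hr₀
  have hr₀pos : 0 < r₀ := by positivity
  have hr₀1 : r₀ ≤ 1 := pow_le_one₀ (by norm_num) (by norm_num)
  have hK12 : (12 : ℝ) ≤ K := by
    have : (0 : ℝ) ≤ K := Nat.cast_nonneg K
    nlinarith
  have hK2 : 2 ≤ K := by
    have : (2 : ℝ) ≤ K := by linarith
    exact_mod_cast this
  obtain ⟨T₁, hT₁⟩ := exists_nat_gt (2 / r₀)
  refine ⟨σ * r₀ / 32, by positivity, σ * r₀ / 32, by positivity, T₁ + 1, by omega, ?_⟩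
  intro m S T D h hD hT v c hv hc hC
  have hT0 : 0 < T := by omega
  have hT' : (0 : ℝ) < T := by exact_mod_cast hT0
  have hTr : 2 ≤ r₀ * T := by
    have h1 : 2 / r₀ < T := hT₁.trans (by exact_mod_cast (by omega : T₁ < T))
    rw [div_lt_iff₀ hr₀pos] at h1
    linarith
  have hσr : σ * r₀ ≤ r₀ := by nlinarith
  have hD' : D ≤ r₀ * T := by nlinarith
  have hvK : ‖v‖ ≤ K * T := by
    by_contra hlt
    have h1 := h.energy_le hK hσ1 (by nlinarith) hT0 hv.ne' (not_le.1 hlt).le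
    rw [h.energy_eq_zero hv.ne' hc] at h1
    have h2 : 0 < ‖v‖ := lt_of_le_of_lt (by positivity) (not_le.1 hlt)
    have : 0 < (T : ℝ) / ‖v‖ ^ 2 := by positivity
    linarith
  refine ⟨?_, hvK⟩
  have hv0 : r₀ * T < ‖v‖ := by
    by_contra hle
    have := h.le_of_norm_le hT0 hK2 hv.ne' hc hC (by omega) hD' (not_lt.1 hle)
    linarith
  have hvT : r₀ * T < ‖v + T‖ := by
    by_contra hle
    have := h.le_of_norm_add_le hT0 hK2 hv.ne' hc hC (by omega) hD' (not_lt.1 hle)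
    linarith
  by_contra hlt
  rw [not_le] at hlt
  have him : v.im ≤ r₀ * T / 2 := by nlinarith
  have hre : r₀ * T / 2 ≤ |v.re| := by
    have := norm_le_abs_re_add_abs_im v
    rw [abs_of_pos hv] at this
    linarith
  have hreT : r₀ * T / 2 ≤ |v.re + T| := by
    have := norm_le_abs_re_add_abs_im (v + T)
    rw [add_im, natCast_im, add_zero, abs_of_pos hv, add_re, natCast_re] at this
    linarith
  have hrevK : |v.re| ≤ K * T := (abs_re_le_norm v).trans hvK
  have e1 : 8 * D < σ * (r₀ * T / 2) := by
    have : 0 < σ * r₀ * T := by positivity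
    nlinarith
  have e2 : 8 * v.im < σ * (r₀ * T / 2) := by
    have : 0 < σ * r₀ * T := by positivity
    nlinarith
  have hz := h.energy_eq_zero hv.ne' hc
  have hKT : r₀ * T / 2 ≤ K * T := by nlinarith
  have hrK := _root_.abs_le.1 hrevK
  -- A point of small height would have real part away from both `0` and `-T`, hence well to the
  -- left of `-T`, well inside `(-T, 0)`, or well to the right of `0`. In each case the energy has a
  -- strict sign, yet it must vanish.
  rcases le_abs'.1 hre with h1 | h1
  · rcases le_abs'.1 hreT with h2 | h2
    · have := h.energy_neg_of_not_mem hσ1 hv (r := r₀ * T / 2) (by linarith) e1 e2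
        (Or.inr ⟨by linarith, by linarith⟩)
      linarith
    · have := h.energy_pos_of_mem hσ1 hv (r := r₀ * T / 2) (by linarith) e1 e2
        (by linarith) (by linarith)
      linarith
  · have := h.energy_neg_of_not_mem hσ1 hv (r := r₀ * T / 2) (by linarith) e1 e2
      (Or.inl ⟨by linarith, by linarith⟩)
    linarith

/-- There is a point on the line `Re v = -T / 2` at which the Cauchy transform is real and bounded. -/
lemma RegularWeights.exists_real_value {m : ℤ → ℝ} {S : ℂ → ℂ} {T : ℕ} {σ D B : ℝ} {K : ℕ}
    (h : RegularWeights m S T σ D B K)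
    (hσ : 0 < σ) (hσ1 : σ ≤ 1) (hK : 12 ≤ σ * K) (hT : 2 ≤ T) (hD : 17 * D ≤ σ * T)
    (hS : ∀ v : ℂ, 0 < v.im → DifferentiableAt ℂ S v) :
    ∃ (v : ℂ) (c : ℝ), 0 < v.im ∧ S v = c ∧ |c| ≤ B + 128 * K / σ := by
  have hT2 : (2 : ℝ) ≤ T := by exact_mod_cast hT
  have hT' : (0 : ℝ) < T := by linarith
  have hK12 : (12 : ℝ) ≤ K := by
    have : (0 : ℝ) ≤ K := Nat.cast_nonneg K
    nlinarith
  set f : ℝ → ℂ := fun y => ((-(T : ℝ) / 2 : ℝ) : ℂ) + y * I with hf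
  have hfim : ∀ y, (f y).im = y := fun y => by simp [hf]
  have hfre : ∀ y, (f y).re = -(T : ℝ) / 2 := fun y => by simp [hf]
  have hle : σ * T / 32 ≤ K * T := by nlinarith
  have hlo : 0 < σ * T / 32 := by positivity
  have hcont : ContinuousOn (fun y => (S (f y)).im) (Set.Icc (σ * T / 32) (K * T)) := by
    intro y hy
    have hy0 : 0 < (f y).im := by rw [hfim]; linarith [hy.1]
    have h1 : ContinuousAt f y := by simp only [hf]; fun_prop
    have h2 : ContinuousAt S (f y) := (hS _ hy0).continuousAt
    exact (continuous_im.continuousAt.comp (h2.comp h1)).continuousWithinAt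
  -- Above the midpoint of `(-T, 0)` the energy is positive at height `σ T / 32` and negative at
  -- height `K T`, so `Im S` vanishes in between.
  have hleft : (S (f (σ * T / 32))).im ≤ 0 := by
    have hv : 0 < (f (σ * T / 32)).im := by rw [hfim]; exact hlo
    have := h.energy_pos_of_mem hσ1 hv (r := T / 2) (by linarith) (by nlinarith)
      (by rw [hfim]; nlinarith) (by rw [hfre]; linarith) (by rw [hfre]; linarith)
    rw [h.im_eq hv.ne']
    nlinarith
  have hright : 0 ≤ (S (f (K * T))).im := by
    have hv : 0 < (f (K * T)).im := by rw [hfim]; linarith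
    have hn : K * T ≤ ‖f (K * T)‖ := by
      have := abs_im_le_norm (f (K * T))
      rwa [hfim, abs_of_pos (by linarith)] at this
    have := h.energy_le hK hσ1 (by nlinarith) (by omega) hv.ne' hn
    have h2 : 0 ≤ (T : ℝ) / ‖f (K * T)‖ ^ 2 := by positivity
    rw [h.im_eq hv.ne']
    nlinarith
  obtain ⟨y, hy, hy0⟩ := intermediate_value_Icc hle hcont ⟨hleft, hright⟩
  have hv : 0 < (f y).im := by rw [hfim]; linarith [hy.1]
  refine ⟨f y, (S (f y)).re, hv, ?_, ?_⟩
  · exact Complex.ext (by simp) (by simpa using hy0)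
  · have hreal : S (f y) = ((S (f y)).re : ℝ) := Complex.ext (by simp) (by simpa using hy0)
    have hvK : ‖f y‖ ≤ K * T := by
      by_contra hlt
      have h1 := h.energy_le hK hσ1 (by nlinarith) (by omega) hv.ne' (not_le.1 hlt).le
      rw [h.energy_eq_zero hv.ne' hreal] at h1
      have h2 : 0 < ‖f y‖ := lt_of_le_of_lt (by positivity) (not_le.1 hlt)
      have : 0 < (T : ℝ) / ‖f y‖ ^ 2 := by positivity
      linarith
    refine (abs_re_le_norm _).trans ?_
    have h1 := h.far (f y) hv.ne' hvK
    set s := Finset.Ioo (-(2 * K * T : ℤ)) (2 * K * T)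
    have h2 : ‖∑ j ∈ s, (m j : ℂ) / (f y - j)‖ ≤ 128 * K / σ := by
      refine (norm_sum_le _ _).trans ?_
      have hterm : ∀ j ∈ s, ‖(m j : ℂ) / (f y - j)‖ ≤ 32 / (σ * T) := fun j _ => by
        rw [norm_div, norm_real, Real.norm_eq_abs]
        have a1 : σ * T / 32 ≤ ‖f y - j‖ := by
          have := abs_im_le_norm (f y - j)
          rw [sub_im, intCast_im, sub_zero, hfim, abs_of_pos (by linarith [hy.1])] at this
          linarith [hy.1]
        calc _ ≤ 1 / (σ * T / 32) := by
              gcongr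
              exact h.abs_le j
          _ = _ := by field_simp
      refine (Finset.sum_le_card_nsmul _ _ _ hterm).trans ?_
      rw [nsmul_eq_mul]
      have hc : (s.card : ℝ) ≤ 4 * K * T := by
        have : s.card ≤ 4 * K * T := by
          rw [Int.card_Ioo]
          have : (2 * K * T : ℤ) - -(2 * K * T : ℤ) = ((4 * K * T : ℕ) : ℤ) := by push_cast; ring
          rw [this]
          omega
        exact_mod_cast this
      calc (s.card : ℝ) * (32 / (σ * T)) ≤ 4 * K * T * (32 / (σ * T)) := by gcongr
        _ = _ := by field_simp; norm_num
    have h3 := norm_add_le (S (f y) - ∑ j ∈ s, (m j : ℂ) / (f y - j))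
      (∑ j ∈ s, (m j : ℂ) / (f y - j))
    rw [sub_add_cancel] at h3
    linarith

/-- Existence of a localized point where the Cauchy transform takes a given real value. -/
lemma exists_critical {σ : ℝ} (hσ : 0 < σ) (hσ1 : σ ≤ 1) (B C : ℝ) {K : ℕ} (hK : 12 ≤ σ * K) :
    ∃ κ > 0, ∃ ε > 0, ∃ T₀ : ℕ, 0 < T₀ ∧ ∀ (m : ℤ → ℝ) (S : ℂ → ℂ) (T : ℕ) (D : ℝ),
      RegularWeights m S T σ D B K → D ≤ ε * T → T₀ ≤ T →
      (∀ v : ℂ, 0 < v.im → DifferentiableAt ℂ S v) → ∀ c : ℝ, |c| ≤ C →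
      ∃ v : ℂ, S v = c ∧ κ * T ≤ v.im ∧ ‖v‖ ≤ K * T := by
  set C' := max C (B + 128 * K / σ) with hC'
  obtain ⟨κ, hκ, ε, hε, T₀, hT₀, H⟩ := exists_apriori hσ hσ1 B (C' + 1) hK
  refine ⟨κ, hκ, min ε (σ / 17), by positivity, T₀ + 2, by omega, ?_⟩
  intro m S T D h hD hT hS c hc
  have hT' : (0 : ℝ) < T := by exact_mod_cast (by omega : 0 < T)
  have hD1 : D ≤ ε * T := hD.trans (by gcongr; exact min_le_left _ _)
  have hD2 : D ≤ σ / 17 * T := hD.trans (by gcongr; exact min_le_right _ _)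
  have hDT : D ≤ T / 2 := by nlinarith
  have hloc := H m S T D h hD1 (by omega)
  -- The interval `[-C', C']` will be contained in this set by connectedness. `C'` is large enough
  -- for the interval to contain the value provided by `exists_real_value`.
  set U : Set ℝ := {c | ∃ v : ℂ, 0 < v.im ∧ S v = c} with hU
  have hUopen : IsOpen U := by
    rw [isOpen_iff_mem_nhds]
    rintro c₁ ⟨v, hv, hvc⟩
    have hopen : IsOpen {w : ℂ | 0 < w.im} := isOpen_lt continuous_const continuous_im
    have han : AnalyticAt ℂ S v :=
      (DifferentiableOn.analyticAt (s := {w : ℂ | 0 < w.im})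
        (fun w hw => (hS w hw).differentiableWithinAt) (hopen.mem_nhds hv))
    -- Local constancy would yield two distinct points with the same real value, against
    -- `eq_of_real`; otherwise `S` is open at `v`.
    rcases han.eventually_constant_or_nhds_le_map_nhds with hcst | hmap
    · exfalso
      have h1 : ∀ᶠ w in 𝓝 v, S w = S v ∧ 0 < w.im := hcst.and (hopen.mem_nhds hv)
      have h2 : ∃ᶠ w in 𝓝[≠] v, S w = S v ∧ 0 < w.im :=
        (h1.filter_mono nhdsWithin_le_nhds).frequently
      obtain ⟨w, ⟨hw1, hw2⟩, hw3⟩ := (h2.and_eventually self_mem_nhdsWithin).exists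
      exact hw3 (h.eq_of_real hσ (by omega) hDT hw2 hv (hw1.trans hvc) hvc)
    · have h1 : S '' {w : ℂ | 0 < w.im} ∈ 𝓝 (S v) := hmap (image_mem_map (hopen.mem_nhds hv))
      rw [hvc] at h1
      have h2 := continuous_ofReal.continuousAt.preimage_mem_nhds h1
      filter_upwards [h2] with x hx
      obtain ⟨w, hw, hwx⟩ := hx
      exact ⟨w, hw, hwx⟩
  set P : Set ℂ := {v : ℂ | κ * T ≤ v.im} ∩ Metric.closedBall 0 (K * T) with hP
  have hPc : IsCompact P := (isCompact_closedBall _ _).inter_left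
    (isClosed_le continuous_const continuous_im)
  have hPim : ∀ v ∈ P, 0 < v.im := fun v hv => lt_of_lt_of_le (by positivity) hv.1
  have hSP : IsCompact (S '' P) := hPc.image_of_continuousOn fun v hv =>
    (hS v (hPim v hv)).continuousAt.continuousWithinAt
  have hclosed : IsClosed ((fun x : ℝ => (x : ℂ)) ⁻¹' (S '' P)) :=
    hSP.isClosed.preimage continuous_ofReal
  -- The margin `1` is needed for closedness: a limit in `[-C', C']` is approached by values that
  -- are only known to lie in a slightly larger interval.
  have hsub : ∀ x ∈ U, |x| ≤ C' + 1 → x ∈ (fun x : ℝ => (x : ℂ)) ⁻¹' (S '' P) := by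
    rintro x ⟨v, hv, hvx⟩ hx
    obtain ⟨k1, k2⟩ := hloc v x hv hvx hx
    exact ⟨v, ⟨k1, by simpa using k2⟩, hvx⟩
  have hne : (Set.Icc (-C') C' ∩ U).Nonempty := by
    obtain ⟨v, x, hv, hvx, hx⟩ := h.exists_real_value hσ hσ1 hK (by omega) (by linarith) hS
    have : |x| ≤ C' := hx.trans (le_max_right _ _)
    exact ⟨x, _root_.abs_le.1 this, v, hv, hvx⟩
  have hcl : closure U ∩ Set.Icc (-C') C' ⊆ U := by
    rintro x ⟨hx1, hx2⟩
    have hx3 : x ∈ Set.Ioo (-(C' + 1)) (C' + 1) := ⟨by linarith [hx2.1], by linarith [hx2.2]⟩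
    have hx4 : x ∈ closure (Set.Ioo (-(C' + 1)) (C' + 1) ∩ U) :=
      isOpen_Ioo.inter_closure ⟨hx3, hx1⟩
    have hx5 : x ∈ (fun x : ℝ => (x : ℂ)) ⁻¹' (S '' P) := by
      refine closure_minimal ?_ hclosed hx4
      rintro y ⟨hy1, hy2⟩
      exact hsub y hy2 (_root_.abs_le.2 ⟨hy1.1.le, hy1.2.le⟩)
    obtain ⟨v, hvP, hvx⟩ := hx5
    exact ⟨v, hPim v hvP, hvx⟩
  have hmain : Set.Icc (-C') C' ⊆ U :=
    isPreconnected_Icc.subset_of_closure_inter_subset hUopen hne hcl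
  have hcC : |c| ≤ C' := hc.trans (le_max_left _ _)
  obtain ⟨v, hv, hvc⟩ := hmain (_root_.abs_le.1 hcC)
  obtain ⟨k1, k2⟩ := hloc v c hv hvc (by linarith)
  exact ⟨v, hvc, k1, k2⟩

end

noncomputable section

/-! ### Regularity of the weights of a configuration -/

/-- The number of particles in `[y, y + ℓ]`. -/
def windowCount {N : ℕ} (a : Fin N → ℤ) (y ℓ : ℝ) : ℕ :=
  (Finset.univ.filter fun i => y ≤ (a i : ℝ) ∧ (a i : ℝ) ≤ y + ℓ).card

section counts

variable {N : ℕ} {a : Fin N → ℤ} {D Q ρ₁ ρ₂ : ℝ}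

lemma windowCount_mono {y ℓ y' ℓ' : ℝ} (h1 : y' ≤ y) (h2 : y + ℓ ≤ y' + ℓ') :
    windowCount a y ℓ ≤ windowCount a y' ℓ' := by
  refine Finset.card_le_card fun i hi => ?_
  rw [Finset.mem_filter] at hi ⊢
  exact ⟨hi.1, by linarith [hi.2.1], by linarith [hi.2.2]⟩

/-- Segments of length `D` are separated by gaps of length `D`: the segments are closed, and
adjacent ones would count a common endpoint twice. -/
lemma mul_le_windowCount_odd (h : LocalDensity a D Q ρ₁ ρ₂) (hD : 0 < D) (n : ℕ) {y : ℝ}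
    (hy : -Q ≤ y) (hyQ : y + (2 * n + 1) * D ≤ Q) :
    (n + 1) * (ρ₁ * D) ≤ windowCount a y ((2 * n + 1) * D) := by
  classical
  induction n with
  | zero =>
    have := (h y hy (by simpa using hyQ)).1
    simpa [windowCount] using this
  | succ n ih =>
    push_cast at hyQ ⊢
    have h1 := ih (by nlinarith)
    have hn : (0 : ℝ) ≤ n := Nat.cast_nonneg n
    have h2 := (h (y + (2 * n + 2) * D) (by nlinarith) (by linarith)).1
    have h3 : windowCount a y ((2 * n + 1) * D) + windowCount a (y + (2 * n + 2) * D) D ≤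
        windowCount a y ((2 * (n + 1) + 1) * D) := by
      rw [windowCount, windowCount, windowCount, ← Finset.card_union_of_disjoint]
      · refine Finset.card_le_card fun i hi => ?_
        rw [Finset.mem_union, Finset.mem_filter, Finset.mem_filter] at hi
        rw [Finset.mem_filter]
        rcases hi with ⟨_, hi1, hi2⟩ | ⟨_, hi1, hi2⟩
        · exact ⟨Finset.mem_univ _, hi1, by nlinarith⟩
        · exact ⟨Finset.mem_univ _, by nlinarith, by linarith⟩
      · rw [Finset.disjoint_left]
        intro i hi hi'
        rw [Finset.mem_filter] at hi hi'
        linarith [hi.2.2, hi'.2.1]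
    have h4 : (windowCount a y ((2 * n + 1) * D) : ℝ) + windowCount a (y + (2 * n + 2) * D) D ≤
        windowCount a y ((2 * (n + 1) + 1) * D) := by exact_mod_cast h3
    have h5 : ρ₁ * D ≤ windowCount a (y + (2 * n + 2) * D) D := h2
    linarith

/-- Using every other segment and discarding the remainder costs the factor `4`. -/
lemma mul_le_windowCount (h : LocalDensity a D Q ρ₁ ρ₂) (hD : 0 < D) (hρ : 0 ≤ ρ₁) {y ℓ : ℝ}
    (hℓ : D ≤ ℓ) (hy : -Q ≤ y) (hyQ : y + ℓ ≤ Q) : ρ₁ / 4 * ℓ ≤ windowCount a y ℓ := by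
  set n := ⌊(ℓ - D) / (2 * D)⌋₊
  have h1 : (n : ℝ) ≤ (ℓ - D) / (2 * D) := Nat.floor_le (div_nonneg (by linarith) (by linarith))
  have h2 : (ℓ - D) / (2 * D) < n + 1 := Nat.lt_floor_add_one _
  rw [le_div_iff₀ (by linarith)] at h1
  rw [div_lt_iff₀ (by linarith)] at h2
  have h3 := mul_le_windowCount_odd h hD n hy (by nlinarith)
  have h4 : (windowCount a y ((2 * n + 1) * D) : ℝ) ≤ windowCount a y ℓ := 
    Nat.cast_le.2 (windowCount_mono le_rfl (by nlinarith))
  have hn : (0 : ℝ) ≤ n := Nat.cast_nonneg n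
  have h5 : ℓ / 4 ≤ (n + 1) * D := by nlinarith
  nlinarith [mul_le_mul_of_nonneg_left h5 hρ]

lemma windowCount_le_mul (h : LocalDensity a D Q ρ₁ ρ₂) (hD : 0 < D) (n : ℕ) {y : ℝ}
    (hy : -Q ≤ y) (hyQ : y + (n + 1) * D ≤ Q) :
    (windowCount a y ((n + 1) * D) : ℝ) ≤ (n + 1) * (ρ₂ * D) := by
  classical
  induction n with
  | zero =>
    have := (h y hy (by simpa using hyQ)).2
    simpa [windowCount] using this
  | succ n ih =>
    push_cast at hyQ ⊢
    have h1 := ih (by nlinarith)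
    have hn : (0 : ℝ) ≤ n := Nat.cast_nonneg n
    have h2 : (windowCount a (y + (n + 1) * D) D : ℝ) ≤ ρ₂ * D :=
      (h (y + (n + 1) * D) (by nlinarith) (by linarith)).2
    have h3 : windowCount a y ((n + 1 + 1) * D) ≤
        windowCount a y ((n + 1) * D) + windowCount a (y + (n + 1) * D) D := by
      rw [windowCount, windowCount, windowCount]
      refine le_trans (Finset.card_le_card fun i hi => ?_) (Finset.card_union_le _ _)
      rw [Finset.mem_union, Finset.mem_filter, Finset.mem_filter]
      rw [Finset.mem_filter] at hi
      rcases le_total (a i : ℝ) (y + (n + 1) * D) with h0 | h0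
      · exact Or.inl ⟨Finset.mem_univ _, hi.2.1, h0⟩
      · exact Or.inr ⟨Finset.mem_univ _, h0, by linarith [hi.2.2]⟩
    have h4 : (windowCount a y ((n + 1 + 1) * D) : ℝ) ≤
        windowCount a y ((n + 1) * D) + windowCount a (y + (n + 1) * D) D := by exact_mod_cast h3
    linarith

/-- Cover the window by adjacent segments of length `D`. The last one may overshoot, hence `ℓ + D`
both in the bound and in the room required inside `[-Q, Q]`. -/
lemma windowCount_le (h : LocalDensity a D Q ρ₁ ρ₂) (hD : 0 < D) (hρ : 0 ≤ ρ₂) {y ℓ : ℝ}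
    (hℓ : 0 ≤ ℓ) (hy : -Q ≤ y) (hyQ : y + ℓ + D ≤ Q) : (windowCount a y ℓ : ℝ) ≤ ρ₂ * (ℓ + D) := by
  set n := ⌊ℓ / D⌋₊
  have h1 : (n : ℝ) ≤ ℓ / D := Nat.floor_le (div_nonneg hℓ hD.le)
  have h2 : ℓ / D < n + 1 := Nat.lt_floor_add_one _
  rw [le_div_iff₀ hD] at h1
  rw [div_lt_iff₀ hD] at h2
  have h3 := windowCount_le_mul h hD n hy (by nlinarith)
  have h4 : (windowCount a y ℓ : ℝ) ≤ windowCount a y ((n + 1) * D) := 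
    Nat.cast_le.2 (windowCount_mono le_rfl (by linarith))
  nlinarith

end counts

section sums

variable {N : ℕ} {a : Fin N → ℤ}

lemma sum_particles_filter (ha : StrictMono a) (s : Finset ℤ) (f : ℤ → ℝ) :
    ∑ j ∈ s, (if ∃ i, a i = j then f j else 0) =
      ∑ i ∈ Finset.univ.filter (fun i => a i ∈ s), f (a i) := by
  classical
  rw [← Finset.sum_filter]
  have : s.filter (fun j => ∃ i, a i = j) = (Finset.univ.filter (fun i => a i ∈ s)).image a := by
    ext j
    simp only [Finset.mem_filter, Finset.mem_image, Finset.mem_univ, true_and]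
    constructor
    · rintro ⟨h1, i, rfl⟩
      exact ⟨i, h1, rfl⟩
    · rintro ⟨i, h1, rfl⟩
      exact ⟨h1, i, rfl⟩
  rw [this, Finset.sum_image (fun x _ y _ h => ha.injective h)]

lemma sum_particles_window (ha : StrictMono a) (y ℓ : ℝ) :
    ∑ j ∈ Finset.Icc ⌈y⌉ ⌊y + ℓ⌋, (if ∃ i, a i = j then (1 : ℝ) else 0) = windowCount a y ℓ := by
  rw [sum_particles_filter ha _ (fun _ => 1), Finset.sum_const, nsmul_eq_mul, mul_one, windowCount]
  congr 2
  ext i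
  simp only [Finset.mem_filter, Finset.mem_Icc, Int.ceil_le, Int.le_floor]

lemma sum_wt_window_mem (ha : StrictMono a) (T : ℕ) {y ℓ : ℝ} (h1 : -(T : ℝ) < y)
    (h2 : y + ℓ < 0) : ∑ j ∈ Finset.Icc ⌈y⌉ ⌊y + ℓ⌋, wt a T j = windowCount a y ℓ := by
  rw [← sum_particles_window ha]
  refine Finset.sum_congr rfl fun j hj => ?_
  rw [Finset.mem_Icc, Int.ceil_le, Int.le_floor] at hj
  have b1 : (-(T : ℤ) : ℝ) < j := by push_cast; linarith [hj.1]
  have b2 : (j : ℝ) < (0 : ℤ) := by push_cast; linarith [hj.2]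
  have b1' : -(T : ℤ) < j := by exact_mod_cast b1
  have b2' : j < 0 := by exact_mod_cast b2
  rw [wt, if_neg (show ¬(j ≤ -(T : ℤ) ∨ 0 ≤ j) by omega), sub_zero]

/-- Here `-wt` is `1` minus the indicator of a particle, and a window of length `ℓ` contains at
least `ℓ - 1` integers. -/
lemma sum_wt_window_not_mem (ha : StrictMono a) (T : ℕ) {y ℓ : ℝ}
    (h : 0 ≤ y ∨ y + ℓ ≤ -(T : ℝ)) :
    ℓ - 1 - windowCount a y ℓ ≤ ∑ j ∈ Finset.Icc ⌈y⌉ ⌊y + ℓ⌋, -wt a T j := by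
  have e : ∑ j ∈ Finset.Icc ⌈y⌉ ⌊y + ℓ⌋, -wt a T j =
      ∑ j ∈ Finset.Icc ⌈y⌉ ⌊y + ℓ⌋, (1 - (if ∃ i, a i = j then (1 : ℝ) else 0)) := by
    refine Finset.sum_congr rfl fun j hj => ?_
    rw [Finset.mem_Icc, Int.ceil_le, Int.le_floor] at hj
    have : j ≤ -(T : ℤ) ∨ 0 ≤ j := by
      rcases h with h | h
      · right
        have : ((0 : ℤ) : ℝ) ≤ j := by push_cast; linarith [hj.1]
        exact_mod_cast this
      · left
        have : (j : ℝ) ≤ (-(T : ℤ) : ℝ) := by push_cast; linarith [hj.2]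
        exact_mod_cast this
    rw [wt, if_pos this, neg_sub]
  rw [e, Finset.sum_sub_distrib, sum_particles_window ha, Finset.sum_const, nsmul_eq_mul, mul_one,
    Int.card_Icc]
  have h1 : ((⌊y + ℓ⌋ + 1 - ⌈y⌉ : ℤ) : ℝ) ≤ ((⌊y + ℓ⌋ + 1 - ⌈y⌉).toNat : ℝ) := by
    exact_mod_cast Int.self_le_toNat _
  push_cast at h1
  have h2 := Int.lt_floor_add_one (y + ℓ)
  have h3 := Int.ceil_lt_add_one y
  linarith

lemma sum_inv_eq_zero (F : Finset ℤ) (hF : ∀ j ∈ F, -j ∈ F) : ∑ j ∈ F, 1 / (j : ℝ) = 0 := by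
  have h : ∑ j ∈ F, 1 / (j : ℝ) = ∑ j ∈ F, -(1 / (j : ℝ)) := by
    refine Finset.sum_nbij' (fun j => -j) (fun j => -j) hF hF (by simp) (by simp) fun j _ => ?_
    push_cast
    rw [div_neg, neg_neg]
  rw [Finset.sum_neg_distrib] at h
  linarith

/-- The contribution of the points at distance at least `2 K T` to the field is bounded. -/
lemma norm_far_le (ha : StrictMono a) {T : ℕ} {A : ℝ → ℝ → ℝ} {N₁ : ℝ → ℝ → ℕ}
    (hI : IntermediateScales a T A N₁) (hT : 0 < T) (hN : 0 < N) {K : ℕ} (hK : 0 < K)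
    (hN₁ : N₁ (2 * K) 1 ≤ N) {v : ℂ} (hv : v.im ≠ 0) (hvK : ‖v‖ ≤ K * T) :
    ‖pvField a T v - ∑ j ∈ Finset.Ioo (-(2 * K * T : ℤ)) (2 * K * T), (wt a T j : ℂ) / (v - j)‖ ≤
      |A (2 * K) 1| + 5 := by
  classical
  have hT' : (1 : ℝ) ≤ T := by exact_mod_cast hT
  have hK' : (1 : ℝ) ≤ K := by exact_mod_cast hK
  have hN' : (0 : ℝ) < N := by exact_mod_cast hN
  have hKT : (1 : ℝ) ≤ K * T := by nlinarith
  set s := Finset.Ioo (-(2 * K * T : ℤ)) (2 * K * T) with hs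
  obtain ⟨M₀, hM₀⟩ := exists_bound_config a
  have ht := (((isCauchyTransform_pvField ha T).tendsto v hv).sub_const
    (∑ j ∈ s, (wt a T j : ℂ) / (v - j))).norm
  refine le_of_tendsto ht ?_
  filter_upwards [eventually_ge_atTop (2 * K * T), eventually_ge_atTop M₀] with M hM hMM
  have hM' : (2 * K * T : ℤ) ≤ M := by exact_mod_cast hM
  have hsub : s ⊆ Finset.Ioo (-(M : ℤ)) M := Finset.Ioo_subset_Ioo (by omega) hM'
  set F := Finset.Ioo (-(M : ℤ)) M \ s with hF
  have hFmem : ∀ j : ℤ, j ∈ F ↔ |j| < M ∧ 2 * K * T ≤ |j| := fun j => by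
    rw [hF, hs, Finset.mem_sdiff, Finset.mem_Ioo, Finset.mem_Ioo, ← abs_lt, ← abs_lt, not_lt]
  have hFabs : ∀ j ∈ F, (2 * K * T : ℝ) ≤ |(j : ℝ)| := fun j hj => by
    exact_mod_cast ((hFmem j).1 hj).2
  rw [cauchySum, ← Finset.sum_sdiff hsub, add_sub_cancel_right]
  -- Expansion `1 / (v - j) = -1 / j + v / (j (v - j))`. The second part converges absolutely and is
  -- bounded for `‖v‖ ≤ K T`; only the first requires the assumption on intermediate scales.
  have e : ∑ j ∈ F, (wt a T j : ℂ) / (v - j) = ((-∑ j ∈ F, wt a T j / j : ℝ) : ℂ) +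
      ∑ j ∈ F, (wt a T j : ℂ) * v / (j * (v - j)) := by
    push_cast
    rw [← Finset.sum_neg_distrib, ← Finset.sum_add_distrib]
    refine Finset.sum_congr rfl fun j hj => ?_
    have h1 := sub_int_ne_zero hv j
    have h2 : (j : ℂ) ≠ 0 := by
      have := hFabs j hj
      intro h0
      have h0' : (j : ℝ) = 0 := by exact_mod_cast h0
      rw [h0', abs_zero] at this
      nlinarith
    field_simp
    ring
  rw [e]
  refine (norm_add_le _ _).trans ?_
  have hsecond : ‖∑ j ∈ F, (wt a T j : ℂ) * v / (j * (v - j))‖ ≤ 4 := by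
    refine (norm_sum_le _ _).trans ?_
    have hterm : ∀ j ∈ F, ‖(wt a T j : ℂ) * v / (j * (v - j))‖ ≤ 2 * (K * T) * (1 / (0 - (j : ℝ)) ^ 2) :=
      fun j hj => by
        have h1 := hFabs j hj
        have h2 : |(j : ℝ)| / 2 ≤ ‖v - j‖ := by
          have := norm_sub_norm_le (j : ℂ) v
          rw [norm_intCast, norm_sub_rev] at this
          linarith
        have h3 : 0 < |(j : ℝ)| := by nlinarith
        rw [norm_div, norm_mul, norm_mul, norm_real, norm_intCast, Real.norm_eq_abs]
        calc |wt a T j| * ‖v‖ / (|(j : ℝ)| * ‖v - j‖) ≤ 1 * (K * T) / (|(j : ℝ)| * (|(j : ℝ)| / 2)) := by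
              gcongr
              exact abs_wt_le a T j
          _ = 2 * (K * T) * (1 / (0 - (j : ℝ)) ^ 2) := by
              rw [zero_sub, neg_sq, ← sq_abs (j : ℝ)]
              field_simp
    refine (Finset.sum_le_sum hterm).trans ?_
    rw [← Finset.mul_sum]
    have := sum_inv_sq_le (s := F) (ξ := 0) (r := 2 * (K * T)) (by linarith) fun j hj => by
      rw [zero_sub, abs_neg]
      have := hFabs j hj
      linarith
    calc _ ≤ 2 * (K * T : ℝ) * (4 / (2 * (K * T))) := by gcongr
      _ = 4 := by field_simp
  have hfirst : ‖((-∑ j ∈ F, wt a T j / j : ℝ) : ℂ)‖ ≤ |A (2 * K) 1| + 1 := by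
    rw [norm_real, Real.norm_eq_abs, abs_neg]
    -- On `F` the weight is the particle indicator minus `1`, and `F` is symmetric, so the constant
    -- part cancels. The particles within distance `N` are handled by the assumption with `R = 2 K`,
    -- `δ = 1`; the others, at most `N` of them, contribute at most `1`.
    have e1 : ∑ j ∈ F, wt a T j / j = ∑ j ∈ F, (if ∃ i, a i = j then 1 / (j : ℝ) else 0) := by
      have h0 := sum_inv_eq_zero F fun j hj => by rw [hFmem, abs_neg, ← hFmem]; exact hj
      have e2 : ∑ j ∈ F, wt a T j / j = ∑ j ∈ F, (if ∃ i, a i = j then 1 / (j : ℝ) else 0) -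
          ∑ j ∈ F, 1 / (j : ℝ) := by
        rw [← Finset.sum_sub_distrib]
        refine Finset.sum_congr rfl fun j hj => ?_
        have h1 := ((hFmem j).1 hj).2
        have h3 : (T : ℤ) ≤ 2 * K * T := by nlinarith
        have h2 : j ≤ -(T : ℤ) ∨ 0 ≤ j := by
          rcases abs_cases j with h | h <;> omega
        rw [wt, if_pos h2]
        split_ifs <;> ring
      rw [e2, h0, sub_zero]
    rw [e1, sum_particles_filter ha F (fun j => 1 / (j : ℝ)),
      ← Finset.sum_filter_add_sum_filter_not _ (fun i => |(a i : ℝ)| ≤ 1 * N)]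
    refine (abs_add_le _ _).trans (add_le_add ?_ ?_)
    · refine le_trans (le_of_eq ?_) ((hI (2 * K) 1 (by positivity) one_pos hN₁).trans (le_abs_self _))
      congr 2
      ext i
      have hi : |a i| < M := (hM₀ i).trans_le (by exact_mod_cast hMM)
      simp only [Finset.mem_filter, Finset.mem_univ, true_and, hFmem, hi]
      have : (2 * K * T : ℝ) ≤ |(a i : ℝ)| ↔ 2 * K * T ≤ |a i| := by norm_cast
      rw [this]
    · refine (Finset.abs_sum_le_sum_abs _ _).trans ?_
      refine (Finset.sum_le_card_nsmul _ _ (1 / (N : ℝ)) fun i hi => ?_).trans ?_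
      · rw [Finset.mem_filter, not_le, one_mul] at hi
        rw [abs_div, abs_one]
        gcongr
        exact hi.2.le
      · rw [nsmul_eq_mul]
        have : ((Finset.univ.filter fun i => a i ∈ F).filter
            fun i => ¬|(a i : ℝ)| ≤ 1 * N).card ≤ N := by
          refine (Finset.card_le_univ _).trans (by simp)
        have h2 : ((((Finset.univ.filter fun i => a i ∈ F).filter
            fun i => ¬|(a i : ℝ)| ≤ 1 * N).card : ℕ) : ℝ) ≤ N := by exact_mod_cast this
        calc _ ≤ (N : ℝ) * (1 / N) := by gcongr
          _ = 1 := by field_simp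
  linarith

end sums

/-- The weights of an admissible configuration are regular. -/
lemma regularWeights_wt {N : ℕ} {a : Fin N → ℤ} (ha : StrictMono a) {D Q ρ₁ ρ₂ : ℝ} (hD : 0 < D)
    (hρ₁ : 0 < ρ₁) (hρ₂ : 0 ≤ ρ₂) (hρ₂' : ρ₂ < 1) (hL : LocalDensity a D Q ρ₁ ρ₂) {T : ℕ}
    {A : ℝ → ℝ → ℝ}
    {N₁ : ℝ → ℝ → ℕ} (hI : IntermediateScales a T A N₁) (hT : 0 < T) (hN : 0 < N) {K : ℕ} (hK : 0 < K)
    (hN₁ : N₁ (2 * K) 1 ≤ N) (hQ : 2 * K * T + D ≤ Q) :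
    RegularWeights (wt a T) (pvField a T) T (min (ρ₁ / 4) ((1 - ρ₂) / 2)) (4 * (1 + D) / (1 - ρ₂))
      (|A (2 * K) 1| + 5) K where
  toIsCauchyTransform := isCauchyTransform_pvField ha T
  nonneg _ := wt_nonneg a T
  nonpos _ := wt_nonpos a T
  far v hv hvK := norm_far_le ha hI hT hN hK hN₁ hv hvK
  window_mem y ℓ hℓ h1 h2 := by
    have hT' : (1 : ℝ) ≤ T := by exact_mod_cast hT
    have hK' : (1 : ℝ) ≤ K := by exact_mod_cast hK
    rw [div_le_iff₀ (by linarith)] at hℓ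
    have hℓ0 : 0 < ℓ := by nlinarith
    have hℓD : D ≤ ℓ := by nlinarith
    rw [sum_wt_window_mem ha T h1 h2]
    refine le_trans ?_ (mul_le_windowCount hL hD hρ₁.le hℓD (by nlinarith) (by nlinarith))
    gcongr
    exact min_le_left _ _
  window_not_mem y ℓ hℓ h := by
    have hT' : (1 : ℝ) ≤ T := by exact_mod_cast hT
    have hK' : (1 : ℝ) ≤ K := by exact_mod_cast hK
    rw [div_le_iff₀ (by linarith)] at hℓ
    have hℓ0 : 0 < ℓ := by nlinarith
    refine le_trans ?_ (sum_wt_window_not_mem ha T (h.imp (fun h => h.1) (fun h => h.2)))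
    -- The lower bound `(1 - ρ₂) ℓ - 1 - ρ₂ D` is at least half of `(1 - ρ₂) ℓ` once `ℓ ≥ 4 (1 + D)
    -- / (1 - ρ₂)`, which explains the window length in the statement.
    have h1 : (windowCount a y ℓ : ℝ) ≤ ρ₂ * (ℓ + D) := by
      have hKT : 0 ≤ (K * T : ℝ) := by positivity
      refine windowCount_le hL hD hρ₂ hℓ0.le ?_ ?_
      · rcases h with h | h <;> nlinarith [h.1]
      · rcases h with h | h <;> nlinarith [h.2]
    have h2 : min (ρ₁ / 4) ((1 - ρ₂) / 2) * ℓ ≤ (1 - ρ₂) / 2 * ℓ := by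
      gcongr
      exact min_le_right _ _
    nlinarith

end

noncomputable section

/-! ### Integrals along curves -/

/-- A curve parametrized by `[0, 1]`, with bounded velocity inside. -/
structure Curve where
  path : ℝ → ℂ
  vel : ℝ → ℂ
  cont : ContinuousOn path (Set.Icc 0 1)
  hasDerivAt : ∀ τ ∈ Set.Ioo (0 : ℝ) 1, HasDerivAt path (vel τ) τ
  vel_cont : ContinuousOn vel (Set.Ioo 0 1)
  vel_bound : ∃ C, ∀ τ ∈ Set.Ioo (0 : ℝ) 1, ‖vel τ‖ ≤ C

namespace Curve

/-- The integral of `φ` along a curve. -/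
def integral (γ : Curve) (φ : ℂ → ℂ) : ℂ := ∫ τ in (0 : ℝ)..1, φ (γ.path τ) * γ.vel τ

/-- The complex conjugate curve. -/
def conj (γ : Curve) : Curve where
  path τ := (starRingEnd ℂ) (γ.path τ)
  vel τ := (starRingEnd ℂ) (γ.vel τ)
  cont := continuous_conj.comp_continuousOn γ.cont
  hasDerivAt τ hτ := (conjCLE.hasFDerivAt (x := γ.path τ)).comp_hasDerivAt τ (γ.hasDerivAt τ hτ)
  vel_cont := continuous_conj.comp_continuousOn γ.vel_cont
  vel_bound := by
    obtain ⟨C, hC⟩ := γ.vel_bound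
    exact ⟨C, fun τ hτ => by simpa using hC τ hτ⟩

lemma conj_path (γ : Curve) (τ : ℝ) : γ.conj.path τ = (starRingEnd ℂ) (γ.path τ) := rfl

lemma conj_vel (γ : Curve) (τ : ℝ) : γ.conj.vel τ = (starRingEnd ℂ) (γ.vel τ) := rfl

lemma integral_conj (γ : Curve) (φ : ℂ → ℂ) :
    γ.conj.integral φ = (starRingEnd ℂ) (γ.integral fun z => (starRingEnd ℂ) (φ ((starRingEnd ℂ) z))) := by
  rw [integral, integral, intervalIntegral.integral_of_le zero_le_one,
    intervalIntegral.integral_of_le zero_le_one, ← _root_.integral_conj]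
  refine MeasureTheory.integral_congr_ae (Eventually.of_forall fun τ => ?_)
  simp [conj_path, conj_vel]

lemma intervalIntegrable (γ : Curve) {φ : ℂ → ℂ}
    (h1 : ContinuousOn (fun τ => φ (γ.path τ)) (Set.Ioo 0 1)) {B : ℝ}
    (h2 : ∀ τ ∈ Set.Ioo (0 : ℝ) 1, ‖φ (γ.path τ)‖ ≤ B) :
    IntervalIntegrable (fun τ => φ (γ.path τ) * γ.vel τ) MeasureTheory.volume 0 1 := by
  obtain ⟨C, hC⟩ := γ.vel_bound
  rw [intervalIntegrable_iff_integrableOn_Ioo_of_le zero_le_one]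
  refine MeasureTheory.IntegrableOn.of_bound (C := B * C) (by simp)
    ((h1.mul γ.vel_cont).aestronglyMeasurable measurableSet_Ioo) ?_
  filter_upwards [MeasureTheory.ae_restrict_mem measurableSet_Ioo] with τ hτ
  rw [norm_mul]
  exact mul_le_mul (h2 τ hτ) (hC τ hτ) (norm_nonneg _) ((norm_nonneg _).trans (h2 τ hτ))

lemma intervalIntegrable_of_continuousOn (γ : Curve) {φ : ℂ → ℂ}
    (h : ContinuousOn φ (γ.path '' Set.Icc 0 1)) :
    IntervalIntegrable (fun τ => φ (γ.path τ) * γ.vel τ) MeasureTheory.volume 0 1 := by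
  have h1 : ContinuousOn (fun τ => φ (γ.path τ)) (Set.Icc 0 1) :=
    h.comp γ.cont (Set.mapsTo_image _ _)
  obtain ⟨B, hB⟩ := isCompact_Icc.exists_bound_of_continuousOn h1
  exact γ.intervalIntegrable (h1.mono Set.Ioo_subset_Icc_self)
    fun τ hτ => hB τ (Set.Ioo_subset_Icc_self hτ)

lemma integral_eq_sub (γ : Curve) {φ G : ℂ → ℂ}
    (h1 : ContinuousOn (fun τ => G (γ.path τ)) (Set.Icc 0 1))
    (h2 : ∀ τ ∈ Set.Ioo (0 : ℝ) 1, HasDerivAt G (φ (γ.path τ)) (γ.path τ))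
    (h3 : IntervalIntegrable (fun τ => φ (γ.path τ) * γ.vel τ) MeasureTheory.volume 0 1) :
    γ.integral φ = G (γ.path 1) - G (γ.path 0) :=
  intervalIntegral.integral_eq_sub_of_hasDerivAt_of_le zero_le_one h1
    (fun τ hτ => (h2 τ hτ).comp τ (γ.hasDerivAt τ hτ)) h3

lemma integral_congr (γ : Curve) {φ ψ : ℂ → ℂ}
    (h : ∀ τ ∈ Set.Ioo (0 : ℝ) 1, φ (γ.path τ) = ψ (γ.path τ)) : γ.integral φ = γ.integral ψ := by
  rw [integral, integral, intervalIntegral.integral_of_le zero_le_one,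
    intervalIntegral.integral_of_le zero_le_one, MeasureTheory.integral_Ioc_eq_integral_Ioo,
    MeasureTheory.integral_Ioc_eq_integral_Ioo]
  exact MeasureTheory.setIntegral_congr_fun measurableSet_Ioo fun τ hτ => by
    simp only [h τ hτ]

end Curve

/-! ### A loop through `zc` and its conjugate -/

/-- Two curves from `zc` to real points; together with their conjugates they form a loop. -/
structure Loop (zc : ℂ) where
  l : Curve
  r : Curve
  start_l : l.path 0 = zc
  start_r : r.path 0 = zc
  im_l : ∀ τ ∈ Set.Ico (0 : ℝ) 1, 0 < (l.path τ).im
  im_r : ∀ τ ∈ Set.Ico (0 : ℝ) 1, 0 < (r.path τ).im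
  end_l : (l.path 1).im = 0
  end_r : (r.path 1).im = 0
  norm_l : ∀ τ ∈ Set.Icc (0 : ℝ) 1, ‖zc‖ ≤ ‖l.path τ‖
  norm_r : ∀ τ ∈ Set.Icc (0 : ℝ) 1, ‖r.path τ‖ ≤ ‖zc‖
  norm_add_one_l : ∀ τ ∈ Set.Icc (0 : ℝ) 1, ‖l.path τ + 1‖ ≤ ‖zc + 1‖
  norm_add_one_r : ∀ τ ∈ Set.Icc (0 : ℝ) 1, ‖zc + 1‖ ≤ ‖r.path τ + 1‖

namespace Loop

variable {zc : ℂ} (W : Loop zc)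

/-- The counterclockwise integral over the loop. -/
def integral (φ : ℂ → ℂ) : ℂ :=
  W.l.integral φ - W.r.integral φ - W.l.conj.integral φ + W.r.conj.integral φ

lemma conj_end_l : W.l.conj.path 1 = W.l.path 1 := by
  rw [Curve.conj_path]; exact conj_eq_iff_im.2 W.end_l

lemma conj_end_r : W.r.conj.path 1 = W.r.path 1 := by
  rw [Curve.conj_path]; exact conj_eq_iff_im.2 W.end_r

/-- A curve of the loop. -/
def IsSide (γ : Curve) : Prop := γ = W.l ∨ γ = W.r ∨ γ = W.l.conj ∨ γ = W.r.conj

/-- An entire function has a primitive, and the four sides close up because their far ends are real.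
-/
lemma integral_eq_zero_of_differentiable {φ : ℂ → ℂ} (hφ : Differentiable ℂ φ) :
    W.integral φ = 0 := by
  obtain ⟨G, hG⟩ := hφ.isExactOn_univ
  have h : ∀ γ : Curve, γ.integral φ = G (γ.path 1) - G (γ.path 0) := fun γ =>
    γ.integral_eq_sub
      ((continuous_iff_continuousAt.2 fun z => (hG z trivial).continuousAt).comp_continuousOn γ.cont)
      (fun τ _ => hG _ trivial) (γ.intervalIntegrable_of_continuousOn hφ.continuous.continuousOn)
  rw [integral, h, h, h, h, conj_end_l, conj_end_r, Curve.conj_path, Curve.conj_path, W.start_l,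
    W.start_r]
  ring

lemma integral_congr {φ ψ : ℂ → ℂ}
    (h : ∀ γ, W.IsSide γ → ∀ τ ∈ Set.Ioo (0 : ℝ) 1, φ (γ.path τ) = ψ (γ.path τ)) :
    W.integral φ = W.integral ψ := by
  rw [integral, integral, W.l.integral_congr (h _ (Or.inl rfl)),
    W.r.integral_congr (h _ (Or.inr (Or.inl rfl))),
    W.l.conj.integral_congr (h _ (Or.inr (Or.inr (Or.inl rfl)))),
    W.r.conj.integral_congr (h _ (Or.inr (Or.inr (Or.inr rfl))))]

/-- Integrability along the loop. -/
def Integrable (φ : ℂ → ℂ) : Prop :=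
  ∀ γ, W.IsSide γ → IntervalIntegrable (fun τ => φ (γ.path τ) * γ.vel τ) MeasureTheory.volume 0 1

variable {W}

lemma integrable_of_continuousOn {φ : ℂ → ℂ}
    (h : ∀ γ, W.IsSide γ → ContinuousOn φ (γ.path '' Set.Icc 0 1)) : W.Integrable φ :=
  fun γ hγ => γ.intervalIntegrable_of_continuousOn (h γ hγ)

lemma Integrable.congr {φ ψ : ℂ → ℂ} (hφ : W.Integrable φ)
    (h : ∀ γ, W.IsSide γ → ∀ τ ∈ Set.Ioo (0 : ℝ) 1, φ (γ.path τ) = ψ (γ.path τ)) :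
    W.Integrable ψ := fun γ hγ => by
  have h1 := hφ γ hγ
  rw [intervalIntegrable_iff_integrableOn_Ioo_of_le zero_le_one] at h1 ⊢
  exact h1.congr_fun (fun τ hτ => by simp only [h γ hγ τ hτ]) measurableSet_Ioo

lemma Integrable.add {φ ψ : ℂ → ℂ} (hφ : W.Integrable φ) (hψ : W.Integrable ψ) :
    W.Integrable fun w => φ w + ψ w := fun γ hγ => by
  simpa only [add_mul] using (hφ γ hγ).add (hψ γ hγ)

lemma Integrable.const_mul {φ : ℂ → ℂ} (hφ : W.Integrable φ) (c : ℂ) :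
    W.Integrable fun w => c * φ w := fun γ hγ => by
  simpa only [mul_assoc] using (hφ γ hγ).const_mul c

lemma Integrable.sum {ι : Type*} {s : Finset ι} {φ : ι → ℂ → ℂ}
    (h : ∀ i ∈ s, W.Integrable (φ i)) : W.Integrable fun w => ∑ i ∈ s, φ i w := fun γ hγ => by
  simp only [Finset.sum_mul]
  have := IntervalIntegrable.sum s fun i hi => h i hi γ hγ
  have e : (fun τ => ∑ i ∈ s, φ i (γ.path τ) * γ.vel τ) =
      ∑ i ∈ s, fun τ => φ i (γ.path τ) * γ.vel τ := by
    ext τ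
    simp
  rw [e]
  exact this

lemma integral_add {φ ψ : ℂ → ℂ} (hφ : W.Integrable φ) (hψ : W.Integrable ψ) :
    W.integral (fun w => φ w + ψ w) = W.integral φ + W.integral ψ := by
  have h : ∀ γ, W.IsSide γ → γ.integral (fun w => φ w + ψ w) = γ.integral φ + γ.integral ψ :=
    fun γ hγ => by
      simp only [Curve.integral, add_mul]
      exact intervalIntegral.integral_add (hφ γ hγ) (hψ γ hγ)
  rw [integral, h _ (Or.inl rfl), h _ (Or.inr (Or.inl rfl)), h _ (Or.inr (Or.inr (Or.inl rfl))),
    h _ (Or.inr (Or.inr (Or.inr rfl))), integral, integral]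
  ring

lemma integral_const_mul (φ : ℂ → ℂ) (c : ℂ) :
    W.integral (fun w => c * φ w) = c * W.integral φ := by
  have h : ∀ γ : Curve, γ.integral (fun w => c * φ w) = c * γ.integral φ := fun γ => by
    simp only [Curve.integral, mul_assoc]
    exact intervalIntegral.integral_const_mul _ _
  rw [integral, h, h, h, h, integral]
  ring

lemma integral_sub {φ ψ : ℂ → ℂ} (hφ : W.Integrable φ) (hψ : W.Integrable ψ) :
    W.integral (fun w => φ w - ψ w) = W.integral φ - W.integral ψ := by
  have h := integral_add hφ (hψ.const_mul (-1))
  rw [integral_const_mul] at h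
  rw [sub_eq_add_neg, ← neg_one_mul, ← h]
  congr 1
  ext w
  ring

lemma integral_sum {ι : Type*} {s : Finset ι} {φ : ι → ℂ → ℂ}
    (h : ∀ i ∈ s, W.Integrable (φ i)) :
    W.integral (fun w => ∑ i ∈ s, φ i w) = ∑ i ∈ s, W.integral (φ i) := by
  classical
  induction s using Finset.induction_on with
  | empty =>
    simp only [Finset.sum_empty]
    exact W.integral_eq_zero_of_differentiable (differentiable_const _)
  | insert i s hi ih =>
    simp only [Finset.sum_insert hi]
    rw [integral_add (h i (Finset.mem_insert_self i s))
      (Integrable.sum fun j hj => h j (Finset.mem_insert_of_mem hj)),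
      ih fun j hj => h j (Finset.mem_insert_of_mem hj)]

lemma integrable_inv_sub {p : ℂ} (h : ∀ γ, W.IsSide γ → ∀ τ ∈ Set.Icc (0 : ℝ) 1, γ.path τ ≠ p) :
    W.Integrable fun w => 1 / (w - p) := by
  refine integrable_of_continuousOn fun γ hγ => ?_
  refine continuousOn_const.div (continuousOn_id.sub continuousOn_const) ?_
  rintro w ⟨τ, hτ, rfl⟩
  exact sub_ne_zero.2 (h γ hγ τ hτ)

/-- Cauchy's formula on the loop for entire functions, in terms of the index. -/
lemma integral_div_sub {E : ℂ → ℂ} (hE : Differentiable ℂ E) {p : ℂ}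
    (h : ∀ γ, W.IsSide γ → ∀ τ ∈ Set.Icc (0 : ℝ) 1, γ.path τ ≠ p) :
    W.Integrable (fun w => E w / (w - p)) ∧
      W.integral (fun w => E w / (w - p)) = E p * W.integral fun w => 1 / (w - p) := by
  have hd : Differentiable ℂ (dslope E p) := (differentiableOn_univ.1
    ((differentiableOn_dslope (Filter.univ_mem)).2 hE.differentiableOn))
  have hdi : W.Integrable (dslope E p) := integrable_of_continuousOn
    fun γ _ => hd.continuous.continuousOn
  have h2 : W.Integrable (fun w => E p * (1 / (w - p))) := (integrable_inv_sub h).const_mul _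
  have e : ∀ γ, W.IsSide γ → ∀ τ ∈ Set.Ioo (0 : ℝ) 1,
      dslope E p (γ.path τ) + E p * (1 / (γ.path τ - p)) = E (γ.path τ) / (γ.path τ - p) :=
    fun γ hγ τ hτ => by
      have hne := h γ hγ τ (Set.Ioo_subset_Icc_self hτ)
      rw [dslope_of_ne _ hne, slope_def_field]
      have := sub_ne_zero.2 hne
      field_simp
      ring
  refine ⟨(hdi.add h2).congr e, ?_⟩
  rw [← W.integral_congr (φ := fun w => dslope E p w + E p * (1 / (w - p))) e,
    integral_add hdi h2, W.integral_eq_zero_of_differentiable hd, zero_add,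
    integral_const_mul]

/-- A zero of `E` removes the singularity. The pole is excluded only from the open sides, so the
loop may cross the real axis exactly at a particle where `E` vanishes. -/
lemma integral_div_sub_of_eq_zero {E : ℂ → ℂ} (hE : Differentiable ℂ E) {p : ℂ} (hp : E p = 0)
    (h : ∀ γ, W.IsSide γ → ∀ τ ∈ Set.Ioo (0 : ℝ) 1, γ.path τ ≠ p) :
    W.Integrable (fun w => E w / (w - p)) ∧ W.integral (fun w => E w / (w - p)) = 0 := by
  have hd : Differentiable ℂ (dslope E p) := (differentiableOn_univ.1
    ((differentiableOn_dslope (Filter.univ_mem)).2 hE.differentiableOn))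
  have hdi : W.Integrable (dslope E p) := integrable_of_continuousOn
    fun γ _ => hd.continuous.continuousOn
  have e : ∀ γ, W.IsSide γ → ∀ τ ∈ Set.Ioo (0 : ℝ) 1,
      dslope E p (γ.path τ) = E (γ.path τ) / (γ.path τ - p) :=
    fun γ hγ τ hτ => by
      rw [dslope_of_ne _ (h γ hγ τ hτ), slope_def_field, hp, sub_zero]
  exact ⟨hdi.congr e, by rw [← W.integral_congr e, W.integral_eq_zero_of_differentiable hd]⟩

end Loop

end

/-! ### The index of the loop -/

noncomputable section

/-- On the negative axis the principal logarithm is still continuous from above, so it is a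
primitive up to the real endpoint of a side. -/
lemma continuousWithinAt_log_upper {w : ℂ} (hw0 : w ≠ 0) :
    ContinuousWithinAt Complex.log {z : ℂ | 0 ≤ z.im} w := by
  by_cases h : w ∈ slitPlane
  · exact (continuousAt_clog h).continuousWithinAt
  · rw [mem_slitPlane_iff, not_or, not_lt, not_not] at h
    refine continuousWithinAt_log_of_re_neg_of_im_zero (lt_of_le_of_ne h.1 fun h0 => ?_) h.2
    exact hw0 (Complex.ext h0 h.2)

lemma slitPlane_one_sub_div {z w : ℂ} (h : ‖z‖ < ‖w‖) : 0 < (1 - z / w).re := by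
  have h1 : ‖z / w‖ < 1 := by
    rw [norm_div, div_lt_one ((norm_nonneg z).trans_lt h)]; exact h
  have := (re_le_norm (z / w)).trans_lt h1
  rw [sub_re, one_re]
  linarith

namespace Curve

/-- Integral of `1 / (w - p)` along a curve in the closed upper half plane avoiding `p`. -/
lemma integral_inv_sub_real (γ : Curve) {p : ℝ} (h1 : ∀ τ ∈ Set.Ico (0 : ℝ) 1, 0 < (γ.path τ).im)
    (h2 : 0 ≤ (γ.path 1).im) (h3 : γ.path 1 ≠ p) :
    γ.integral (fun w => 1 / (w - p)) = Complex.log (γ.path 1 - p) - Complex.log (γ.path 0 - p) := by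
  have him : ∀ τ ∈ Set.Icc (0 : ℝ) 1, 0 ≤ (γ.path τ - p).im ∧ γ.path τ - p ≠ 0 := fun τ hτ => by
    rcases hτ.2.lt_or_eq with h | h
    · have := h1 τ ⟨hτ.1, h⟩
      refine ⟨by simpa using this.le, fun h0 => ?_⟩
      have h0' := congrArg Complex.im h0
      simp at h0'
      linarith
    · rw [h]
      exact ⟨by simpa using h2, sub_ne_zero.2 h3⟩
  refine γ.integral_eq_sub (G := fun w => Complex.log (w - p)) ?_ ?_ ?_
  · intro τ hτ
    exact ContinuousWithinAt.comp (g := Complex.log) (f := fun τ => γ.path τ - p)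
      (continuousWithinAt_log_upper (him τ hτ).2)
      ((γ.cont τ hτ).sub continuousWithinAt_const) fun τ' hτ' => (him τ' hτ').1
  · intro τ hτ
    have hs : γ.path τ - p ∈ slitPlane := by
      rw [mem_slitPlane_iff]
      right
      have := h1 τ ⟨hτ.1.le, hτ.2⟩
      simpa using this.ne'
    exact ((hasDerivAt_id _).sub_const _).clog hs
  · refine γ.intervalIntegrable_of_continuousOn (φ := fun w => 1 / (w - (p : ℂ))) ?_
    refine continuousOn_const.div (continuousOn_id.sub continuousOn_const) ?_
    rintro w ⟨τ, hτ, rfl⟩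
    exact (him τ hτ).2

lemma continuousOn_log_comp (γ : Curve) {f : ℂ → ℂ}
    (hf : ∀ τ ∈ Set.Icc (0 : ℝ) 1, ContinuousAt f (γ.path τ) ∧ 0 < (f (γ.path τ)).re) :
    ContinuousOn (fun τ => Complex.log (f (γ.path τ))) (Set.Icc 0 1) := fun τ hτ =>
  (ContinuousAt.clog (hf τ hτ).1 (mem_slitPlane_iff.2 (Or.inl (hf τ hτ).2))).comp_continuousWithinAt
    (γ.cont τ hτ)

lemma intervalIntegrable_inv_sub (γ : Curve) {z : ℂ}
    (h : ∀ τ ∈ Set.Icc (0 : ℝ) 1, γ.path τ ≠ z) :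
    IntervalIntegrable (fun τ => 1 / (γ.path τ - z) * γ.vel τ) MeasureTheory.volume 0 1 := by
  refine γ.intervalIntegrable_of_continuousOn (φ := fun w => 1 / (w - z)) ?_
  refine continuousOn_const.div (continuousOn_id.sub continuousOn_const) ?_
  rintro w ⟨τ, hτ, rfl⟩
  exact sub_ne_zero.2 (h τ hτ)

/-- A curve inside the disc around `-c` through `z` keeps `1 - (w + c) / (z + c)` in the right half
plane, where the principal logarithm is a primitive. -/
lemma integral_inv_sub_of_norm_lt (γ : Curve) {z c : ℂ}
    (h : ∀ τ ∈ Set.Icc (0 : ℝ) 1, ‖γ.path τ + c‖ < ‖z + c‖) :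
    γ.integral (fun w => 1 / (w - z)) = Complex.log (1 - (γ.path 1 + c) / (z + c)) -
      Complex.log (1 - (γ.path 0 + c) / (z + c)) := by
  have hne : ∀ τ ∈ Set.Icc (0 : ℝ) 1, γ.path τ ≠ z := fun τ hτ h0 => by
    have := h τ hτ
    rw [h0] at this
    exact lt_irrefl _ this
  have hz : z + c ≠ 0 := fun h0 => by
    have := h 0 ⟨le_rfl, zero_le_one⟩
    rw [h0, norm_zero] at this
    exact (norm_nonneg _).not_gt this
  refine γ.integral_eq_sub (G := fun w => Complex.log (1 - (w + c) / (z + c)))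
    (γ.continuousOn_log_comp (f := fun w => 1 - (w + c) / (z + c)) fun τ hτ => ⟨by fun_prop,
      slitPlane_one_sub_div (h τ hτ)⟩) (fun τ hτ => ?_) (γ.intervalIntegrable_inv_sub hne)
  have hτ' := Set.Ioo_subset_Icc_self hτ
  have hpos := slitPlane_one_sub_div (h τ hτ')
  have hd : HasDerivAt (fun w : ℂ => 1 - (w + c) / (z + c)) (-(1 / (z + c))) (γ.path τ) :=
    (((hasDerivAt_id _).add_const c).div_const _).const_sub 1
  have := hd.clog (mem_slitPlane_iff.2 (Or.inl hpos))
  convert this using 1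
  have h1 := sub_ne_zero.2 (hne τ hτ')
  have h2 : 1 - (γ.path τ + c) / (z + c) = -(γ.path τ - z) / (z + c) := by
    field_simp
    ring
  rw [h2]
  field_simp

/-- For curves outside the disc, `log (1 - (z + c) / (w + c))` has derivative `1 / (w - z) - 1 / (w
+ c)`. The spurious second term cancels in the difference of two poles. -/
lemma integral_inv_sub_sub_of_lt_norm (γ : Curve) {z x c : ℂ}
    (hz : ∀ τ ∈ Set.Icc (0 : ℝ) 1, ‖z + c‖ < ‖γ.path τ + c‖)
    (hx : ∀ τ ∈ Set.Icc (0 : ℝ) 1, ‖x + c‖ < ‖γ.path τ + c‖) :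
    γ.integral (fun w => 1 / (w - z)) - γ.integral (fun w => 1 / (w - x)) =
      (Complex.log (1 - (z + c) / (γ.path 1 + c)) - Complex.log (1 - (x + c) / (γ.path 1 + c))) -
      (Complex.log (1 - (z + c) / (γ.path 0 + c)) - Complex.log (1 - (x + c) / (γ.path 0 + c))) := by
  have hne : ∀ u : ℂ, (∀ τ ∈ Set.Icc (0 : ℝ) 1, ‖u + c‖ < ‖γ.path τ + c‖) →
      ∀ τ ∈ Set.Icc (0 : ℝ) 1, γ.path τ ≠ u := fun u hu τ hτ h0 => by
    have := hu τ hτ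
    rw [h0] at this
    exact lt_irrefl _ this
  have hw : ∀ τ ∈ Set.Icc (0 : ℝ) 1, γ.path τ + c ≠ 0 := fun τ hτ h0 => by
    have := hz τ hτ
    rw [h0, norm_zero] at this
    exact (norm_nonneg _).not_gt this
  have hiz := γ.intervalIntegrable_inv_sub (hne z hz)
  have hix := γ.intervalIntegrable_inv_sub (hne x hx)
  have e : γ.integral (fun w => 1 / (w - z)) - γ.integral (fun w => 1 / (w - x)) =
      γ.integral (fun w => 1 / (w - z) - 1 / (w - x)) := by
    simp only [integral, sub_mul]
    exact (intervalIntegral.integral_sub hiz hix).symm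
  rw [e]
  have hcont : ∀ u : ℂ, (∀ τ ∈ Set.Icc (0 : ℝ) 1, ‖u + c‖ < ‖γ.path τ + c‖) →
      ContinuousOn (fun τ => Complex.log (1 - (u + c) / (γ.path τ + c))) (Set.Icc 0 1) :=
    fun u hu => γ.continuousOn_log_comp (f := fun w => 1 - (u + c) / (w + c)) fun τ hτ =>
      ⟨continuousAt_const.sub (continuousAt_const.div (continuousAt_id.add continuousAt_const)
        (hw τ hτ)), slitPlane_one_sub_div (hu τ hτ)⟩
  have hder : ∀ u : ℂ, (∀ τ ∈ Set.Icc (0 : ℝ) 1, ‖u + c‖ < ‖γ.path τ + c‖) →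
      ∀ τ ∈ Set.Icc (0 : ℝ) 1, HasDerivAt (fun w => Complex.log (1 - (u + c) / (w + c)))
        (1 / (γ.path τ - u) - 1 / (γ.path τ + c)) (γ.path τ) := fun u hu τ hτ => by
    have hd : HasDerivAt (fun w : ℂ => 1 - (u + c) / (w + c))
        (-((0 * (γ.path τ + c) - (u + c) * 1) / (γ.path τ + c) ^ 2)) (γ.path τ) :=
      ((hasDerivAt_const _ _).div ((hasDerivAt_id _).add_const c) (hw τ hτ)).const_sub 1
    have := hd.clog (mem_slitPlane_iff.2 (Or.inl (slitPlane_one_sub_div (hu τ hτ))))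
    convert this using 1
    have h1 := sub_ne_zero.2 (hne u hu τ hτ)
    have h3 := hw τ hτ
    have h2 : 1 - (u + c) / (γ.path τ + c) = (γ.path τ - u) / (γ.path τ + c) := by
      field_simp
      ring
    rw [h2]
    field_simp
    ring
  refine γ.integral_eq_sub (G := fun w => Complex.log (1 - (z + c) / (w + c)) -
    Complex.log (1 - (x + c) / (w + c))) ((hcont z hz).sub (hcont x hx)) (fun τ hτ => ?_) ?_
  · have hτ' := Set.Ioo_subset_Icc_self hτ
    have := (hder z hz τ hτ').fun_sub (hder x hx τ hτ')
    rwa [sub_sub_sub_cancel_right] at this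
  · simp only [sub_mul]
    exact hiz.sub hix

end Curve

namespace Loop

variable {zc : ℂ} (W : Loop zc)

/-- The logarithm, continued through the upper half plane, has argument `π` at the left end and `0`
at the right end; the conjugate half doubles the difference. -/
lemma index_real {p : ℝ} (h1 : (W.l.path 1).re < p) (h2 : p < (W.r.path 1).re) :
    W.integral (fun w => 1 / (w - p)) = 2 * Real.pi * I := by
  have hl : W.l.path 1 = ((W.l.path 1).re : ℝ) := Complex.ext (by simp) (by simpa using W.end_l)
  have hr : W.r.path 1 = ((W.r.path 1).re : ℝ) := Complex.ext (by simp) (by simpa using W.end_r)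
  have el := W.l.integral_inv_sub_real (p := p) W.im_l W.end_l.ge fun h0 => by
    rw [h0, ofReal_re] at h1
    exact lt_irrefl _ h1
  have er := W.r.integral_inv_sub_real (p := p) W.im_r W.end_r.ge fun h0 => by
    rw [h0, ofReal_re] at h2
    exact lt_irrefl _ h2
  have hc : (fun z : ℂ => (starRingEnd ℂ) (1 / ((starRingEnd ℂ) z - p))) =
      fun z : ℂ => 1 / (z - (p : ℂ)) := by
    ext z
    simp
  rw [integral, Curve.integral_conj, Curve.integral_conj, hc, el, er, W.start_l, W.start_r, hl, hr,
    ← ofReal_sub, ← ofReal_sub]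
  have a1 : (Complex.log (((W.l.path 1).re - p : ℝ) : ℂ)).im = Real.pi := by
    rw [log_im, arg_ofReal_of_neg (by linarith)]
  have a2 : (Complex.log (((W.r.path 1).re - p : ℝ) : ℂ)).im = 0 := by
    rw [log_im, arg_ofReal_of_nonneg (by linarith)]
  rw [ofReal_sub] at a1 a2 ⊢
  rw [ofReal_sub]
  apply Complex.ext
  · simp
  · simp [a1, a2]
    ring

lemma norm_conj_add_one (z : ℂ) : ‖(starRingEnd ℂ) z + 1‖ = ‖z + 1‖ := by
  rw [← norm_conj (z + 1)]
  simp

/-- The index of the loop is constant on the lens `|z| < |zc|`, `|z + 1| < |zc + 1|`. -/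
lemma index_eq_of_norm_lt {z x : ℂ} (hz : ‖z‖ < ‖zc‖) (hz1 : ‖z + 1‖ < ‖zc + 1‖)
    (hx : ‖x‖ < ‖zc‖) (hx1 : ‖x + 1‖ < ‖zc + 1‖) :
    W.integral (fun w => 1 / (w - z)) = W.integral (fun w => 1 / (w - x)) := by
  -- The boundary terms at the real ends cancel between a side and its conjugate, leaving `H z - H
  -- x`. The derivative of `H` is zero and the lens is convex, so `H` is constant.
  set H : ℂ → ℂ := fun z => -Complex.log (1 - (z + 0) / (zc + 0)) + Complex.log (1 - (z + 1) / (zc + 1)) +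
    Complex.log (1 - (z + 0) / ((starRingEnd ℂ) zc + 0)) -
    Complex.log (1 - (z + 1) / ((starRingEnd ℂ) zc + 1)) with hH
  have el := W.l.integral_inv_sub_sub_of_lt_norm (z := z) (x := x) (c := 0)
    (fun τ hτ => by simpa using hz.trans_le (W.norm_l τ hτ))
    (fun τ hτ => by simpa using hx.trans_le (W.norm_l τ hτ))
  have er := W.r.integral_inv_sub_sub_of_lt_norm (z := z) (x := x) (c := 1)
    (fun τ hτ => hz1.trans_le (W.norm_add_one_r τ hτ))
    (fun τ hτ => hx1.trans_le (W.norm_add_one_r τ hτ))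
  have elc := W.l.conj.integral_inv_sub_sub_of_lt_norm (z := z) (x := x) (c := 0)
    (fun τ hτ => by
      rw [Curve.conj_path, add_zero, add_zero, norm_conj]; exact hz.trans_le (W.norm_l τ hτ))
    (fun τ hτ => by
      rw [Curve.conj_path, add_zero, add_zero, norm_conj]; exact hx.trans_le (W.norm_l τ hτ))
  have erc := W.r.conj.integral_inv_sub_sub_of_lt_norm (z := z) (x := x) (c := 1)
    (fun τ hτ => by
      rw [Curve.conj_path, norm_conj_add_one]; exact hz1.trans_le (W.norm_add_one_r τ hτ))
    (fun τ hτ => by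
      rw [Curve.conj_path, norm_conj_add_one]; exact hx1.trans_le (W.norm_add_one_r τ hτ))
  rw [W.conj_end_l, Curve.conj_path, W.start_l] at elc
  rw [W.conj_end_r, Curve.conj_path, W.start_r] at erc
  rw [W.start_l] at el
  rw [W.start_r] at er
  have key : W.integral (fun w => 1 / (w - z)) - W.integral (fun w => 1 / (w - x)) = H z - H x := by
    simp only [integral, hH]
    linear_combination el - er - elc + erc
  rw [← sub_eq_zero, key, sub_eq_zero]
  set s : Set ℂ := Metric.ball 0 ‖zc‖ ∩ Metric.ball (-1) ‖zc + 1‖ with hs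
  have hmem : ∀ u : ℂ, u ∈ s ↔ ‖u‖ < ‖zc‖ ∧ ‖u + 1‖ < ‖zc + 1‖ := fun u => by
    simp [hs, dist_eq_norm]
  have hder : ∀ u ∈ s, HasDerivAt H 0 u := fun u hu => by
    rw [hmem] at hu
    have aux : ∀ (c w : ℂ), ‖u + c‖ < ‖w + c‖ →
        HasDerivAt (fun u => Complex.log (1 - (u + c) / (w + c))) (1 / (u - w)) u := fun c w h => by
      have hwc : w + c ≠ 0 := fun h0 => by
        rw [h0, norm_zero] at h
        exact (norm_nonneg _).not_gt h
      have huw : u - w ≠ 0 := fun h0 => by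
        rw [sub_eq_zero.1 h0] at h
        exact lt_irrefl _ h
      have hd : HasDerivAt (fun u : ℂ => 1 - (u + c) / (w + c)) (-(1 / (w + c))) u :=
        (((hasDerivAt_id _).add_const c).div_const _).const_sub 1
      have := hd.clog (mem_slitPlane_iff.2 (Or.inl (slitPlane_one_sub_div h)))
      convert this using 1
      have h2 : 1 - (u + c) / (w + c) = -(u - w) / (w + c) := by
        field_simp
        ring
      rw [h2]
      field_simp
    have b1 := aux 0 zc (by simpa using hu.1)
    have b2 := aux 1 zc hu.2
    have b3 := aux 0 ((starRingEnd ℂ) zc) (by simpa using hu.1)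
    have b4 := aux 1 ((starRingEnd ℂ) zc) (by rw [norm_conj_add_one]; exact hu.2)
    have := ((b1.fun_neg.fun_add b2).fun_add b3).fun_sub b4
    rwa [neg_add_cancel, zero_add, sub_self] at this
  have hconv : Convex ℝ s := (convex_ball _ _).inter (convex_ball _ _)
  exact (Metric.isOpen_ball.inter Metric.isOpen_ball).is_const_of_deriv_eq_zero
    hconv.isPreconnected (fun u hu => (hder u hu).differentiableAt.differentiableWithinAt)
    (fun u hu => (hder u hu).deriv) ((hmem z).2 ⟨hz, hz1⟩) ((hmem x).2 ⟨hx, hx1⟩)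

/-- The index integral is a signed sum of four logarithms with arguments below `π / 2`. Its
exponential is `1` and its imaginary part is smaller than `2 π` in absolute value, so it vanishes.
-/
lemma index_eq_zero {z : ℂ} (hz : ‖zc‖ < ‖z‖) (hz1 : ‖zc + 1‖ < ‖z + 1‖) :
    W.integral (fun w => 1 / (w - z)) = 0 := by
  have el := W.l.integral_inv_sub_of_norm_lt (z := z) (c := 1)
    (fun τ hτ => (W.norm_add_one_l τ hτ).trans_lt hz1)
  have er := W.r.integral_inv_sub_of_norm_lt (z := z) (c := 0)
    (fun τ hτ => by simpa using (W.norm_r τ hτ).trans_lt hz)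
  have elc := W.l.conj.integral_inv_sub_of_norm_lt (z := z) (c := 1) (fun τ hτ => by
    rw [Curve.conj_path, norm_conj_add_one]; exact (W.norm_add_one_l τ hτ).trans_lt hz1)
  have erc := W.r.conj.integral_inv_sub_of_norm_lt (z := z) (c := 0) (fun τ hτ => by
    rw [Curve.conj_path, add_zero, add_zero, norm_conj]; exact (W.norm_r τ hτ).trans_lt hz)
  rw [W.conj_end_l, Curve.conj_path, W.start_l] at elc
  rw [W.conj_end_r, Curve.conj_path, W.start_r] at erc
  rw [W.start_l] at el
  rw [W.start_r] at er
  have key : W.integral (fun w => 1 / (w - z)) =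
      -Complex.log (1 - (zc + 1) / (z + 1)) + Complex.log (1 - (zc + 0) / (z + 0)) +
      Complex.log (1 - ((starRingEnd ℂ) zc + 1) / (z + 1)) -
      Complex.log (1 - ((starRingEnd ℂ) zc + 0) / (z + 0)) := by
    simp only [integral]
    linear_combination el - er - elc + erc
  have aux : ∀ w c : ℂ, ‖w + c‖ < ‖z + c‖ → |(Complex.log (1 - (w + c) / (z + c))).im| < Real.pi / 2 ∧
      exp (Complex.log (1 - (w + c) / (z + c))) = (z - w) / (z + c) ∧ z + c ≠ 0 ∧ z - w ≠ 0 :=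
    fun w c h => by
      have hpos := slitPlane_one_sub_div h
      have hzc : z + c ≠ 0 := fun h0 => by
        rw [h0, norm_zero] at h
        exact (norm_nonneg _).not_gt h
      refine ⟨?_, ?_, hzc, fun h0 => ?_⟩
      · rw [log_im, abs_arg_lt_pi_div_two_iff]
        exact Or.inl hpos
      · rw [exp_log (fun h0 => by rw [h0] at hpos; simp at hpos)]
        field_simp
        ring
      · rw [sub_eq_zero.1 h0] at h
        exact lt_irrefl _ h
  obtain ⟨i1, e1, n1, m1⟩ := aux zc 1 hz1
  obtain ⟨i2, e2, n2, m2⟩ := aux zc 0 (by simpa using hz)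
  obtain ⟨i3, e3, n3, m3⟩ := aux ((starRingEnd ℂ) zc) 1 (by rw [norm_conj_add_one]; exact hz1)
  obtain ⟨i4, e4, n4, m4⟩ := aux ((starRingEnd ℂ) zc) 0 (by simpa using hz)
  have hexp : exp (W.integral (fun w => 1 / (w - z))) = 1 := by
    rw [key, exp_sub, exp_add, exp_add, exp_neg, e1, e2, e3, e4]
    field_simp
  obtain ⟨n, hn⟩ := exp_eq_one_iff.1 hexp
  have him : (W.integral (fun w => 1 / (w - z))).im = n * (2 * Real.pi) := by
    rw [hn]; simp
  have hlt : |(W.integral (fun w => 1 / (w - z))).im| < 2 * Real.pi := by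
    rw [key, sub_im, add_im, add_im, neg_im, abs_lt]
    rw [abs_lt] at i1 i2 i3 i4
    constructor <;> linarith [i1.1, i1.2, i2.1, i2.2, i3.1, i3.2, i4.1, i4.2]
  have hn0 : n = 0 := by
    rw [him, abs_mul, abs_of_pos Real.two_pi_pos] at hlt
    have : |(n : ℝ)| < 1 := by
      by_contra h
      nlinarith [Real.two_pi_pos]
    have : |n| < 1 := by exact_mod_cast this
    exact Int.abs_lt_one_iff.1 this
  rw [hn, hn0]
  simp

end Loop

end

noncomputable section

/-! ### Lagrange interpolation and the kernel `∏ (z - α r) / (w - α r) / (w - z)` -/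

/-- The Lagrange basis function of the node `α r`. -/
def lagBasis {N : ℕ} (α : Fin N → ℂ) (r : Fin N) (z : ℂ) : ℂ :=
  ∏ s ∈ Finset.univ.erase r, (z - α s) / (α r - α s)

/-- The Lagrange interpolant of `E` at the nodes `α`. -/
def lagInterp {N : ℕ} (α : Fin N → ℂ) (E : ℂ → ℂ) (z : ℂ) : ℂ := ∑ r, lagBasis α r z * E (α r)

/-- The kernel `∏ (z - α r) / (w - α r) / (w - z)`. -/
def nodeKernel {N : ℕ} (α : Fin N → ℂ) (z w : ℂ) : ℂ :=
  (∏ r, (z - α r) / (w - α r)) * (1 / (w - z))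

section

variable {N : ℕ} (α : Fin N → ℂ)

lemma lagBasis_eq (r : Fin N) (z : ℂ) :
    lagBasis α r z = (Lagrange.basis Finset.univ α r).eval z := by
  rw [lagBasis, Lagrange.basis, Polynomial.eval_prod]
  refine Finset.prod_congr rfl fun s _ => ?_
  simp [Lagrange.basisDivisor, div_eq_inv_mul]

lemma differentiable_lagInterp (E : ℂ → ℂ) : Differentiable ℂ (lagInterp α E) := by
  have : lagInterp α E = fun z => ∑ r, (Lagrange.basis Finset.univ α r).eval z * E (α r) := by
    ext z
    simp [lagInterp, lagBasis_eq]
  rw [this]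
  exact Differentiable.fun_sum fun r _ => (Polynomial.differentiable _).mul_const _

variable {α}

/-- Partial fractions in `w`. With `P` the nodal polynomial, `(P z - P w) / (z - w)` has degree
below the number of nodes in `z`, hence equals its own Lagrange interpolant. -/
lemma nodeKernel_eq (hα : Function.Injective α) {z w : ℂ} (hwz : w ≠ z) (hw : ∀ r, w ≠ α r) :
    nodeKernel α z w = 1 / (w - z) - ∑ r, lagBasis α r z * (1 / (w - α r)) := by
  set P : Polynomial ℂ := Lagrange.nodal Finset.univ α with hP
  have hPeval : ∀ x, P.eval x = ∏ r, (x - α r) := fun x => Lagrange.eval_nodal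
  have hPw : P.eval w ≠ 0 := by
    rw [hPeval]
    exact Finset.prod_ne_zero_iff.2 fun r _ => sub_ne_zero.2 (hw r)
  set q : Polynomial ℂ := P /ₘ (Polynomial.X - Polynomial.C w) with hq
  have hdiv : ∀ x, (x - w) * q.eval x = P.eval x - P.eval w := fun x => by
    have := congrArg (Polynomial.eval x) (Polynomial.modByMonic_add_div P (Polynomial.X - Polynomial.C w))
    rw [Polynomial.modByMonic_X_sub_C_eq_C_eval] at this
    simp only [Polynomial.eval_add, Polynomial.eval_C, Polynomial.eval_mul, Polynomial.eval_sub,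
      Polynomial.eval_X] at this
    linear_combination this
  have hdeg : (Polynomial.C (P.eval w)⁻¹ * q).degree < (Finset.univ : Finset (Fin N)).card := by
    rw [Polynomial.degree_C_mul (inv_ne_zero hPw)]
    rcases Nat.eq_zero_or_pos N with hN | hN
    · subst hN
      have : P = 1 := by simp [hP, Lagrange.nodal]
      have hq0 : q = 0 := by
        rw [hq, this]
        exact (Polynomial.divByMonic_eq_zero_iff (Polynomial.monic_X_sub_C w)).2 (by simp)
      rw [hq0]
      simp
    · have hdP : P.degree = (Finset.univ : Finset (Fin N)).card := Lagrange.degree_nodal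
      rw [← hdP]
      have hP0 : P ≠ 0 := fun h0 => hPw (by rw [h0, Polynomial.eval_zero])
      refine Polynomial.degree_divByMonic_lt _ _ hP0 ?_
      rw [Polynomial.degree_X_sub_C]
      norm_num
  have hinterp := Lagrange.eq_interpolate_of_eval_eq (s := Finset.univ) (v := α)
    (fun r => 1 / (w - α r)) (hα.injOn) hdeg fun r _ => by
      have h1 := hdiv (α r)
      have h0 : P.eval (α r) = 0 := Lagrange.eval_nodal_at_node (Finset.mem_univ r)
      rw [h0, zero_sub] at h1
      have h2 : α r - w ≠ 0 := sub_ne_zero.2 (hw r).symm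
      have h3 : w - α r ≠ 0 := sub_ne_zero.2 (hw r)
      rw [Polynomial.eval_mul, Polynomial.eval_C]
      have h4 : q.eval (α r) = -P.eval w / (α r - w) := by
        rw [eq_div_iff h2, mul_comm]; exact h1
      rw [h4, ← neg_sub w, neg_div_neg_eq]
      field_simp
  have hz := congrArg (Polynomial.eval z) hinterp
  rw [Lagrange.interpolate_apply, Polynomial.eval_finsetSum, Polynomial.eval_mul,
    Polynomial.eval_C] at hz
  have hsum : ∑ r, lagBasis α r z * (1 / (w - α r)) = (P.eval w)⁻¹ * q.eval z := by
    rw [hz]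
    refine Finset.sum_congr rfl fun r _ => ?_
    rw [lagBasis_eq, Polynomial.eval_mul, Polynomial.eval_C, mul_comm]
  have h1 := hdiv z
  have h2 : w - z ≠ 0 := sub_ne_zero.2 hwz
  have h3 : q.eval z = -(P.eval z - P.eval w) / (w - z) := by
    rw [eq_div_iff h2]; linear_combination -h1
  rw [hsum, h3, nodeKernel, Finset.prod_div_distrib, ← hPeval, ← hPeval]
  field_simp
  ring

lemma lagBasis_smul {c : ℂ} (hc : c ≠ 0) (r : Fin N) (z : ℂ) :
    lagBasis (fun r => c * α r) r (c * z) = lagBasis α r z := by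
  refine Finset.prod_congr rfl fun s _ => ?_
  rw [← mul_sub, ← mul_sub, mul_div_mul_left _ _ hc]

lemma lagInterp_smul {c : ℂ} (hc : c ≠ 0) (E : ℂ → ℂ) (z : ℂ) :
    lagInterp (fun r => c * α r) E (c * z) = lagInterp α (fun w => E (c * w)) z := by
  simp only [lagInterp, lagBasis_smul hc]

lemma lagInterp_conj {E : ℂ → ℂ} (hα : ∀ r, (starRingEnd ℂ) (α r) = α r)
    (hE : ∀ z, E ((starRingEnd ℂ) z) = (starRingEnd ℂ) (E z)) (z : ℂ) :
    lagInterp α E ((starRingEnd ℂ) z) = (starRingEnd ℂ) (lagInterp α E z) := by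
  simp only [lagInterp, lagBasis, map_sum, map_mul, map_prod, map_div₀, map_sub, hα, ← hE]

namespace Loop

variable {zc : ℂ} (W : Loop zc)

lemma path_ne_real {γ : Curve} (hγ : W.IsSide γ) {τ : ℝ} (hτ : τ ∈ Set.Ioo (0 : ℝ) 1) (p : ℝ) :
    γ.path τ ≠ p := by
  have hτ' : τ ∈ Set.Ico (0 : ℝ) 1 := ⟨hτ.1.le, hτ.2⟩
  intro h0
  have him := congrArg Complex.im h0
  have h1 := W.im_l τ hτ'
  have h2 := W.im_r τ hτ'
  rcases hγ with rfl | rfl | rfl | rfl <;> simp [Curve.conj_path] at him <;> linarith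

lemma path_ne_real_of_mem {γ : Curve} (hγ : W.IsSide γ) {τ : ℝ} (hτ : τ ∈ Set.Icc (0 : ℝ) 1) {p : ℝ}
    (h1 : (W.l.path 1).re < p) (h2 : p < (W.r.path 1).re) : γ.path τ ≠ p := by
  intro h0
  rcases hτ.2.lt_or_eq with h | rfl
  · have a1 := W.im_l τ ⟨hτ.1, h⟩
    have a2 := W.im_r τ ⟨hτ.1, h⟩
    have him := congrArg Complex.im h0
    rcases hγ with rfl | rfl | rfl | rfl <;> simp [Curve.conj_path] at him <;> linarith
  · have hre := congrArg Complex.re h0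
    rcases hγ with rfl | rfl | rfl | rfl <;> simp [Curve.conj_path] at hre <;> linarith

/-- The loop integral of `E w` against the node kernel. -/
lemma integral_nodeKernel {E : ℂ → ℂ} (hE : Differentiable ℂ E) {a : Fin N → ℝ}
    (ha : Function.Injective a)
    (hEa : ∀ r, E (a r) = 0 ∨ (W.l.path 1).re < a r ∧ a r < (W.r.path 1).re) {z : ℂ}
    (hz : ∀ γ, W.IsSide γ → ∀ τ ∈ Set.Icc (0 : ℝ) 1, γ.path τ ≠ z) :
    W.integral (fun w => E w * nodeKernel (fun r => (a r : ℂ)) z w) =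
      E z * W.integral (fun w => 1 / (w - z)) -
        2 * Real.pi * I * lagInterp (fun r => (a r : ℂ)) E z := by
  set α : Fin N → ℂ := fun r => (a r : ℂ) with hα
  have hαi : Function.Injective α := fun r s h => ha (by simpa [hα] using h)
  have hnode : ∀ r, W.Integrable (fun w => E w / (w - α r)) ∧
      W.integral (fun w => E w / (w - α r)) = 2 * Real.pi * I * E (α r) := fun r => by
    rcases hEa r with h | ⟨h1, h2⟩
    · obtain ⟨k1, k2⟩ := integral_div_sub_of_eq_zero (W := W) hE h
        fun γ hγ τ hτ => W.path_ne_real hγ hτ (a r)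
      exact ⟨k1, by rw [k2, h, mul_zero]⟩
    · obtain ⟨k1, k2⟩ := integral_div_sub (W := W) hE (p := α r)
        fun γ hγ τ hτ => W.path_ne_real_of_mem hγ hτ h1 h2
      exact ⟨k1, by rw [k2, W.index_real h1 h2, mul_comm]⟩
  obtain ⟨k1, k2⟩ := integral_div_sub (W := W) hE hz
  have e : W.integral (fun w => E w * nodeKernel α z w) =
      W.integral (fun w => E w / (w - z) - ∑ r, lagBasis α r z * (E w / (w - α r))) := by
    refine W.integral_congr fun γ hγ τ hτ => ?_
    rw [nodeKernel_eq hαi (hz γ hγ τ (Set.Ioo_subset_Icc_self hτ))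
      (fun r => W.path_ne_real hγ hτ (a r)), mul_sub, Finset.mul_sum]
    congr 1
    · ring
    · exact Finset.sum_congr rfl fun r _ => by ring
  rw [e, integral_sub k1 (Integrable.sum fun r _ => (hnode r).1.const_mul _), k2,
    integral_sum fun r _ => (hnode r).1.const_mul _, lagInterp, Finset.mul_sum]
  congr 1
  refine Finset.sum_congr rfl fun r _ => ?_
  rw [integral_const_mul, (hnode r).2]
  ring

lemma ne_of_norm_lt {z : ℂ} (hz : ‖z‖ < ‖zc‖) (hz1 : ‖z + 1‖ < ‖zc + 1‖) :
    ∀ γ, W.IsSide γ → ∀ τ ∈ Set.Icc (0 : ℝ) 1, γ.path τ ≠ z := by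
  rintro γ hγ τ hτ rfl
  have a1 := W.norm_l τ hτ
  have a2 := W.norm_add_one_r τ hτ
  rcases hγ with rfl | rfl | rfl | rfl
  · linarith
  · linarith
  · rw [Curve.conj_path, norm_conj] at hz; linarith
  · rw [Curve.conj_path, norm_conj_add_one] at hz1; linarith

lemma ne_of_lt_norm {z : ℂ} (hz : ‖zc‖ < ‖z‖) (hz1 : ‖zc + 1‖ < ‖z + 1‖) :
    ∀ γ, W.IsSide γ → ∀ τ ∈ Set.Icc (0 : ℝ) 1, γ.path τ ≠ z := by
  rintro γ hγ τ hτ rfl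
  have a1 := W.norm_add_one_l τ hτ
  have a2 := W.norm_r τ hτ
  rcases hγ with rfl | rfl | rfl | rfl
  · linarith
  · linarith
  · rw [Curve.conj_path, norm_conj_add_one] at hz1; linarith
  · rw [Curve.conj_path, norm_conj] at hz; linarith

end Loop

end

end

noncomputable section

/-! ### The `z` and `w` factors of the Bernoulli kernel in terms of the Gamma function -/

/-- The factor `(z - x₂ + 1)_{t₂ - 1} b ^ (-z) / sin (π z)`, where `ℓ = log b`. -/
def zFactor (ℓ : ℝ) (t₂ : ℕ) (x₂ : ℤ) (z : ℂ) : ℂ :=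
  -(-1) ^ x₂ * (Gamma (z - x₂ + t₂) * Gamma (x₂ - z)) * exp (-(ℓ * z)) / Real.pi

/-- The entire function `sin (π w) b ^ w / (w - x₁)_{t₁ + 1}`, where `ℓ = log b`. -/
def wFactor (ℓ : ℝ) (t₁ : ℕ) (x₁ : ℤ) (w : ℂ) : ℂ :=
  (-1) ^ x₁ * Real.pi * exp (ℓ * w) * ((Gamma (w - x₁ + t₁ + 1))⁻¹ * (Gamma (1 + x₁ - w))⁻¹)

lemma add_int_ne {z : ℂ} (hz : z ∈ integerComplement) (n m : ℤ) : z + n ≠ m := fun h =>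
  hz ⟨m - n, by push_cast; rw [← h]; ring⟩

lemma poch_mul_Gamma {z : ℂ} (hz : ∀ n : ℕ, z + n ≠ 0) (k : ℕ) :
    poch z k * Gamma z = Gamma (z + k) := by
  induction k with
  | zero => simp [poch]
  | succ k ih =>
    have e : poch z (k + 1) = poch z k * (z + k) := by
      rw [poch, poch, ascPochhammer_succ_eval]
    rw [e, Nat.cast_succ, ← add_assoc, Gamma_add_one _ (hz k), ← ih]
    ring

lemma neg_one_zpow_mul_self (n : ℤ) : ((-1 : ℂ) ^ n) * (-1) ^ n = 1 := by
  rw [← mul_zpow]; simp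

lemma complex_sin_sub_int_mul_pi (x : ℂ) (n : ℤ) : sin (x - n * Real.pi) = (-1) ^ n * sin x :=
  n.cast_negOnePow ℂ ▸ sin_antiperiodic.sub_int_mul_eq n

/-- Reflection formula. The sine form is the one in the kernel; the Gamma form is entire and
displays the zeros at the integers outside `{x₁ - t₁, …, x₁}`. -/
lemma wFactor_eq (ℓ : ℝ) (t₁ : ℕ) (x₁ : ℤ) {w : ℂ} (hw : w ∈ integerComplement) :
    wFactor ℓ t₁ x₁ w = sin (Real.pi * w) * exp (ℓ * w) / poch (w - x₁) (t₁ + 1) := by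
  have hne : ∀ n : ℕ, w - x₁ + n ≠ 0 := fun n h => by
    refine add_int_ne hw (n - x₁) 0 ?_
    push_cast
    rw [← h]; ring
  have h1 := poch_mul_Gamma hne (t₁ + 1)
  have hG : Gamma (w - x₁) ≠ 0 := Gamma_ne_zero fun m h => hne m (by rw [h]; ring)
  have hG1 : Gamma (1 + x₁ - w) ≠ 0 := Gamma_ne_zero fun m h => by
    refine add_int_ne hw (-x₁ - 1) m ?_
    push_cast
    linear_combination -h
  have hp : poch (w - x₁) (t₁ + 1) ≠ 0 := fun h0 => by
    rw [h0, zero_mul] at h1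
    refine Gamma_ne_zero (s := w - x₁ + (t₁ + 1 : ℕ)) (fun m h => hne (t₁ + 1 + m) ?_) h1.symm
    push_cast at h ⊢
    linear_combination h
  have h2 := Gamma_mul_Gamma_one_sub (w - x₁)
  have h3 : sin (Real.pi * (w - x₁)) = (-1) ^ x₁ * sin (Real.pi * w) := by
    rw [mul_sub, mul_comm (Real.pi : ℂ) (x₁ : ℂ), complex_sin_sub_int_mul_pi]
  have h4 : sin (Real.pi * w) ≠ 0 := sin_pi_mul_ne_zero hw
  have hs := neg_one_zpow_mul_self x₁
  have hs0 : ((-1 : ℂ) ^ x₁) ≠ 0 := by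
    intro h0; rw [h0] at hs; simp at hs
  rw [h3, show (1 : ℂ) - (w - x₁) = 1 + x₁ - w by ring] at h2
  rw [wFactor, show w - x₁ + t₁ + 1 = w - x₁ + (t₁ + 1 : ℕ) by push_cast; ring, ← h1]
  have h5 : (Real.pi : ℂ) = Gamma (w - x₁) * Gamma (1 + x₁ - w) * ((-1) ^ x₁ * sin (Real.pi * w)) := by
    rw [h2]; field_simp
  generalize sin (Real.pi * w) = S at *
  field_simp
  rw [h5]
  linear_combination (Gamma (w - x₁) * Gamma (1 + x₁ - w) * S) * hs

/-- Reflection formula again. In the Gamma form the zeros of the rising factorial have cancelled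
poles of `1 / sin`, so the function is regular on the real interval `(x₂ - t₂, x₂)`. -/
lemma zFactor_eq (ℓ : ℝ) {t₂ : ℕ} (ht : 1 ≤ t₂) (x₂ : ℤ) {z : ℂ} (hz : z ∈ integerComplement) :
    zFactor ℓ t₂ x₂ z = poch (z - x₂ + 1) (t₂ - 1) * exp (-(ℓ * z)) / sin (Real.pi * z) := by
  have hne : ∀ n : ℕ, z - x₂ + 1 + n ≠ 0 := fun n h => by
    refine add_int_ne hz (n + 1 - x₂) 0 ?_
    push_cast
    rw [← h]; ring
  have h1 := poch_mul_Gamma hne (t₂ - 1)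
  rw [show z - x₂ + 1 + (t₂ - 1 : ℕ) = z - x₂ + t₂ by rw [Nat.cast_sub ht]; push_cast; ring] at h1
  have h2 := Gamma_mul_Gamma_one_sub (z - x₂ + 1)
  have h3 : sin (Real.pi * (z - x₂ + 1)) = -((-1) ^ x₂ * sin (Real.pi * z)) := by
    rw [show (Real.pi : ℂ) * (z - x₂ + 1) = Real.pi * z - x₂ * Real.pi + Real.pi by ring, sin_add_pi,
      complex_sin_sub_int_mul_pi]
  have h4 : sin (Real.pi * z) ≠ 0 := sin_pi_mul_ne_zero hz
  have hs := neg_one_zpow_mul_self x₂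
  have hs0 : ((-1 : ℂ) ^ x₂) ≠ 0 := by
    intro h0; rw [h0] at hs; simp at hs
  rw [h3, show (1 : ℂ) - (z - x₂ + 1) = x₂ - z by ring] at h2
  have hpi : (Real.pi : ℂ) ≠ 0 := by exact_mod_cast Real.pi_ne_zero
  rw [zFactor, ← h1, mul_assoc (poch _ _), h2]
  field_simp

lemma differentiable_wFactor (ℓ : ℝ) (t₁ : ℕ) (x₁ : ℤ) : Differentiable ℂ (wFactor ℓ t₁ x₁) := by
  have h1 : Differentiable ℂ fun w : ℂ => (Gamma (w - x₁ + t₁ + 1))⁻¹ :=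
    differentiable_one_div_Gamma.comp (f := fun w : ℂ => w - x₁ + t₁ + 1) (by fun_prop)
  have h2 : Differentiable ℂ fun w : ℂ => (Gamma (1 + x₁ - w))⁻¹ :=
    differentiable_one_div_Gamma.comp (f := fun w : ℂ => 1 + x₁ - w) (by fun_prop)
  have h3 : Differentiable ℂ fun w : ℂ => (-1) ^ x₁ * (Real.pi : ℂ) * exp (ℓ * w) := by fun_prop
  exact h3.mul (h1.mul h2)

lemma wFactor_int_eq_zero (ℓ : ℝ) (t₁ : ℕ) (x₁ : ℤ) {j : ℤ} (hj : j < x₁ - t₁ ∨ x₁ < j) :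
    wFactor ℓ t₁ x₁ j = 0 := by
  rcases hj with h | h
  · obtain ⟨n, hn⟩ := Int.eq_ofNat_of_zero_le (by omega : 0 ≤ x₁ - t₁ - j - 1)
    have : (j : ℂ) - x₁ + t₁ + 1 = -(n : ℂ) := by
      have : (x₁ - t₁ - j - 1 : ℤ) = (n : ℤ) := hn
      have h2 : ((x₁ - t₁ - j - 1 : ℤ) : ℂ) = ((n : ℤ) : ℂ) := by rw [this]
      push_cast at h2
      linear_combination -h2
    rw [wFactor, this, Gamma_neg_nat_eq_zero]
    simp
  · obtain ⟨n, hn⟩ := Int.eq_ofNat_of_zero_le (by omega : 0 ≤ j - x₁ - 1)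
    have : 1 + (x₁ : ℂ) - j = -(n : ℂ) := by
      have h2 : ((j - x₁ - 1 : ℤ) : ℂ) = ((n : ℤ) : ℂ) := by rw [hn]
      push_cast at h2
      linear_combination -h2
    rw [wFactor, this, Gamma_neg_nat_eq_zero]
    simp

lemma exp_real_mul_conj (ℓ : ℝ) (z : ℂ) :
    exp (ℓ * (starRingEnd ℂ) z) = (starRingEnd ℂ) (exp (ℓ * z)) := by
  rw [← exp_conj]; simp

lemma wFactor_conj (ℓ : ℝ) (t₁ : ℕ) (x₁ : ℤ) (w : ℂ) :
    wFactor ℓ t₁ x₁ ((starRingEnd ℂ) w) = (starRingEnd ℂ) (wFactor ℓ t₁ x₁ w) := by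
  simp only [wFactor, map_mul, map_inv₀, ← Gamma_conj, exp_real_mul_conj]
  simp

lemma zFactor_conj (ℓ : ℝ) (t₂ : ℕ) (x₂ : ℤ) (z : ℂ) :
    zFactor ℓ t₂ x₂ ((starRingEnd ℂ) z) = (starRingEnd ℂ) (zFactor ℓ t₂ x₂ z) := by
  simp only [zFactor, map_mul, map_div₀, ← Gamma_conj, ← exp_conj]
  simp

/-- The open upper half plane together with the real interval `(l, u)`. -/
def upperWith (l u : ℝ) : Set ℂ := {z | 0 < z.im ∨ z.im = 0 ∧ l < z.re ∧ z.re < u}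

lemma differentiableAt_zFactor (ℓ : ℝ) (t₂ : ℕ) (x₂ : ℤ) {z : ℂ}
    (hz : z ∈ upperWith (x₂ - t₂) x₂) : DifferentiableAt ℂ (zFactor ℓ t₂ x₂) z := by
  have h1 : DifferentiableAt ℂ (fun z : ℂ => Gamma (z - x₂ + t₂)) z := by
    refine (differentiableAt_Gamma _ fun m h => ?_).comp z (f := fun z : ℂ => z - x₂ + t₂) (by fun_prop)
    have hre := congrArg Complex.re h
    have him := congrArg Complex.im h
    simp at hre him
    rcases hz with hz | ⟨_, hz1, _⟩
    · linarith
    · have : (0 : ℝ) ≤ m := Nat.cast_nonneg m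
      linarith
  have h2 : DifferentiableAt ℂ (fun z : ℂ => Gamma (x₂ - z)) z := by
    refine (differentiableAt_Gamma _ fun m h => ?_).comp z (f := fun z : ℂ => x₂ - z) (by fun_prop)
    have hre := congrArg Complex.re h
    have him := congrArg Complex.im h
    simp at hre him
    rcases hz with hz | ⟨_, _, hz1⟩
    · linarith
    · have : (0 : ℝ) ≤ m := Nat.cast_nonneg m
      linarith
  have h3 : DifferentiableAt ℂ (fun z : ℂ => exp (-(ℓ * z))) z := by fun_prop
  exact (((h1.mul h2).const_mul _).mul h3).div_const _

end

noncomputable section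

/-! ### The circle integrals of the Bernoulli kernel -/

lemma circleIntegral_div_sub_of_not_mem {E : ℂ → ℂ} (hE : Differentiable ℂ E) {c p : ℂ} {R : ℝ}
    (hR : 0 ≤ R) (hp : p ∉ Metric.closedBall c R) : ∮ w in C(c, R), E w / (w - p) = 0 := by
  refine circleIntegral_eq_zero_of_differentiable_on_off_countable hR Set.countable_empty ?_ ?_
  · refine hE.continuous.continuousOn.div (continuousOn_id.sub continuousOn_const) fun w hw h0 => hp ?_
    rw [← sub_eq_zero.1 h0]
    exact hw
  · intro w hw
    refine hE.differentiableAt.div (differentiableAt_id.sub_const p) fun h0 => hp ?_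
    rw [← sub_eq_zero.1 h0]
    exact Metric.ball_subset_closedBall hw.1

/-- Residues term by term in the partial fractions `nodeKernel_eq`; the pole at `z` lies outside and
does not contribute. -/
lemma circleIntegral_nodeKernel {N : ℕ} {α : Fin N → ℂ} (hα : Function.Injective α) {E : ℂ → ℂ}
    (hE : Differentiable ℂ E) {c z : ℂ} {R : ℝ} (hR : 0 ≤ R) (hz : z ∉ Metric.closedBall c R)
    (hs : ∀ r, α r ∉ Metric.sphere c R) :
    ∮ w in C(c, R), E w * nodeKernel α z w =
      -(2 * Real.pi * I * ∑ r, lagBasis α r z * (if dist (α r) c < R then E (α r) else 0)) := by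
  have hz' : ∀ w ∈ Metric.sphere c R, w ≠ z := by
    rintro w hw rfl
    exact hz (Metric.sphere_subset_closedBall hw)
  have hα' : ∀ r, ∀ w ∈ Metric.sphere c R, w ≠ α r := by
    rintro r w hw rfl
    exact hs r hw
  have hintg : ∀ p, (∀ w ∈ Metric.sphere c R, w ≠ p) →
      CircleIntegrable (fun w => E w / (w - p)) c R := fun p hp =>
    (hE.continuous.continuousOn.div (continuousOn_id.sub continuousOn_const)
      fun w hw => sub_ne_zero.2 (hp w hw)).circleIntegrable hR
  have hint2 : ∀ r, CircleIntegrable (fun w => lagBasis α r z * (E w / (w - α r))) c R := fun r =>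
    (hintg _ (hα' r)).const_smul
  have e : (∮ w in C(c, R), E w * nodeKernel α z w) =
      ∮ w in C(c, R), (E w / (w - z) - ∑ r, lagBasis α r z * (E w / (w - α r))) := by
    refine circleIntegral.integral_congr hR fun w hw => ?_
    rw [nodeKernel_eq hα (hz' w hw) (fun r => hα' r w hw), mul_sub, Finset.mul_sum]
    congr 1
    · ring
    · exact Finset.sum_congr rfl fun r _ => by ring
  rw [e, circleIntegral.integral_sub (hintg z hz') (CircleIntegrable.fun_sum _ fun r _ => hint2 r),
    circleIntegral.integral_fun_sum fun r _ => hint2 r,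
    circleIntegral_div_sub_of_not_mem hE hR hz, zero_sub, Finset.mul_sum]
  congr 1
  refine Finset.sum_congr rfl fun r _ => ?_
  rw [circleIntegral.integral_const_mul]
  split_ifs with h
  · rw [circleIntegral_div_sub_of_differentiable_on_off_countable Set.countable_empty
      (Metric.mem_ball.2 h) hE.continuous.continuousOn fun w _ => hE.differentiableAt]
    ring
  · rw [circleIntegral_div_sub_of_not_mem hE hR]
    · ring
    · intro hm
      rcases (Metric.mem_closedBall.1 hm).lt_or_eq with h1 | h1
      · exact h h1
      · exact hs r h1

/-- The offset `1 / 4` in the radius keeps the circle off the integers, so identities valid only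
there may be used under the integral. -/
lemma blockCircleIntegral_congr {f g : ℂ → ℂ} {m M : ℤ}
    (h : ∀ w ∈ integerComplement, f w = g w) :
    blockCircleIntegral f m M = blockCircleIntegral g m M := by
  rw [blockCircleIntegral, blockCircleIntegral]
  split_ifs with hm
  · have hm' : (m : ℝ) ≤ M := by exact_mod_cast hm
    refine circleIntegral.integral_congr (by linarith) fun w hw => h w ?_
    rintro ⟨n, rfl⟩
    rw [mem_sphere_iff_norm, ← ofReal_intCast, ← ofReal_sub, norm_real, Real.norm_eq_abs] at hw
    rcases abs_cases ((n : ℝ) - (m + M) / 2) with h1 | h1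
    · have h2 : (4 * n - 2 * m - 2 * M : ℝ) = 2 * M - 2 * m + 1 := by linarith [h1.1]
      have h3 : 4 * n - 2 * m - 2 * M = 2 * M - 2 * m + 1 := by exact_mod_cast h2
      omega
    · have h2 : (2 * m + 2 * M - 4 * n : ℝ) = 2 * M - 2 * m + 1 := by linarith [h1.1]
      have h3 : 2 * m + 2 * M - 4 * n = 2 * M - 2 * m + 1 := by exact_mod_cast h2
      omega
  · rfl

lemma blockCircleIntegral_nodeKernel {N : ℕ} {a : Fin N → ℤ} (ha : StrictMono a) {E : ℂ → ℂ}
    (hE : Differentiable ℂ E) {m M : ℤ} {z : ℂ} (hz : z.re + 1 / 2 ≤ m ∨ M + 1 / 2 ≤ z.re) :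
    blockCircleIntegral (fun w => E w * nodeKernel (fun r => (a r : ℂ)) z w) m M =
      -(2 * Real.pi * I * ∑ r, lagBasis (fun r => (a r : ℂ)) r z *
        (if m ≤ a r ∧ a r ≤ M then E (a r) else 0)) := by
  rw [blockCircleIntegral]
  split_ifs with hm
  · have hm' : (m : ℝ) ≤ M := by exact_mod_cast hm
    have hinj : Function.Injective fun r => (a r : ℂ) := fun r s h => ha.injective (by
      simpa using h)
    rw [circleIntegral_nodeKernel hinj hE (by linarith)]
    · congr 2
      refine Finset.sum_congr rfl fun r _ => ?_
      have : dist (a r : ℂ) (((m + M : ℝ) / 2 : ℝ) : ℂ) < (M - m : ℝ) / 2 + 1 / 4 ↔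
          m ≤ a r ∧ a r ≤ M := by
        rw [dist_eq_norm, ← ofReal_intCast, ← ofReal_sub, norm_real, Real.norm_eq_abs, abs_lt]
        constructor
        · rintro ⟨h1, h2⟩
          have h3 : (m : ℝ) - 1 < a r := by linarith
          have h4 : (a r : ℝ) < M + 1 := by linarith
          have h5 : m - 1 < a r := by exact_mod_cast h3
          have h6 : a r < M + 1 := by exact_mod_cast h4
          omega
        · rintro ⟨h1, h2⟩
          have h3 : (m : ℝ) ≤ a r := by exact_mod_cast h1
          have h4 : (a r : ℝ) ≤ M := by exact_mod_cast h2
          constructor <;> linarith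
      simp only [this]
    · intro hzb
      rw [Metric.mem_closedBall, dist_eq_norm] at hzb
      have h1 := (abs_re_le_norm _).trans hzb
      rw [sub_re, ofReal_re, abs_le] at h1
      rcases hz with h | h <;> linarith [h1.1, h1.2]
    · intro r hr
      rw [mem_sphere_iff_norm, ← ofReal_intCast, ← ofReal_sub, norm_real, Real.norm_eq_abs] at hr
      rcases abs_cases ((a r : ℝ) - (m + M) / 2) with h1 | h1
      · have h2 : (4 * a r - 2 * m - 2 * M : ℝ) = 2 * M - 2 * m + 1 := by linarith [h1.1]
        have h3 : 4 * a r - 2 * m - 2 * M = 2 * M - 2 * m + 1 := by exact_mod_cast h2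
        omega
      · have h2 : (2 * m + 2 * M - 4 * a r : ℝ) = 2 * M - 2 * m + 1 := by linarith [h1.1]
        have h3 : 2 * m + 2 * M - 4 * a r = 2 * M - 2 * m + 1 := by exact_mod_cast h2
        omega
  · have : ∀ r, ¬(m ≤ a r ∧ a r ≤ M) := fun r h => hm (h.1.trans h.2)
    simp [this]

/-- The product of the `z` factor and the interpolant of the `w` factor. -/
def residueSum {N : ℕ} (a : Fin N → ℤ) (ℓ : ℝ) (t₁ : ℕ) (x₁ : ℤ) (t₂ : ℕ) (x₂ : ℤ) (z : ℂ) : ℂ :=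
  zFactor ℓ t₂ x₂ z * lagInterp (fun r => (a r : ℂ)) (wFactor ℓ t₁ x₁) z

lemma blockCircleIntegral_const_mul (c : ℂ) (f : ℂ → ℂ) (m M : ℤ) :
    blockCircleIntegral (fun w => c * f w) m M = c * blockCircleIntegral f m M := by
  rw [blockCircleIntegral, blockCircleIntegral]
  split_ifs
  · rw [circleIntegral.integral_const_mul]
  · simp

/-- The `w` integral of the Bernoulli kernel. -/
lemma wContourIntegral_bernoulli {N : ℕ} {a : Fin N → ℤ} (ha : StrictMono a) {β : ℝ} (hβ0 : 0 < β)
    (hβ1 : β < 1) (t₁ : ℕ) (x₁ : ℤ) {t₂ : ℕ} (ht₂ : 1 ≤ t₂) (x₂ : ℤ) {z : ℂ}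
    (hz : z.re = x₂ - t₂ + 1 / 2) :
    wContourIntegral (bernoulliIntegrand a β t₁ x₁ t₂ x₂ z) t₁ x₁ t₂ x₂ =
      -(2 * Real.pi * I * residueSum a (Real.log (β⁻¹ - 1)) t₁ x₁ t₂ x₂ z) := by
  set ℓ := Real.log (β⁻¹ - 1) with hℓ
  set E := wFactor ℓ t₁ x₁ with hE
  have hEd : Differentiable ℂ E := differentiable_wFactor ℓ t₁ x₁
  have hzc : z ∈ integerComplement := by
    rintro ⟨n, rfl⟩
    rw [intCast_re] at hz
    have h2 : (2 * n : ℝ) = 2 * x₂ - 2 * t₂ + 1 := by linarith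
    have h3 : 2 * n = 2 * x₂ - 2 * t₂ + 1 := by exact_mod_cast h2
    omega
  have hb : β⁻¹ - 1 = (1 - β) / β := by field_simp
  have hbpos : 0 < (1 - β) / β := div_pos (by linarith) hβ0
  have hintg : ∀ w ∈ integerComplement, bernoulliIntegrand a β t₁ x₁ t₂ x₂ z w =
      zFactor ℓ t₂ x₂ z * (E w * nodeKernel (fun r => (a r : ℂ)) z w) := fun w hw => by
    rw [bernoulliIntegrand, hE, wFactor_eq ℓ t₁ x₁ hw, zFactor_eq ℓ ht₂ x₂ hzc, nodeKernel,
      cpow_def_of_ne_zero (by exact_mod_cast hbpos.ne'), ← ofReal_log hbpos.le, ← hb, ← hℓ]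
    have : exp (ℓ * (w - z)) = exp (ℓ * w) * exp (-(ℓ * z)) := by rw [← exp_add]; ring_nf
    rw [this]
    ring
  rw [wContourIntegral, blockCircleIntegral_congr hintg, blockCircleIntegral_congr hintg,
    blockCircleIntegral_const_mul, blockCircleIntegral_const_mul,
    blockCircleIntegral_nodeKernel ha hEd, blockCircleIntegral_nodeKernel ha hEd, residueSum,
    lagInterp]
  · rw [← mul_add, ← neg_add, ← mul_add, ← Finset.sum_add_distrib]
    -- The two circles share out the particles in `{x₁ - t₁, …, x₁}` without overlap; at all other
    -- particles `wFactor` vanishes, so the full Lagrange interpolant appears.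
    have : ∀ r, lagBasis (fun r => (a r : ℂ)) r z *
          (if x₁ - t₁ ≤ a r ∧ a r ≤ min x₁ (x₂ - t₂) then E (a r) else 0) +
        lagBasis (fun r => (a r : ℂ)) r z *
          (if max (x₁ - t₁) (x₂ - t₂ + 1) ≤ a r ∧ a r ≤ x₁ then E (a r) else 0) =
        lagBasis (fun r => (a r : ℂ)) r z * E (a r) := fun r => by
      rw [← mul_add]
      congr 1
      by_cases h1 : x₁ - t₁ ≤ a r ∧ a r ≤ x₁
      · by_cases h2 : a r ≤ x₂ - t₂
        · rw [if_pos (by omega), if_neg (by omega), add_zero]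
        · rw [if_neg (by omega), if_pos (by omega), zero_add]
      · rw [if_neg (by omega), if_neg (by omega), hE, wFactor_int_eq_zero ℓ t₁ x₁ (by omega),
          add_zero]
    rw [Finset.sum_congr rfl fun r _ => this r]
    ring
  · left
    rw [hz]
    have : x₂ - t₂ + 1 ≤ max (x₁ - t₁) (x₂ - t₂ + 1) := le_max_right _ _
    have h2 : ((x₂ - t₂ + 1 : ℤ) : ℝ) ≤ ((max (x₁ - t₁) (x₂ - t₂ + 1) : ℤ) : ℝ) := by exact_mod_cast this
    push_cast at h2 ⊢
    linarith
  · right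
    rw [hz]
    have : min x₁ (x₂ - t₂) ≤ x₂ - t₂ := min_le_right _ _
    have h2 : ((min x₁ (x₂ - t₂) : ℤ) : ℝ) ≤ ((x₂ - t₂ : ℤ) : ℝ) := by exact_mod_cast this
    push_cast at h2 ⊢
    linarith

end

noncomputable section

/-! ### Decay of the integrand on vertical lines and the kernel as a half line integral -/

lemma exists_polynomial_le_exp (p : Polynomial ℂ) :
    ∃ C, 0 ≤ C ∧ ∀ z : ℂ, ‖p.eval z‖ ≤ C * Real.exp ‖z‖ := by
  induction p using Polynomial.induction_on' with
  | add p q hp hq =>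
    obtain ⟨C, hC, h1⟩ := hp
    obtain ⟨D, hD, h2⟩ := hq
    refine ⟨C + D, by positivity, fun z => ?_⟩
    rw [Polynomial.eval_add, add_mul]
    exact (norm_add_le _ _).trans (add_le_add (h1 z) (h2 z))
  | monomial n a =>
    refine ⟨‖a‖ * n.factorial, by positivity, fun z => ?_⟩
    rw [Polynomial.eval_monomial, norm_mul, norm_pow, mul_assoc]
    gcongr
    have := Real.pow_div_factorial_le_exp ‖z‖ (norm_nonneg z) n
    rwa [div_le_iff₀ (by positivity), mul_comm] at this

lemma norm_sin_ge (z : ℂ) : (Real.exp z.im - Real.exp (-z.im)) / 2 ≤ ‖sin z‖ := by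
  have h : sin z = (exp (-z * I) - exp (z * I)) * I / 2 := rfl
  rw [h, norm_div, norm_mul, norm_I, mul_one, Complex.norm_ofNat]
  have h1 : ‖exp (-z * I)‖ = Real.exp z.im := by rw [norm_exp]; simp
  have h2 : ‖exp (z * I)‖ = Real.exp (-z.im) := by rw [norm_exp]; simp
  have := norm_sub_norm_le (exp (-z * I)) (exp (z * I))
  rw [h1, h2] at this
  linarith

lemma norm_sin_pi_mul_ge {z : ℂ} (hz : 1 ≤ z.im) : Real.exp (3 * z.im) / 4 ≤ ‖sin (Real.pi * z)‖ := by
  have h1 := norm_sin_ge (Real.pi * z)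
  rw [im_ofReal_mul] at h1
  have h3 : 3 * z.im ≤ Real.pi * z.im := by nlinarith [Real.pi_gt_three]
  have h4 : Real.exp (3 * z.im) ≤ Real.exp (Real.pi * z.im) := Real.exp_le_exp.2 h3
  have h5 : Real.exp (-(Real.pi * z.im)) ≤ 1 := Real.exp_le_one_iff.2 (by nlinarith)
  have h6 : 2 ≤ Real.exp (3 * z.im) := by
    have := Real.add_one_le_exp (3 * z.im)
    linarith
  linarith

section

variable {N : ℕ} (a : Fin N → ℤ) (ℓ : ℝ) (t₁ : ℕ) (x₁ : ℤ) (t₂ : ℕ) (x₂ : ℤ)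

/-- On vertical strips `residueSum` is a polynomial times a bounded exponential over `sin (π z)`.
The polynomial costs at most `exp ‖z‖`, and the sine gains `exp (3 Im z)` because `π > 3`. -/
lemma exists_residueSum_le (ht₂ : 1 ≤ t₂) (X : ℝ) :
    ∃ C, 0 ≤ C ∧ ∀ z : ℂ, |z.re| ≤ X → 1 ≤ z.im →
      ‖residueSum a ℓ t₁ x₁ t₂ x₂ z‖ ≤ C * Real.exp (-z.im) := by
  set α : Fin N → ℂ := fun r => (a r : ℂ)
  set p : Polynomial ℂ := (ascPochhammer ℂ (t₂ - 1)).comp (Polynomial.X - Polynomial.C (x₂ : ℂ) + 1) *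
    ∑ r, Lagrange.basis Finset.univ α r * Polynomial.C (wFactor ℓ t₁ x₁ (α r)) with hp
  obtain ⟨C, hC, h⟩ := exists_polynomial_le_exp p
  refine ⟨C * Real.exp X * Real.exp (|ℓ| * X) * 4, by positivity, fun z hX hz => ?_⟩
  have hzc : z ∈ integerComplement := mem_integerComplement_of_im (by linarith)
  have e : residueSum a ℓ t₁ x₁ t₂ x₂ z = p.eval z * exp (-(ℓ * z)) / sin (Real.pi * z) := by
    rw [residueSum, zFactor_eq ℓ ht₂ x₂ hzc, hp, lagInterp, poch, Polynomial.eval_mul,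
      Polynomial.eval_comp, Polynomial.eval_finsetSum]
    simp only [lagBasis_eq, Polynomial.eval_mul, Polynomial.eval_C, Polynomial.eval_add,
      Polynomial.eval_sub, Polynomial.eval_X, Polynomial.eval_one]
    ring
  have h1 : ‖p.eval z‖ ≤ C * (Real.exp X * Real.exp z.im) := by
    refine (h z).trans ?_
    rw [← Real.exp_add]
    gcongr
    have := norm_le_abs_re_add_abs_im z
    rw [abs_of_pos (by linarith : 0 < z.im)] at this
    linarith
  have h2 : ‖exp (-(ℓ * z))‖ ≤ Real.exp (|ℓ| * X) := by
    rw [norm_exp, Real.exp_le_exp, neg_re, re_ofReal_mul]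
    have := neg_abs_le (ℓ * z.re)
    rw [abs_mul] at this
    nlinarith [abs_nonneg ℓ]
  have h3 := norm_sin_pi_mul_ge hz
  rw [e, norm_div, norm_mul]
  calc ‖p.eval z‖ * ‖exp (-(ℓ * z))‖ / ‖sin (Real.pi * z)‖
      ≤ C * (Real.exp X * Real.exp z.im) * Real.exp (|ℓ| * X) / (Real.exp (3 * z.im) / 4) := by
        gcongr
    _ = C * Real.exp X * Real.exp (|ℓ| * X) * 4 * (Real.exp z.im * (Real.exp (3 * z.im))⁻¹) := by
        field_simp
    _ ≤ C * Real.exp X * Real.exp (|ℓ| * X) * 4 * Real.exp (-z.im) := by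
        gcongr
        rw [← Real.exp_neg, ← Real.exp_add, Real.exp_le_exp]
        linarith

lemma differentiableAt_residueSum {z : ℂ} (hz : z ∈ upperWith (x₂ - t₂) x₂) :
    DifferentiableAt ℂ (residueSum a ℓ t₁ x₁ t₂ x₂) z :=
  (differentiableAt_zFactor ℓ t₂ x₂ hz).mul (differentiable_lagInterp _ _).differentiableAt

lemma residueSum_conj (z : ℂ) : residueSum a ℓ t₁ x₁ t₂ x₂ ((starRingEnd ℂ) z) =
    (starRingEnd ℂ) (residueSum a ℓ t₁ x₁ t₂ x₂ z) := by
  rw [residueSum, residueSum, zFactor_conj, lagInterp_conj (fun r => by simp) (wFactor_conj ℓ t₁ x₁),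
    map_mul]

end

lemma integrableOn_Ioi_of_le_exp {g : ℝ → ℂ} (hg : ContinuousOn g (Set.Ici 0)) {C : ℝ}
    (h : ∀ y, 1 ≤ y → ‖g y‖ ≤ C * Real.exp (-y)) : MeasureTheory.IntegrableOn g (Set.Ioi 0) := by
  have h1 : MeasureTheory.IntegrableOn (fun y => ‖g y‖) (Set.Ioi 0) := by
    refine integrable_of_isBigO_exp_neg one_pos hg.norm (Asymptotics.IsBigO.of_bound C ?_)
    filter_upwards [eventually_ge_atTop 1] with y hy
    rw [norm_norm, Real.norm_of_nonneg (Real.exp_pos _).le, neg_one_mul]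
    exact h y hy
  have h2 : MeasureTheory.AEStronglyMeasurable g (MeasureTheory.volume.restrict (Set.Ioi 0)) :=
    (hg.mono Set.Ioi_subset_Ici_self).aestronglyMeasurable measurableSet_Ioi
  exact (MeasureTheory.integrable_norm_iff h2).1 h1

/-- The lower half line gives the conjugate of the upper one. Thus the kernel is real and only
contours in the upper half plane need to be deformed. -/
lemma integral_of_conj_symm {g : ℝ → ℂ} (hg : ∀ y, g (-y) = (starRingEnd ℂ) (g y))
    (hi : MeasureTheory.IntegrableOn g (Set.Ioi 0)) :
    ∫ y, g y = ((2 * (∫ y in Set.Ioi (0 : ℝ), g y).re : ℝ) : ℂ) := by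
  have hc : MeasureTheory.IntegrableOn (fun y => (starRingEnd ℂ) (g y)) (Set.Ioi 0) :=
    hi.norm.mono' (continuous_conj.comp_aestronglyMeasurable hi.aestronglyMeasurable)
      (Eventually.of_forall fun y => by simp)
  have hleft : MeasureTheory.IntegrableOn g (Set.Iic 0) := by
    have h1 := ((MeasureTheory.Measure.measurePreserving_neg
      (MeasureTheory.volume : MeasureTheory.Measure ℝ)).integrableOn_comp_preimage
      (Homeomorph.neg ℝ).measurableEmbedding (f := fun y => (starRingEnd ℂ) (g y))
      (s := Set.Ioi 0)).2 hc
    have e1 : (Neg.neg : ℝ → ℝ) ⁻¹' Set.Ioi 0 = Set.Iio 0 := by ext; simp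
    have e2 : ((fun y => (starRingEnd ℂ) (g y)) ∘ (Neg.neg : ℝ → ℝ)) = g := by
      ext y
      simp [hg]
    rw [e1, e2] at h1
    exact (integrableOn_Iic_iff_integrableOn_Iio (by simp)).2 h1
  rw [← intervalIntegral.integral_Iic_add_Ioi hleft hi]
  have e3 : ∫ y in Set.Iic (0 : ℝ), g y = (starRingEnd ℂ) (∫ y in Set.Ioi (0 : ℝ), g y) := by
    rw [← integral_conj, ← neg_zero, ← integral_comp_neg_Iic, neg_zero]
    refine MeasureTheory.setIntegral_congr_fun measurableSet_Iic fun y _ => ?_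
    simp [hg]
  rw [e3]
  apply Complex.ext <;> simp
  ring

/-- The Bernoulli kernel as an integral over the upper half of the vertical line. -/
lemma bernoulliKernel_eq {N : ℕ} {a : Fin N → ℤ} (ha : StrictMono a) {β : ℝ} (hβ0 : 0 < β)
    (hβ1 : β < 1) (t₁ : ℕ) (x₁ : ℤ) {t₂ : ℕ} (ht₂ : 1 ≤ t₂) (x₂ : ℤ) :
    MeasureTheory.IntegrableOn (fun y : ℝ => residueSum a (Real.log (β⁻¹ - 1)) t₁ x₁ t₂ x₂
      ((x₂ : ℂ) - t₂ + 1 / 2 + y * I)) (Set.Ioi 0) ∧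
    bernoulliKernel a β t₁ x₁ t₂ x₂ =
      (if x₂ ≤ x₁ ∧ t₂ < t₁ then
        (-1 : ℂ) ^ (x₁ - x₂ + 1) * ((t₁ - t₂).choose (x₁ - x₂).toNat : ℂ) else 0) -
      (((t₁.factorial : ℝ) / ((t₂ - 1).factorial : ℝ) / Real.pi *
        (∫ y in Set.Ioi (0 : ℝ), I * residueSum a (Real.log (β⁻¹ - 1)) t₁ x₁ t₂ x₂
          ((x₂ : ℂ) - t₂ + 1 / 2 + y * I)).im : ℝ) : ℂ) := by
  set ℓ := Real.log (β⁻¹ - 1)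
  set g : ℝ → ℂ := fun y => residueSum a ℓ t₁ x₁ t₂ x₂ ((x₂ : ℂ) - t₂ + 1 / 2 + y * I) with hg
  have hre : ∀ y : ℝ, ((x₂ : ℂ) - t₂ + 1 / 2 + y * I).re = x₂ - t₂ + 1 / 2 := fun y => by simp
  have him : ∀ y : ℝ, ((x₂ : ℂ) - t₂ + 1 / 2 + y * I).im = y := fun y => by simp
  have hmem : ∀ y ∈ Set.Ici (0 : ℝ), (x₂ : ℂ) - t₂ + 1 / 2 + y * I ∈ upperWith (x₂ - t₂) x₂ :=
    fun y hy => by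
      rcases (Set.mem_Ici.1 hy).lt_or_eq with h | h
      · left; rw [him]; exact h
      · right
        rw [him, hre]
        have : (1 : ℝ) ≤ t₂ := by exact_mod_cast ht₂
        exact ⟨h.symm, by linarith, by linarith⟩
  have hcont : ContinuousOn g (Set.Ici 0) := fun y hy =>
    (ContinuousAt.comp (g := residueSum a ℓ t₁ x₁ t₂ x₂)
      (f := fun y : ℝ => (x₂ : ℂ) - t₂ + 1 / 2 + y * I)
      (differentiableAt_residueSum a ℓ t₁ x₁ t₂ x₂ (hmem y hy)).continuousAt
      (by fun_prop)).continuousWithinAt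
  obtain ⟨C, _, hC⟩ := exists_residueSum_le a ℓ t₁ x₁ t₂ x₂ ht₂ |((x₂ : ℝ) - t₂ + 1 / 2)|
  have hintg : MeasureTheory.IntegrableOn g (Set.Ioi 0) :=
    integrableOn_Ioi_of_le_exp hcont (C := C) fun y hy => by
      have := hC ((x₂ : ℂ) - t₂ + 1 / 2 + y * I) (by rw [hre]) (by rw [him]; exact hy)
      rwa [him] at this
  refine ⟨hintg, ?_⟩
  have hsymm : ∀ y, g (-y) = (starRingEnd ℂ) (g y) := fun y => by
    simp only [hg]
    rw [← residueSum_conj]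
    congr 1
    apply Complex.ext <;> simp
  have e1 : (∫ y : ℝ, I * wContourIntegral
        (bernoulliIntegrand a β t₁ x₁ t₂ x₂ ((x₂ : ℂ) - t₂ + 1 / 2 + y * I)) t₁ x₁ t₂ x₂) =
      I * (-(2 * Real.pi * I)) * ∫ y, g y := by
    rw [← MeasureTheory.integral_const_mul]
    congr 1
    ext y
    rw [wContourIntegral_bernoulli ha hβ0 hβ1 t₁ x₁ ht₂ x₂ (hre y)]
    ring
  have e2 : (∫ y in Set.Ioi (0 : ℝ), I * g y).im = (∫ y in Set.Ioi (0 : ℝ), g y).re := by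
    rw [MeasureTheory.integral_const_mul]
    simp
  rw [bernoulliKernel, e1, integral_of_conj_symm hsymm hintg, e2]
  have hpi : (Real.pi : ℂ) ≠ 0 := by exact_mod_cast Real.pi_ne_zero
  have hI : I ^ 2 = -1 := I_sq
  push_cast
  field_simp
  ring

end

noncomputable section

/-! ### Deformation of the vertical half line -/

/-- Convexity provides a primitive on this set, which is not open but contains the real interval
where the contours start. -/
lemma convex_upperWith (l u : ℝ) : Convex ℝ (upperWith l u) := by
  intro z hz w hw a b ha hb hab
  have e1 : (a • z + b • w).im = a * z.im + b * w.im := by simp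
  have e2 : (a • z + b • w).re = a * z.re + b * w.re := by simp
  have hz0 : 0 ≤ z.im := by rcases hz with h | h <;> [exact h.le; exact h.1.ge]
  have hw0 : 0 ≤ w.im := by rcases hw with h | h <;> [exact h.le; exact h.1.ge]
  by_cases h0 : 0 < a * z.im + b * w.im
  · left; rw [e1]; exact h0
  · have h1 : a * z.im = 0 ∧ b * w.im = 0 := by
      constructor <;> nlinarith [mul_nonneg ha hz0, mul_nonneg hb hw0]
    right
    rw [e1, e2]
    refine ⟨by linarith [h1.1, h1.2], ?_⟩
    rcases hz with hz | hz
    · have ha0 : a = 0 := by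
        rcases mul_eq_zero.1 h1.1 with h | h
        · exact h
        · exact absurd h hz.ne'
      have hb1 : b = 1 := by linarith
      rcases hw with hw | hw
      · rw [hb1] at h1
        linarith [h1.2]
      · rw [ha0, hb1]
        simpa using hw.2
    · rcases hw with hw | hw
      · have hb0 : b = 0 := by
          rcases mul_eq_zero.1 h1.2 with h | h
          · exact h
          · exact absurd h hw.ne'
        have ha1 : a = 1 := by linarith
        rw [hb0, ha1]
        simpa using hz.2
      · have ha' : a = 1 - b := by linarith
        subst ha'
        constructor
        · rcases hb.lt_or_eq with h | h
          · nlinarith [hz.2.1, hw.2.1]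
          · rw [← h]; simpa using hz.2.1
        · rcases hb.lt_or_eq with h | h
          · nlinarith [hz.2.2, hw.2.2]
          · rw [← h]; simpa using hz.2.2

lemma mem_upperWith_of_im {l u : ℝ} {z : ℂ} (h : 0 < z.im) : z ∈ upperWith l u := Or.inl h

lemma upperWith_mem_nhds {l u : ℝ} {z : ℂ} (h : 0 < z.im) : upperWith l u ∈ 𝓝 z :=
  Filter.mem_of_superset ((isOpen_lt continuous_const continuous_im).mem_nhds h)
    fun _ => mem_upperWith_of_im

/-- A primitive that has a real derivative on a real interval has constant imaginary part there. -/
lemma im_eq_of_primitive {F G : ℂ → ℂ} {l u : ℝ}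
    (hG : ∀ z ∈ upperWith l u, HasDerivWithinAt G (F z) (upperWith l u) z)
    (hreal : ∀ x : ℝ, l < x → x < u → (F x).im = 0) {x y : ℝ} (hx : x ∈ Set.Ioo l u)
    (hy : y ∈ Set.Ioo l u) : (G y).im = (G x).im := by
  have hconv := (convex_Ioo l u).norm_image_sub_le_of_norm_hasDerivWithin_le
    (f := fun x : ℝ => (G x).im) (f' := fun x => (F x).im) (C := 0) (x := x)
    (y := y) (fun x hx => ?_) (fun x hx => ?_) hx hy
  · rw [zero_mul] at hconv
    exact sub_eq_zero.1 (norm_le_zero_iff.1 hconv)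
  · have hx' : (x : ℂ) ∈ upperWith l u := Or.inr ⟨by simp, by simpa using hx.1, by simpa using hx.2⟩
    have hd := HasDerivWithinAt.scomp (t' := upperWith l u) (h := fun y : ℝ => (y : ℂ)) (h' := 1)
      (s := Set.Ioo l u) x (hG x hx') (ofRealCLM.hasDerivAt (x := x)).hasDerivWithinAt
      (fun y hy => Or.inr ⟨by simp, by simpa using hy.1, by simpa using hy.2⟩)
    rw [one_smul] at hd
    exact imCLM.hasFDerivAt.comp_hasDerivWithinAt x hd
  · rw [hreal x hx.1 hx.2]
    simp

section deform

variable {F : ℂ → ℂ} {l u : ℝ}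

lemma integrableOn_vertical (hF : ∀ z ∈ upperWith l u, DifferentiableAt ℂ F z)
    (hdec : ∀ X, ∃ C, 0 ≤ C ∧ ∀ z : ℂ, |z.re| ≤ X → 1 ≤ z.im → ‖F z‖ ≤ C * Real.exp (-z.im))
    {p : ℂ} (hp : p ∈ upperWith l u) :
    MeasureTheory.IntegrableOn (fun y : ℝ => I * F (p + y * I)) (Set.Ioi 0) := by
  have hp0 : 0 ≤ p.im := by rcases hp with h | h <;> [exact h.le; exact h.1.ge]
  have hmem : ∀ y ∈ Set.Ici (0 : ℝ), p + y * I ∈ upperWith l u := fun y hy => by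
    rcases (Set.mem_Ici.1 hy).lt_or_eq with h | h
    · left
      simp
      linarith
    · rw [← h]
      simpa using hp
  obtain ⟨C, hC0, hC⟩ := hdec |p.re|
  refine integrableOn_Ioi_of_le_exp (C := C) (fun y hy => ?_) fun y hy => ?_
  · have := ContinuousAt.comp (g := F) (f := fun y : ℝ => p + y * I) (x := y)
      (hF _ (hmem y hy)).continuousAt (by fun_prop)
    exact (continuousAt_const.mul this).continuousWithinAt
  · rw [norm_mul, norm_I, one_mul]
    refine (hC _ (by simp) (by simp; linarith)).trans ?_
    gcongr
    simp
    linarith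

/-- Expresses a ray integral as the limit of the primitive at infinity minus its value at the foot,
so that two rays can be compared through their limits. -/
lemma tendsto_vertical {G : ℂ → ℂ} (hF : ∀ z ∈ upperWith l u, DifferentiableAt ℂ F z)
    (hdec : ∀ X, ∃ C, 0 ≤ C ∧ ∀ z : ℂ, |z.re| ≤ X → 1 ≤ z.im → ‖F z‖ ≤ C * Real.exp (-z.im))
    (hG : ∀ z ∈ upperWith l u, HasDerivWithinAt G (F z) (upperWith l u) z)
    {p : ℂ} (hp : p ∈ upperWith l u) :
    Tendsto (fun Y : ℝ => G (p + Y * I)) atTop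
      (𝓝 (G p + ∫ y in Set.Ioi (0 : ℝ), I * F (p + y * I))) := by
  have hp0 : 0 ≤ p.im := by rcases hp with h | h <;> [exact h.le; exact h.1.ge]
  have hmem : ∀ y ∈ Set.Ici (0 : ℝ), p + y * I ∈ upperWith l u := fun y hy => by
    rcases (Set.mem_Ici.1 hy).lt_or_eq with h | h
    · left
      simp
      linarith
    · rw [← h]
      simpa using hp
  have hintg := integrableOn_vertical hF hdec hp
  have h1 := (MeasureTheory.intervalIntegral_tendsto_integral_Ioi 0 hintg tendsto_id).const_add (G p)
  refine h1.congr' ?_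
  filter_upwards [eventually_ge_atTop 0] with Y hY
  have h2 : ∫ y in (0 : ℝ)..Y, I * F (p + y * I) = G (p + Y * I) - G (p + (0 : ℝ) * I) := by
    refine intervalIntegral.integral_eq_sub_of_hasDerivAt_of_le hY
      (f := fun y : ℝ => G (p + y * I)) ?_ ?_ ?_
    · intro y hy
      exact ContinuousWithinAt.comp (g := G) (f := fun y : ℝ => p + y * I) (t := upperWith l u)
        (hG _ (hmem y hy.1)).continuousWithinAt (by fun_prop) fun y' hy' => hmem y' hy'.1
    · intro y hy
      have him : 0 < (p + y * I).im := by simp; linarith [hy.1]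
      have hd := (hG _ (mem_upperWith_of_im him)).hasDerivAt (upperWith_mem_nhds him)
      have hl : HasDerivAt (fun y : ℝ => p + y * I) I y := by
        have := ((ofRealCLM.hasDerivAt (x := y)).mul_const I).const_add p
        simpa using this
      have := hd.comp y hl
      rwa [mul_comm] at this
    · rw [intervalIntegrable_iff_integrableOn_Ioc_of_le hY]
      exact hintg.mono_set Set.Ioc_subset_Ioi_self
  simp only [id]
  rw [h2]
  simp

/-- Deformation of a vertical half line to a contour through `zc`. -/
lemma im_integral_vertical_eq {xL : ℝ} (h1 : l < xL) (h2 : xL < u)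
    (hF : ∀ z ∈ upperWith l u, DifferentiableAt ℂ F z)
    (hreal : ∀ x : ℝ, l < x → x < u → (F x).im = 0)
    (hdec : ∀ X, ∃ C, 0 ≤ C ∧ ∀ z : ℂ, |z.re| ≤ X → 1 ≤ z.im → ‖F z‖ ≤ C * Real.exp (-z.im))
    (zd zu : Curve) (hstart : zd.path 0 = zu.path 0)
    (hzd : ∀ τ ∈ Set.Ico (0 : ℝ) 1, 0 < (zd.path τ).im) (hzd1 : (zd.path 1).im = 0)
    (hzd2 : l < (zd.path 1).re) (hzd3 : (zd.path 1).re < u)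
    (hzu : ∀ τ ∈ Set.Icc (0 : ℝ) 1, 0 < (zu.path τ).im) :
    (∫ y in Set.Ioi (0 : ℝ), I * F (xL + y * I)).im =
      (zu.integral F - zd.integral F +
        ∫ y in Set.Ioi (0 : ℝ), I * F (zu.path 1 + y * I)).im := by
  obtain ⟨G, hG⟩ := (convex_upperWith l u).exists_forall_hasDerivWithinAt (f := F)
    fun z hz => (hF z hz).differentiableWithinAt
  have hGc : ContinuousOn G (upperWith l u) := fun z hz => (hG z hz).continuousWithinAt
  have hFc : ContinuousOn F (upperWith l u) := fun z hz => (hF z hz).continuousAt.continuousWithinAt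
  have hcurve : ∀ γ : Curve, (∀ τ ∈ Set.Icc (0 : ℝ) 1, γ.path τ ∈ upperWith l u) →
      (∀ τ ∈ Set.Ioo (0 : ℝ) 1, 0 < (γ.path τ).im) →
      γ.integral F = G (γ.path 1) - G (γ.path 0) := fun γ hγ hγ' => by
    refine γ.integral_eq_sub (hGc.comp γ.cont hγ) (fun τ hτ => ?_)
      (γ.intervalIntegrable_of_continuousOn (hFc.mono ?_))
    · exact (hG _ (mem_upperWith_of_im (hγ' τ hτ))).hasDerivAt (upperWith_mem_nhds (hγ' τ hτ))
    · rintro z ⟨τ, hτ, rfl⟩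
      exact hγ τ hτ
  have ezd := hcurve zd (fun τ hτ => by
    rcases hτ.2.lt_or_eq with h | rfl
    · exact Or.inl (hzd τ ⟨hτ.1, h⟩)
    · exact Or.inr ⟨hzd1, hzd2, hzd3⟩) fun τ hτ => hzd τ ⟨hτ.1.le, hτ.2⟩
  have ezu := hcurve zu (fun τ hτ => Or.inl (hzu τ hτ)) fun τ hτ => hzu τ (Set.Ioo_subset_Icc_self hτ)
  have hxL : (xL : ℂ) ∈ upperWith l u := Or.inr ⟨by simp, by simpa using h1, by simpa using h2⟩
  have hq : 0 < (zu.path 1).im := hzu 1 ⟨zero_le_one, le_rfl⟩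
  set q := zu.path 1 with hqdef
  have t1 := tendsto_vertical hF hdec hG hxL
  have t2 := tendsto_vertical hF hdec hG (mem_upperWith_of_im (l := l) (u := u) hq)
  have t1' : Tendsto (fun Y : ℝ => G (xL + ((Y + q.im : ℝ) : ℂ) * I)) atTop
      (𝓝 (G xL + ∫ y in Set.Ioi (0 : ℝ), I * F (xL + y * I))) :=
    t1.comp (tendsto_atTop_add_const_right _ _ tendsto_id)
  obtain ⟨C, hC0, hC⟩ := hdec (max |xL| |q.re|)
  -- The two rays are compared at equal height: the horizontal segment between them has fixed
  -- length, and on it the derivative of `G` is exponentially small.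
  have hdiff : Tendsto (fun Y : ℝ => G (xL + ((Y + q.im : ℝ) : ℂ) * I) - G (q + Y * I)) atTop (𝓝 0) := by
    have hexp : Tendsto (fun Y : ℝ => C * Real.exp (-Y) * ‖(xL : ℂ) - q.re‖) atTop (𝓝 0) := by
      have := (Real.tendsto_exp_neg_atTop_nhds_zero.const_mul C).mul_const ‖(xL : ℂ) - q.re‖
      simpa using this
    refine squeeze_zero_norm' ?_ hexp
    filter_upwards [eventually_ge_atTop 1] with Y hY
    set A : ℂ := xL + ((Y + q.im : ℝ) : ℂ) * I with hA
    set B : ℂ := q + Y * I with hB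
    have hAim : A.im = Y + q.im := by simp [hA]
    have hBim : B.im = Y + q.im := by simp [hB]; ring
    have hAre : A.re = xL := by simp [hA]
    have hBre : B.re = q.re := by simp [hB]
    have hseg : ∀ w ∈ segment ℝ B A, w.im = Y + q.im ∧ |w.re| ≤ max |xL| |q.re| := by
      rintro w ⟨a, b, ha, hb, hab, rfl⟩
      constructor
      · simp only [add_im, smul_im, hAim, hBim, smul_eq_mul]
        rw [← add_mul, hab, one_mul]
      · simp only [add_re, smul_re, hAre, hBre, smul_eq_mul]
        calc |a * q.re + b * xL| ≤ |a * q.re| + |b * xL| := abs_add_le _ _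
          _ = a * |q.re| + b * |xL| := by rw [abs_mul, abs_mul, abs_of_nonneg ha, abs_of_nonneg hb]
          _ ≤ a * max |xL| |q.re| + b * max |xL| |q.re| := by
              gcongr
              · exact le_max_right _ _
              · exact le_max_left _ _
          _ = max |xL| |q.re| := by rw [← add_mul, hab, one_mul]
    have hAB : A - B = xL - q.re := by
      apply Complex.ext
      · simp [hAre, hBre]
      · simp [hAim, hBim]
    rw [← hAB]
    refine (convex_segment B A).norm_image_sub_le_of_norm_hasDerivWithin_le (f := G) (f' := F)
      (fun w hw => ?_) (fun w hw => ?_) (left_mem_segment _ _ _) (right_mem_segment _ _ _)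
    · have him : 0 < w.im := by rw [(hseg w hw).1]; linarith
      exact ((hG _ (mem_upperWith_of_im him)).hasDerivAt (upperWith_mem_nhds him)).hasDerivWithinAt
    · obtain ⟨k1, k2⟩ := hseg w hw
      refine (hC w k2 (by rw [k1]; linarith)).trans ?_
      gcongr
      rw [k1]
      linarith
  have heq : G xL + (∫ y in Set.Ioi (0 : ℝ), I * F (xL + y * I)) -
      (G q + ∫ y in Set.Ioi (0 : ℝ), I * F (q + y * I)) = 0 :=
    tendsto_nhds_unique (t1'.sub t2) hdiff
  have hzd1' : zd.path 1 = ((zd.path 1).re : ℝ) := Complex.ext (by simp) (by simpa using hzd1)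
  -- The endpoints `zd.path 1` and `xL` differ, but between them the integrand is real, so the
  -- difference is invisible in the imaginary part.
  have hGreal : (G (zd.path 1)).im = (G xL).im := by
    rw [hzd1']
    exact im_eq_of_primitive hG hreal ⟨h1, h2⟩ ⟨hzd2, hzd3⟩
  have key : (∫ y in Set.Ioi (0 : ℝ), I * F (xL + y * I)) =
      zu.integral F - zd.integral F + (∫ y in Set.Ioi (0 : ℝ), I * F (q + y * I)) +
        (G (zd.path 1) - G xL) := by
    rw [ezd, ezu, hstart]
    linear_combination heq
  rw [key, add_im, sub_im (G _), hGreal]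
  ring

end deform

end

noncomputable section

/-! ### The kernel as a main term and a double contour integral -/

/-- The factor `4` is the integral of `τ ^ (-3/4)` over `[0, 1]`; this exponent is the one produced
by `exp_mul_exp_div_le` at the critical point. -/
lemma Curve.norm_integral_le (γ : Curve) {φ : ℂ → ℂ} {B V : ℝ}
    (hφ : ∀ τ ∈ Set.Ioo (0 : ℝ) 1, ‖φ (γ.path τ)‖ ≤ B * τ ^ (-(3 / 4) : ℝ))
    (hV : ∀ τ ∈ Set.Ioo (0 : ℝ) 1, ‖γ.vel τ‖ ≤ V) : ‖γ.integral φ‖ ≤ 4 * B * V := by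
  have hintg : IntervalIntegrable (fun τ : ℝ => B * V * τ ^ (-(3 / 4) : ℝ))
      MeasureTheory.volume 0 1 :=
    (intervalIntegral.intervalIntegrable_rpow' (by norm_num)).const_mul _
  have h := intervalIntegral.norm_integral_le_of_norm_le (f := fun τ => φ (γ.path τ) * γ.vel τ)
    (g := fun τ : ℝ => B * V * τ ^ (-(3 / 4) : ℝ)) zero_le_one ?_ hintg
  · refine h.trans_eq ?_
    rw [intervalIntegral.integral_const_mul, integral_rpow (Or.inl (by norm_num))]
    norm_num
    ring
  · filter_upwards [MeasureTheory.Measure.ae_ne MeasureTheory.volume 1] with τ hτ1 hτ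
    have hτ' : τ ∈ Set.Ioo (0 : ℝ) 1 := ⟨hτ.1, lt_of_le_of_ne hτ.2 hτ1⟩
    rw [norm_mul]
    calc ‖φ (γ.path τ)‖ * ‖γ.vel τ‖ ≤ B * τ ^ (-(3 / 4) : ℝ) * V :=
          mul_le_mul (hφ τ hτ') (hV τ hτ') (norm_nonneg _) ((norm_nonneg _).trans (hφ τ hτ'))
      _ = _ := by ring

namespace Loop

variable {zc : ℂ} (W : Loop zc)

lemma norm_integral_le {φ : ℂ → ℂ} {B V : ℝ}
    (hφ : ∀ γ, W.IsSide γ → ∀ τ ∈ Set.Ioo (0 : ℝ) 1, ‖φ (γ.path τ)‖ ≤ B * τ ^ (-(3 / 4) : ℝ))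
    (hl : ∀ τ ∈ Set.Ioo (0 : ℝ) 1, ‖W.l.vel τ‖ ≤ V)
    (hr : ∀ τ ∈ Set.Ioo (0 : ℝ) 1, ‖W.r.vel τ‖ ≤ V) : ‖W.integral φ‖ ≤ 16 * B * V := by
  have h1 := W.l.norm_integral_le (hφ _ (Or.inl rfl)) hl
  have h2 := W.r.norm_integral_le (hφ _ (Or.inr (Or.inl rfl))) hr
  have h3 := W.l.conj.norm_integral_le (hφ _ (Or.inr (Or.inr (Or.inl rfl))))
    (fun τ hτ => by rw [Curve.conj_vel, norm_conj]; exact hl τ hτ)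
  have h4 := W.r.conj.norm_integral_le (hφ _ (Or.inr (Or.inr (Or.inr rfl))))
    (fun τ hτ => by rw [Curve.conj_vel, norm_conj]; exact hr τ hτ)
  rw [integral]
  refine (norm_add_le _ _).trans ?_
  have := norm_sub_le (W.l.integral φ - W.r.integral φ) (W.l.conj.integral φ)
  have := norm_sub_le (W.l.integral φ) (W.r.integral φ)
  linarith

end Loop

section

variable {N : ℕ} (a : Fin N → ℤ) (ℓ : ℝ) (t₁ : ℕ) (x₁ : ℤ) (t₂ : ℕ) (x₂ : ℤ) (T : ℕ)

/-- The double contour integrand in the scaled variables. -/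
def scaledIntegrand (ζ ω : ℂ) : ℂ :=
  zFactor ℓ t₂ x₂ (T * ζ) * wFactor ℓ t₁ x₁ (T * ω) *
    nodeKernel (fun r => ((a r / T : ℝ) : ℂ)) ζ ω

-- Rescaled form of `Loop.integral_nodeKernel`. The loop need only surround `[(x₁ - t₁) / T, x₁ /
-- T]`, because `wFactor` vanishes at the particles outside.
variable {a T} in
lemma Loop.residueSum_eq {zc : ℂ} (W : Loop zc) (hT : 0 < T) (ha : StrictMono a)
    (hl : (W.l.path 1).re < (x₁ - t₁) / T) (hr : x₁ / T < (W.r.path 1).re) {ζ : ℂ}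
    (hζ : ∀ γ, W.IsSide γ → ∀ τ ∈ Set.Icc (0 : ℝ) 1, γ.path τ ≠ ζ) :
    2 * Real.pi * I * residueSum a ℓ t₁ x₁ t₂ x₂ (T * ζ) =
      zFactor ℓ t₂ x₂ (T * ζ) * wFactor ℓ t₁ x₁ (T * ζ) * W.integral (fun w => 1 / (w - ζ)) -
        W.integral (scaledIntegrand a ℓ t₁ x₁ t₂ x₂ T ζ) := by
  have hT0 : (0 : ℝ) < T := Nat.cast_pos.2 hT
  have hTc : (T : ℂ) ≠ 0 := Nat.cast_ne_zero.2 hT.ne'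
  have hnode : ∀ r, (T : ℂ) * ((a r / T : ℝ) : ℂ) = a r := fun r => by
    push_cast
    field_simp
  have h1 := W.integral_nodeKernel (E := fun w => wFactor ℓ t₁ x₁ (T * w))
    ((differentiable_wFactor ℓ t₁ x₁).comp (f := fun w : ℂ => T * w) (by fun_prop))
    (a := fun r => (a r / T : ℝ)) (fun r s h => ha.injective (by
      have h' : (a r / T : ℝ) = a s / T := h
      field_simp at h'
      exact_mod_cast h')) (fun r => ?_) hζ
  · have h2 := lagInterp_smul (α := fun r => ((a r / T : ℝ) : ℂ)) hTc (wFactor ℓ t₁ x₁) ζ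
    simp only [hnode] at h2
    have h3 : W.integral (scaledIntegrand a ℓ t₁ x₁ t₂ x₂ T ζ) = zFactor ℓ t₂ x₂ (T * ζ) *
        W.integral (fun w => wFactor ℓ t₁ x₁ (T * w) *
          nodeKernel (fun r => ((a r / T : ℝ) : ℂ)) ζ w) := by
      rw [← Loop.integral_const_mul]
      exact W.integral_congr fun γ hγ τ hτ => by rw [scaledIntegrand, mul_assoc]
    rw [h3, h1, residueSum, h2]
    ring
  · by_cases h : a r < x₁ - t₁ ∨ x₁ < a r
    · left
      simp only [hnode]
      exact wFactor_int_eq_zero ℓ t₁ x₁ h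
    · right
      push Not at h
      have e1 : (x₁ - t₁ : ℝ) ≤ a r := by exact_mod_cast h.1
      have e2 : (a r : ℝ) ≤ x₁ := by exact_mod_cast h.2
      exact ⟨hl.trans_le (by gcongr), lt_of_le_of_lt (by gcongr) hr⟩

lemma smul_mem_upperWith {l u : ℝ} {T : ℕ} (hT : 0 < T) {ζ : ℂ}
    (hζ : ζ ∈ upperWith (l / T) (u / T)) : (T : ℂ) * ζ ∈ upperWith l u := by
  have hT0 : (0 : ℝ) < T := Nat.cast_pos.2 hT
  have hre : ((T : ℂ) * ζ).re = ζ.re * T := by simp [mul_comm]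
  have him : ((T : ℂ) * ζ).im = ζ.im * T := by simp [mul_comm]
  rcases hζ with h | ⟨h1, h2, h3⟩
  · left
    rw [him]
    positivity
  · right
    rw [him, hre, h1, zero_mul]
    exact ⟨rfl, (div_lt_iff₀ hT0).1 h2, (lt_div_iff₀ hT0).1 h3⟩

lemma integral_vertical_smul {T : ℕ} (hT : 0 < T) (f : ℂ → ℂ) (p : ℂ) :
    ∫ y in Set.Ioi (0 : ℝ), I * f (p + y * I) =
      T * ∫ y in Set.Ioi (0 : ℝ), I * f (T * (p / T + y * I)) := by
  have hTc : (T : ℂ) ≠ 0 := Nat.cast_ne_zero.2 hT.ne'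
  have := MeasureTheory.integral_comp_mul_left_Ioi (fun y : ℝ => I * f (p + y * I)) 0
    (Nat.cast_pos.2 hT : (0 : ℝ) < T)
  rw [mul_zero, real_smul] at this
  have e : ∀ y : ℝ, (T : ℂ) * (p / T + y * I) = p + (T * y : ℝ) * I := fun y => by
    push_cast
    field_simp
  simp only [e]
  rw [this]
  push_cast
  field_simp

lemma norm_lt_norm_add_mul_I {p : ℂ} (hp : 0 < p.im) {y : ℝ} (hy : 0 < y) (c : ℝ) :
    ‖p + c‖ < ‖p + y * I + c‖ := by
  rw [← sq_lt_sq₀ (norm_nonneg _) (norm_nonneg _), ← normSq_eq_norm_sq, ← normSq_eq_norm_sq,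
    normSq_apply, normSq_apply]
  simp
  nlinarith

end

set_option maxHeartbeats 800000 in
/-- The Bernoulli kernel is the integral of the residue at `w = z` along a curve from `zc` to
`(-1, 0)`, up to a bound for the double contour integral. -/
lemma norm_bernoulliKernel_sub_le {N : ℕ} {a : Fin N → ℤ} (ha : StrictMono a) {β : ℝ} (hβ0 : 0 < β)
    (hβ1 : β < 1) (t₁ : ℕ) (x₁ : ℤ) {t₂ : ℕ} (ht₂ : 1 ≤ t₂) (x₂ : ℤ) {T : ℕ} (hT : 0 < T) {zc : ℂ}
    (W : Loop zc) (zd zu : Curve) (hl : (W.l.path 1).re < (x₁ - t₁) / T)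
    (hr : x₁ / T < (W.r.path 1).re) (hl0 : (W.l.path 1).re < (zd.path 1).re)
    (hr0 : (zd.path 1).re < (W.r.path 1).re) (hd0 : zd.path 0 = zc) (hu0 : zu.path 0 = zc)
    (hzd : ∀ τ ∈ Set.Ico (0 : ℝ) 1, 0 < (zd.path τ).im) (hzd1 : (zd.path 1).im = 0)
    (hzd2 : (x₂ - t₂) / T < (zd.path 1).re) (hzd3 : (zd.path 1).re < x₂ / T)
    (hzu : ∀ τ ∈ Set.Icc (0 : ℝ) 1, 0 < (zu.path τ).im)
    (hdn : ∀ τ ∈ Set.Ioc (0 : ℝ) 1, ‖zd.path τ‖ < ‖zc‖ ∧ ‖zd.path τ + 1‖ < ‖zc + 1‖)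
    (hun : ∀ τ ∈ Set.Ioc (0 : ℝ) 1, ‖zc‖ < ‖zu.path τ‖ ∧ ‖zc + 1‖ < ‖zu.path τ + 1‖)
    {V : ℝ} (hV : 0 ≤ V) (hVd : ∀ τ ∈ Set.Ioo (0 : ℝ) 1, ‖zd.vel τ‖ ≤ V)
    (hVu : ∀ τ ∈ Set.Ioo (0 : ℝ) 1, ‖zu.vel τ‖ ≤ V)
    (hVl : ∀ τ ∈ Set.Ioo (0 : ℝ) 1, ‖W.l.vel τ‖ ≤ V)
    (hVr : ∀ τ ∈ Set.Ioo (0 : ℝ) 1, ‖W.r.vel τ‖ ≤ V) {η : ℝ} (hη : 0 ≤ η)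
    (hGd : ∀ γ, W.IsSide γ → ∀ τ ∈ Set.Ioo (0 : ℝ) 1, ∀ σ ∈ Set.Ioo (0 : ℝ) 1,
      (t₁.factorial : ℝ) / (t₂ - 1).factorial * T *
        ‖scaledIntegrand a (Real.log (β⁻¹ - 1)) t₁ x₁ t₂ x₂ T (zd.path τ) (γ.path σ)‖ ≤
          η * τ ^ (-(3 / 4) : ℝ) * σ ^ (-(3 / 4) : ℝ))
    (hGu : ∀ γ, W.IsSide γ → ∀ τ ∈ Set.Ioo (0 : ℝ) 1, ∀ σ ∈ Set.Ioo (0 : ℝ) 1,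
      (t₁.factorial : ℝ) / (t₂ - 1).factorial * T *
        ‖scaledIntegrand a (Real.log (β⁻¹ - 1)) t₁ x₁ t₂ x₂ T (zu.path τ) (γ.path σ)‖ ≤
          η * τ ^ (-(3 / 4) : ℝ) * σ ^ (-(3 / 4) : ℝ))
    (hGr : ∀ γ, W.IsSide γ → ∀ y ∈ Set.Ioi (0 : ℝ), ∀ σ ∈ Set.Ioo (0 : ℝ) 1,
      (t₁.factorial : ℝ) / (t₂ - 1).factorial * T *
        ‖scaledIntegrand a (Real.log (β⁻¹ - 1)) t₁ x₁ t₂ x₂ T (zu.path 1 + y * I) (γ.path σ)‖ ≤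
          η * (1 + y ^ 2)⁻¹ * σ ^ (-(3 / 4) : ℝ)) :
    ‖bernoulliKernel a β t₁ x₁ t₂ x₂ -
      ((if x₂ ≤ x₁ ∧ t₂ < t₁ then
        (-1 : ℂ) ^ (x₁ - x₂ + 1) * ((t₁ - t₂).choose (x₁ - x₂).toNat : ℂ) else 0) +
      ((1 / Real.pi * (zd.integral fun ζ => ((t₁.factorial : ℝ) / (t₂ - 1).factorial * T : ℝ) *
        (zFactor (Real.log (β⁻¹ - 1)) t₂ x₂ (T * ζ) *
          wFactor (Real.log (β⁻¹ - 1)) t₁ x₁ (T * ζ))).im : ℝ) : ℂ))‖ ≤ 160 * (V + 1) ^ 2 * η := by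
  set ℓ := Real.log (β⁻¹ - 1)
  set c : ℝ := (t₁.factorial : ℝ) / (t₂ - 1).factorial * T with hc
  have hT0 : (0 : ℝ) < T := Nat.cast_pos.2 hT
  have hTc : (T : ℂ) ≠ 0 := Nat.cast_ne_zero.2 hT.ne'
  have hc0 : 0 < c := by positivity
  set G := scaledIntegrand a ℓ t₁ x₁ t₂ x₂ T with hG
  set F : ℂ → ℂ := fun ζ => residueSum a ℓ t₁ x₁ t₂ x₂ (T * ζ) with hF
  set M : ℂ → ℂ := fun ζ => zFactor ℓ t₂ x₂ (T * ζ) * wFactor ℓ t₁ x₁ (T * ζ) with hM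
  set U := upperWith (((x₂ : ℝ) - t₂) / T) ((x₂ : ℝ) / T) with hU
  have hFd : ∀ ζ ∈ U, DifferentiableAt ℂ F ζ := fun ζ hζ =>
    (differentiableAt_residueSum a ℓ t₁ x₁ t₂ x₂ (smul_mem_upperWith hT hζ)).comp ζ
      (f := fun ζ : ℂ => T * ζ) (by fun_prop)
  have hMd : ∀ ζ ∈ U, DifferentiableAt ℂ M ζ := fun ζ hζ =>
    ((differentiableAt_zFactor ℓ t₂ x₂ (smul_mem_upperWith hT hζ)).comp ζ
      (f := fun ζ : ℂ => T * ζ) (by fun_prop)).mul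
    ((differentiable_wFactor ℓ t₁ x₁).differentiableAt.comp ζ
      (f := fun ζ : ℂ => T * ζ) (by fun_prop))
  have hreal : ∀ x : ℝ, ((x₂ : ℝ) - t₂) / T < x → x < (x₂ : ℝ) / T → (F x).im = 0 :=
    fun x _ _ => by
      have := residueSum_conj a ℓ t₁ x₁ t₂ x₂ (T * x)
      rw [map_mul, conj_ofReal, map_natCast] at this
      exact conj_eq_iff_im.1 this.symm
  have hdec : ∀ X, ∃ C, 0 ≤ C ∧ ∀ z : ℂ, |z.re| ≤ X → 1 ≤ z.im → ‖F z‖ ≤ C * Real.exp (-z.im) :=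
    fun X => by
      obtain ⟨C, hC, h⟩ := exists_residueSum_le a ℓ t₁ x₁ t₂ x₂ ht₂ (T * X)
      have hT1 : (1 : ℝ) ≤ T := Nat.one_le_cast.2 hT
      refine ⟨C, hC, fun z hz hz1 => (h _ ?_ ?_).trans ?_⟩
      · simp only [mul_re, natCast_re, natCast_im, zero_mul, sub_zero, abs_mul, Nat.abs_cast]
        gcongr
      · simp
        nlinarith
      · gcongr
        simp
        nlinarith
  have hp1 : zu.path 1 ∈ U := Or.inl (hzu 1 ⟨zero_le_one, le_rfl⟩)
  have hkey := im_integral_vertical_eq (xL := ((x₂ : ℝ) - t₂ + 1 / 2) / T) (by gcongr; linarith)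
    (by
      have : (1 : ℝ) ≤ t₂ := Nat.one_le_cast.2 ht₂
      gcongr; linarith) hFd hreal hdec zd zu (hd0.trans hu0.symm) hzd hzd1 hzd2 hzd3 hzu
  have hscale : (∫ y in Set.Ioi (0 : ℝ), I * residueSum a ℓ t₁ x₁ t₂ x₂
      ((x₂ : ℂ) - t₂ + 1 / 2 + y * I)) =
      T * ∫ y in Set.Ioi (0 : ℝ), I * F ((((x₂ : ℝ) - t₂ + 1 / 2) / T : ℝ) + y * I) := by
    have h := integral_vertical_smul hT (residueSum a ℓ t₁ x₁ t₂ x₂) ((x₂ : ℂ) - t₂ + 1 / 2)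
    push_cast
    exact h
  -- The arm `zd` lies in the lens inside the loop. Its index there is carried over from its real
  -- endpoint, where `index_real` computes it, and the residue at `w = z` is the main term `M`.
  have hin : ∀ τ ∈ Set.Ioo (0 : ℝ) 1,
      F (zd.path τ) - M (zd.path τ) = -(1 / (2 * Real.pi * I)) * W.integral (G (zd.path τ)) :=
    fun τ hτ => by
      have h1 := hdn τ ⟨hτ.1, hτ.2.le⟩
      have h2 := hdn 1 ⟨zero_lt_one, le_rfl⟩
      have e1 := W.residueSum_eq ℓ t₁ x₁ t₂ x₂ hT ha hl hr (W.ne_of_norm_lt h1.1 h1.2)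
      have hre : zd.path 1 = ((zd.path 1).re : ℝ) :=
        Complex.ext (by simp) (by simpa using hzd1)
      rw [W.index_eq_of_norm_lt h1.1 h1.2 h2.1 h2.2, hre, W.index_real hl0 hr0] at e1
      have hpi : (Real.pi : ℂ) ≠ 0 := by exact_mod_cast Real.pi_ne_zero
      have hI := I_ne_zero
      rw [hF, hM, hG]
      field_simp
      linear_combination e1
  -- Outside the loop the index vanishes and there is no main term; this applies to `zu` and to the
  -- ray above its end.
  have hout : ∀ ζ : ℂ, ‖zc‖ < ‖ζ‖ → ‖zc + 1‖ < ‖ζ + 1‖ →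
      F ζ = -(1 / (2 * Real.pi * I)) * W.integral (G ζ) := fun ζ h1 h2 => by
    have e1 := W.residueSum_eq ℓ t₁ x₁ t₂ x₂ hT ha hl hr (W.ne_of_lt_norm h1 h2)
    rw [W.index_eq_zero h1 h2] at e1
    have hpi : (Real.pi : ℂ) ≠ 0 := by exact_mod_cast Real.pi_ne_zero
    have hI := I_ne_zero
    rw [hF, hG]
    field_simp
    linear_combination e1
  have hpi3 := Real.pi_gt_three
  have hnc : ‖-(1 / (2 * Real.pi * I) : ℂ)‖ ≤ 1 := by
    rw [norm_neg, norm_div, norm_mul, norm_mul, norm_I, norm_real, Real.norm_of_nonneg Real.pi_pos.le]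
    simp
    rw [← mul_inv]
    exact inv_le_one_of_one_le₀ (by linarith)
  have hW : ∀ {ζ : ℂ} {b : ℝ}, (∀ γ, W.IsSide γ → ∀ σ ∈ Set.Ioo (0 : ℝ) 1,
      c * ‖G ζ (γ.path σ)‖ ≤ b * σ ^ (-(3 / 4) : ℝ)) →
      c * ‖-(1 / (2 * Real.pi * I)) * W.integral (G ζ)‖ ≤ 16 * b * V := fun {ζ b} h => by
    have h1 := W.norm_integral_le (φ := fun w => (c : ℂ) * G ζ w) (B := b) (V := V) (fun γ hγ σ hσ => by
      rw [norm_mul, norm_real, Real.norm_of_nonneg hc0.le]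
      exact h γ hγ σ hσ) hVl hVr
    rw [Loop.integral_const_mul, norm_mul, norm_real, Real.norm_of_nonneg hc0.le] at h1
    refine le_trans ?_ h1
    rw [norm_mul]
    have := mul_le_mul_of_nonneg_right hnc (norm_nonneg (W.integral (G ζ)))
    gcongr
    linarith
  -- the three pieces of the error
  have hzdU : ∀ τ ∈ Set.Icc (0 : ℝ) 1, zd.path τ ∈ U := fun τ hτ => by
    rcases hτ.2.lt_or_eq with h | rfl
    · exact Or.inl (hzd τ ⟨hτ.1, h⟩)
    · exact Or.inr ⟨hzd1, hzd2, hzd3⟩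
  have hFi := zd.intervalIntegrable_of_continuousOn (φ := F) (by
    rintro z ⟨τ, hτ, rfl⟩
    exact (hFd _ (hzdU τ hτ)).continuousAt.continuousWithinAt)
  have hMi := zd.intervalIntegrable_of_continuousOn (φ := M) (by
    rintro z ⟨τ, hτ, rfl⟩
    exact (hMd _ (hzdU τ hτ)).continuousAt.continuousWithinAt)
  have hsub : zd.integral (fun ζ => (c : ℂ) * (F ζ - M ζ)) =
      c * (zd.integral F - zd.integral M) := by
    simp only [Curve.integral]
    rw [← intervalIntegral.integral_sub hFi hMi, ← intervalIntegral.integral_const_mul]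
    congr 1
    ext τ
    ring
  have hcM : zd.integral (fun ζ => (c : ℂ) * M ζ) = c * zd.integral M := by
    simp only [Curve.integral]
    rw [← intervalIntegral.integral_const_mul]
    congr 1
    ext τ
    ring
  have hcF : zu.integral (fun ζ => (c : ℂ) * F ζ) = c * zu.integral F := by
    simp only [Curve.integral]
    rw [← intervalIntegral.integral_const_mul]
    congr 1
    ext τ
    ring
  have b1 : ‖(c : ℂ) * (zd.integral F - zd.integral M)‖ ≤ 4 * (16 * η * V) * V := by
    rw [← hsub]
    refine zd.norm_integral_le (fun τ hτ => ?_) hVd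
    rw [norm_mul, norm_real, Real.norm_of_nonneg hc0.le, hin τ hτ]
    refine (hW fun γ hγ σ hσ => hGd γ hγ τ hτ σ hσ).trans_eq ?_
    ring
  have b2 : ‖(c : ℂ) * zu.integral F‖ ≤ 4 * (16 * η * V) * V := by
    rw [← hcF]
    refine zu.norm_integral_le (fun τ hτ => ?_) hVu
    have hn := hun τ ⟨hτ.1, hτ.2.le⟩
    rw [norm_mul, norm_real, Real.norm_of_nonneg hc0.le, hout _ hn.1 hn.2]
    refine (hW fun γ hγ σ hσ => hGu γ hγ τ hτ σ hσ).trans_eq ?_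
    ring
  have b3 : ‖(c : ℂ) * ∫ y in Set.Ioi (0 : ℝ), I * F (zu.path 1 + y * I)‖ ≤ 32 * η * V := by
    rw [← MeasureTheory.integral_const_mul]
    have hg : MeasureTheory.IntegrableOn (fun y : ℝ => 16 * η * V * (1 + y ^ 2)⁻¹) (Set.Ioi 0) :=
      (integrable_inv_one_add_sq.const_mul _).integrableOn
    have h := MeasureTheory.norm_integral_le_of_norm_le
      (f := fun y : ℝ => (c : ℂ) * (I * F (zu.path 1 + y * I))) hg ?_
    · refine h.trans ?_
      rw [MeasureTheory.integral_const_mul, integral_Ioi_inv_one_add_sq, Real.arctan_zero, sub_zero]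
      have h16 : 0 ≤ 16 * η * V := by positivity
      have := Real.pi_lt_four
      nlinarith
    · filter_upwards [MeasureTheory.ae_restrict_mem measurableSet_Ioi] with y hy
      have hp := hzu 1 ⟨zero_le_one, le_rfl⟩
      have hn := hun 1 ⟨zero_lt_one, le_rfl⟩
      have n0 := norm_lt_norm_add_mul_I hp hy 0
      have n1 := norm_lt_norm_add_mul_I hp hy 1
      simp only [ofReal_zero, add_zero, ofReal_one] at n0 n1
      rw [norm_mul, norm_mul, norm_I, one_mul, norm_real, Real.norm_of_nonneg hc0.le,
        hout _ (hn.1.trans n0) (hn.2.trans n1)]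
      refine (hW fun γ hγ σ hσ => hGr γ hγ y hy σ hσ).trans_eq ?_
      ring
  have hfin : bernoulliKernel a β t₁ x₁ t₂ x₂ -
      ((if x₂ ≤ x₁ ∧ t₂ < t₁ then
        (-1 : ℂ) ^ (x₁ - x₂ + 1) * ((t₁ - t₂).choose (x₁ - x₂).toNat : ℂ) else 0) +
      ((1 / Real.pi * (zd.integral fun ζ => (c : ℂ) * M ζ).im : ℝ) : ℂ)) =
      ((1 / Real.pi * (c * (zd.integral F - zd.integral M) - c * zu.integral F -
        c * ∫ y in Set.Ioi (0 : ℝ), I * F (zu.path 1 + y * I)).im : ℝ) : ℂ) := by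
    rw [(bernoulliKernel_eq ha hβ0 hβ1 t₁ x₁ ht₂ x₂).2, hscale, hcM]
    have e1 : ∀ z : ℂ, ((c : ℂ) * z).im = c * z.im := fun z => by simp
    have e2 : ∀ z : ℂ, ((T : ℂ) * z).im = T * z.im := fun z => by simp
    rw [e2, hkey, sub_im, sub_im, e1, e1, e1, e1, add_im, sub_im, sub_im, hc]
    push_cast
    ring
  rw [hfin, norm_real, norm_mul, norm_div, norm_one, Real.norm_of_nonneg Real.pi_pos.le]
  have hle : ‖(c * (zd.integral F - zd.integral M) - c * zu.integral F -
        c * ∫ y in Set.Ioi (0 : ℝ), I * F (zu.path 1 + y * I)).im‖ ≤ 160 * (V + 1) ^ 2 * η := by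
    rw [Real.norm_eq_abs]
    refine (abs_im_le_norm _).trans ((norm_sub_le _ _).trans ?_)
    have := norm_sub_le ((c : ℂ) * (zd.integral F - zd.integral M)) (c * zu.integral F)
    have h1 : 0 ≤ η * V := by positivity
    nlinarith [mul_nonneg h1 hV]
  have hp1' : 1 / Real.pi ≤ 1 := by
    rw [div_le_one Real.pi_pos]
    linarith
  calc _ ≤ 1 * _ := mul_le_mul_of_nonneg_right hp1' (norm_nonneg _)
    _ ≤ _ := by rw [one_mul]; exact hle

end

noncomputable section

/-! ### Ratios of Gamma functions at points that differ by an integer -/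

/-- The ratio of `Γ (v + k)` and `Γ v * v ^ k`. -/
def gammaRatio (k : ℤ) (v : ℂ) : ℂ := Gamma (v + k) / (Gamma v * v ^ k)

lemma Gamma_ne_zero_of_mem_slitPlane {v : ℂ} (hv : v ∈ slitPlane) : Gamma v ≠ 0 :=
  Gamma_ne_zero fun m h => by
    rcases hv with h1 | h1
    · have : (0 : ℝ) ≤ m := Nat.cast_nonneg m
      simp [h] at h1
      linarith
    · simp [h] at h1

lemma Gamma_add_int {v : ℂ} (hv : v ∈ slitPlane) (k : ℤ) :
    Gamma (v + k) = gammaRatio k v * Gamma v * v ^ k := by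
  have h1 := Gamma_ne_zero_of_mem_slitPlane hv
  have h2 := zpow_ne_zero k (slitPlane_ne_zero hv)
  rw [gammaRatio]
  field_simp

lemma tendsto_one_add_div (c : ℂ) : Tendsto (fun v : ℂ => (v + c) / v)
    (Bornology.cobounded ℂ ⊓ 𝓟 slitPlane) (𝓝 1) := by
  have h1 : Tendsto (fun v : ℂ => 1 + c * v⁻¹) (Bornology.cobounded ℂ) (𝓝 (1 + c * 0)) :=
    (tendsto_inv₀_cobounded.const_mul c).const_add 1
  rw [mul_zero, add_zero] at h1
  refine (h1.mono_left inf_le_left).congr' ?_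
  filter_upwards [mem_inf_of_right (mem_principal_self _)] with v hv
  have := slitPlane_ne_zero hv
  field_simp

/-- Only integer shifts occur, so the functional equation and induction on `k` in both directions
suffice; no asymptotics of the Gamma function itself is needed. -/
lemma tendsto_gammaRatio (k : ℤ) :
    Tendsto (gammaRatio k) (Bornology.cobounded ℂ ⊓ 𝓟 slitPlane) (𝓝 1) := by
  have hne : ∀ j : ℤ, ∀ᶠ v : ℂ in Bornology.cobounded ℂ ⊓ 𝓟 slitPlane, v + j ≠ 0 := fun j => by
    refine Eventually.filter_mono inf_le_left ?_
    filter_upwards [tendsto_norm_cobounded_atTop.eventually_gt_atTop ‖(j : ℂ)‖] with v hv h0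
    rw [eq_neg_of_add_eq_zero_left h0, norm_neg] at hv
    exact lt_irrefl _ hv
  have hmem : ∀ᶠ v : ℂ in Bornology.cobounded ℂ ⊓ 𝓟 slitPlane, v ∈ slitPlane :=
    mem_inf_of_right (mem_principal_self _)
  induction k with
  | zero =>
    refine tendsto_const_nhds.congr' ?_
    filter_upwards [hmem] with v hv
    have := Gamma_ne_zero_of_mem_slitPlane hv
    simp [gammaRatio, this]
  | succ i ih =>
    have := ih.mul (tendsto_one_add_div i)
    rw [mul_one] at this
    refine this.congr' ?_
    filter_upwards [hmem, hne i] with v hv hvi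
    have h0 := slitPlane_ne_zero hv
    have h1 := Gamma_ne_zero_of_mem_slitPlane hv
    rw [gammaRatio, gammaRatio, zpow_add_one₀ h0]
    push_cast at hvi ⊢
    rw [← add_assoc, Gamma_add_one _ hvi]
    field_simp
  | pred i ih =>
    have := ih.div (tendsto_one_add_div ((-i - 1 : ℤ) : ℂ)) one_ne_zero
    rw [div_one] at this
    refine this.congr' ?_
    filter_upwards [hmem, hne (-i - 1)] with v hv hvi
    have h0 := slitPlane_ne_zero hv
    have h1 := Gamma_ne_zero_of_mem_slitPlane hv
    simp only [Pi.div_apply, gammaRatio, zpow_sub_one₀ h0]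
    have e : v + ((-i : ℤ) : ℂ) = v + ((-i - 1 : ℤ) : ℂ) + 1 := by push_cast; ring
    rw [e, Gamma_add_one _ hvi]
    have := zpow_ne_zero (-i : ℤ) h0
    field_simp

/-- Uniform closeness of `gammaRatio` to `1` far from the origin. -/
lemma exists_gammaRatio_sub_le (k : ℤ) {ε : ℝ} (hε : 0 < ε) :
    ∃ R : ℝ, ∀ v ∈ slitPlane, R ≤ ‖v‖ → ‖gammaRatio k v - 1‖ ≤ ε := by
  have h := (tendsto_gammaRatio k).eventually (Metric.closedBall_mem_nhds 1 hε)
  rw [eventually_inf_principal, ← comap_norm_atTop, eventually_comap] at h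
  obtain ⟨R, hR⟩ := eventually_atTop.1 h
  exact ⟨R, fun v hv hRv => by simpa [dist_eq_norm] using hR ‖v‖ hRv v rfl hv⟩

lemma exists_gammaRatio_bounds (k : ℤ) :
    ∃ R : ℝ, ∀ v ∈ slitPlane, R ≤ ‖v‖ → ‖gammaRatio k v‖ ≤ 2 ∧ 1 / 2 ≤ ‖gammaRatio k v‖ := by
  obtain ⟨R, hR⟩ := exists_gammaRatio_sub_le k (ε := 1 / 2) (by norm_num)
  refine ⟨R, fun v hv hRv => ?_⟩
  have h := hR v hv hRv
  have h1 := norm_sub_norm_le (gammaRatio k v) 1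
  have h2 := norm_sub_norm_le 1 (gammaRatio k v)
  rw [norm_sub_rev] at h2
  rw [norm_one] at h1 h2
  constructor <;> linarith

section

variable {t x : ℤ} {t' T : ℕ} {ℓ : ℝ} {v : ℂ}

lemma mem_slitPlane_of_im (hv : v.im ≠ 0) : v ∈ slitPlane := Or.inr hv

/-- Separates the factor `Γ (v + T) Γ (-v) exp (-ℓ v)`, common to `z` and `w`, from the dependence
on `t` and `x`, which is a power times ratios tending to `1`. -/
lemma zFactor_eq_gammaRatio (ht : (t' : ℤ) = t + T) (hv : v.im ≠ 0) :
    zFactor ℓ t' x v = -(-1) ^ x / Real.pi * (Gamma (v + T) * Gamma (-v) * exp (-(ℓ * v))) *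
      ((v + T) ^ (t - x) * (-v) ^ x) * (gammaRatio (t - x) (v + T) * gammaRatio x (-v)) := by
  have ht' : (t' : ℂ) = t + T := by exact_mod_cast congrArg (Int.cast : ℤ → ℂ) ht
  have h1 := Gamma_add_int (v := v + T) (mem_slitPlane_of_im (by simpa using hv)) (t - x)
  have h2 := Gamma_add_int (v := -v) (mem_slitPlane_of_im (by simpa using hv)) x
  rw [zFactor, ht', show v - x + (t + T) = v + T + (t - x : ℤ) by push_cast; ring,
    show (x : ℂ) - v = -v + x by ring, h1, h2]
  ring

lemma wFactor_eq_gammaRatio (ht : (t' : ℤ) = t + T) (hv : v.im ≠ 0) :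
    wFactor ℓ t' x v = (-1) ^ x * Real.pi / (Gamma (v + T) * Gamma (-v) * exp (-(ℓ * v)) *
      ((v + T) ^ (t + 1 - x) * (-v) ^ (x + 1)) *
        (gammaRatio (t + 1 - x) (v + T) * gammaRatio (x + 1) (-v))) := by
  have ht' : (t' : ℂ) = t + T := by exact_mod_cast congrArg (Int.cast : ℤ → ℂ) ht
  have h1 := Gamma_add_int (v := v + T) (mem_slitPlane_of_im (by simpa using hv)) (t + 1 - x)
  have h2 := Gamma_add_int (v := -v) (mem_slitPlane_of_im (by simpa using hv)) (x + 1)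
  rw [wFactor, ht', show v - x + (t + T) + 1 = v + T + (t + 1 - x : ℤ) by push_cast; ring,
    show 1 + (x : ℂ) - v = -v + (x + 1 : ℤ) by push_cast; ring, h1, h2, exp_neg]
  have := exp_ne_zero (ℓ * v)
  simp only [mul_inv, div_eq_mul_inv, inv_inv]
  ring

/-- The factorials are Gamma values at integer shifts of `T`, so `gammaRatio` applies to them as
well. -/
lemma factorial_div_eq {t₁ t₂ : ℤ} {t₁' t₂' T : ℕ} (hT : 0 < T) (ht₁ : (t₁' : ℤ) = t₁ + T)
    (ht₂ : (t₂' : ℤ) = t₂ + T) (h1 : 1 ≤ t₂') :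
    (((t₁'.factorial : ℝ) / (t₂' - 1).factorial : ℝ) : ℂ) =
      gammaRatio (t₁ + 1) T / gammaRatio t₂ T * (T : ℂ) ^ (t₁ - t₂ + 1) := by
  have hTs : (T : ℂ) ∈ slitPlane := Or.inl (by simpa using hT)
  have hT0 := slitPlane_ne_zero hTs
  have hG := Gamma_ne_zero_of_mem_slitPlane hTs
  have e1 : (t₁'.factorial : ℂ) = Gamma (T + (t₁ + 1 : ℤ)) := by
    rw [← Gamma_nat_eq_factorial]
    congr 1
    have : (t₁' : ℂ) = t₁ + T := by exact_mod_cast congrArg (Int.cast : ℤ → ℂ) ht₁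
    rw [this]
    push_cast
    ring
  have e2 : ((t₂' - 1).factorial : ℂ) = Gamma (T + t₂) := by
    rw [← Gamma_nat_eq_factorial]
    congr 1
    have : (t₂' : ℂ) = t₂ + T := by exact_mod_cast congrArg (Int.cast : ℤ → ℂ) ht₂
    rw [Nat.cast_sub h1, this]
    push_cast
    ring
  push_cast
  have hne : Gamma (T + t₂) ≠ 0 := by
    rw [← e2]
    exact Nat.cast_ne_zero.2 (Nat.factorial_ne_zero _)
  rw [e1, e2, gammaRatio, gammaRatio, show t₁ - t₂ + 1 = t₁ + 1 - t₂ by ring, zpow_sub₀ hT0]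
  have h3 := zpow_ne_zero (t₁ + 1) hT0
  have h4 := zpow_ne_zero t₂ hT0
  field_simp

end

/-- Treats both signs of the exponent at once: `1 + x` takes care of positive ones and `c⁻¹` of
negative ones. -/
lemma zpow_le_mul_one_add_pow {c x : ℝ} (hc : 0 < c) (hc1 : c ≤ 1) (hx : c ≤ x) (m : ℤ) :
    x ^ m ≤ c⁻¹ ^ m.natAbs * (1 + x) ^ m.natAbs := by
  have hx0 : 0 < x := hc.trans_le hx
  have h1 : 1 ≤ c⁻¹ := (one_le_inv₀ hc).2 hc1
  obtain ⟨n, rfl | rfl⟩ := m.eq_nat_or_neg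
  · rw [zpow_natCast, Int.natAbs_natCast, ← one_mul (x ^ n)]
    exact mul_le_mul (one_le_pow₀ h1) (by gcongr; linarith) (by positivity) (by positivity)
  · rw [zpow_neg, zpow_natCast, Int.natAbs_neg, Int.natAbs_natCast, ← inv_pow, ← mul_one (x⁻¹ ^ n)]
    exact mul_le_mul (by gcongr) (one_le_pow₀ (by linarith)) (by positivity) (by positivity)

end

noncomputable section

/-! ### The exponential of the action -/

lemma HasDerivAt.mul_of_log {f g : ℂ → ℂ} {p q v : ℂ} (hf : HasDerivAt f (p * f v) v)
    (hg : HasDerivAt g (q * g v) v) : HasDerivAt (fun v => f v * g v) ((p + q) * (f v * g v)) v := by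
  refine (hf.fun_mul hg).congr_deriv ?_
  ring

lemma hasDerivAt_prod_sub {ι : Type*} (s : Finset ι) (c : ι → ℂ) {v : ℂ}
    (h : ∀ i ∈ s, v - c i ≠ 0) :
    HasDerivAt (fun v => ∏ i ∈ s, (v - c i)) ((∑ i ∈ s, 1 / (v - c i)) * ∏ i ∈ s, (v - c i)) v := by
  classical
  induction s using Finset.induction_on with
  | empty => simpa using hasDerivAt_const v (1 : ℂ)
  | insert i s hi ih =>
    simp only [Finset.prod_insert hi, Finset.sum_insert hi]
    refine HasDerivAt.mul_of_log (f := fun v => v - c i) ?_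
      (ih fun j hj => h j (Finset.mem_insert_of_mem hj))
    refine ((hasDerivAt_id v).sub_const (c i)).congr_deriv ?_
    rw [one_div, inv_mul_cancel₀ (h i (Finset.mem_insert_self i s))]

lemma poch_add_one_eq_prod (T : ℕ) (v : ℂ) :
    poch (v + 1) (T - 1) = ∏ j ∈ Finset.Ioo (-(T : ℤ)) 0, (v - (j : ℂ)) := by
  induction T with
  | zero => simp [poch]
  | succ T ih =>
    rcases Nat.eq_zero_or_pos T with rfl | hT
    · have : Finset.Ioo (-((0 + 1 : ℕ) : ℤ)) 0 = ∅ := by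
        ext j
        simp
        omega
      rw [this]
      simp [poch]
    · obtain ⟨k, rfl⟩ : ∃ k, T = k + 1 := ⟨T - 1, by omega⟩
      have hI : Finset.Ioo (-((k + 1 + 1 : ℕ) : ℤ)) 0 =
          insert (-((k + 1 : ℕ) : ℤ)) (Finset.Ioo (-((k + 1 : ℕ) : ℤ)) 0) := by
        ext j
        simp
        omega
      rw [hI, Finset.prod_insert (by simp), ← ih]
      simp only [Nat.add_sub_cancel]
      rw [poch, poch, ascPochhammer_succ_eval]
      push_cast
      ring

section

variable {N : ℕ} (a : Fin N → ℤ) (ℓ : ℝ) (T : ℕ)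

/-- The function `Γ (v + T) Γ (-v) e ^ (-ℓ v) ∏ (v - a r)`, whose logarithmic derivative is
`pvField a T - ℓ`. -/
def action (v : ℂ) : ℂ := Gamma (v + T) * Gamma (-v) * exp (-(ℓ * v)) * ∏ r, (v - a r)

variable {a T}

lemma action_ne_zero {v : ℂ} (hv : v.im ≠ 0) : action a ℓ T v ≠ 0 := by
  refine mul_ne_zero (mul_ne_zero (mul_ne_zero ?_ ?_) (exp_ne_zero _))
    (Finset.prod_ne_zero_iff.2 fun r _ => sub_int_ne_zero hv _)
  · exact Gamma_ne_zero_of_mem_slitPlane (mem_slitPlane_of_im (by simpa using hv))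
  · exact Gamma_ne_zero_of_mem_slitPlane (mem_slitPlane_of_im (by simpa using hv))

lemma norm_action_conj (v : ℂ) : ‖action a ℓ T ((starRingEnd ℂ) v)‖ = ‖action a ℓ T v‖ := by
  have : action a ℓ T ((starRingEnd ℂ) v) = (starRingEnd ℂ) (action a ℓ T v) := by
    simp only [action, map_mul, map_prod, ← Gamma_conj, ← exp_conj]
    simp
  rw [this, norm_conj]

/-- By the reflection formula `action` is a product of linear factors, an exponential and `1 / sin
(π v)`. Its logarithmic derivative is read off factor by factor, and the sine gives the cotangent of
`pvField_eq`. -/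
lemma hasDerivAt_action (hT : 0 < T) {v : ℂ} (hv : v.im ≠ 0) :
    HasDerivAt (action a ℓ T) ((pvField a T v - ℓ) * action a ℓ T v) v := by
  set P : ℂ → ℂ := fun v => ∏ j ∈ Finset.Ioo (-(T : ℤ)) 0, (v - (j : ℂ))
  set Q : ℂ → ℂ := fun v => ∏ r, (v - (a r : ℂ))
  set e : ℂ → ℂ := fun v => -Real.pi * exp (-(ℓ * v))
  set s : ℂ → ℂ := fun v => (sin (Real.pi * v))⁻¹
  have hev : ∀ᶠ w : ℂ in 𝓝 v, w.im ≠ 0 :=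
    (isOpen_compl_singleton.preimage continuous_im).mem_nhds hv
  have heq : ∀ w : ℂ, w.im ≠ 0 → action a ℓ T w = P w * e w * s w * Q w := fun w hw => by
    have h1 := zFactor_eq ℓ (t₂ := T) hT 0 (mem_integerComplement_of_im hw)
    rw [zFactor] at h1
    simp only [Int.cast_zero, sub_zero, zero_sub, zpow_zero, poch_add_one_eq_prod] at h1
    have hpi : (Real.pi : ℂ) ≠ 0 := by exact_mod_cast Real.pi_ne_zero
    have h2 : Gamma (w + T) * Gamma (-w) * exp (-(ℓ * w)) = P w * e w * s w := by
      simp only [P, e, s]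
      rw [div_eq_iff hpi] at h1
      rw [div_eq_mul_inv] at h1
      linear_combination -h1
    rw [action, h2]
  have hsin : sin (Real.pi * v) ≠ 0 := sin_pi_mul_ne_zero (mem_integerComplement_of_im hv)
  have hP : HasDerivAt P ((∑ j ∈ Finset.Ioo (-(T : ℤ)) 0, 1 / (v - (j : ℂ))) * P v) v :=
    hasDerivAt_prod_sub _ _ fun j _ => sub_int_ne_zero hv _
  have hQ : HasDerivAt Q ((∑ r, 1 / (v - (a r : ℂ))) * Q v) v :=
    hasDerivAt_prod_sub _ _ fun j _ => sub_int_ne_zero hv _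
  have he : HasDerivAt e (-ℓ * e v) v := by
    have := (((hasDerivAt_id v).const_mul (ℓ : ℂ)).fun_neg.cexp).const_mul (-Real.pi : ℂ)
    refine this.congr_deriv ?_
    simp only [e, id]
    ring
  have hs : HasDerivAt s (-(Real.pi * cot (Real.pi * v)) * s v) v := by
    have := (((hasDerivAt_id v).const_mul (Real.pi : ℂ)).csin).fun_inv hsin
    refine this.congr_deriv ?_
    simp only [s, id, cot_eq_cos_div_sin]
    field_simp
  have h := ((hP.mul_of_log he).mul_of_log hs).mul_of_log hQ
  refine (h.congr_of_eventuallyEq (hev.mono fun w hw => heq w hw)).congr_deriv ?_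
  rw [heq v hv, pvField_eq a T hv]
  ring

end

lemma hasDerivAt_log_norm {f : ℝ → ℂ} {q : ℂ} {τ : ℝ} (hf : HasDerivAt f (q * f τ) τ)
    (h0 : f τ ≠ 0) : HasDerivAt (fun s => Real.log ‖f s‖) q.re τ := by
  have h1 := (hf.norm_sq).log (by positivity)
  have h2 := h1.const_mul (1 / 2 : ℝ)
  have e : (fun s => 1 / 2 * Real.log (‖f s‖ ^ 2)) = fun s => Real.log ‖f s‖ := by
    ext s
    rw [Real.log_pow]
    push_cast
    ring
  rw [e] at h2
  refine h2.congr_deriv ?_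
  have h3 : inner ℝ (f τ) (q * f τ) = q.re * ‖f τ‖ ^ 2 := by
    rw [Complex.inner, ← normSq_eq_norm_sq, normSq_apply]
    simp
    ring
  have : ‖f τ‖ ≠ 0 := norm_ne_zero_iff.2 h0
  rw [h3]
  field_simp

lemma le_of_hasDerivAt_nonpos {h h' : ℝ → ℝ} {a b : ℝ} (hab : a ≤ b)
    (hc : ContinuousOn h (Set.Icc a b)) (hd : ∀ s ∈ Set.Ioo a b, HasDerivAt h (h' s) s)
    (hn : ∀ s ∈ Set.Ioo a b, h' s ≤ 0) : h b ≤ h a := by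
  refine antitoneOn_of_deriv_nonpos (convex_Icc a b) hc ?_ ?_ ⟨le_rfl, hab⟩ ⟨hab, le_rfl⟩ hab
  · rw [interior_Icc]
    exact fun s hs => (hd s hs).differentiableAt.differentiableWithinAt
  · rw [interior_Icc]
    exact fun s hs => by
      rw [(hd s hs).deriv]
      exact hn s hs

section

variable {N : ℕ} {a : Fin N → ℤ} {ℓ : ℝ} {T : ℕ} {σ D B : ℝ} {K : ℕ}

/-- The modulus of the action is monotone along an arm. -/
lemma Arm.log_norm_action {zc : ℂ} {e f c₀ C : ℝ} (arm : Arm zc e f c₀ C) (hc₀ : 0 < c₀)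
    (h : RegularWeights (wt a T) (pvField a T) T σ D B K) (hσ : 0 < σ) (hT : 0 < T)
    (hD : D ≤ T / 2) (hc : pvField a T (T * zc) = ℓ) {τ : ℝ} (hτ : τ ∈ Set.Icc (0 : ℝ) 1)
    (him : 0 < (arm.path τ).im) :
    e * f * (Real.log ‖action a ℓ T (T * arm.path τ)‖ - Real.log ‖action a ℓ T (T * zc)‖) ≤
      -(3 * σ * c₀ ^ 2 / (256 * (C + 1) ^ 4) * T * τ ^ 2) := by
  have hT0 : (0 : ℝ) < T := Nat.cast_pos.2 hT
  have hTc : (T : ℂ) ≠ 0 := Nat.cast_ne_zero.2 hT.ne'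
  have hC0 : 0 ≤ C := (norm_nonneg _).trans (arm.norm_le 0 ⟨le_rfl, zero_le_one⟩)
  set c := 3 * σ / (32 * (C + 1) ^ 4) with hcdef
  have hcpos : 0 < c := by positivity
  have himI : ∀ s ∈ Set.Icc 0 τ, 0 < (arm.path s).im := fun s hs => by
    rcases hs.2.lt_or_eq with h1 | rfl
    · exact arm.im_pos s ⟨hs.1, h1.trans_le hτ.2⟩
    · exact him
  have hTim : ∀ z : ℂ, ((T : ℂ) * z).im = T * z.im := fun z => by simp
  have hzim : 0 < zc.im := by
    have := arm.im_pos 0 ⟨le_rfl, one_pos⟩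
    rwa [arm.start] at this
  set L : ℝ → ℝ := fun s => e * f * Real.log ‖action a ℓ T (T * arm.path s)‖ with hL
  have hne : ∀ s ∈ Set.Icc 0 τ, ((T : ℂ) * arm.path s).im ≠ 0 := fun s hs => by
    rw [hTim]
    exact (mul_pos hT0 (himI s hs)).ne'
  have hLc : ContinuousOn L (Set.Icc 0 τ) := by
    refine continuousOn_const.mul (ContinuousOn.log (ContinuousOn.norm fun s hs => ?_) fun s hs =>
      norm_ne_zero_iff.2 (action_ne_zero ℓ (hne s hs)))
    exact ContinuousAt.comp_continuousWithinAt (g := action a ℓ T)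
      (f := fun s => (T : ℂ) * arm.path s) (hasDerivAt_action ℓ hT (hne s hs)).continuousAt
      (continuousWithinAt_const.mul ((arm.cont s ⟨hs.1, hs.2.trans hτ.2⟩).mono
        (Set.Icc_subset_Icc_right hτ.2)))
  have hder : ∀ s ∈ Set.Ioo 0 τ, ∃ d, HasDerivAt L d s ∧ d ≤ 0 ∧
      (s ≤ 1 / 2 → d ≤ -(T * c * c₀ ^ 2 * s)) := fun s hs => by
    have hs1 : s ∈ Set.Ioo (0 : ℝ) 1 := ⟨hs.1, hs.2.trans_le hτ.2⟩
    have hsI := Set.Ioo_subset_Icc_self hs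
    have hsI1 := Set.Ioo_subset_Icc_self hs1
    obtain ⟨κ, h1, h2, h3⟩ := arm.descent s hs1
    set n := nevan (wt a T) T (T * zc) (T * arm.path s) with hn
    have hfac := h.toIsCauchyTransform.factor (T := T) (hne s hsI)
      (vc := T * zc) (c := ℓ) (by rw [hTim]; positivity) hc
    have hnim := h.nevan_im_ge hT hD (v := T * arm.path s) (vc := T * zc) (C := C)
      (by rw [hTim]; exact mul_pos hT0 (himI s hsI)) (by rw [hTim]; positivity)
      (by
        have := arm.norm_le s hsI1
        rw [norm_mul, norm_natCast, mul_comm]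
        gcongr)
      (by
        have := arm.norm_le 0 ⟨le_rfl, zero_le_one⟩
        rw [arm.start] at this
        rw [norm_mul, norm_natCast, mul_comm]
        gcongr)
    rw [hTim, mul_div_cancel_left₀ _ hT0.ne', ← hn, ← hcdef] at hnim
    have hnpos : 0 ≤ n.im := le_trans (mul_nonneg hcpos.le (himI s hsI).le) hnim
    -- The factorization of `pvField - ℓ` meets the descent property of the arm: the real part of
    -- the right side is `-T κ Im n`, of known sign whatever the configuration.
    have hq : (pvField a T (T * arm.path s) - ℓ) * (T * arm.vel s) = T * (I * κ * n) := by
      rw [hfac, ← h1, ← hn, map_mul, map_natCast]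
      have e1 : (T : ℂ) * arm.path s - T * zc = T * (arm.path s - zc) := by ring
      have e2 : (T : ℂ) * arm.path s - T * (starRingEnd ℂ) zc =
        T * (arm.path s - (starRingEnd ℂ) zc) := by ring
      have e3 : (T : ℂ) * arm.path s * (T * arm.path s + T) =
        T * T * (arm.path s * (arm.path s + 1)) := by ring
      have e4 : (T : ℂ) * (arm.path s - zc) * (T * (arm.path s - (starRingEnd ℂ) zc)) =
        T * T * ((arm.path s - zc) * (arm.path s - (starRingEnd ℂ) zc)) := by ring
      rw [e1, e2, e3, e4, mul_div_mul_left _ _ (mul_ne_zero hTc hTc)]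
      ring
    have hd := (hasDerivAt_action (a := a) ℓ hT (hne s hsI)).comp s
      ((arm.hasDerivAt s hs1).const_mul (T : ℂ))
    have hd2 := (hasDerivAt_log_norm (f := fun s => action a ℓ T (T * arm.path s))
      (q := T * (I * κ * n)) (hd.congr_deriv (by rw [← hq]; ring))
      (action_ne_zero ℓ (hne s hsI))).const_mul (e * f)
    have hre : ((T : ℂ) * (I * κ * n)).re = -(T * κ * n.im) := by
      simp
      ring
    refine ⟨_, hd2, ?_, fun hs2 => ?_⟩
    · rw [hre]
      have : 0 ≤ T * (e * f * κ) * n.im := by positivity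
      linarith
    · rw [hre]
      have g1 := h3 hs2
      have g2 := arm.im_ge s ⟨hs.1.le, hs2⟩
      have g3 : c * c₀ ≤ n.im := le_trans (by gcongr) hnim
      have : T * (c₀ * s) * (c * c₀) ≤ T * (e * f * κ) * n.im := by
        have := hs.1.le
        gcongr
      linarith
  choose! d hd1 hd2 hd3 using hder
  -- Quadratic gain is available only up to `τ = 1 / 2`, where the ordinate is bounded below;
  -- afterwards mere monotonicity is used, whence the constant `1 / 8` in the final bound.
  have key : ∀ b, 0 ≤ b → b ≤ τ → b ≤ 1 / 2 → L b + T * c * c₀ ^ 2 / 2 * b ^ 2 ≤ L 0 :=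
    fun b hb hbτ hb2 => by
      have := le_of_hasDerivAt_nonpos (h := fun s => L s + T * c * c₀ ^ 2 / 2 * s ^ 2)
        (h' := fun s => d s + T * c * c₀ ^ 2 / 2 * (2 * s)) hb
        ((hLc.mono (Set.Icc_subset_Icc_right hbτ)).add (by fun_prop))
        (fun s hs => by
          refine (hd1 s ⟨hs.1, hs.2.trans_le hbτ⟩).fun_add ?_
          have := (hasDerivAt_pow 2 s).const_mul (T * c * c₀ ^ 2 / 2)
          refine this.congr_deriv ?_
          norm_num)
        (fun s hs => by
          have := hd3 s ⟨hs.1, hs.2.trans_le hbτ⟩ (hs.2.le.trans hb2)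
          linarith)
      simpa using this
  have hL0 : L 0 = e * f * Real.log ‖action a ℓ T (T * zc)‖ := by simp only [hL, arm.start]
  have hgoal : L τ - L 0 ≤ -(T * c * c₀ ^ 2 / 8 * τ ^ 2) := by
    have hμ : 0 ≤ T * c * c₀ ^ 2 := by positivity
    rcases le_total τ (1 / 2) with h1 | h1
    · have := key τ hτ.1 le_rfl h1
      have : T * c * c₀ ^ 2 / 8 * τ ^ 2 ≤ T * c * c₀ ^ 2 / 2 * τ ^ 2 := by gcongr; norm_num
      linarith
    · have g1 := key (1 / 2) (by norm_num) h1 le_rfl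
      have g2 := le_of_hasDerivAt_nonpos (h := L) (h' := d) h1
        (hLc.mono (Set.Icc_subset_Icc_left (by norm_num)))
        (fun s hs => hd1 s ⟨lt_trans (by norm_num) hs.1, hs.2⟩)
        (fun s hs => hd2 s ⟨lt_trans (by norm_num) hs.1, hs.2⟩)
      have : T * c * c₀ ^ 2 / 8 * τ ^ 2 ≤ T * c * c₀ ^ 2 / 8 * 1 := by
        gcongr
        exact pow_le_one₀ hτ.1 hτ.2
      linarith
  rw [mul_sub, ← hL0]
  refine hgoal.trans_eq ?_
  rw [hcdef]
  field_simp
  ring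

/-- The modulus of the action decays along vertical rays far from the origin. -/
lemma log_norm_action_ray (h : RegularWeights (wt a T) (pvField a T) T σ D B K)
    (hσ1 : σ ≤ 1) (hK : 12 ≤ σ * K) (hT : 0 < T) (hD : D ≤ K * T) {p : ℂ} (hp : 0 < p.im)
    (hpK : K ≤ ‖p‖) {y : ℝ} (hy : 0 < y) :
    Real.log ‖action a ℓ T (T * (p + y * I))‖ - Real.log ‖action a ℓ T (T * p)‖ ≤
      T * (Real.log ‖p‖ - Real.log ‖p + y * I‖) := by
  have hT0 : (0 : ℝ) < T := Nat.cast_pos.2 hT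
  have hTim : ∀ z : ℂ, ((T : ℂ) * z).im = T * z.im := fun z => by simp
  have him : ∀ s : ℝ, 0 ≤ s → 0 < (p + s * I).im := fun s hs => by
    simp
    linarith
  have hne : ∀ s : ℝ, 0 ≤ s → ((T : ℂ) * (p + s * I)).im ≠ 0 := fun s hs => by
    rw [hTim]
    exact (mul_pos hT0 (him s hs)).ne'
  have h0 : ∀ s : ℝ, 0 ≤ s → p + s * I ≠ 0 := fun s hs h0 => by
    have := him s hs
    rw [h0] at this
    simp at this
  have hl : ∀ s : ℝ, HasDerivAt (fun y : ℝ => p + y * I) I s := fun s => by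
    simpa using ((ofRealCLM.hasDerivAt (x := s)).mul_const I).const_add p
  have hd : ∀ s : ℝ, 0 ≤ s → HasDerivAt
      (fun s : ℝ => Real.log ‖action a ℓ T (T * (p + s * I))‖ + T * Real.log ‖p + s * I‖)
      ((T * I * (pvField a T (T * (p + s * I)) - ℓ)).re + T * (I / (p + s * I)).re) s :=
    fun s hs => by
      refine HasDerivAt.fun_add ?_ (HasDerivAt.const_mul _ ?_)
      · refine hasDerivAt_log_norm (f := fun s : ℝ => action a ℓ T (T * (p + s * I))) ?_
          (action_ne_zero ℓ (hne s hs))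
        have := (hasDerivAt_action (a := a) ℓ hT (hne s hs)).comp s ((hl s).const_mul (T : ℂ))
        exact this.congr_deriv (by ring)
      · refine hasDerivAt_log_norm (f := fun s : ℝ => p + s * I) ((hl s).congr_deriv ?_) (h0 s hs)
        rw [div_mul_cancel₀ _ (h0 s hs)]
  -- With `T log |p + s i|` added, the logarithm is still nonincreasing, because `energy_le` bounds
  -- its derivative by the negative of the derivative of that term. So the action decays along the
  -- ray like the power `-T` of the modulus.
  have hle := le_of_hasDerivAt_nonpos hy.le
    (fun s hs => (hd s hs.1).continuousAt.continuousWithinAt) (fun s hs => hd s hs.1.le)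
    fun s hs => by
      set z := p + s * I with hz
      have hzp := him s hs.1.le
      have hnz : 0 < ‖z‖ := norm_pos_iff.2 (h0 s hs.1.le)
      have hpz : ‖p‖ ≤ ‖z‖ := by
        have := norm_lt_norm_add_mul_I hp hs.1 0
        simp only [ofReal_zero, add_zero] at this
        exact this.le
      have hen := h.energy_le hK hσ1 hD hT (hne s hs.1.le) (by
        rw [norm_mul, norm_natCast, mul_comm]
        have := hpK.trans hpz
        gcongr)
      have hS := h.toIsCauchyTransform.im_eq (hne s hs.1.le)
      rw [← hz] at hS hen hzp
      rw [norm_mul, norm_natCast] at hen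
      have e1 : ((T : ℂ) * I * (pvField a T (T * z) - ℓ)).re = -(T * (pvField a T (T * z)).im) := by
        simp
      have e2 : (I / z).re = z.im / ‖z‖ ^ 2 := by
        rw [div_re, ← normSq_eq_norm_sq]
        simp
      rw [e1, e2, hS, hTim]
      have hfin : T * (T * z.im) * energy (wt a T) (T * z) ≤
          T * (T * z.im) * -(T / (T * ‖z‖) ^ 2) := by
        have : 0 ≤ T * (T * z.im) := by positivity
        gcongr
      have e3 : T * (T * z.im) * -(T / (T * ‖z‖) ^ 2) = -(T * (z.im / ‖z‖ ^ 2)) := by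
        field_simp
      linarith
  simp only [ofReal_zero, zero_mul, add_zero] at hle
  linarith

end

end

noncomputable section

/-! ### The size of the double contour integrand -/

/-- The power and Gamma ratio corrections to the action. -/
def powerFactor (p q : ℤ) (T : ℕ) (v : ℂ) : ℂ :=
  (v + T) ^ p * (-v) ^ q * (gammaRatio p (v + T) * gammaRatio q (-v))

lemma norm_neg_one_zpow (n : ℤ) : ‖((-1 : ℂ) ^ n)‖ = 1 := by simp

section

variable {N : ℕ} {a : Fin N → ℤ} {ℓ : ℝ} {t₁ x₁ t₂ x₂ : ℤ} {t₁' t₂' T : ℕ}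

/-- The product over particles joins the common Gamma and exponential factors to form `action`,
leaving only power corrections. -/
lemma norm_scaledIntegrand (hT : 0 < T) (ht₁ : (t₁' : ℤ) = t₁ + T) (ht₂ : (t₂' : ℤ) = t₂ + T)
    {ζ ω : ℂ} (hζ : ζ.im ≠ 0) (hω : ω.im ≠ 0) :
    ‖scaledIntegrand a ℓ t₁' x₁ t₂' x₂ T ζ ω‖ =
      ‖action a ℓ T (T * ζ)‖ / ‖action a ℓ T (T * ω)‖ * (1 / ‖ω - ζ‖) *
        (‖powerFactor (t₂ - x₂) x₂ T (T * ζ)‖ /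
          ‖powerFactor (t₁ + 1 - x₁) (x₁ + 1) T (T * ω)‖) := by
  have hTc : (T : ℂ) ≠ 0 := Nat.cast_ne_zero.2 hT.ne'
  have hTim : ∀ {z : ℂ}, z.im ≠ 0 → ((T : ℂ) * z).im ≠ 0 := fun {z} hz => by
    simpa using ⟨hT.ne', hz⟩
  have hprod : ∏ r, (ζ - ((a r / T : ℝ) : ℂ)) / (ω - ((a r / T : ℝ) : ℂ)) =
      (∏ r, ((T : ℂ) * ζ - a r)) / ∏ r, ((T : ℂ) * ω - a r) := by
    rw [← Finset.prod_div_distrib]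
    refine Finset.prod_congr rfl fun r _ => ?_
    rw [← mul_div_mul_left _ _ hTc, mul_sub, mul_sub]
    push_cast
    rw [mul_div_cancel₀ _ hTc]
  rw [scaledIntegrand, nodeKernel, hprod, zFactor_eq_gammaRatio ht₂ (hTim hζ),
    wFactor_eq_gammaRatio ht₁ (hTim hω), action, action, powerFactor, powerFactor]
  have hpi : ‖(Real.pi : ℂ)‖ ≠ 0 := by simp [Real.pi_ne_zero]
  simp only [norm_mul, norm_div, norm_neg, norm_neg_one_zpow, norm_one]
  generalize ‖(Real.pi : ℂ)‖ = ϖ at *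
  simp only [div_eq_mul_inv, mul_inv, one_mul]
  linear_combination (‖Gamma (T * ζ + T)‖ * ‖Gamma (-(T * ζ))‖ * ‖exp (-(ℓ * (T * ζ)))‖ *
    ‖((T : ℂ) * ζ + T) ^ (t₂ - x₂)‖ * ‖(-((T : ℂ) * ζ)) ^ x₂‖ * ‖gammaRatio (t₂ - x₂) (T * ζ + T)‖ *
    ‖gammaRatio x₂ (-(T * ζ))‖ * ‖Gamma (T * ω + T)‖⁻¹ * ‖Gamma (-(T * ω))‖⁻¹ *
    ‖exp (-(ℓ * (T * ω)))‖⁻¹ * ‖((T : ℂ) * ω + T) ^ (t₁ + 1 - x₁)‖⁻¹ *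
    ‖(-((T : ℂ) * ω)) ^ (x₁ + 1)‖⁻¹ * ‖gammaRatio (t₁ + 1 - x₁) (T * ω + T)‖⁻¹ *
    ‖gammaRatio (x₁ + 1) (-(T * ω))‖⁻¹ * ‖∏ r, ((T : ℂ) * ζ - a r)‖ *
    ‖∏ r, ((T : ℂ) * ω - a r)‖⁻¹ * ‖ω - ζ‖⁻¹) * mul_inv_cancel₀ hpi

lemma norm_powerFactor {p q : ℤ} (v : ℂ) (hT : 0 < T) : ‖powerFactor p q T (T * v)‖ =
    (T : ℝ) ^ (p + q) * (‖v + 1‖ ^ p * ‖v‖ ^ q) *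
      (‖gammaRatio p (T * v + T)‖ * ‖gammaRatio q (-(T * v))‖) := by
  have hT0 : (T : ℝ) ≠ 0 := Nat.cast_ne_zero.2 hT.ne'
  rw [powerFactor, show (T : ℂ) * v + T = T * (v + 1) by ring]
  simp only [norm_mul, norm_zpow, norm_neg, norm_natCast, mul_zpow]
  rw [zpow_add₀ hT0]
  ring

end

/-- Far from the origin the power factors are bounded above and below by powers. -/
lemma exists_powerFactor_bounds (p q : ℤ) {c₀ : ℝ} (hc₀ : 0 < c₀) :
    ∃ T₀ : ℕ, ∀ T : ℕ, T₀ ≤ T → 0 < T → ∀ v : ℂ, v.im ≠ 0 → c₀ ≤ ‖v‖ → c₀ ≤ ‖v + 1‖ →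
      ‖powerFactor p q T (T * v)‖ ≤ 4 * ((T : ℝ) ^ (p + q) * (‖v + 1‖ ^ p * ‖v‖ ^ q)) ∧
      (T : ℝ) ^ (p + q) * (‖v + 1‖ ^ p * ‖v‖ ^ q) ≤ 4 * ‖powerFactor p q T (T * v)‖ := by
  obtain ⟨R1, hR1⟩ := exists_gammaRatio_bounds p
  obtain ⟨R2, hR2⟩ := exists_gammaRatio_bounds q
  obtain ⟨T₀, hT₀⟩ := exists_nat_ge (max R1 R2 / c₀)
  refine ⟨T₀, fun T hT hTp v hv h0 h1 => ?_⟩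
  have hT' : max R1 R2 ≤ T * c₀ := by
    have : (T₀ : ℝ) ≤ T := Nat.cast_le.2 hT
    exact (div_le_iff₀ hc₀).1 (hT₀.trans this)
  have hTim : ((T : ℂ) * v).im ≠ 0 := by simpa using ⟨hTp.ne', hv⟩
  have e1 := hR1 (T * v + T) (mem_slitPlane_of_im (by simpa using hTim)) (by
    rw [show (T : ℂ) * v + T = T * (v + 1) by ring, norm_mul, norm_natCast]
    exact (le_max_left _ _).trans (hT'.trans (by gcongr)))
  have e2 := hR2 (-(T * v)) (mem_slitPlane_of_im (by simpa using hTim)) (by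
    rw [norm_neg, norm_mul, norm_natCast]
    exact (le_max_right _ _).trans (hT'.trans (by gcongr)))
  rw [norm_powerFactor v hTp]
  have hP : 0 ≤ (T : ℝ) ^ (p + q) * (‖v + 1‖ ^ p * ‖v‖ ^ q) := by positivity
  have u1 : ‖gammaRatio p (T * v + T)‖ * ‖gammaRatio q (-(T * v))‖ ≤ 2 * 2 :=
    mul_le_mul e1.1 e2.1 (norm_nonneg _) (by norm_num)
  have u2 : 1 / 2 * (1 / 2) ≤ ‖gammaRatio p (T * v + T)‖ * ‖gammaRatio q (-(T * v))‖ :=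
    mul_le_mul e1.2 e2.2 (by norm_num) (norm_nonneg _)
  constructor <;> nlinarith

lemma exists_factorial_div_le (t₁ t₂ : ℤ) :
    ∃ T₀ : ℕ, ∀ T t₁' t₂' : ℕ, T₀ ≤ T → 0 < T → (t₁' : ℤ) = t₁ + T → (t₂' : ℤ) = t₂ + T →
      1 ≤ t₂' → (t₁'.factorial : ℝ) / (t₂' - 1).factorial ≤ 4 * (T : ℝ) ^ (t₁ - t₂ + 1) := by
  obtain ⟨R1, hR1⟩ := exists_gammaRatio_bounds (t₁ + 1)
  obtain ⟨R2, hR2⟩ := exists_gammaRatio_bounds t₂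
  obtain ⟨T₀, hT₀⟩ := exists_nat_ge (max R1 R2)
  refine ⟨T₀, fun T t₁' t₂' hT hTp ht₁ ht₂ h1 => ?_⟩
  have hTs : (T : ℂ) ∈ slitPlane := Or.inl (by simpa using hTp)
  have hTT : max R1 R2 ≤ ‖(T : ℂ)‖ := by
    rw [norm_natCast]
    exact hT₀.trans (Nat.cast_le.2 hT)
  have e1 := (hR1 T hTs ((le_max_left _ _).trans hTT)).1
  have e2 := (hR2 T hTs ((le_max_right _ _).trans hTT)).2
  have h := congrArg norm (factorial_div_eq hTp ht₁ ht₂ h1)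
  rw [norm_real, Real.norm_of_nonneg (by positivity), norm_mul, norm_div, norm_zpow,
    norm_natCast] at h
  rw [h]
  have : ‖gammaRatio (t₁ + 1) T‖ / ‖gammaRatio t₂ T‖ ≤ 2 / (1 / 2) :=
    div_le_div₀ (by norm_num) e1 (by norm_num) e2
  gcongr
  linarith

/-- All powers of `T` cancel: `t₁ - t₂ + 1` from the factorials, `1` from rescaling the double
integral, `t₂` and `-(t₁ + 2)` from the power factors. No bound on `ζ` is assumed because `ζ` also
runs over a ray. -/
lemma exists_scaledIntegrand_le (t₁ x₁ t₂ x₂ : ℤ) {c₀ C : ℝ} (hc₀ : 0 < c₀) (hC : 0 ≤ C) :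
    ∃ M > 0, ∃ T₀ : ℕ, ∀ T t₁' t₂' : ℕ, T₀ ≤ T → 0 < T → (t₁' : ℤ) = t₁ + T →
      (t₂' : ℤ) = t₂ + T → 1 ≤ t₂' → ∀ (N : ℕ) (a : Fin N → ℤ) (ℓ : ℝ) (ζ ω : ℂ), ζ.im ≠ 0 →
      ω.im ≠ 0 → c₀ ≤ ‖ζ‖ → c₀ ≤ ‖ζ + 1‖ → c₀ ≤ ‖ω‖ → c₀ ≤ ‖ω + 1‖ → ‖ω‖ ≤ C →
      (t₁'.factorial : ℝ) / (t₂' - 1).factorial * T *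
        ‖scaledIntegrand a ℓ t₁' x₁ t₂' x₂ T ζ ω‖ ≤
        M * (1 + ‖ζ‖) ^ ((t₂ - x₂).natAbs + x₂.natAbs) *
          (‖action a ℓ T (T * ζ)‖ / ‖action a ℓ T (T * ω)‖) * (1 / ‖ω - ζ‖) := by
  set c := min c₀ 1 with hc
  have hc0 : 0 < c := lt_min hc₀ one_pos
  have hc1 : c ≤ 1 := min_le_right _ _
  have hcc : c ≤ c₀ := min_le_left _ _
  obtain ⟨T₁, hT₁⟩ := exists_powerFactor_bounds (t₂ - x₂) x₂ hc₀
  obtain ⟨T₂, hT₂⟩ := exists_powerFactor_bounds (t₁ + 1 - x₁) (x₁ + 1) hc₀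
  obtain ⟨T₃, hT₃⟩ := exists_factorial_div_le t₁ t₂
  set m₁ := (t₂ - x₂).natAbs
  set m₂ := x₂.natAbs
  set m₃ := (-(t₁ + 1 - x₁)).natAbs
  set m₄ := (-(x₁ + 1)).natAbs
  refine ⟨64 * (c⁻¹ ^ m₁ * 2 ^ m₁ * c⁻¹ ^ m₂) *
    (c⁻¹ ^ m₃ * (2 + C) ^ m₃ * (c⁻¹ ^ m₄ * (2 + C) ^ m₄)), by positivity, max T₁ (max T₂ T₃),
    fun T t₁' t₂' hT hTp ht₁ ht₂ h1 N a ℓ ζ ω hζ hω z0 z1 w0 w1 wC => ?_⟩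
  have hT0 : (0 : ℝ) < T := Nat.cast_pos.2 hTp
  obtain ⟨hA, -⟩ := hT₁ T ((le_max_left _ _).trans hT) hTp ζ hζ z0 z1
  obtain ⟨-, hB⟩ := hT₂ T ((le_max_left _ _).trans ((le_max_right _ _).trans hT)) hTp ω hω w0 w1
  have hF := hT₃ T t₁' t₂' ((le_max_right _ _).trans ((le_max_right _ _).trans hT)) hTp ht₁ ht₂ h1
  rw [norm_scaledIntegrand hTp ht₁ ht₂ hζ hω]
  set A := ‖powerFactor (t₂ - x₂) x₂ T (T * ζ)‖
  set B := ‖powerFactor (t₁ + 1 - x₁) (x₁ + 1) T (T * ω)‖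
  have w0' : 0 < ‖ω‖ := hc₀.trans_le w0
  have w1' : 0 < ‖ω + 1‖ := hc₀.trans_le w1
  have hζ1 : ‖ζ + 1‖ ≤ ‖ζ‖ + 1 := (norm_add_le _ _).trans (by simp)
  have hω1 : ‖ω + 1‖ ≤ C + 1 := (norm_add_le _ _).trans (by simpa using wC)
  have p1 : ‖ζ + 1‖ ^ (t₂ - x₂) ≤ c⁻¹ ^ m₁ * 2 ^ m₁ * (1 + ‖ζ‖) ^ m₁ := by
    refine (zpow_le_mul_one_add_pow hc0 hc1 (hcc.trans z1) _).trans ?_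
    have : 1 + ‖ζ + 1‖ ≤ 2 * (1 + ‖ζ‖) := by linarith [norm_nonneg ζ]
    calc c⁻¹ ^ m₁ * (1 + ‖ζ + 1‖) ^ m₁ ≤ c⁻¹ ^ m₁ * (2 * (1 + ‖ζ‖)) ^ m₁ := by gcongr
      _ = _ := by rw [mul_pow]; ring
  have p2 : ‖ζ‖ ^ x₂ ≤ c⁻¹ ^ m₂ * (1 + ‖ζ‖) ^ m₂ :=
    zpow_le_mul_one_add_pow hc0 hc1 (hcc.trans z0) _
  have p3 : ‖ω + 1‖ ^ (-(t₁ + 1 - x₁)) ≤ c⁻¹ ^ m₃ * (2 + C) ^ m₃ := by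
    refine (zpow_le_mul_one_add_pow hc0 hc1 (hcc.trans w1) _).trans ?_
    have : 1 + ‖ω + 1‖ ≤ 2 + C := by linarith
    gcongr
  have p4 : ‖ω‖ ^ (-(x₁ + 1)) ≤ c⁻¹ ^ m₄ * (2 + C) ^ m₄ := by
    refine (zpow_le_mul_one_add_pow hc0 hc1 (hcc.trans w0) _).trans ?_
    have : 1 + ‖ω‖ ≤ 2 + C := by linarith
    gcongr
  have hBinv : 1 / B ≤ 4 * ((T : ℝ) ^ (-(t₁ + 2)) *
      (‖ω + 1‖ ^ (-(t₁ + 1 - x₁)) * ‖ω‖ ^ (-(x₁ + 1)))) := by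
    rw [show t₁ + 1 - x₁ + (x₁ + 1) = t₁ + 2 by ring] at hB
    have hpos : 0 < (T : ℝ) ^ (t₁ + 2) * (‖ω + 1‖ ^ (t₁ + 1 - x₁) * ‖ω‖ ^ (x₁ + 1)) := by positivity
    have hBp : 0 < B := by linarith
    rw [zpow_neg, zpow_neg, zpow_neg, ← mul_inv, ← mul_inv, div_le_iff₀ hBp, mul_assoc,
      inv_mul_eq_div, ← mul_div_assoc, le_div_iff₀ hpos, one_mul]
    exact hB
  have hAle : A ≤ 4 * ((T : ℝ) ^ t₂ * ((c⁻¹ ^ m₁ * 2 ^ m₁ * (1 + ‖ζ‖) ^ m₁) *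
      (c⁻¹ ^ m₂ * (1 + ‖ζ‖) ^ m₂))) := by
    rw [show t₂ - x₂ + x₂ = t₂ by ring] at hA
    refine hA.trans ?_
    gcongr
  have hBle : 1 / B ≤ 4 * ((T : ℝ) ^ (-(t₁ + 2)) * (c⁻¹ ^ m₃ * (2 + C) ^ m₃ *
      (c⁻¹ ^ m₄ * (2 + C) ^ m₄))) := by
    refine hBinv.trans ?_
    gcongr
  have hTpow : (T : ℝ) ^ (t₁ - t₂ + 1) * T * (T : ℝ) ^ t₂ * (T : ℝ) ^ (-(t₁ + 2)) = 1 := by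
    rw [← zpow_add_one₀ hT0.ne', ← zpow_add₀ hT0.ne', ← zpow_add₀ hT0.ne',
      show t₁ - t₂ + 1 + 1 + t₂ + -(t₁ + 2) = 0 by ring, zpow_zero]
  have hmain : (t₁'.factorial : ℝ) / (t₂' - 1).factorial * T * (A * (1 / B)) ≤
      64 * (c⁻¹ ^ m₁ * 2 ^ m₁ * c⁻¹ ^ m₂) * (c⁻¹ ^ m₃ * (2 + C) ^ m₃ * (c⁻¹ ^ m₄ * (2 + C) ^ m₄)) *
        (1 + ‖ζ‖) ^ (m₁ + m₂) := by
    have hB0 : 0 ≤ 1 / B := by positivity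
    calc _ ≤ 4 * (T : ℝ) ^ (t₁ - t₂ + 1) * T * ((4 * ((T : ℝ) ^ t₂ *
          ((c⁻¹ ^ m₁ * 2 ^ m₁ * (1 + ‖ζ‖) ^ m₁) * (c⁻¹ ^ m₂ * (1 + ‖ζ‖) ^ m₂)))) *
          (4 * ((T : ℝ) ^ (-(t₁ + 2)) * (c⁻¹ ^ m₃ * (2 + C) ^ m₃ *
            (c⁻¹ ^ m₄ * (2 + C) ^ m₄))))) := by gcongr
      _ = ((T : ℝ) ^ (t₁ - t₂ + 1) * T * (T : ℝ) ^ t₂ * (T : ℝ) ^ (-(t₁ + 2))) *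
          (64 * (c⁻¹ ^ m₁ * 2 ^ m₁ * c⁻¹ ^ m₂) *
          (c⁻¹ ^ m₃ * (2 + C) ^ m₃ * (c⁻¹ ^ m₄ * (2 + C) ^ m₄)) * (1 + ‖ζ‖) ^ (m₁ + m₂)) := by
        rw [pow_add]
        ring
      _ = _ := by rw [hTpow, one_mul]
  set q := ‖action a ℓ T (T * ζ)‖ / ‖action a ℓ T (T * ω)‖ * (1 / ‖ω - ζ‖) with hq
  have hq0 : 0 ≤ q := by positivity
  calc _ = (t₁'.factorial : ℝ) / (t₂' - 1).factorial * T * (A * (1 / B)) * q := by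
        rw [div_eq_mul_one_div A B]
        ring
    _ ≤ _ := mul_le_mul_of_nonneg_right hmain hq0
    _ = _ := by
      rw [hq]
      ring

end

noncomputable section

/-! ### The contribution of the double contour integral vanishes -/

namespace Arm

variable {zc : ℂ} {e f c₀ C : ℝ}

/-- The underlying curve of an arm. -/
def curve (γ : Arm zc e f c₀ C) : Curve where
  path := γ.path
  vel := γ.vel
  cont := γ.cont
  hasDerivAt := γ.hasDerivAt
  vel_cont := γ.vel_cont
  vel_bound := ⟨C, γ.vel_bound⟩

/-- The loop formed by the two arms along which the action grows. -/
def loop (wl : Arm zc 1 (-1) c₀ C) (wr : Arm zc (-1) 1 c₀ C) (hc₀ : 0 < c₀)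
    (hl : (wl.path 1).im = 0) (hr : (wr.path 1).im = 0) : Loop zc where
  l := wl.curve
  r := wr.curve
  start_l := wl.start
  start_r := wr.start
  im_l := wl.im_pos
  im_r := wr.im_pos
  end_l := hl
  end_r := hr
  norm_l τ hτ := by
    have := wl.grow τ hτ
    have := mul_nonneg hc₀.le hτ.1
    change ‖zc‖ ≤ ‖wl.path τ‖
    linarith
  norm_r τ hτ := by
    have := wr.grow τ hτ
    have := mul_nonneg hc₀.le hτ.1
    change ‖wr.path τ‖ ≤ ‖zc‖
    linarith
  norm_add_one_l τ hτ := by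
    have := wl.grow_add_one τ hτ
    have := mul_nonneg hc₀.le hτ.1
    change ‖wl.path τ + 1‖ ≤ ‖zc + 1‖
    linarith
  norm_add_one_r τ hτ := by
    have := wr.grow_add_one τ hτ
    have := mul_nonneg hc₀.le hτ.1
    change ‖zc + 1‖ ≤ ‖wr.path τ + 1‖
    linarith

end Arm

lemma Real.exp_neg_le_rpow_neg {x s : ℝ} (hx : 0 < x) (hs : 0 ≤ s) (hs1 : s ≤ 1) :
    Real.exp (-x) ≤ x ^ (-s) := by
  rw [Real.exp_neg, Real.rpow_neg hx.le]
  refine inv_anti₀ (by positivity) ?_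
  have h := Real.add_one_le_exp x
  rcases le_total x 1 with h1 | h1
  · have := Real.rpow_le_one hx.le h1 hs
    linarith
  · have := Real.rpow_le_rpow_of_exponent_le h1 hs1
    rw [Real.rpow_one] at this
    linarith

/-- `exp (-x) ≤ x ^ (-1/8)` for each Gaussian and `1 / (τ + σ) ≤ (τ σ) ^ (-1/2)` for the singularity
at the common starting point. The resulting exponents `-3/4` are integrable, and a power of `μ` is
gained. -/
lemma exp_mul_exp_div_le {μ τ σ : ℝ} (hμ : 0 < μ) (hτ : 0 < τ) (hσ : 0 < σ) :
    Real.exp (-(μ * τ ^ 2)) * Real.exp (-(μ * σ ^ 2)) * (1 / (τ + σ)) ≤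
      μ ^ (-(1 / 4) : ℝ) * τ ^ (-(3 / 4) : ℝ) * σ ^ (-(3 / 4) : ℝ) := by
  have h1 : ∀ x : ℝ, 0 < x → Real.exp (-(μ * x ^ 2)) ≤ μ ^ (-(1 / 8) : ℝ) * x ^ (-(1 / 4) : ℝ) :=
    fun x hx => by
      refine (Real.exp_neg_le_rpow_neg (s := 1 / 8) (by positivity) (by norm_num)
        (by norm_num)).trans_eq ?_
      rw [Real.mul_rpow hμ.le (by positivity), ← Real.rpow_natCast x 2, ← Real.rpow_mul hx.le]
      norm_num
  have h2 : 1 / (τ + σ) ≤ τ ^ (-(1 / 2) : ℝ) * σ ^ (-(1 / 2) : ℝ) := by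
    rw [Real.rpow_neg hτ.le, Real.rpow_neg hσ.le, ← mul_inv, one_div, ← Real.sqrt_eq_rpow,
      ← Real.sqrt_eq_rpow]
    refine inv_anti₀ (by positivity) ?_
    nlinarith [Real.sq_sqrt hτ.le, Real.sq_sqrt hσ.le, sq_nonneg (√τ - √σ), Real.sqrt_nonneg τ,
      Real.sqrt_nonneg σ, mul_nonneg (Real.sqrt_nonneg τ) (Real.sqrt_nonneg σ)]
  have h3 : ∀ x : ℝ, 0 < x → x ^ (-(1 / 4) : ℝ) * x ^ (-(1 / 2) : ℝ) = x ^ (-(3 / 4) : ℝ) :=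
    fun x hx => by
      rw [← Real.rpow_add hx]
      norm_num
  calc _ ≤ μ ^ (-(1 / 8) : ℝ) * τ ^ (-(1 / 4) : ℝ) * (μ ^ (-(1 / 8) : ℝ) * σ ^ (-(1 / 4) : ℝ)) *
        (τ ^ (-(1 / 2) : ℝ) * σ ^ (-(1 / 2) : ℝ)) := by
        gcongr
        · exact h1 τ hτ
        · exact h1 σ hσ
    _ = (μ ^ (-(1 / 8) : ℝ) * μ ^ (-(1 / 8) : ℝ)) * (τ ^ (-(1 / 4) : ℝ) * τ ^ (-(1 / 2) : ℝ)) *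
        (σ ^ (-(1 / 4) : ℝ) * σ ^ (-(1 / 2) : ℝ)) := by ring
    _ = _ := by
        rw [h3 τ hτ, h3 σ hσ, ← Real.rpow_add hμ]
        norm_num

section

variable {N : ℕ} {a : Fin N → ℤ} {ℓ : ℝ} {T : ℕ}

lemma norm_action_div_eq {v w : ℂ} (hv : v.im ≠ 0) (hw : w.im ≠ 0) :
    ‖action a ℓ T v‖ / ‖action a ℓ T w‖ =
      Real.exp (Real.log ‖action a ℓ T v‖ - Real.log ‖action a ℓ T w‖) := by
  rw [Real.exp_sub, Real.exp_log (norm_pos_iff.2 (action_ne_zero ℓ hv)),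
    Real.exp_log (norm_pos_iff.2 (action_ne_zero ℓ hw))]

/-- Properties of the points `ω` at time `σ` on the loop. -/
structure LoopPoint (a : Fin N → ℤ) (ℓ : ℝ) (T : ℕ) (zc : ℂ) (c₀ C μ R σ : ℝ) (ω : ℂ) : Prop where
  im_ne : ω.im ≠ 0
  le_norm : c₀ ≤ ‖ω‖
  le_norm_add_one : c₀ ≤ ‖ω + 1‖
  norm_le : ‖ω‖ ≤ C
  log_ge : Real.log ‖action a ℓ T (T * zc)‖ + μ * σ ^ 2 ≤ Real.log ‖action a ℓ T (T * ω)‖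
  outside : ‖zc‖ + c₀ * σ ≤ ‖ω‖ ∨ ‖zc + 1‖ + c₀ * σ ≤ ‖ω + 1‖
  inside : ‖ω‖ ≤ ‖zc‖ - c₀ * σ ∨ ‖ω + 1‖ ≤ ‖zc + 1‖ - c₀ * σ
  lt_far : ‖ω‖ + 1 ≤ R

lemma LoopPoint.conj {zc ω : ℂ} {c₀ C μ R σ : ℝ} (h : LoopPoint a ℓ T zc c₀ C μ R σ ω) :
    LoopPoint a ℓ T zc c₀ C μ R σ ((starRingEnd ℂ) ω) := by
  have e1 : ‖(starRingEnd ℂ) ω + 1‖ = ‖ω + 1‖ := Loop.norm_conj_add_one ω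
  have e2 : ‖action a ℓ T (T * (starRingEnd ℂ) ω)‖ = ‖action a ℓ T (T * ω)‖ := by
    rw [← norm_action_conj, map_mul, conj_conj, map_natCast]
  constructor
  · simpa using h.im_ne
  · rw [norm_conj]; exact h.le_norm
  · rw [e1]; exact h.le_norm_add_one
  · rw [norm_conj]; exact h.norm_le
  · rw [e2]; exact h.log_ge
  · rw [norm_conj, e1]; exact h.outside
  · rw [norm_conj, e1]; exact h.inside
  · rw [norm_conj]; exact h.lt_far

end

set_option maxHeartbeats 1000000 in
/-- Near the critical point, the Bernoulli kernel is the integral of the residue at `w = z`, up to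
a small error. -/
theorem exists_norm_bernoulliKernel_sub_le {β : ℝ} (hβ0 : 0 < β) (hβ1 : β < 1)
    (t₁ x₁ t₂ x₂ : ℤ) {σ : ℝ} (hσ : 0 < σ) (hσ1 : σ ≤ 1) {K : ℕ} (hK : 12 ≤ σ * K) {κ : ℝ}
    (hκ : 0 < κ) :
    ∃ c₀ > 0, ∃ C > 0, ∀ ε > 0, ∃ T₀ : ℕ, ∀ T t₁' t₂' : ℕ, T₀ ≤ T → 0 < T →
      (t₁' : ℤ) = t₁ + T → (t₂' : ℤ) = t₂ + T → 1 ≤ t₂' → ∀ (N : ℕ) (a : Fin N → ℤ), StrictMono a →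
      ∀ D B : ℝ, RegularWeights (wt a T) (pvField a T) T σ D B K → D ≤ T / 2 →
      ∀ zc : ℂ, κ ≤ zc.im → ‖zc‖ ≤ K → pvField a T (T * zc) = (Real.log (β⁻¹ - 1) : ℝ) →
      ∃ zd : Arm zc (-1) (-1) c₀ C, ((zd.path 1).im = 0 ∧ -1 < (zd.path 1).re ∧ (zd.path 1).re < 0) ∧
        ‖bernoulliKernel a β t₁' x₁ t₂' x₂ -
        ((if x₂ ≤ x₁ ∧ t₂' < t₁' then
          (-1 : ℂ) ^ (x₁ - x₂ + 1) * ((t₁' - t₂').choose (x₁ - x₂).toNat : ℂ) else 0) +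
        ((1 / Real.pi * (zd.curve.integral fun ζ =>
          ((t₁'.factorial : ℝ) / (t₂' - 1).factorial * T : ℝ) *
            (zFactor (Real.log (β⁻¹ - 1)) t₂' x₂ (T * ζ) *
              wFactor (Real.log (β⁻¹ - 1)) t₁' x₁ (T * ζ))).im : ℝ) : ℂ))‖ ≤ ε := by
  set S : Set ℂ := Metric.closedBall 0 K ∩ {z | κ ≤ z.im} with hS
  have hSc : IsCompact S := (isCompact_closedBall 0 (K : ℝ)).inter_right
    (isClosed_le continuous_const continuous_im)
  obtain ⟨c₀, hc₀, C, hC, hcont⟩ := exists_contours hSc (fun z hz => hκ.trans_le hz.2) (K + 1)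
  obtain ⟨M, hM, T₁, hT₁⟩ := exists_scaledIntegrand_le t₁ x₁ t₂ x₂ hc₀ hC.le
  set n := (t₂ - x₂).natAbs + x₂.natAbs
  clear_value n
  set c₁ := 3 * σ * c₀ ^ 2 / (256 * (C + 1) ^ 4) with hc₁
  have hc₁0 : 0 < c₁ := by positivity
  -- The first summand is for `z` on the two arms, the second for `z` on the vertical ray.
  set M' := M * (1 + C) ^ n * (1 / c₀) + M * 2 ^ n * C ^ (n + 2) * 2 with hM'
  have hM'0 : 0 < M' := by positivity
  refine ⟨c₀, hc₀, C, hC, fun ε hε => ?_⟩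
  have hlim : Tendsto (fun T : ℕ => 160 * (C + 1) ^ 2 * (M' * (c₁ * T) ^ (-(1 / 4) : ℝ))) atTop
      (𝓝 (160 * (C + 1) ^ 2 * (M' * 0))) :=
    (((tendsto_rpow_neg_atTop (by norm_num : (0 : ℝ) < 1 / 4)).comp
      (tendsto_natCast_atTop_atTop.const_mul_atTop hc₁0)).const_mul _).const_mul _
  rw [mul_zero, mul_zero] at hlim
  obtain ⟨T₂, hT₂⟩ := eventually_atTop.1 (hlim.eventually (ge_mem_nhds hε))
  -- For `T > X / c₀` the points `x₁ / T`, `x₂ / T` are within `c₀` of `0`, and `(x₁ - t₁') / T`,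
  -- `(x₂ - t₂') / T` within `c₀` of `-1`. The real ends of the arms keep distance `c₀` from `0` and
  -- `-1`, so they lie on the correct side.
  set X : ℝ := |(x₁ : ℝ) - t₁| + |(x₁ : ℝ)| + |(x₂ : ℝ) - t₂| + |(x₂ : ℝ)| with hX
  obtain ⟨T₃, hT₃⟩ := exists_nat_gt (X / c₀)
  refine ⟨max (max T₁ T₂) (max T₃ (n + 2)), fun T t₁' t₂' hT hTp ht₁ ht₂ h1 N a ha D B hreg hD zc
    hzκ hzK hcrit => ?_⟩
  have hTT₁ : T₁ ≤ T := (le_max_left _ _).trans ((le_max_left _ _).trans hT)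
  have hTT₂ : T₂ ≤ T := (le_max_right _ _).trans ((le_max_left _ _).trans hT)
  have hTT₃ : T₃ ≤ T := (le_max_left _ _).trans ((le_max_right _ _).trans hT)
  have hTn : n + 2 ≤ T := (le_max_right _ _).trans ((le_max_right _ _).trans hT)
  have hT0 : (0 : ℝ) < T := Nat.cast_pos.2 hTp
  set ℓ := Real.log (β⁻¹ - 1)
  obtain ⟨zd, zu, wr, wl, ⟨hd1, hd2, hd3⟩, ⟨hr1, hr2⟩, ⟨hl1, hl2⟩, hu1, hu2, hu3, hu4⟩ :=
    hcont zc ⟨by simpa using hzK, hzκ⟩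
  refine ⟨zd, ⟨hd1, hd2, hd3⟩, ?_⟩
  have h01 : (1 : ℝ) ∈ Set.Icc (0 : ℝ) 1 := ⟨zero_le_one, le_rfl⟩
  have hzim : 0 < zc.im := hκ.trans_le hzκ
  have hTim : ∀ {z : ℂ}, z.im ≠ 0 → ((T : ℂ) * z).im ≠ 0 := fun {z} hz => by
    simpa using ⟨hTp.ne', hz⟩
  -- positions of the real end points
  have hXT : X < c₀ * T := by
    have : X / c₀ < T := hT₃.trans_le (Nat.cast_le.2 hTT₃)
    rw [div_lt_iff₀ hc₀] at this
    linarith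
  have hreal : ∀ {z : ℂ}, z.im = 0 → ‖z‖ = |z.re| ∧ ‖z + 1‖ = |z.re + 1| := fun {z} hz => by
    have e : z = (z.re : ℝ) := Complex.ext (by simp) (by simpa using hz)
    constructor
    · conv_lhs => rw [e, norm_real, Real.norm_eq_abs]
    · conv_lhs => rw [e, ← ofReal_one, ← ofReal_add, norm_real, Real.norm_eq_abs]
  have hle : (wl.path 1).re ≤ -1 - c₀ := by
    have := wl.le_norm_add_one 1 h01
    rw [(hreal hl1).2, abs_of_neg (by linarith)] at this
    linarith
  have hre : c₀ ≤ (wr.path 1).re := by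
    have := wr.le_norm 1 h01
    rwa [(hreal hr1).1, abs_of_pos hr2] at this
  have hde : (zd.path 1).re ≤ -c₀ := by
    have := zd.le_norm 1 h01
    rw [(hreal hd1).1, abs_of_neg hd3] at this
    linarith
  have hde' : -1 + c₀ ≤ (zd.path 1).re := by
    have := zd.le_norm_add_one 1 h01
    rw [(hreal hd1).2, abs_of_pos (by linarith)] at this
    linarith
  have ht₁r : (t₁' : ℝ) = t₁ + T := by exact_mod_cast congrArg (Int.cast : ℤ → ℝ) ht₁
  have ht₂r : (t₂' : ℝ) = t₂ + T := by exact_mod_cast congrArg (Int.cast : ℤ → ℝ) ht₂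
  have b1 := neg_abs_le ((x₁ : ℝ) - t₁)
  have b2 := le_abs_self (x₁ : ℝ)
  have b3 := le_abs_self ((x₂ : ℝ) - t₂)
  have b4 := neg_abs_le (x₂ : ℝ)
  have a1 := abs_nonneg ((x₁ : ℝ) - t₁)
  have a2 := abs_nonneg (x₁ : ℝ)
  have a3 := abs_nonneg ((x₂ : ℝ) - t₂)
  have a4 := abs_nonneg (x₂ : ℝ)
  -- the size of the action on the contours
  set W := Arm.loop wl wr hc₀ hl1 hr1 with hW
  set μ := c₁ * T with hμ
  have hμ0 : 0 < μ := by positivity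
  have hwl : ∀ s ∈ Set.Ioo (0 : ℝ) 1,
      LoopPoint a ℓ T zc c₀ C μ ‖zu.path 1‖ s (wl.path s) := fun s hs => by
    have hsI := Set.Ioo_subset_Icc_self hs
    have him := wl.im_pos s ⟨hs.1.le, hs.2⟩
    have hlog := wl.log_norm_action hc₀ hreg hσ hTp hD hcrit hsI him
    have g1 := wl.grow s hsI
    have g2 := wl.grow_add_one s hsI
    exact ⟨him.ne', wl.le_norm s hsI, wl.le_norm_add_one s hsI, wl.norm_le s hsI, by linarith,
      Or.inl (by linarith), Or.inr (by linarith), hu4 s hsI⟩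
  have hwr : ∀ s ∈ Set.Ioo (0 : ℝ) 1,
      LoopPoint a ℓ T zc c₀ C μ ‖zu.path 1‖ s (wr.path s) := fun s hs => by
    have hsI := Set.Ioo_subset_Icc_self hs
    have him := wr.im_pos s ⟨hs.1.le, hs.2⟩
    have hlog := wr.log_norm_action hc₀ hreg hσ hTp hD hcrit hsI him
    have g1 := wr.grow s hsI
    have g2 := wr.grow_add_one s hsI
    exact ⟨him.ne', wr.le_norm s hsI, wr.le_norm_add_one s hsI, wr.norm_le s hsI, by linarith,
      Or.inr (by linarith), Or.inl (by linarith), hu3 s hsI⟩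
  have hside : ∀ γ, W.IsSide γ → ∀ s ∈ Set.Ioo (0 : ℝ) 1,
      LoopPoint a ℓ T zc c₀ C μ ‖zu.path 1‖ s (γ.path s) := by
    rintro γ (rfl | rfl | rfl | rfl) s hs
    · exact hwl s hs
    · exact hwr s hs
    · exact (hwl s hs).conj
    · exact (hwr s hs).conj
  have hzdlog : ∀ s ∈ Set.Ioo (0 : ℝ) 1, Real.log ‖action a ℓ T (T * zd.path s)‖ ≤
      Real.log ‖action a ℓ T (T * zc)‖ - μ * s ^ 2 := fun s hs => by
    have := zd.log_norm_action hc₀ hreg hσ hTp hD hcrit (Set.Ioo_subset_Icc_self hs)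
      (zd.im_pos s ⟨hs.1.le, hs.2⟩)
    linarith
  have huim : ∀ s ∈ Set.Icc (0 : ℝ) 1, 0 < (zu.path s).im := fun s hs => by
    rcases hs.2.lt_or_eq with h | rfl
    · exact zu.im_pos s ⟨hs.1, h⟩
    · exact hu1
  have hzulog : ∀ s ∈ Set.Icc (0 : ℝ) 1, Real.log ‖action a ℓ T (T * zu.path s)‖ ≤
      Real.log ‖action a ℓ T (T * zc)‖ - μ * s ^ 2 := fun s hs => by
    have := zu.log_norm_action hc₀ hreg hσ hTp hD hcrit hs (huim s hs)
    linarith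
  set η := M' * μ ^ (-(1 / 4) : ℝ) with hη
  have hη0 : 0 ≤ η := by positivity
  have harm : ∀ (ζ ω : ℂ) (τ s : ℝ), 0 < τ → 0 < s → ζ.im ≠ 0 → c₀ ≤ ‖ζ‖ → c₀ ≤ ‖ζ + 1‖ →
      ‖ζ‖ ≤ C → LoopPoint a ℓ T zc c₀ C μ ‖zu.path 1‖ s ω →
      Real.log ‖action a ℓ T (T * ζ)‖ ≤ Real.log ‖action a ℓ T (T * zc)‖ - μ * τ ^ 2 →
      c₀ * (τ + s) ≤ ‖ω - ζ‖ →
      (t₁'.factorial : ℝ) / (t₂' - 1).factorial * T *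
        ‖scaledIntegrand a ℓ t₁' x₁ t₂' x₂ T ζ ω‖ ≤
          η * τ ^ (-(3 / 4) : ℝ) * s ^ (-(3 / 4) : ℝ) := by
    intro ζ ω τ s hτ hs hζ z0 z1 zC hω hlog hsep
    refine (hT₁ T t₁' t₂' hTT₁ hTp ht₁ ht₂ h1 N a ℓ ζ ω hζ hω.im_ne z0 z1 hω.le_norm
      hω.le_norm_add_one hω.norm_le).trans ?_
    have e1 : ‖action a ℓ T (T * ζ)‖ / ‖action a ℓ T (T * ω)‖ ≤
        Real.exp (-(μ * τ ^ 2)) * Real.exp (-(μ * s ^ 2)) := by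
      rw [norm_action_div_eq (hTim hζ) (hTim hω.im_ne), ← Real.exp_add]
      gcongr
      have := hω.log_ge
      linarith
    have e2 : 1 / ‖ω - ζ‖ ≤ 1 / c₀ * (1 / (τ + s)) := by
      rw [div_mul_div_comm, one_mul]
      exact one_div_le_one_div_of_le (by positivity) hsep
    calc _ ≤ M * (1 + C) ^ n * (Real.exp (-(μ * τ ^ 2)) * Real.exp (-(μ * s ^ 2))) *
          (1 / c₀ * (1 / (τ + s))) := by gcongr
      _ = M * (1 + C) ^ n * (1 / c₀) *
          (Real.exp (-(μ * τ ^ 2)) * Real.exp (-(μ * s ^ 2)) * (1 / (τ + s))) := by ring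
      _ ≤ M' * (μ ^ (-(1 / 4) : ℝ) * τ ^ (-(3 / 4) : ℝ) * s ^ (-(3 / 4) : ℝ)) := by
        refine mul_le_mul ?_ (exp_mul_exp_div_le hμ0 hτ hs) (by positivity) hM'0.le
        rw [hM']
        have : 0 ≤ M * 2 ^ n * C ^ (n + 2) * 2 := by positivity
        linarith
      _ = _ := by rw [hη]; ring
  have hray : ∀ (ω : ℂ) (y s : ℝ), 0 < y → s ∈ Set.Ioo (0 : ℝ) 1 →
      LoopPoint a ℓ T zc c₀ C μ ‖zu.path 1‖ s ω →
      (t₁'.factorial : ℝ) / (t₂' - 1).factorial * T *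
        ‖scaledIntegrand a ℓ t₁' x₁ t₂' x₂ T (zu.path 1 + y * I) ω‖ ≤
          η * (1 + y ^ 2)⁻¹ * s ^ (-(3 / 4) : ℝ) := by
    intro ω y s hy hs hω
    set p := zu.path 1 with hp
    set ζ := p + y * I with hζ
    have hζim : 0 < ζ.im := by
      simp [hζ]
      linarith
    have hK1 : (1 : ℝ) ≤ K + 1 := by
      have : (0 : ℝ) ≤ K := Nat.cast_nonneg K
      linarith
    have n0 := norm_lt_norm_add_mul_I hu1 hy 0
    have n1 := norm_lt_norm_add_mul_I hu1 hy 1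
    simp only [ofReal_zero, add_zero, ofReal_one] at n0 n1
    rw [← hζ] at n0 n1
    have hζ1 : 1 ≤ ‖ζ‖ := by linarith
    have hp0 : 0 < ‖p‖ := by linarith
    have hζ0 : 0 < ‖ζ‖ := by linarith
    have hpC : ‖p‖ ≤ C := zu.norm_le 1 h01
    refine (hT₁ T t₁' t₂' hTT₁ hTp ht₁ ht₂ h1 N a ℓ ζ ω hζim.ne' hω.im_ne
      ((zu.le_norm 1 h01).trans n0.le) ((zu.le_norm_add_one 1 h01).trans n1.le) hω.le_norm
      hω.le_norm_add_one hω.norm_le).trans ?_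
    have hDK : D ≤ K * T := by
      have h12 := hK.trans (mul_le_of_le_one_left (Nat.cast_nonneg K) hσ1)
      have := le_mul_of_one_le_left hT0.le (by linarith : (1 : ℝ) ≤ K)
      linarith
    have hlog := log_norm_action_ray (ℓ := ℓ) hreg hσ1 hK hTp hDK hu1 (by linarith) hy
    have hlog1 := hzulog 1 h01
    rw [← hp] at hlog1
    rw [← hζ] at hlog
    have e1 : ‖action a ℓ T (T * ζ)‖ / ‖action a ℓ T (T * ω)‖ ≤
        Real.exp (-μ) * (‖p‖ / ‖ζ‖) ^ T := by
      rw [norm_action_div_eq (hTim hζim.ne') (hTim hω.im_ne),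
        ← Real.exp_log (show 0 < (‖p‖ / ‖ζ‖) ^ T by positivity), Real.log_pow,
        Real.log_div hp0.ne' hζ0.ne', ← Real.exp_add]
      gcongr
      have := hω.log_ge
      have : 0 ≤ μ * s ^ 2 := by positivity
      linarith
    -- Of the decay of order `T` only `n + 2` powers are used: `n` against the polynomial factor and
    -- `2` for integrability along the ray.
    have e2 : (‖p‖ / ‖ζ‖) ^ T ≤ C ^ (n + 2) / ‖ζ‖ ^ (n + 2) := by
      rw [← div_pow]
      calc _ ≤ (‖p‖ / ‖ζ‖) ^ (n + 2) :=
            pow_le_pow_of_le_one (by positivity) ((div_le_one hζ0).2 n0.le) hTn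
        _ ≤ _ := by gcongr
    have e3 : (1 + ‖ζ‖) ^ n ≤ 2 ^ n * ‖ζ‖ ^ n := by
      rw [← mul_pow]
      gcongr
      linarith
    have e4 : 1 / ‖ω - ζ‖ ≤ 1 := by
      have := norm_sub_norm_le ζ ω
      rw [norm_sub_rev] at this
      have := hω.lt_far
      exact div_le_one_of_le₀ (by linarith) (norm_nonneg _)
    have e5 : 1 / ‖ζ‖ ^ 2 ≤ 2 * (1 + y ^ 2)⁻¹ := by
      have h1 : y ≤ ‖ζ‖ := by
        refine le_trans ?_ ((le_abs_self _).trans (abs_im_le_norm ζ))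
        simp [hζ]
        exact hu1.le
      rw [← div_eq_mul_inv, div_le_div_iff₀ (by positivity) (by positivity)]
      have h2 := pow_le_pow_left₀ hy.le h1 2
      have h3 := one_le_pow₀ hζ1 (n := 2)
      linarith
    have e6 : Real.exp (-μ) ≤ μ ^ (-(1 / 4) : ℝ) :=
      Real.exp_neg_le_rpow_neg hμ0 (by norm_num) (by norm_num)
    have e7 : 1 ≤ s ^ (-(3 / 4) : ℝ) :=
      Real.one_le_rpow_of_pos_of_le_one_of_nonpos hs.1 hs.2.le (by norm_num)
    calc _ ≤ M * (2 ^ n * ‖ζ‖ ^ n) * (Real.exp (-μ) * (C ^ (n + 2) / ‖ζ‖ ^ (n + 2))) * 1 := by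
          gcongr
          exact e1.trans (by gcongr)
      _ = M * 2 ^ n * C ^ (n + 2) * Real.exp (-μ) * (1 / ‖ζ‖ ^ 2) := by
          rw [pow_add ‖ζ‖ n 2]
          field_simp
      _ ≤ M * 2 ^ n * C ^ (n + 2) * μ ^ (-(1 / 4) : ℝ) * (2 * (1 + y ^ 2)⁻¹) := by gcongr
      _ = M * 2 ^ n * C ^ (n + 2) * 2 * μ ^ (-(1 / 4) : ℝ) * (1 + y ^ 2)⁻¹ * 1 := by ring
      _ ≤ M' * μ ^ (-(1 / 4) : ℝ) * (1 + y ^ 2)⁻¹ * s ^ (-(3 / 4) : ℝ) := by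
          gcongr
          rw [hM']
          have : 0 ≤ M * (1 + C) ^ n * (1 / c₀) := by positivity
          linarith
  refine (norm_bernoulliKernel_sub_le ha hβ0 hβ1 t₁' x₁ h1 x₂ hTp W zd.curve zu.curve ?_ ?_ ?_ ?_
    zd.start zu.start zd.im_pos hd1 ?_ ?_ huim ?_ ?_ hC.le zd.vel_bound zu.vel_bound wl.vel_bound
    wr.vel_bound hη0 ?_ ?_ ?_).trans (hT₂ T hTT₂)
  · change (wl.path 1).re < _
    rw [lt_div_iff₀ hT0, ht₁r]
    have := mul_le_mul_of_nonneg_right hle hT0.le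
    linarith
  · change _ < (wr.path 1).re
    rw [div_lt_iff₀ hT0]
    have := mul_le_mul_of_nonneg_right hre hT0.le
    linarith
  · change (wl.path 1).re < (zd.path 1).re
    linarith
  · change (zd.path 1).re < (wr.path 1).re
    linarith
  · change _ < (zd.path 1).re
    rw [div_lt_iff₀ hT0, ht₂r]
    have := mul_le_mul_of_nonneg_right hde' hT0.le
    linarith
  · change (zd.path 1).re < _
    rw [lt_div_iff₀ hT0]
    have := mul_le_mul_of_nonneg_right hde hT0.le
    linarith
  · intro τ hτ
    have g1 := zd.grow τ ⟨hτ.1.le, hτ.2⟩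
    have g2 := zd.grow_add_one τ ⟨hτ.1.le, hτ.2⟩
    have := mul_pos hc₀ hτ.1
    change ‖zd.path τ‖ < _ ∧ ‖zd.path τ + 1‖ < _
    constructor <;> linarith
  · intro τ hτ
    have g1 := zu.grow τ ⟨hτ.1.le, hτ.2⟩
    have g2 := zu.grow_add_one τ ⟨hτ.1.le, hτ.2⟩
    have := mul_pos hc₀ hτ.1
    change _ < ‖zu.path τ‖ ∧ _ < ‖zu.path τ + 1‖
    constructor <;> linarith
  · intro γ hγ τ hτ s hs
    have hτI := Set.Ioo_subset_Icc_self hτ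
    have hω := hside γ hγ s hs
    refine harm _ _ τ s hτ.1 hs.1 (zd.im_pos τ ⟨hτ.1.le, hτ.2⟩).ne' (zd.le_norm τ hτI)
      (zd.le_norm_add_one τ hτI) (zd.norm_le τ hτI) hω (hzdlog τ hτ) ?_
    have g1 := zd.grow τ hτI
    have g2 := zd.grow_add_one τ hτI
    -- On `zd` both distances, to `0` and to `-1`, have decreased by at least `c₀ τ`, while on the
    -- loop one of them has increased by at least `c₀ s`; that one separates the points.
    rcases hω.outside with h | h
    · have := norm_sub_norm_le (γ.path s) (zd.path τ)
      change _ ≤ ‖γ.path s - zd.path τ‖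
      linarith
    · have := norm_sub_norm_le (γ.path s + 1) (zd.path τ + 1)
      rw [add_sub_add_right_eq_sub] at this
      change _ ≤ ‖γ.path s - zd.path τ‖
      linarith
  · intro γ hγ τ hτ s hs
    have hτI := Set.Ioo_subset_Icc_self hτ
    have hω := hside γ hγ s hs
    refine harm _ _ τ s hτ.1 hs.1 (huim τ hτI).ne' (zu.le_norm τ hτI)
      (zu.le_norm_add_one τ hτI) (zu.norm_le τ hτI) hω (hzulog τ hτI) ?_
    have g1 := zu.grow τ hτI
    have g2 := zu.grow_add_one τ hτI
    rcases hω.inside with h | h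
    · have := norm_sub_norm_le (zu.path τ) (γ.path s)
      rw [norm_sub_rev] at this
      change _ ≤ ‖γ.path s - zu.path τ‖
      linarith
    · have := norm_sub_norm_le (zu.path τ + 1) (γ.path s + 1)
      rw [add_sub_add_right_eq_sub, norm_sub_rev] at this
      change _ ≤ ‖γ.path s - zu.path τ‖
      linarith
  · intro γ hγ y hy s hs
    exact hray _ y s hy hs (hside γ hγ s hs)

end

noncomputable section

/-! ### The extended sine kernel as an integral in the upper half plane -/

lemma segmentIntegral_symm (f : ℂ → ℂ) (p q : ℂ) :
    segmentIntegral f p q = -segmentIntegral f q p := by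
  have h := intervalIntegral.integral_comp_sub_left (a := 0) (b := 1)
    (fun s : ℝ => (q - p) * f (p + s * (q - p))) 1
  rw [sub_self, sub_zero] at h
  rw [segmentIntegral, segmentIntegral, ← h, ← intervalIntegral.integral_neg]
  congr 1
  ext s
  rw [← neg_mul, neg_sub]
  congr 2
  push_cast
  ring

lemma segmentIntegral_conj {f : ℂ → ℂ}
    (hf : ∀ z, f ((starRingEnd ℂ) z) = (starRingEnd ℂ) (f z)) (p q : ℂ) :
    segmentIntegral f ((starRingEnd ℂ) p) ((starRingEnd ℂ) q) =
      (starRingEnd ℂ) (segmentIntegral f p q) := by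
  rw [segmentIntegral, segmentIntegral, intervalIntegral.integral_of_le zero_le_one,
    intervalIntegral.integral_of_le zero_le_one, ← integral_conj]
  refine MeasureTheory.integral_congr_ae (Eventually.of_forall fun s => ?_)
  simp [← hf]

lemma extendedSineIntegrand_conj (t x s y : ℤ) (z : ℂ) :
    extendedSineIntegrand t x s y ((starRingEnd ℂ) z) =
      (starRingEnd ℂ) (extendedSineIntegrand t x s y z) := by
  simp [extendedSineIntegrand]

lemma continuousAt_extendedSineIntegrand (t x s y : ℤ) {z : ℂ} (h0 : z ≠ 0) (h1 : z ≠ 1) :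
    ContinuousAt (extendedSineIntegrand t x s y) z :=
  ((continuousAt_const.sub continuousAt_id).zpow₀ _ (Or.inl (sub_ne_zero.2 h1.symm))).mul
    (continuousAt_id.zpow₀ _ (Or.inl h0))

/-- The integrand commutes with conjugation and the crossing point is real, so the lower half of the
path gives minus the conjugate of the upper half. -/
lemma extendedSineKernel_eq (u : ℂ) (t x s y : ℤ) :
    extendedSineKernel u t x s y = ((-(1 / Real.pi) *
      (segmentIntegral (extendedSineIntegrand t x s y) (crossingPoint t s) u).im : ℝ) : ℂ) := by
  set J := segmentIntegral (extendedSineIntegrand t x s y) (crossingPoint t s) u with hJ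
  have hc : (starRingEnd ℂ) (crossingPoint t s) = crossingPoint t s := by
    rw [crossingPoint]
    split_ifs <;> simp [conj_ofNat]
  have h1 : segmentIntegral (extendedSineIntegrand t x s y) ((starRingEnd ℂ) u)
      (crossingPoint t s) = -(starRingEnd ℂ) J := by
    rw [segmentIntegral_symm, hJ, ← segmentIntegral_conj (extendedSineIntegrand_conj t x s y), hc]
  rw [extendedSineKernel, h1, ← hJ]
  have h2 : -(starRingEnd ℂ) J + J = 2 * I * (J.im : ℝ) := by
    rw [neg_add_eq_sub, sub_conj]
    push_cast
    ring
  have hpi : (Real.pi : ℂ) ≠ 0 := by exact_mod_cast Real.pi_ne_zero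
  have hI := I_ne_zero
  rw [h2]
  push_cast
  field_simp

/-- The pullback of the integrand of the extended sine kernel by `ζ ↦ ζ / (ζ + 1)`. -/
def limitIntegrand (t₁ x₁ t₂ x₂ : ℤ) (ζ : ℂ) : ℂ :=
  (ζ + 1) ^ (t₂ - x₂ - (t₁ + 1 - x₁)) * ζ ^ (x₂ - (x₁ + 1))

/-- Change of variables `u = ζ / (ζ + 1)`, `1 - u = 1 / (ζ + 1)`, `du = dζ / (ζ + 1)²`. It preserves
the upper half plane and takes `(-1, 0)` to `(-∞, 0)`. -/
lemma limitIntegrand_eq (t₁ x₁ t₂ x₂ : ℤ) {ζ : ℂ} (h1 : ζ + 1 ≠ 0) :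
    limitIntegrand t₁ x₁ t₂ x₂ ζ =
      extendedSineIntegrand t₁ x₁ t₂ x₂ (ζ / (ζ + 1)) * (1 / (ζ + 1) ^ 2) := by
  have e1 : 1 - ζ / (ζ + 1) = (ζ + 1)⁻¹ := by
    field_simp
    ring
  rw [limitIntegrand, extendedSineIntegrand, e1, div_zpow, inv_zpow, ← zpow_neg, div_eq_mul_inv,
    ← zpow_neg, one_div, ← zpow_natCast, ← zpow_neg]
  have e2 : t₂ - x₂ - (t₁ + 1 - x₁) = -(t₁ - t₂) + -(-(x₁ - x₂) - 1) + -((2 : ℕ) : ℤ) := by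
    push_cast
    ring
  rw [e2, zpow_add₀ h1, zpow_add₀ h1, show x₂ - (x₁ + 1) = -(x₁ - x₂) - 1 by ring]
  ring

lemma continuousAt_limitIntegrand (t₁ x₁ t₂ x₂ : ℤ) {ζ : ℂ} (h0 : ζ ≠ 0) (h1 : ζ + 1 ≠ 0) :
    ContinuousAt (limitIntegrand t₁ x₁ t₂ x₂) ζ :=
  ((continuousAt_id.add continuousAt_const).zpow₀ _ (Or.inl h1)).mul
    (continuousAt_id.zpow₀ _ (Or.inl h0))

/-- A primitive of the integrand in the upper half plane relates the two integrals. -/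
lemma im_integral_limitIntegrand (t₁ x₁ t₂ x₂ : ℤ) {zc : ℂ} (zd : Curve) (hd0 : zd.path 0 = zc)
    (hzd : ∀ τ ∈ Set.Ico (0 : ℝ) 1, 0 < (zd.path τ).im) {x c : ℝ} (hzd1 : zd.path 1 = x)
    (hx1 : -1 < x) (hx0 : x < 0) (hc : crossingPoint t₁ t₂ = c) {S : Set ℂ} {G : ℂ → ℂ}
    (hS : ∀ z : ℂ, 0 < z.im → z ∈ S) (hxS : ((x / (x + 1) : ℝ) : ℂ) ∈ S) (hcS : (c : ℂ) ∈ S)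
    (hGc : ContinuousOn G S)
    (hG : ∀ z : ℂ, 0 < z.im → HasDerivAt G (extendedSineIntegrand t₁ x₁ t₂ x₂ z) z) :
    (zd.integral (limitIntegrand t₁ x₁ t₂ x₂)).im =
      -(segmentIntegral (extendedSineIntegrand t₁ x₁ t₂ x₂) (crossingPoint t₁ t₂)
        (zc / (zc + 1))).im + ((G (x / (x + 1) : ℝ)).im - (G c).im) := by
  have hzc : 0 < zc.im := by
    have := hzd 0 ⟨le_rfl, one_pos⟩
    rwa [hd0] at this
  have hne : ∀ z : ℂ, 0 < z.im → z ≠ 0 ∧ z + 1 ≠ 0 := fun z hz =>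
    ⟨fun h => by simp [h] at hz, fun h => by
      have := congrArg Complex.im h
      simp at this
      linarith⟩
  have him : ∀ z : ℂ, 0 < z.im → 0 < (z / (z + 1)).im := fun z hz => by
    have h1 : 0 < normSq (z + 1) := normSq_pos.2 (hne z hz).2
    have : (z / (z + 1)).im = z.im / normSq (z + 1) := by
      rw [div_im]
      field_simp
      simp
      ring
    rw [this]
    positivity
  have hxne : (x : ℂ) ≠ 0 ∧ (x : ℂ) + 1 ≠ 0 := by
    constructor
    · exact_mod_cast hx0.ne
    · exact_mod_cast (by linarith : 0 < x + 1).ne'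
  have hpne : ∀ τ ∈ Set.Icc (0 : ℝ) 1, zd.path τ ≠ 0 ∧ zd.path τ + 1 ≠ 0 := fun τ hτ => by
    rcases hτ.2.lt_or_eq with h | rfl
    · exact hne _ (hzd τ ⟨hτ.1, h⟩)
    · rw [hzd1]
      exact hxne
  have h1 : zd.integral (limitIntegrand t₁ x₁ t₂ x₂) =
      G (x / (x + 1) : ℝ) - G (zc / (zc + 1)) := by
    have := zd.integral_eq_sub (φ := limitIntegrand t₁ x₁ t₂ x₂) (G := fun ζ => G (ζ / (ζ + 1)))
      (hGc.comp (f := fun τ => zd.path τ / (zd.path τ + 1))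
        (zd.cont.div (zd.cont.add continuousOn_const) fun τ hτ => (hpne τ hτ).2) fun τ hτ => ?_)
      (fun τ hτ => ?_) (zd.intervalIntegrable_of_continuousOn ?_)
    · rw [this, hzd1, hd0]
      push_cast
      rfl
    · rcases hτ.2.lt_or_eq with h | rfl
      · exact hS _ (him _ (hzd τ ⟨hτ.1, h⟩))
      · simp only [hzd1]
        exact_mod_cast hxS
    · have hτ' := hzd τ ⟨hτ.1.le, hτ.2⟩
      have hn := hne _ hτ'
      have hm : HasDerivAt (fun ζ : ℂ => ζ / (ζ + 1)) (1 / (zd.path τ + 1) ^ 2) (zd.path τ) := by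
        refine ((hasDerivAt_id (zd.path τ)).fun_div ((hasDerivAt_id (zd.path τ)).add_const 1)
          hn.2).congr_deriv ?_
        simp
      rw [limitIntegrand_eq _ _ _ _ hn.2]
      exact (hG _ (him _ hτ')).comp (zd.path τ) hm
    · rintro z ⟨τ, hτ, rfl⟩
      exact (continuousAt_limitIntegrand _ _ _ _ (hpne τ hτ).1 (hpne τ hτ).2).continuousWithinAt
  have hcne : (c : ℂ) ≠ 0 ∧ (c : ℂ) ≠ 1 := by
    rw [← hc, crossingPoint]
    split_ifs <;> norm_num
  set u := zc / (zc + 1) with hu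
  have hui := him zc hzc
  have hpim : ∀ s : ℝ, ((c : ℂ) + s * (u - c)).im = s * u.im := fun s => by simp
  have h2 : segmentIntegral (extendedSineIntegrand t₁ x₁ t₂ x₂) (crossingPoint t₁ t₂) u =
      G u - G c := by
    rw [hc, segmentIntegral]
    have hpc : Continuous fun s : ℝ => (c : ℂ) + s * (u - c) := by fun_prop
    have := intervalIntegral.integral_eq_sub_of_hasDerivAt_of_le zero_le_one
      (f := fun s : ℝ => G (c + s * (u - c)))
      (f' := fun s : ℝ => (u - c) * extendedSineIntegrand t₁ x₁ t₂ x₂ (c + s * (u - c))) ?_ ?_ ?_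
    · rw [this]
      simp
    · refine hGc.comp hpc.continuousOn fun s hs => ?_
      rcases hs.1.lt_or_eq with h | h
      · exact hS _ (by rw [hpim]; positivity)
      · rw [← h]
        simpa using hcS
    · intro s hs
      have hd : HasDerivAt (fun s : ℝ => (c : ℂ) + s * (u - c)) (u - c) s := by
        simpa using ((ofRealCLM.hasDerivAt (x := s)).mul_const (u - c)).const_add (c : ℂ)
      have := (hG (c + s * (u - c)) (by rw [hpim]; exact mul_pos hs.1 hui)).comp s hd
      rwa [mul_comm] at this
    · refine ContinuousOn.intervalIntegrable fun s hs => ?_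
      rw [Set.uIcc_of_le zero_le_one] at hs
      have hn : (c : ℂ) + s * (u - c) ≠ 0 ∧ (c : ℂ) + s * (u - c) ≠ 1 := by
        rcases hs.1.lt_or_eq with h | h
        · have : 0 < ((c : ℂ) + s * (u - c)).im := by rw [hpim]; positivity
          constructor <;> intro h0 <;> rw [h0] at this <;> simp at this
        · rw [← h]
          simpa using hcne
      exact (continuousAt_const.mul (ContinuousAt.comp
        (g := extendedSineIntegrand t₁ x₁ t₂ x₂) (f := fun s : ℝ => (c : ℂ) + s * (u - c))
        (continuousAt_extendedSineIntegrand _ _ _ _ hn.1 hn.2)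
        hpc.continuousAt)).continuousWithinAt
  rw [h1, h2, sub_im, sub_im]
  ring

/-- A primitive of `u ^ (k - 1)` on the slit plane. -/
def zpowPrimitive (k : ℤ) (u : ℂ) : ℂ := if k = 0 then log u else u ^ k / k

lemma hasDerivAt_zpowPrimitive (k : ℤ) {u : ℂ} (hu : u ∈ slitPlane) :
    HasDerivAt (zpowPrimitive k) (u ^ (k - 1)) u := by
  by_cases hk : k = 0
  · subst hk
    have : zpowPrimitive 0 = log := by
      ext u
      simp [zpowPrimitive]
    rw [this]
    simpa using hasDerivAt_log hu
  · have : zpowPrimitive k = fun u : ℂ => u ^ k / k := by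
      ext u
      simp [zpowPrimitive, hk]
    rw [this]
    refine ((hasDerivAt_zpow k u (Or.inl (slitPlane_ne_zero hu))).div_const (k : ℂ)).congr_deriv ?_
    have : (k : ℂ) ≠ 0 := Int.cast_ne_zero.2 hk
    field_simp

/-- Continuity from above on the negative axis is what matters: the transformed arm ends there, on
the cut of the logarithm. -/
lemma continuousOn_zpowPrimitive (k : ℤ) :
    ContinuousOn (zpowPrimitive k) {z | 0 ≤ z.im ∧ z ≠ 0} := by
  rintro z ⟨h1, h2⟩
  by_cases hz : z ∈ slitPlane
  · exact (hasDerivAt_zpowPrimitive k hz).continuousAt.continuousWithinAt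
  · have hz' : z.re ≤ 0 ∧ z.im = 0 := by
      rw [mem_slitPlane_iff] at hz
      push Not at hz
      exact hz
    by_cases hk : k = 0
    · have : zpowPrimitive k = log := by
        ext u
        simp [zpowPrimitive, hk]
      rw [this]
      refine (continuousWithinAt_log_of_re_neg_of_im_zero ?_ hz'.2).mono fun w hw => hw.1
      exact lt_of_le_of_ne hz'.1 fun h => h2 (Complex.ext h hz'.2)
    · have : zpowPrimitive k = fun u : ℂ => u ^ k / k := by
        ext u
        simp [zpowPrimitive, hk]
      rw [this]
      exact ((continuousAt_zpow₀ z k (Or.inl h2)).div_const _).continuousWithinAt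

/-- Only the logarithm distinguishes the two sides of the origin; this is the source of the binomial
term. -/
lemma zpowPrimitive_ofReal_im (k : ℤ) (x : ℝ) :
    (zpowPrimitive k x).im = if k = 0 then arg x else 0 := by
  rw [zpowPrimitive]
  split_ifs with h
  · rw [log_im]
  · rw [← ofReal_zpow, ← ofReal_intCast, ← ofReal_div, ofReal_im]

/-- The limit of the Bernoulli kernel is the extended sine kernel. -/
theorem binomial_add_integral_eq_extendedSineKernel (t₁ x₁ t₂ x₂ : ℤ) {zc : ℂ} (zd : Curve)
    (hd0 : zd.path 0 = zc) (hzd : ∀ τ ∈ Set.Ico (0 : ℝ) 1, 0 < (zd.path τ).im)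
    (hd1 : (zd.path 1).im = 0) (hx1 : -1 < (zd.path 1).re) (hx0 : (zd.path 1).re < 0) :
    (if x₂ ≤ x₁ ∧ t₂ < t₁ then
      (-1 : ℂ) ^ (x₁ - x₂ + 1) * ((t₁ - t₂).toNat.choose (x₁ - x₂).toNat : ℂ) else 0) +
      ((1 / Real.pi * (zd.integral (limitIntegrand t₁ x₁ t₂ x₂)).im : ℝ) : ℂ) =
    extendedSineKernel (zc / (zc + 1)) t₁ x₁ t₂ x₂ := by
  set x := (zd.path 1).re with hx
  have hzd1 : zd.path 1 = x := Complex.ext (by simp [hx]) (by simpa using hd1)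
  have hxx : x / (x + 1) < 0 := div_neg_of_neg_of_pos hx0 (by linarith)
  rw [extendedSineKernel_eq]
  set J := segmentIntegral (extendedSineIntegrand t₁ x₁ t₂ x₂) (crossingPoint t₁ t₂) (zc / (zc + 1))
  rcases le_or_gt t₁ t₂ with htt | htt
  · rw [if_neg (by omega)]
    -- For `t₁ ≤ t₂` the crossing point `-1` and the end of the transformed arm both lie in `(l,
    -- 0)`, where the integrand is regular and real, so no correction arises.
    set l := min (-1) (x / (x + 1)) - 1 with hl
    have hl1 : l < -1 := by
      have := min_le_left (-1) (x / (x + 1))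
      linarith
    have hl2 : l < x / (x + 1) := by
      have := min_le_right (-1) (x / (x + 1))
      linarith
    have hmem : ∀ y : ℝ, y ∈ Set.Ioo l 0 → (y : ℂ) ∈ upperWith l 0 := fun y hy =>
      Or.inr ⟨by simp, by simpa using hy.1, by simpa using hy.2⟩
    have hF : ∀ z ∈ upperWith l 0, DifferentiableAt ℂ (extendedSineIntegrand t₁ x₁ t₂ x₂) z :=
      fun z hz => by
        have hz01 : z ≠ 0 ∧ z ≠ 1 := by
          constructor <;> rintro rfl <;> rcases hz with h | h <;> norm_num at h
        exact ((differentiableAt_id.const_sub 1).zpow (Or.inl (sub_ne_zero.2 hz01.2.symm))).mul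
          (differentiableAt_id.zpow (Or.inl hz01.1))
    obtain ⟨G, hG⟩ := (convex_upperWith l 0).exists_forall_hasDerivWithinAt
      (f := extendedSineIntegrand t₁ x₁ t₂ x₂) fun z hz => (hF z hz).differentiableWithinAt
    have hc : crossingPoint t₁ t₂ = ((-1 : ℝ) : ℂ) := by
      rw [crossingPoint, if_neg (by omega)]
      simp
    have key := im_integral_limitIntegrand t₁ x₁ t₂ x₂ zd hd0 hzd hzd1 hx1 hx0 hc
      (S := upperWith l 0) (G := G) (fun z hz => Or.inl hz) (hmem _ ⟨hl2, hxx⟩)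
      (hmem _ ⟨hl1, by norm_num⟩) (fun z hz => (hG z hz).continuousWithinAt)
      (fun z hz => (hG z (Or.inl hz)).hasDerivAt (upperWith_mem_nhds hz))
    have hG0 := im_eq_of_primitive hG (fun y _ _ => by
      have := extendedSineIntegrand_conj t₁ x₁ t₂ x₂ y
      rw [conj_ofReal] at this
      exact conj_eq_iff_im.1 this.symm) (x := -1) (y := x / (x + 1)) ⟨hl1, by norm_num⟩ ⟨hl2, hxx⟩
    rw [key, hG0]
    push_cast
    ring
  · obtain ⟨n, hn⟩ : ∃ n : ℕ, t₁ - t₂ = n := ⟨(t₁ - t₂).toNat, by omega⟩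
    set m := x₁ - x₂ with hm
    -- For `t₁ > t₂` the factor `(1 - u) ^ n` is expanded binomially. The only term without a power
    -- primitive is `u⁻¹`, with coefficient `(-1) ^ m * n.choose m`.
    set G : ℂ → ℂ := fun u => ∑ k ∈ Finset.range (n + 1),
      ((-1) ^ k * (n.choose k) : ℝ) * zpowPrimitive (k - m) u with hGdef
    have hc : crossingPoint t₁ t₂ = ((1 / 2 : ℝ) : ℂ) := by
      rw [crossingPoint, if_pos htt]
      push_cast
      rfl
    have hxS : ∀ y : ℝ, y ≠ 0 → (y : ℂ) ∈ {z : ℂ | 0 ≤ z.im ∧ z ≠ 0} := fun y hy =>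
      ⟨by simp, by exact_mod_cast hy⟩
    have key := im_integral_limitIntegrand t₁ x₁ t₂ x₂ zd hd0 hzd hzd1 hx1 hx0 hc
      (S := {z | 0 ≤ z.im ∧ z ≠ 0}) (G := G) (fun z hz => ⟨hz.le, fun h => by simp [h] at hz⟩)
      (hxS _ hxx.ne) (hxS _ (by norm_num))
      (continuousOn_finsetSum _ fun k _ => continuousOn_const.mul (continuousOn_zpowPrimitive _))
      (fun z hz => by
        have hz0 : z ≠ 0 := fun h => by simp [h] at hz
        refine (HasDerivAt.fun_sum fun (k : ℕ) _ => (hasDerivAt_zpowPrimitive (k - m)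
          (mem_slitPlane_of_im hz.ne')).const_mul (((-1) ^ k * (n.choose k) : ℝ) : ℂ)).congr_deriv ?_
        rw [extendedSineIntegrand, hn, zpow_natCast, sub_eq_neg_add, add_pow, Finset.sum_mul]
        refine Finset.sum_congr rfl fun k _ => ?_
        rw [show (k : ℤ) - m - 1 = k + (-m - 1) by ring, zpow_add₀ hz0, zpow_natCast, neg_pow]
        push_cast
        ring)
    have hGim : ∀ y : ℝ, (G y).im =
        if 0 ≤ m then (-1) ^ m * (n.choose m.toNat : ℝ) * arg y else 0 := fun y => by
      simp only [hGdef, im_sum, im_ofReal_mul, zpowPrimitive_ofReal_im]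
      split_ifs with h
      · obtain ⟨j, hj⟩ := Int.eq_ofNat_of_zero_le h
        rw [hj, Int.toNat_natCast, zpow_natCast]
        have : ∀ k : ℕ, ((k : ℤ) - (j : ℤ) = 0) ↔ j = k := fun k => by omega
        simp only [this, mul_ite, mul_zero]
        rw [Finset.sum_ite_eq]
        split_ifs with h'
        · rfl
        · rw [Nat.choose_eq_zero_of_lt (by simpa using h')]
          simp
      · refine Finset.sum_eq_zero fun k _ => ?_
        rw [if_neg (by omega), mul_zero]
    -- The argument is `π` at the negative end and `0` at `1 / 2`. After division by `π` the
    -- difference is exactly the negative of the explicit binomial term, whose sign has exponent `m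
    -- + 1`.
    rw [key, hGim, hGim, arg_ofReal_of_neg hxx, arg_ofReal_of_nonneg (by norm_num), hn,
      Int.toNat_natCast]
    have hpi : (Real.pi : ℂ) ≠ 0 := by exact_mod_cast Real.pi_ne_zero
    by_cases h : 0 ≤ m
    · rw [if_pos ⟨by omega, htt⟩, if_pos h, if_pos h, zpow_add_one₀ (by norm_num)]
      push_cast
      field_simp
      ring
    · rw [if_neg (by omega), if_neg h, if_neg h]
      push_cast
      ring

end

noncomputable section

/-! ### The limit of the main term -/

lemma neg_one_zpow_cancel (x₁ x₂ : ℤ) :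
    -((-1 : ℂ) ^ x₂ * (-1) ^ x₁ * (-1) ^ (x₂ - (x₁ + 1))) = 1 := by
  have h : (-1 : ℂ) ≠ 0 := by norm_num
  rw [← zpow_add₀ h, ← zpow_add₀ h, show x₂ + x₁ + (x₂ - (x₁ + 1)) = 2 * (x₂ - 1) + 1 by ring,
    zpow_add_one₀ h, zpow_mul]
  simp

/-- The exact relation between the main term and its limit. -/
lemma mainTerm_eq {t₁ x₁ t₂ x₂ : ℤ} {t₁' t₂' T : ℕ} (hT : 0 < T) (ht₁ : (t₁' : ℤ) = t₁ + T)
    (ht₂ : (t₂' : ℤ) = t₂ + T) (h1 : 1 ≤ t₂') (ℓ : ℝ) {ζ : ℂ} (hζ : ζ.im ≠ 0) :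
    ((t₁'.factorial : ℝ) / (t₂' - 1).factorial * T : ℝ) *
      (zFactor ℓ t₂' x₂ (T * ζ) * wFactor ℓ t₁' x₁ (T * ζ)) =
    gammaRatio (t₁ + 1) T * gammaRatio (t₂ - x₂) (T * ζ + T) * gammaRatio x₂ (-(T * ζ)) /
      (gammaRatio t₂ T * gammaRatio (t₁ + 1 - x₁) (T * ζ + T) * gammaRatio (x₁ + 1) (-(T * ζ))) *
        limitIntegrand t₁ x₁ t₂ x₂ ζ := by
  have hTc : (T : ℂ) ≠ 0 := Nat.cast_ne_zero.2 hT.ne'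
  have hv : ((T : ℂ) * ζ).im ≠ 0 := by simpa using ⟨hT.ne', hζ⟩
  have hζ0 : ζ ≠ 0 := fun h => by simp [h] at hζ
  have hζ1 : ζ + 1 ≠ 0 := fun h => by
    have := congrArg Complex.im h
    simp at this
    exact hζ this
  set v := (T : ℂ) * ζ with hvdef
  have hpi : (Real.pi : ℂ) ≠ 0 := by exact_mod_cast Real.pi_ne_zero
  have hvT0 : v + T ≠ 0 := by
    rw [hvdef, show (T : ℂ) * ζ + T = T * (ζ + 1) by ring]
    exact mul_ne_zero hTc hζ1
  have hv0 : -v ≠ 0 := neg_ne_zero.2 (mul_ne_zero hTc hζ0)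
  have hg1 : Gamma (v + T) ≠ 0 :=
    Gamma_ne_zero_of_mem_slitPlane (mem_slitPlane_of_im (by simpa using hv))
  have hg2 : Gamma (-v) ≠ 0 :=
    Gamma_ne_zero_of_mem_slitPlane (mem_slitPlane_of_im (by simpa using hv))
  have hX : Gamma (v + T) * Gamma (-v) * exp (-(ℓ * v)) ≠ 0 :=
    mul_ne_zero (mul_ne_zero hg1 hg2) (exp_ne_zero _)
  have hpow : (T : ℂ) ^ (t₁ - t₂ + 1) * T * ((v + T) ^ (t₂ - x₂) * (-v) ^ x₂) /
      ((v + T) ^ (t₁ + 1 - x₁) * (-v) ^ (x₁ + 1)) =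
      (-1) ^ (x₂ - (x₁ + 1)) * limitIntegrand t₁ x₁ t₂ x₂ ζ := by
    rw [mul_div_assoc, mul_div_mul_comm, ← zpow_sub₀ hvT0, ← zpow_sub₀ hv0, hvdef,
      show (T : ℂ) * ζ + T = T * (ζ + 1) by ring, show -((T : ℂ) * ζ) = -1 * (T * ζ) by ring,
      mul_zpow, mul_zpow, mul_zpow, limitIntegrand, ← zpow_add_one₀ hTc]
    have e : (T : ℂ) ^ (t₁ - t₂ + 1 + 1) * ((T : ℂ) ^ (t₂ - x₂ - (t₁ + 1 - x₁)) *
        (T : ℂ) ^ (x₂ - (x₁ + 1))) = 1 := by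
      rw [← zpow_add₀ hTc, ← zpow_add₀ hTc,
        show t₁ - t₂ + 1 + 1 + (t₂ - x₂ - (t₁ + 1 - x₁) + (x₂ - (x₁ + 1))) = 0 by ring, zpow_zero]
    linear_combination ((-1) ^ (x₂ - (x₁ + 1)) * ((ζ + 1) ^ (t₂ - x₂ - (t₁ + 1 - x₁)) *
      ζ ^ (x₂ - (x₁ + 1)))) * e
  have hsign := neg_one_zpow_cancel x₁ x₂
  rw [ofReal_mul, factorial_div_eq hT ht₁ ht₂ h1, zFactor_eq_gammaRatio ht₂ hv,
    wFactor_eq_gammaRatio ht₁ hv, ofReal_natCast]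
  set X := Gamma (v + T) * Gamma (-v) * exp (-(ℓ * v))
  have e1 : X * X⁻¹ = 1 := mul_inv_cancel₀ hX
  have e2 : (Real.pi : ℂ) * (Real.pi : ℂ)⁻¹ = 1 := mul_inv_cancel₀ hpi
  calc _ = -((-1 : ℂ) ^ x₂ * (-1) ^ x₁) * (X * X⁻¹) * ((Real.pi : ℂ) * (Real.pi : ℂ)⁻¹) *
        ((T : ℂ) ^ (t₁ - t₂ + 1) * T * ((v + T) ^ (t₂ - x₂) * (-v) ^ x₂) /
          ((v + T) ^ (t₁ + 1 - x₁) * (-v) ^ (x₁ + 1))) *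
        (gammaRatio (t₁ + 1) T * gammaRatio (t₂ - x₂) (v + T) * gammaRatio x₂ (-v) /
          (gammaRatio t₂ T * gammaRatio (t₁ + 1 - x₁) (v + T) * gammaRatio (x₁ + 1) (-v))) := by
        simp only [div_eq_mul_inv, mul_inv]
        ring
    _ = -((-1 : ℂ) ^ x₂ * (-1) ^ x₁ * (-1) ^ (x₂ - (x₁ + 1))) *
        (limitIntegrand t₁ x₁ t₂ x₂ ζ) *
        (gammaRatio (t₁ + 1) T * gammaRatio (t₂ - x₂) (v + T) * gammaRatio x₂ (-v) /
          (gammaRatio t₂ T * gammaRatio (t₁ + 1 - x₁) (v + T) * gammaRatio (x₁ + 1) (-v))) := by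
        rw [e1, e2, hpow]
        ring
    _ = _ := by
        rw [hsign]
        ring

lemma exists_mul_div_sub_one_le {ε : ℝ} (hε : 0 < ε) : ∃ δ > 0, ∀ q : Fin 6 → ℂ,
    (∀ i, ‖q i - 1‖ ≤ δ) → ‖q 0 * q 1 * q 2 / (q 3 * q 4 * q 5) - 1‖ ≤ ε := by
  have hc : ContinuousAt (fun q : Fin 6 → ℂ => q 0 * q 1 * q 2 / (q 3 * q 4 * q 5)) fun _ => 1 := by
    refine ContinuousAt.div (by fun_prop) (by fun_prop) (by norm_num)
  obtain ⟨δ, hδ, h⟩ := Metric.continuousAt_iff.1 hc ε hε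
  refine ⟨δ / 2, by positivity, fun q hq => ?_⟩
  have := h (x := q) ((dist_pi_lt_iff hδ).2 fun i => by
    rw [dist_eq_norm]
    exact (hq i).trans_lt (by linarith))
  rw [dist_eq_norm] at this
  simpa using this.le

lemma norm_limitIntegrand_le (t₁ x₁ t₂ x₂ : ℤ) {c₀ C : ℝ} (hc₀ : 0 < c₀) :
    ∃ M > 0, ∀ ζ : ℂ, c₀ ≤ ‖ζ‖ → c₀ ≤ ‖ζ + 1‖ → ‖ζ‖ ≤ C → ‖limitIntegrand t₁ x₁ t₂ x₂ ζ‖ ≤ M := by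
  set c := min c₀ 1 with hc
  have hc0 : 0 < c := lt_min hc₀ one_pos
  have hc1 : c ≤ 1 := min_le_right _ _
  have hcc : c ≤ c₀ := min_le_left _ _
  set p := t₂ - x₂ - (t₁ + 1 - x₁)
  set q := x₂ - (x₁ + 1)
  refine ⟨c⁻¹ ^ p.natAbs * (2 + |C|) ^ p.natAbs * (c⁻¹ ^ q.natAbs * (2 + |C|) ^ q.natAbs),
    by positivity, fun ζ h0 h1 hC => ?_⟩
  have hζ1 : ‖ζ + 1‖ ≤ ‖ζ‖ + 1 := (norm_add_le _ _).trans (by simp)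
  have hCa := le_abs_self C
  rw [limitIntegrand, norm_mul, norm_zpow, norm_zpow]
  refine mul_le_mul ((zpow_le_mul_one_add_pow hc0 hc1 (hcc.trans h1) _).trans ?_)
    ((zpow_le_mul_one_add_pow hc0 hc1 (hcc.trans h0) _).trans ?_) (by positivity) (by positivity)
  · have : 1 + ‖ζ + 1‖ ≤ 2 + |C| := by linarith
    gcongr
  · have : 1 + ‖ζ‖ ≤ 2 + |C| := by linarith
    gcongr

/-- `mainTerm_eq` is exact, so the error comes only from six values of `gammaRatio`, at points whose
moduli are at least `T * min c₀ 1`. -/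
lemma exists_mainTerm_sub_le (t₁ x₁ t₂ x₂ : ℤ) {c₀ C : ℝ} (hc₀ : 0 < c₀) {ε : ℝ} (hε : 0 < ε) :
    ∃ T₀ : ℕ, ∀ T t₁' t₂' : ℕ, T₀ ≤ T → 0 < T → (t₁' : ℤ) = t₁ + T → (t₂' : ℤ) = t₂ + T →
      1 ≤ t₂' → ∀ (ℓ : ℝ) (ζ : ℂ), ζ.im ≠ 0 → c₀ ≤ ‖ζ‖ → c₀ ≤ ‖ζ + 1‖ → ‖ζ‖ ≤ C →
      ‖((t₁'.factorial : ℝ) / (t₂' - 1).factorial * T : ℝ) *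
        (zFactor ℓ t₂' x₂ (T * ζ) * wFactor ℓ t₁' x₁ (T * ζ)) - limitIntegrand t₁ x₁ t₂ x₂ ζ‖ ≤
        ε := by
  obtain ⟨M, hM, hMb⟩ := norm_limitIntegrand_le t₁ x₁ t₂ x₂ (C := C) hc₀
  obtain ⟨δ, hδ, hQ⟩ := exists_mul_div_sub_one_le (ε := ε / M) (by positivity)
  obtain ⟨R0, hR0⟩ := exists_gammaRatio_sub_le (t₁ + 1) hδ
  obtain ⟨R1, hR1⟩ := exists_gammaRatio_sub_le (t₂ - x₂) hδ
  obtain ⟨R2, hR2⟩ := exists_gammaRatio_sub_le x₂ hδ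
  obtain ⟨R3, hR3⟩ := exists_gammaRatio_sub_le t₂ hδ
  obtain ⟨R4, hR4⟩ := exists_gammaRatio_sub_le (t₁ + 1 - x₁) hδ
  obtain ⟨R5, hR5⟩ := exists_gammaRatio_sub_le (x₁ + 1) hδ
  set R := |R0| + |R1| + |R2| + |R3| + |R4| + |R5| with hR
  obtain ⟨T₀, hT₀⟩ := exists_nat_ge (R / min c₀ 1)
  refine ⟨T₀, fun T t₁' t₂' hT hTp ht₁ ht₂ h1 ℓ ζ hζ h0 h1' hC => ?_⟩
  have hc0 : 0 < min c₀ 1 := lt_min hc₀ one_pos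
  have hRT : R ≤ T * min c₀ 1 := (div_le_iff₀ hc0).1 (hT₀.trans (Nat.cast_le.2 hT))
  have hT0 : (0 : ℝ) ≤ T := Nat.cast_nonneg T
  have b1 : R ≤ ‖(T : ℂ)‖ := by
    rw [norm_natCast]
    exact hRT.trans (mul_le_of_le_one_right hT0 (min_le_right _ _))
  have b2 : R ≤ ‖(T : ℂ) * ζ + T‖ := by
    rw [show (T : ℂ) * ζ + T = T * (ζ + 1) by ring, norm_mul, norm_natCast]
    exact hRT.trans (mul_le_mul_of_nonneg_left ((min_le_left _ _).trans h1') hT0)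
  have b3 : R ≤ ‖-((T : ℂ) * ζ)‖ := by
    rw [norm_neg, norm_mul, norm_natCast]
    exact hRT.trans (mul_le_mul_of_nonneg_left ((min_le_left _ _).trans h0) hT0)
  have s1 : (T : ℂ) ∈ slitPlane := Or.inl (by simpa using hTp)
  have hv : ((T : ℂ) * ζ).im ≠ 0 := by simpa using ⟨hTp.ne', hζ⟩
  have s2 : (T : ℂ) * ζ + T ∈ slitPlane := mem_slitPlane_of_im (by simpa using hv)
  have s3 : -((T : ℂ) * ζ) ∈ slitPlane := mem_slitPlane_of_im (by simpa using hv)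
  have g0 := abs_nonneg R0
  have g1 := abs_nonneg R1
  have g2 := abs_nonneg R2
  have g3 := abs_nonneg R3
  have g4 := abs_nonneg R4
  have g5 := abs_nonneg R5
  have hq := hQ ![gammaRatio (t₁ + 1) T, gammaRatio (t₂ - x₂) (T * ζ + T),
    gammaRatio x₂ (-(T * ζ)), gammaRatio t₂ T, gammaRatio (t₁ + 1 - x₁) (T * ζ + T),
    gammaRatio (x₁ + 1) (-(T * ζ))] (fun i => by
      fin_cases i
      · exact hR0 _ s1 (by linarith [le_abs_self R0])
      · exact hR1 _ s2 (by linarith [le_abs_self R1])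
      · exact hR2 _ s3 (by linarith [le_abs_self R2])
      · exact hR3 _ s1 (by linarith [le_abs_self R3])
      · exact hR4 _ s2 (by linarith [le_abs_self R4])
      · exact hR5 _ s3 (by linarith [le_abs_self R5]))
  rw [mainTerm_eq hTp ht₁ ht₂ h1 ℓ hζ, ← sub_one_mul, norm_mul]
  calc _ ≤ ε / M * M := mul_le_mul hq (hMb ζ h0 h1' hC) (norm_nonneg _) (by positivity)
    _ = ε := div_mul_cancel₀ _ hM.ne'

/-- Along an arm, the integral of the main term is close to the integral of its limit. -/
lemma exists_integral_mainTerm_sub_le (t₁ x₁ t₂ x₂ : ℤ) {c₀ C : ℝ} (hc₀ : 0 < c₀) (hC : 0 < C)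
    {ε : ℝ} (hε : 0 < ε) :
    ∃ T₀ : ℕ, ∀ T t₁' t₂' : ℕ, T₀ ≤ T → 0 < T → (t₁' : ℤ) = t₁ + T → (t₂' : ℤ) = t₂ + T →
      1 ≤ t₂' → ∀ (ℓ : ℝ) (zc : ℂ) (e f : ℝ) (zd : Arm zc e f c₀ C),
      ‖(zd.curve.integral fun ζ => ((t₁'.factorial : ℝ) / (t₂' - 1).factorial * T : ℝ) *
        (zFactor ℓ t₂' x₂ (T * ζ) * wFactor ℓ t₁' x₁ (T * ζ))) -
          zd.curve.integral (limitIntegrand t₁ x₁ t₂ x₂)‖ ≤ ε := by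
  obtain ⟨M, hM, hMb⟩ := norm_limitIntegrand_le t₁ x₁ t₂ x₂ (C := C) hc₀
  obtain ⟨T₀, hT₀⟩ := exists_mainTerm_sub_le t₁ x₁ t₂ x₂ (C := C) hc₀ (ε := ε / C) (by positivity)
  refine ⟨T₀, fun T t₁' t₂' hT hTp ht₁ ht₂ h1 ℓ zc e f zd => ?_⟩
  set φ : ℂ → ℂ := fun ζ => ((t₁'.factorial : ℝ) / (t₂' - 1).factorial * T : ℝ) *
        (zFactor ℓ t₂' x₂ (T * ζ) * wFactor ℓ t₁' x₁ (T * ζ)) with hφ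
  have him : ∀ τ ∈ Set.Ioo (0 : ℝ) 1, 0 < (zd.curve.path τ).im := fun τ hτ =>
    zd.im_pos τ ⟨hτ.1.le, hτ.2⟩
  have hsub : ∀ τ ∈ Set.Ioo (0 : ℝ) 1,
      ‖φ (zd.curve.path τ) - limitIntegrand t₁ x₁ t₂ x₂ (zd.curve.path τ)‖ ≤ ε / C := fun τ hτ =>
    have hτI := Set.Ioo_subset_Icc_self hτ
    hT₀ T t₁' t₂' hT hTp ht₁ ht₂ h1 ℓ _ (him τ hτ).ne' (zd.le_norm τ hτI)
      (zd.le_norm_add_one τ hτI) (zd.norm_le τ hτI)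
  have hlb : ∀ τ ∈ Set.Ioo (0 : ℝ) 1, ‖limitIntegrand t₁ x₁ t₂ x₂ (zd.curve.path τ)‖ ≤ M :=
    fun τ hτ =>
      have hτI := Set.Ioo_subset_Icc_self hτ
      hMb _ (zd.le_norm τ hτI) (zd.le_norm_add_one τ hτI) (zd.norm_le τ hτI)
  have hpc : ∀ τ ∈ Set.Ioo (0 : ℝ) 1, ContinuousAt zd.curve.path τ := fun τ hτ =>
    (zd.curve.hasDerivAt τ hτ).continuousAt
  have hφc : ∀ ζ : ℂ, 0 < ζ.im → ContinuousAt φ ζ := fun ζ hζ => by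
    have hTζ : 0 < ((T : ℂ) * ζ).im := by
      simp
      positivity
    have d1 : DifferentiableAt ℂ (fun ζ => zFactor ℓ t₂' x₂ (T * ζ)) ζ :=
      (differentiableAt_zFactor ℓ t₂' x₂ (mem_upperWith_of_im hTζ)).comp ζ
        (f := fun ζ : ℂ => T * ζ) (by fun_prop)
    have d2 : DifferentiableAt ℂ (fun ζ => wFactor ℓ t₁' x₁ (T * ζ)) ζ :=
      (differentiable_wFactor ℓ t₁' x₁).differentiableAt.comp ζ (f := fun ζ : ℂ => T * ζ)
        (by fun_prop)
    exact continuousAt_const.mul (d1.continuousAt.mul d2.continuousAt)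
  have i1 := zd.curve.intervalIntegrable (φ := φ) (B := M + ε / C)
    (fun τ hτ => (ContinuousAt.comp (hφc _ (him τ hτ)) (hpc τ hτ)).continuousWithinAt)
    fun τ hτ => by
      have := norm_sub_norm_le (φ (zd.curve.path τ)) (limitIntegrand t₁ x₁ t₂ x₂ (zd.curve.path τ))
      have := hsub τ hτ
      have := hlb τ hτ
      linarith
  have i2 := zd.curve.intervalIntegrable (φ := limitIntegrand t₁ x₁ t₂ x₂) (B := M)
    (fun τ hτ => (ContinuousAt.comp (continuousAt_limitIntegrand _ _ _ _
      (norm_pos_iff.1 (hc₀.trans_le (zd.le_norm τ (Set.Ioo_subset_Icc_self hτ))))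
      (norm_pos_iff.1 (hc₀.trans_le (zd.le_norm_add_one τ (Set.Ioo_subset_Icc_self hτ)))))
      (hpc τ hτ)).continuousWithinAt) hlb
  rw [Curve.integral, Curve.integral, ← intervalIntegral.integral_sub i1 i2]
  have hb := intervalIntegral.norm_integral_le_of_norm_le (μ := MeasureTheory.volume)
    (f := fun τ => φ (zd.curve.path τ) * zd.curve.vel τ -
      limitIntegrand t₁ x₁ t₂ x₂ (zd.curve.path τ) * zd.curve.vel τ)
    (g := fun _ => ε) zero_le_one ?_ (by simp)
  · simpa using hb
  · filter_upwards [MeasureTheory.Measure.ae_ne MeasureTheory.volume 1] with τ hτ1 hτ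
    have hτ' : τ ∈ Set.Ioo (0 : ℝ) 1 := ⟨hτ.1, lt_of_le_of_ne hτ.2 hτ1⟩
    rw [← sub_mul, norm_mul]
    calc _ ≤ ε / C * C := mul_le_mul (hsub τ hτ') (zd.vel_bound τ hτ') (norm_nonneg _)
          (by positivity)
      _ = ε := div_mul_cancel₀ _ hC.ne'

end

/-! ### The uniform limit -/

/-- Take the infimum of the admissible errors. It need not be admissible itself, so `1 / (N + 1)` is
added. -/
lemma exists_tendsto_zero_of_forall_pos {P : ℕ → ℝ → Prop}
    (hmono : ∀ N e e', e ≤ e' → P N e → P N e') (h : ∀ ε > 0, ∃ N₀, ∀ N, N₀ ≤ N → P N ε) :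
    ∃ (ε : ℕ → ℝ) (N₀ : ℕ), Tendsto ε atTop (𝓝 0) ∧ ∀ N, N₀ ≤ N → P N (ε N) := by
  obtain ⟨N₀, hN₀⟩ := h 1 one_pos
  set s : ℕ → Set ℝ := fun N => {e | 0 ≤ e ∧ P N e} with hs
  have hbdd : ∀ N, BddBelow (s N) := fun N => ⟨0, fun e he => he.1⟩
  refine ⟨fun N => sInf (s N) + 1 / (N + 1), N₀, ?_, fun N hN => ?_⟩
  · have h1 : Tendsto (fun N => sInf (s N)) atTop (𝓝 0) := by
      rw [Metric.tendsto_atTop]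
      intro ε hε
      obtain ⟨n, hn⟩ := h (ε / 2) (by positivity)
      refine ⟨n, fun N hN => ?_⟩
      have h0 : 0 ≤ sInf (s N) := Real.sInf_nonneg fun e he => he.1
      have h2 : sInf (s N) ≤ ε / 2 := csInf_le (hbdd N) ⟨by positivity, hn N hN⟩
      rw [Real.dist_eq, sub_zero, abs_of_nonneg h0]
      linarith
    simpa using h1.add tendsto_one_div_add_atTop_nhds_zero_nat
  · obtain ⟨e, he, hlt⟩ := exists_lt_of_csInf_lt (s := s N)
      (b := sInf (s N) + 1 / (N + 1)) ⟨1, zero_le_one, hN₀ N hN⟩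
      (lt_add_of_pos_right _ (by positivity))
    exact hmono N e _ hlt.le he.2

theorem theorem2p5
    (β : ℝ) (hβ0 : 0 < β) (hβ1 : β < 1)
    -- the time scale `1 ≪ T ≪ N`
    (T : ℕ → ℕ) (hT : Tendsto T atTop atTop)
    (hTN : Tendsto (fun N : ℕ => (T N : ℝ) / (N : ℝ)) atTop (𝓝 0))
    -- the scales `D ≪ T ≪ Q ≪ N`
    (D Q : ℕ → ℝ) (hD : ∀ N, 0 < D N) (hQ : ∀ N, 0 < Q N)
    (hDT : Tendsto (fun N : ℕ => D N / (T N : ℝ)) atTop (𝓝 0))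
    (hTQ : Tendsto (fun N : ℕ => (T N : ℝ) / Q N) atTop (𝓝 0))
    (hQN : Tendsto (fun N : ℕ => Q N / (N : ℝ)) atTop (𝓝 0))
    -- the constants of the two assumptions
    (ρ₁ ρ₂ : ℝ) (hρ₁ : 0 < ρ₁) (hρ : ρ₁ ≤ ρ₂) (hρ₂ : ρ₂ < 1)
    (A : ℝ → ℝ → ℝ) (N₁ : ℝ → ℝ → ℕ)
    (t₁ x₁ t₂ x₂ : ℤ) :
    ∃ (ε : ℕ → ℝ) (N₀ : ℕ), Tendsto ε atTop (𝓝 0) ∧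
      ∀ N : ℕ, N₀ ≤ N → ∀ a : Fin N → ℤ, StrictMono a →
        LocalDensity a (D N) (Q N) ρ₁ ρ₂ →
        IntermediateScales a (T N) A N₁ →
        ∃ zc : ℂ, (0 < zc.im ∧ SPrime a β (T N) zc = 0) ∧
          (∀ z : ℂ, 0 < z.im → SPrime a β (T N) z = 0 → z = zc) ∧
          -- both times are genuine times `≥ 1` of the walk
          1 ≤ t₁ + (T N : ℤ) ∧ 1 ≤ t₂ + (T N : ℤ) ∧
          ‖bernoulliKernel a β (t₁ + (T N : ℤ)).toNat x₁ (t₂ + (T N : ℤ)).toNat x₂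
              - extendedSineKernel (zc / (zc + 1)) t₁ x₁ t₂ x₂‖ ≤ ε N := by
  refine exists_tendsto_zero_of_forall_pos
    (P := fun N e => ∀ a : Fin N → ℤ, StrictMono a → LocalDensity a (D N) (Q N) ρ₁ ρ₂ →
      IntermediateScales a (T N) A N₁ → ∃ zc : ℂ, (0 < zc.im ∧ SPrime a β (T N) zc = 0) ∧
        (∀ z : ℂ, 0 < z.im → SPrime a β (T N) z = 0 → z = zc) ∧
        1 ≤ t₁ + (T N : ℤ) ∧ 1 ≤ t₂ + (T N : ℤ) ∧
        ‖bernoulliKernel a β (t₁ + (T N : ℤ)).toNat x₁ (t₂ + (T N : ℤ)).toNat x₂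
          - extendedSineKernel (zc / (zc + 1)) t₁ x₁ t₂ x₂‖ ≤ e) ?_ ?_
  · intro N e e' hee h a h1 h2 h3
    obtain ⟨zc, g1, g2, g3, g4, g5⟩ := h a h1 h2 h3
    exact ⟨zc, g1, g2, g3, g4, g5.trans hee⟩
  intro ε hε
  set ℓ := Real.log (β⁻¹ - 1) with hℓ
  set σ := min (ρ₁ / 4) ((1 - ρ₂) / 2) with hσdef
  have hσ : 0 < σ := lt_min (by positivity) (by linarith)
  have hσ1 : σ ≤ 1 := (min_le_left _ _).trans (by linarith)
  -- `K` fixes the size `K T` of the region searched for the critical point; `12 ≤ σ K` is the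
  -- condition under which `energy_le` rules out everything beyond.
  obtain ⟨K, hK'⟩ := exists_nat_ge (12 / σ)
  have hK : 12 ≤ σ * K := by
    rw [div_le_iff₀ hσ] at hK'
    linarith
  have hK0 : 0 < K := Nat.pos_of_ne_zero fun h => by
    rw [h, Nat.cast_zero, mul_zero] at hK
    norm_num at hK
  obtain ⟨κ, hκ, ε₀, hε₀, T₁, hT₁, hcrit⟩ := exists_critical hσ hσ1 (|A (2 * K) 1| + 5) |ℓ| hK
  obtain ⟨c₀, hc₀, C, hC, happrox⟩ :=
    exists_norm_bernoulliKernel_sub_le hβ0 hβ1 t₁ x₁ t₂ x₂ hσ hσ1 hK hκ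
  obtain ⟨T₂, hT₂⟩ := happrox (ε / 2) (by positivity)
  obtain ⟨T₃, hT₃⟩ := exists_integral_mainTerm_sub_le t₁ x₁ t₂ x₂ hc₀ hC (ε := ε / 2) (by positivity)
  have hTr : Tendsto (fun N => (T N : ℝ)) atTop atTop := tendsto_natCast_atTop_atTop.comp hT
  -- This is the window length `4 (1 + D) / (1 - ρ₂)` of `regularWeights_wt` divided by `T`; it must
  -- fall below both `ε₀` and `1 / 2`.
  have hDlim : Tendsto (fun N => 4 / (1 - ρ₂) * ((T N : ℝ)⁻¹ + D N / (T N : ℝ))) atTop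
      (𝓝 (4 / (1 - ρ₂) * (0 + 0))) := ((tendsto_inv_atTop_zero.comp hTr).add hDT).const_mul _
  rw [add_zero, mul_zero] at hDlim
  have hm : 0 < min ε₀ (1 / 2) := lt_min hε₀ (by norm_num)
  -- The threshold involves only the data of the assumptions and the four integers. The bound `1 /
  -- (2 K + 1)` on `T / Q` leaves room for `2 K T + D` inside `[-Q, Q]`.
  obtain ⟨N₀, hN₀⟩ := eventually_atTop.1 ((((hT.eventually_ge_atTop
    (max (max T₁ T₂) (max T₃ (t₁.natAbs + t₂.natAbs + 1)))).and
      (hDlim.eventually (ge_mem_nhds hm))).and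
    ((hTQ.eventually (ge_mem_nhds (by positivity : (0 : ℝ) < 1 / (2 * K + 1)))).and
      (hDT.eventually (ge_mem_nhds one_pos)))).and
    (eventually_ge_atTop (max 1 (N₁ (2 * K) 1))))
  refine ⟨N₀, fun N hN a ha hL hI => ?_⟩
  obtain ⟨⟨⟨hTN', hDN⟩, hTQN, hDTN⟩, hNN⟩ := hN₀ N hN
  have l1 : T₁ ≤ T N := (le_max_left _ _).trans ((le_max_left _ _).trans hTN')
  have l2 : T₂ ≤ T N := (le_max_right _ _).trans ((le_max_left _ _).trans hTN')
  have l3 : T₃ ≤ T N := (le_max_left _ _).trans ((le_max_right _ _).trans hTN')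
  have l4 : t₁.natAbs + t₂.natAbs + 1 ≤ T N := (le_max_right _ _).trans ((le_max_right _ _).trans hTN')
  have hTp : 0 < T N := by omega
  have hT0 : (0 : ℝ) < T N := Nat.cast_pos.2 hTp
  have hDle : D N ≤ T N := (div_le_one hT0).1 hDTN
  have hQle : 2 * K * T N + D N ≤ Q N := by
    rw [div_le_div_iff₀ (hQ N) (by positivity)] at hTQN
    linarith
  have hreg := regularWeights_wt ha (hD N) hρ₁ (hρ₁.le.trans hρ) hρ₂ hL hI hTp
    (le_of_max_le_left hNN) hK0 (le_of_max_le_right hNN) hQle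
  rw [← hσdef] at hreg
  have hD' : 4 * (1 + D N) / (1 - ρ₂) ≤ min ε₀ (1 / 2) * T N := by
    have e : 4 / (1 - ρ₂) * ((T N : ℝ)⁻¹ + D N / (T N : ℝ)) =
        4 * (1 + D N) / (1 - ρ₂) / T N := by
      field_simp
    rw [e, div_le_iff₀ hT0] at hDN
    exact hDN
  have hDε : 4 * (1 + D N) / (1 - ρ₂) ≤ ε₀ * T N :=
    hD'.trans (mul_le_mul_of_nonneg_right (min_le_left _ _) hT0.le)
  have hD2 : 4 * (1 + D N) / (1 - ρ₂) ≤ T N / 2 := by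
    have := hD'.trans (mul_le_mul_of_nonneg_right (min_le_right _ _) hT0.le)
    linarith
  obtain ⟨v, hv1, hv2, hv3⟩ := hcrit _ _ _ _ hreg hDε l1
    (fun v hv => differentiableAt_pvField a (T N) hv.ne') ℓ le_rfl
  have hTc : (T N : ℂ) ≠ 0 := Nat.cast_ne_zero.2 hTp.ne'
  set zc : ℂ := v / T N with hzc
  have hTzc : (T N : ℂ) * zc = v := mul_div_cancel₀ _ hTc
  have hzim : κ ≤ zc.im := by
    rw [hzc, div_natCast_im, le_div_iff₀ hT0]
    exact hv2
  have hznorm : ‖zc‖ ≤ K := by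
    rw [hzc, norm_div, norm_natCast, div_le_iff₀ hT0]
    exact hv3
  have hzpos : 0 < zc.im := hκ.trans_le hzim
  have hS0 : ∀ z : ℂ, SPrime a β (T N) z = 0 ↔ pvField a (T N) (T N * z) = (ℓ : ℝ) := fun z => by
    rw [SPrime_eq, sub_eq_zero]
  have hvpos : 0 < v.im := lt_of_lt_of_le (by positivity) hv2
  have e1 : ((t₁ + (T N : ℤ)).toNat : ℤ) = t₁ + T N := Int.toNat_of_nonneg (by omega)
  have e2 : ((t₂ + (T N : ℤ)).toNat : ℤ) = t₂ + T N := Int.toNat_of_nonneg (by omega)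
  refine ⟨zc, ⟨hzpos, (hS0 zc).2 (by rw [hTzc]; exact hv1)⟩, fun z hz hz0 => ?_, by omega, by omega,
    ?_⟩
  · have := hreg.eq_of_real hσ hTp hD2 (v := T N * z) (vc := v) (by simp; positivity) hvpos
      ((hS0 z).1 hz0) hv1
    rw [hzc, ← this, mul_div_cancel_left₀ _ hTc]
  · set t₁' := (t₁ + (T N : ℤ)).toNat with ht₁'
    set t₂' := (t₂ + (T N : ℤ)).toNat with ht₂'
    obtain ⟨zd, ⟨hd1, hd2, hd3⟩, hbound⟩ := hT₂ (T N) t₁' t₂' l2 hTp e1 e2 (by omega) N a ha _ _ hreg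
      hD2 zc hzim hznorm (by rw [hTzc]; exact hv1)
    have hmain := hT₃ (T N) t₁' t₂' l3 hTp e1 e2 (by omega) ℓ zc _ _ zd
    have hlim := binomial_add_integral_eq_extendedSineKernel t₁ x₁ t₂ x₂ zd.curve zd.start
      zd.im_pos hd1 hd2 hd3
    -- Both truncate at zero, so the binomial terms at the shifted and unshifted times coincide.
    have c1 : (t₁ - t₂).toNat = t₁' - t₂' := by omega
    have c2 : (x₂ ≤ x₁ ∧ t₂ < t₁) = (x₂ ≤ x₁ ∧ t₂' < t₁') := by
      apply propext
      constructor <;> rintro ⟨h1, h2⟩ <;> exact ⟨h1, by omega⟩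
    simp only [c1, c2] at hlim
    rw [← hlim]
    set b : ℂ := if x₂ ≤ x₁ ∧ t₂' < t₁' then
      (-1 : ℂ) ^ (x₁ - x₂ + 1) * ((t₁' - t₂').choose (x₁ - x₂).toNat : ℂ) else 0
    set Z := zd.curve.integral fun ζ => ((t₁'.factorial : ℝ) / (t₂' - 1).factorial * T N : ℝ) *
        (zFactor ℓ t₂' x₂ (T N * ζ) * wFactor ℓ t₁' x₁ (T N * ζ))
    set Z' := zd.curve.integral (limitIntegrand t₁ x₁ t₂ x₂)
    have hdiff : ‖((1 / Real.pi * Z.im : ℝ) : ℂ) - ((1 / Real.pi * Z'.im : ℝ) : ℂ)‖ ≤ ε / 2 := by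
      rw [← ofReal_sub, ← mul_sub, ← sub_im, norm_real, norm_mul, norm_div, norm_one,
        Real.norm_of_nonneg Real.pi_pos.le, Real.norm_eq_abs]
      have hp : 1 / Real.pi ≤ 1 := by
        rw [div_le_one Real.pi_pos]
        linarith [Real.pi_gt_three]
      calc _ ≤ 1 * ‖Z - Z'‖ := mul_le_mul hp (abs_im_le_norm _) (abs_nonneg _) zero_le_one
        _ ≤ _ := by rw [one_mul]; exact hmain
    have := norm_add_le (bernoulliKernel a β t₁' x₁ t₂' x₂ - (b + ((1 / Real.pi * Z.im : ℝ) : ℂ)))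
      (((1 / Real.pi * Z.im : ℝ) : ℂ) - ((1 / Real.pi * Z'.im : ℝ) : ℂ))
    rw [show bernoulliKernel a β t₁' x₁ t₂' x₂ - (b + ((1 / Real.pi * Z.im : ℝ) : ℂ)) +
      (((1 / Real.pi * Z.im : ℝ) : ℂ) - ((1 / Real.pi * Z'.im : ℝ) : ℂ)) =
      bernoulliKernel a β t₁' x₁ t₂' x₂ - (b + ((1 / Real.pi * Z'.im : ℝ) : ℂ)) by ring] at this
    linarith
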